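/- Let $3\le p<5$. Let $u:\mathbb R^3\times\mathbb R\to\mathbb R$ be a finite-energy solution of the defocusing wave equation $$\partial_t^2u-\Delta u=-|u|^{p-1}u\quad\text{on }\mathbb R^3\times\mathbb R .$$ This means that $(u,u_t)\in C(\mathbb R;\dot H^1\times L^2(\mathbb R^3))$, where $\dot H^1(\mathbb R^3)=\{f\in L^6:\nabla f\in L^2\}$; that $u\in L^{2p/(p-3)}_tL^{2p}_x([a,b]\times\mathbb R^3)$ for all $a<b$ (time exponent $\infty$ if $p=3$); that the equation holds in the sense of distributions; and that the initial data $(u_0,u_1)=(u,u_t)(\cdot,0)$ satisfy $$\int_{\mathbb R^3}\Big(\tfrac12|\nabla u_0|^2+\tfrac12|u_1|^2+\tfrac1{p+1}|u_0|^{p+1}\Big)dx<\infty .$$ Write $\mathbf L_+u=\nabla u\cdot\frac{x}{|x|}+\frac{u}{|x|}+u_t$ and $\mathbf L_+(u_0,u_1)=\nabla u_0\cdot\frac{x}{|x|}+\frac{u_0}{|x|}+u_1$, let $\slashed\nabla u=\nabla u-\big(\nabla u\cdot\frac{x}{|x|}\big)\frac{x}{|x|}$ be the angular gradient, and let $$E_-(t)=\int_{\mathbb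 R^3}\Big(\tfrac14|\mathbf L_+u(x,t)|^2+\tfrac14|\slashed\nabla u(x,t)|^2+\tfrac1{2(p+1)}|u(x,t)|^{p+1}\Big)dx$$ be the inward energy. There is a unique finite Borel measure $\mu$ on $\mathbb R$ without atoms (the measure in the energy flux formula of $u$) such that, for all $t_1<t_2$, $$\pi\,\mu([t_1,t_2])=\lim_{r\to0^+}\int_{t_1}^{t_2}\int_{|x|=r}\Big(\tfrac14|\mathbf L_+u|^2-\tfrac14|\slashed\nabla u|^2-\tfrac1{2(p+1)}|u|^{p+1}\Big)d\sigma_r(x)\,dt ,$$ where $\sigma_r$ is surface measure on the sphere $|x|=r$ and the limit is taken outside a set of radii $r$ of Lebesgue measure zero. Let $0<\kappa<1$ and suppose that $$K=\int_{\mathbb R^3}|x|^\kappa\Big(\tfrac14|\mathbf L_+(u_0,u_1)|^2+\tfrac14|\slashed\nabla u_0|^2+\tfrac1{2(p+1)}|u_0|^{p+1}\Big)dx<\infty .$$ Then $$\int_0^\infty t^\kappa\,d\mu(t)\le C_1K,\qquad \int_0^\infty\!\!\int_{\mathbb R^3}\frac{(|x|+t)^\kappa\big(|u(x,t)|^{p+1}+|\slashed\nabla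 u(x,t)|^2\big)}{|x|}\,dx\,dt\le C_2K,$$ and $$E_-(t)\le C_3\,K\,t^{-\kappa}\qquad\text{for all }t>0,$$ where $C_1$ depends only on $p$, and $C_2,C_3$ depend only on $p$ and $\kappa$. -/

import Mathlib

open MeasureTheory Filter Topology
open scoped ENNReal NNReal ContDiff

namespace DefocusingWave

/-- Physical space `ℝ³` with the Euclidean norm. -/
abbrev Space : Type := EuclideanSpace ℝ (Fin 3)

/-- `g` is the weak gradient of `f` on `ℝ³`. -/
def IsWeakGradient (f : Space → ℝ) (g : Space → Space) : Prop :=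
  ∀ ψ : Space → ℝ, ContDiff ℝ ∞ ψ → HasCompactSupport ψ → ∀ e : Space,
    ∫ x, f x * fderiv ℝ ψ x e = - ∫ x, inner ℝ (g x) e * ψ x

/-- `(f, h)` belongs to the energy space `Ḣ¹ × L²(ℝ³)` and `g` is the weak gradient of `f`.
Here `Ḣ¹(ℝ³)` is the space of functions in `L⁶(ℝ³)` whose weak gradient is in `L²(ℝ³)`. -/
structure MemEnergySpace (f h : Space → ℝ) (g : Space → Space) : Prop where
  memLp_six : MemLp f 6 volume
  memLp_grad : MemLp g 2 volume
  isWeakGradient : IsWeakGradient f g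
  memLp_velocity : MemLp h 2 volume

/-- `v = ∂ₜ u` in the sense of distributions on `ℝ × ℝ³`. -/
def IsWeakTimeDeriv (u v : ℝ → Space → ℝ) : Prop :=
  ∀ φ : ℝ × Space → ℝ, ContDiff ℝ ∞ φ → HasCompactSupport φ →
    ∫ z : ℝ × Space, u z.1 z.2 * deriv (fun s => φ (s, z.2)) z.1
      = - ∫ z : ℝ × Space, v z.1 z.2 * φ z

/-- `∂ₜ² u - Δ u = - |u|^{p-1} u` in the sense of distributions on `ℝ × ℝ³`. -/
def SolvesWaveEq (p : ℝ) (u : ℝ → Space → ℝ) : Prop :=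
  ∀ φ : ℝ × Space → ℝ, ContDiff ℝ ∞ φ → HasCompactSupport φ →
    ∫ z : ℝ × Space, u z.1 z.2 *
        (iteratedDeriv 2 (fun s => φ (s, z.2)) z.1
          - Laplacian.laplacian (fun y => φ (z.1, y)) z.2)
      = - ∫ z : ℝ × Space, |u z.1 z.2| ^ (p - 1) * u z.1 z.2 * φ z

/-- The energy of `(f, h)`, where `g` is the gradient of `f`. -/
noncomputable def energy (p : ℝ) (f h : Space → ℝ) (g : Space → Space) : ℝ≥0∞ :=
  ∫⁻ x, ENNReal.ofReal
    (1 / 2 * ‖g x‖ ^ 2 + 1 / 2 * |h x| ^ 2 + 1 / (p + 1) * |f x| ^ (p + 1))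

/-- `u` is a solution on `ℝ³ × ℝ` of `∂ₜ² u - Δ u = - |u|^{p-1} u` with finite energy, with
time derivative `v` and spatial gradient `g`: the curve `(u, uₜ)` is continuous in
`Ḣ¹ × L²`, `u` lies in `L^{2p/(p-3)} L^{2p}([a, b] × ℝ³)` for all `a < b`
(the time exponent is `∞` for `p = 3`), and the energy of the data at time `0` is finite. -/
structure IsFiniteEnergySolution (p : ℝ) (u v : ℝ → Space → ℝ) (g : ℝ → Space → Space) :
    Prop where
  aestronglyMeasurable_u : AEStronglyMeasurable (fun z : ℝ × Space => u z.1 z.2) volume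
  aestronglyMeasurable_v : AEStronglyMeasurable (fun z : ℝ × Space => v z.1 z.2) volume
  aestronglyMeasurable_g : AEStronglyMeasurable (fun z : ℝ × Space => g z.1 z.2) volume
  memEnergySpace : ∀ t, MemEnergySpace (u t) (v t) (g t)
  continuous_grad : ∀ s, Tendsto (fun t => eLpNorm (g t - g s) 2 volume) (𝓝 s) (𝓝 0)
  continuous_velocity : ∀ s, Tendsto (fun t => eLpNorm (v t - v s) 2 volume) (𝓝 s) (𝓝 0)
  spaceTimeNorm : ∀ a b : ℝ, a < b →
    eLpNorm (fun t => eLpNorm (u t) (ENNReal.ofReal (2 * p)) volume)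
      (ENNReal.ofReal (2 * p) / ENNReal.ofReal (p - 3)) (volume.restrict (Set.Icc a b)) < ⊤
  isWeakTimeDeriv : IsWeakTimeDeriv u v
  solvesWaveEq : SolvesWaveEq p u
  energy_lt_top : energy p (u 0) (v 0) (g 0) < ⊤

/-- The radial unit vector `x / |x|`. -/
noncomputable def radialDir (x : Space) : Space := ‖x‖⁻¹ • x

/-- `𝐋₊(f, h) = ∇f · x/|x| + f/|x| + h`, where `g` is the gradient of `f`. -/
noncomputable def Lplus (f h : Space → ℝ) (g : Space → Space) (x : Space) : ℝ :=
  inner ℝ (g x) (radialDir x) + f x / ‖x‖ + h x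

/-- The angular gradient: the component of the gradient `g` tangent to the sphere
centred at the origin through `x`. -/
noncomputable def angularGrad (g : Space → Space) (x : Space) : Space :=
  g x - inner ℝ (g x) (radialDir x) • radialDir x

/-- The inward energy density of `(f, h)`, where `g` is the gradient of `f`. -/
noncomputable def inwardDensity (p : ℝ) (f h : Space → ℝ) (g : Space → Space) (x : Space) : ℝ :=
  1 / 4 * |Lplus f h g x| ^ 2 + 1 / 4 * ‖angularGrad g x‖ ^ 2
    + 1 / (2 * (p + 1)) * |f x| ^ (p + 1)

/-- The inward energy `E₋` of `(f, h)`, where `g` is the gradient of `f`. -/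
noncomputable def inwardEnergy (p : ℝ) (f h : Space → ℝ) (g : Space → Space) : ℝ≥0∞ :=
  ∫⁻ x, ENNReal.ofReal (inwardDensity p f h g x)

/-- The inward energy of `(f, h)` with the weight `|x|^κ`. -/
noncomputable def weightedInwardEnergy (p κ : ℝ) (f h : Space → ℝ) (g : Space → Space) : ℝ≥0∞ :=
  ∫⁻ x, ENNReal.ofReal (‖x‖ ^ κ * inwardDensity p f h g x)

/-- The flux of inward energy through the cylinder `|x| = r`, `t₁ < t < t₂`, oriented towards
the time axis:
`∫ (|𝐋₊u|²/4 - |∇̸u|²/4 - |u|^{p+1}/(2(p+1))) dS` with `dS = r² dσ(θ) dt` at `(rθ, t)`. -/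
noncomputable def cylinderFlux (p : ℝ) (u v : ℝ → Space → ℝ) (g : ℝ → Space → Space)
    (t₁ t₂ r : ℝ) : ℝ :=
  ∫ t in Set.Ioo t₁ t₂, ∫ θ : Metric.sphere (0 : Space) 1,
    (1 / 4 * |Lplus (u t) (v t) (g t) (r • (θ : Space))| ^ 2
      - 1 / 4 * ‖angularGrad (g t) (r • (θ : Space))‖ ^ 2
      - 1 / (2 * (p + 1)) * |u t (r • (θ : Space))| ^ (p + 1)) * r ^ 2
    ∂(volume : Measure Space).toSphere

/-- `μ` is the measure in the energy flux formula of `u`: the finite measure without atoms such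
that `π μ([t₁, t₂])` is the limit, as `r → 0⁺`, of the flux of inward energy through the
cylinder `|x| = r`, `t₁ < t < t₂`. The derivatives of a finite-energy solution are only defined
almost everywhere, so the flux is only defined for almost every `r`; accordingly the limit
is taken outside a set of radii of measure zero. -/
structure IsFluxMeasure (p : ℝ) (u v : ℝ → Space → ℝ) (g : ℝ → Space → Space)
    (μ : Measure ℝ) : Prop where
  isFiniteMeasure : IsFiniteMeasure μ
  noAtoms : ∀ t : ℝ, μ {t} = 0
  tendsto_flux : ∀ t₁ t₂ : ℝ, t₁ < t₂ →
    Tendsto (cylinderFlux p u v g t₁ t₂) (𝓝[>] 0 ⊓ ae volume)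
      (𝓝 (Real.pi * (μ (Set.Icc t₁ t₂)).toReal))

end DefocusingWave

/-! Write α = |L₊u|²/4, β = |∇̸u|²/4 + |u|^{p+1}/(2(p+1)) and N = |∇̸u|²/2 +
(p-1)|u|^{p+1}/(2(p+1)). Multiplying the equation by ½L₊u shows that the inward energy α + β moves
towards the origin with flux α - β and is lost at the rate N/|x|. Tested on X(t,|x|) vanishing near
the time axis, this reads ∬ X_t(α+β) - X_r(α-β) - X N/|x| = 0.

A weight φ(t+|x|) is constant along incoming cones, so α disappears from the balance and β enters
only as 2φ'β. Since p ≥ 3 one has 2β ≤ N, and for φ(s) = s^κ one has sφ'(s) = κφ(s). Hence 2φ'β ≤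
κφN/|x|, which the loss term absorbs because κ < 1. Integrating from 0 to T gives ∫φ(T+|x|)(α+β)(T)
+ (1-κ)∬φ(t+|x|)N/|x| + π∫φ dμ ≤ ∫φ(|x|)(α+β)(0), where π∫φ dμ is what flows into the axis
(`IsInwardFlow.weighted_inequality`). The three terms on the left are the three estimates, with
constants 4/(1-κ) for the space-time integral, 1/π for μ and 1 for the decay of E₋.

The balance law has to be proved for non-smooth u (`IsWeakWave.inward_balance`). The identities hold
exactly for mollifications of u, and the limit is taken using u in local L^∞_t L²_x (from Hardy) and
|u|^p in L¹_t L²_x (from the space-time norm). The potential term is treated separately, through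
truncations of the nonlinearity. Conservation of energy then makes α, β and N continuous in time as
densities and bounds the inward energy uniformly.

The behaviour at the axis is handled for an abstract flow `IsInwardFlow`. Weights vanishing linearly
at r = 0 are admissible (`IsInwardFlow.integral_balance`, by a logarithmic cutoff). A smoothed step
in r bounds the loss by the decrease of energy (`lintegral_bulk_le`), so E₋(t) plus the accumulated
loss is continuous and decreasing. The Stieltjes measure of its negative, divided by π, is μ.
Testing with primitives of bumps in r identifies the flux through almost every cylinder and its
limit (`IsInwardFlow.tendsto_flux`). -/

namespace DefocusingWave

set_option linter.unusedSectionVars false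

/-! ### Mollification on a finite-dimensional space -/

section Mollifier

open scoped Convolution Pointwise
open ContinuousLinearMap (lsmul)

variable {E F : Type*} [NormedAddCommGroup E] [NormedSpace ℝ E] [FiniteDimensional ℝ E]
  [MeasureSpace E] [BorelSpace E] [(volume : Measure E).IsAddHaarMeasure]
  [NormedAddCommGroup F] [NormedSpace ℝ F]

/-- A bump function at the origin with outer radius `1 / (n + 1)`. -/
noncomputable def mollBump (E : Type*) [NormedAddCommGroup E] [NormedSpace ℝ E]
    [FiniteDimensional ℝ E] (n : ℕ) : ContDiffBump (0 : E) where
  rIn := 1 / (2 * (n + 1))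
  rOut := 1 / (n + 1)
  rIn_pos := by positivity
  rIn_lt_rOut := by
    apply one_div_lt_one_div_of_lt <;> [positivity; nlinarith [Nat.cast_nonneg (α := ℝ) n]]

/-- The standard mollifying kernel, supported in the ball of radius `1 / (n + 1)`. -/
noncomputable def mollKernel (E : Type*) [NormedAddCommGroup E] [NormedSpace ℝ E]
    [FiniteDimensional ℝ E] [MeasureSpace E] [BorelSpace E] (n : ℕ) : E → ℝ :=
  (mollBump E n).normed volume

/-- The mollification of `f` at scale `1 / (n + 1)`. -/
noncomputable def moll (n : ℕ) (f : E → F) : E → F :=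
  mollKernel E n ⋆[lsmul ℝ ℝ, volume] f

lemma mollBump_rOut (n : ℕ) : (mollBump E n).rOut = 1 / ((n : ℝ) + 1) := rfl

lemma mollKernel_nonneg (n : ℕ) (y : E) : 0 ≤ mollKernel E n y :=
  (mollBump E n).nonneg_normed y

lemma contDiff_mollKernel (n : ℕ) : ContDiff ℝ ∞ (mollKernel E n) :=
  (mollBump E n).contDiff_normed

lemma hasCompactSupport_mollKernel (n : ℕ) : HasCompactSupport (mollKernel E n) :=
  (mollBump E n).hasCompactSupport_normed

lemma continuous_mollKernel (n : ℕ) : Continuous (mollKernel E n) :=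
  (contDiff_mollKernel n).continuous

lemma integral_mollKernel (n : ℕ) : ∫ y, mollKernel E n y = 1 :=
  (mollBump E n).integral_normed

lemma mollKernel_neg (n : ℕ) (y : E) : mollKernel E n (-y) = mollKernel E n y :=
  (mollBump E n).normed_neg y

lemma mollKernel_eq_zero {n : ℕ} {y : E} (hy : 1 / ((n : ℝ) + 1) ≤ ‖y‖) :
    mollKernel E n y = 0 := by
  have : y ∉ Function.support ((mollBump E n).normed volume) := by
    rw [ContDiffBump.support_normed_eq]
    simpa [mollBump_rOut] using hy
  exact Function.notMem_support.1 this

lemma integrable_mollKernel (n : ℕ) : Integrable (mollKernel E n) :=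
  (mollBump E n).integrable_normed

lemma lintegral_mollKernel (n : ℕ) : ∫⁻ y, ENNReal.ofReal (mollKernel E n y) = 1 := by
  rw [← ofReal_integral_eq_lintegral_ofReal (integrable_mollKernel n)
    (Eventually.of_forall (mollKernel_nonneg n)), integral_mollKernel, ENNReal.ofReal_one]

lemma measurable_mollKernel (n : ℕ) : Measurable (mollKernel E n) :=
  (continuous_mollKernel n).measurable

lemma moll_apply (n : ℕ) (f : E → F) (z : E) :
    moll n f z = ∫ y, mollKernel E n y • f (z - y) := rfl

lemma moll_apply' (n : ℕ) (f : E → F) (z : E) :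
    moll n f z = ∫ y, mollKernel E n (z - y) • f y := by
  rw [moll_apply, ← integral_sub_left_eq_self (fun y => mollKernel E n (z - y) • f y) volume z]
  simp

lemma contDiff_moll (n : ℕ) {f : E → F} (hf : LocallyIntegrable f) : ContDiff ℝ ∞ (moll n f) :=
  (hasCompactSupport_mollKernel n).contDiff_convolution_left (n := ⊤) _ (contDiff_mollKernel n) hf

lemma moll_congr_ae (n : ℕ) {f g : E → F} (h : f =ᵐ[volume] g) : moll n f = moll n g := by
  ext z
  rw [moll_apply', moll_apply']
  refine integral_congr_ae ?_
  filter_upwards [h] with y hy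
  rw [hy]

lemma moll_congr_ball {n : ℕ} {f g : E → F} {z : E}
    (h : ∀ y, ‖y - z‖ < 1 / ((n : ℝ) + 1) → f y = g y) : moll n f z = moll n g z := by
  rw [moll_apply, moll_apply]
  refine integral_congr_ae (Eventually.of_forall fun y => ?_)
  by_cases hy : 1 / ((n : ℝ) + 1) ≤ ‖y‖
  · simp [mollKernel_eq_zero hy]
  · simp only
    rw [h]
    simpa using hy

lemma ae_tendsto_moll {f : E → F} [CompleteSpace F] (hf : LocallyIntegrable f) :
    ∀ᵐ z, Tendsto (fun n => moll n f z) atTop (𝓝 (f z)) := by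
  refine ContDiffBump.ae_convolution_tendsto_right_of_locallyIntegrable (K := 2) ?_ ?_ hf
  · simp only [mollBump_rOut]
    exact tendsto_one_div_add_atTop_nhds_zero_nat
  -- Lebesgue differentiation needs rOut ≤ K rIn for a fixed K; the bumps have ratio exactly 2.
  · refine Eventually.of_forall fun n => ?_
    simp only [mollBump]
    apply le_of_eq
    field_simp

/-- Jensen's inequality: the kernel is a probability density, so for that measure the L¹ norm is at
most the L^q norm. -/
lemma enorm_moll_rpow_le (n : ℕ) {f : E → F} (hf : AEStronglyMeasurable f) {q : ℝ} (hq : 1 ≤ q)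
    (z : E) :
    ‖moll n f z‖ₑ ^ q ≤ ∫⁻ y, ENNReal.ofReal (mollKernel E n y) * ‖f (z - y)‖ₑ ^ q := by
  set ν : Measure E := volume.withDensity fun y => ENNReal.ofReal (mollKernel E n y) with hν
  have hm : Measurable fun y => ENNReal.ofReal (mollKernel E n y) :=
    (measurable_mollKernel n).ennreal_ofReal
  have : IsProbabilityMeasure ν := ⟨by
    rw [hν, withDensity_apply _ MeasurableSet.univ, setLIntegral_univ, lintegral_mollKernel]⟩
  have hfz : AEStronglyMeasurable (fun y => f (z - y)) volume :=
    hf.comp_quasiMeasurePreserving (quasiMeasurePreserving_sub_left volume z)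
  have hfz' : AEStronglyMeasurable (fun y => f (z - y)) ν :=
    hfz.mono_ac (withDensity_absolutelyContinuous _ _)
  have key := eLpNorm'_le_eLpNorm'_of_exponent_le one_pos hq ν hfz'
  simp only [eLpNorm', ENNReal.rpow_one, ne_eq, one_ne_zero, not_false_eq_true, div_self] at key
  have h1 : ‖moll n f z‖ₑ ≤ ∫⁻ y, ‖f (z - y)‖ₑ ∂ν := by
    rw [moll_apply, hν, lintegral_withDensity_eq_lintegral_mul₀ hm.aemeasurable hfz.enorm]
    refine (enorm_integral_le_lintegral_enorm _).trans (le_of_eq ?_)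
    refine lintegral_congr fun y => ?_
    rw [enorm_smul, Pi.mul_apply, Real.enorm_of_nonneg (mollKernel_nonneg n y)]
  have h2 := ENNReal.rpow_le_rpow (h1.trans key) (by linarith : (0 : ℝ) ≤ q)
  rw [← ENNReal.rpow_mul, one_div, inv_mul_cancel₀ (by linarith), ENNReal.rpow_one, hν,
    lintegral_withDensity_eq_lintegral_mul₀ hm.aemeasurable (hfz.enorm.pow_const q)] at h2
  exact h2

lemma lintegral_enorm_moll_rpow_le (n : ℕ) {f : E → F} (hf : AEStronglyMeasurable f) {q : ℝ}
    (hq : 1 ≤ q) : ∫⁻ z, ‖moll n f z‖ₑ ^ q ≤ ∫⁻ z, ‖f z‖ₑ ^ q := by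
  have hm : Measurable fun y => ENNReal.ofReal (mollKernel E n y) :=
    (measurable_mollKernel n).ennreal_ofReal
  calc ∫⁻ z, ‖moll n f z‖ₑ ^ q
      ≤ ∫⁻ z, ∫⁻ y, ENNReal.ofReal (mollKernel E n y) * ‖f (z - y)‖ₑ ^ q :=
        lintegral_mono fun z => enorm_moll_rpow_le n hf hq z
    _ = ∫⁻ y, ∫⁻ z, ENNReal.ofReal (mollKernel E n y) * ‖f (z - y)‖ₑ ^ q := by
        refine lintegral_lintegral_swap ?_
        have h2 : AEStronglyMeasurable (fun p : E × E => f (p.1 - p.2))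
            ((volume : Measure E).prod volume) :=
          hf.comp_quasiMeasurePreserving (quasiMeasurePreserving_sub volume volume)
        exact (hm.comp measurable_snd).aemeasurable.mul (h2.enorm.pow_const q)
    _ = ∫⁻ y, ENNReal.ofReal (mollKernel E n y) * ∫⁻ z, ‖f z‖ₑ ^ q := by
        refine lintegral_congr fun y => ?_
        rw [lintegral_const_mul', lintegral_sub_right_eq_self (fun z => ‖f z‖ₑ ^ q) y]
        exact ENNReal.ofReal_ne_top
    _ = ∫⁻ z, ‖f z‖ₑ ^ q := by
        rw [lintegral_mul_const _ hm, lintegral_mollKernel, one_mul]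

lemma moll_sub (n : ℕ) {f g : E → F} (hf : LocallyIntegrable f) (hg : LocallyIntegrable g) :
    moll n (f - g) = moll n f - moll n g := by
  have hc := hasCompactSupport_mollKernel (E := E) n
  have h1 := hc.convolutionExists_left (lsmul ℝ ℝ) (continuous_mollKernel n) hf
  have h2 := hc.convolutionExists_left (lsmul ℝ ℝ) (continuous_mollKernel n) hg
  ext z
  simp only [moll_apply, Pi.sub_apply, smul_sub]
  exact integral_sub (h1 z) (h2 z)

lemma tendsto_eLpNorm_translate {f : E → F} {q : ℝ≥0∞} [Fact (1 ≤ q)] (hq : q ≠ ⊤)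
    (hf : MemLp f q volume) :
    Tendsto (fun y : E => eLpNorm (fun z => f (z - y) - f z) q volume) (𝓝 0) (𝓝 0) := by
  let T : E → C(E, E) := fun y => ⟨fun z => z - y, by fun_prop⟩
  have hT : Continuous T := by
    let g : C(E × E, E) := ⟨fun p => p.2 - p.1, by fun_prop⟩
    exact g.curry.continuous
  have hmp : ∀ y, MeasurePreserving (T y) volume volume := fun y =>
    measurePreserving_sub_right volume y
  have h := (Continuous.compMeasurePreservingLp (E := F) (p := q)
    (continuous_const (y := hf.toLp f)) hT hmp hq).tendsto 0
  rw [Lp.tendsto_Lp_iff_tendsto_eLpNorm'] at h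
  refine h.congr fun y => ?_
  refine eLpNorm_congr_ae ?_
  have h1 := hf.coeFn_toLp
  have h2 := Lp.coeFn_compMeasurePreserving (hf.toLp f) (hmp y)
  have h3 := Lp.coeFn_compMeasurePreserving (hf.toLp f) (hmp 0)
  have h4 := (hmp y).quasiMeasurePreserving.ae_eq_comp h1
  have h5 := (hmp 0).quasiMeasurePreserving.ae_eq_comp h1
  filter_upwards [h2, h3, h4, h5] with z h2 h3 h4 h5
  rw [Pi.sub_apply, h2, h3, h4, h5]
  simp [T]

lemma eLpNorm_two_rpow {α G : Type*} [MeasurableSpace α] [NormedAddCommGroup G] (f : α → G)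
    (μ : Measure α) : eLpNorm f 2 μ ^ (2 : ℝ) = ∫⁻ x, ‖f x‖ₑ ^ (2 : ℝ) ∂μ := by
  rw [eLpNorm_eq_lintegral_rpow_enorm_toReal two_ne_zero ENNReal.ofNat_ne_top, ENNReal.toReal_ofNat,
    ← ENNReal.rpow_mul]
  norm_num

lemma eLpNorm_two_eq {α G : Type*} [MeasurableSpace α] [NormedAddCommGroup G] (f : α → G)
    (μ : Measure α) : eLpNorm f 2 μ = (∫⁻ x, ‖f x‖ₑ ^ (2 : ℝ) ∂μ) ^ (1 / 2 : ℝ) := by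
  rw [eLpNorm_eq_lintegral_rpow_enorm_toReal two_ne_zero ENNReal.ofNat_ne_top, ENNReal.toReal_ofNat]

lemma eLpNorm_moll_two_le (n : ℕ) {f : E → F} (hf : AEStronglyMeasurable f) :
    eLpNorm (moll n f) 2 volume ≤ eLpNorm f 2 volume := by
  rw [eLpNorm_two_eq, eLpNorm_two_eq]
  exact ENNReal.rpow_le_rpow (lintegral_enorm_moll_rpow_le n hf one_le_two) (by norm_num)

lemma moll_const [CompleteSpace F] (n : ℕ) (c : F) (z : E) : moll n (fun _ => c) z = c := by
  rw [moll_apply, integral_smul_const, integral_mollKernel, one_smul]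

/-- The difference is an average of f(· - y) - f over |y| < 1/(n+1). Jensen and Tonelli bound its L²
norm by the largest L² translation error at that scale, which tends to 0. -/
lemma tendsto_eLpNorm_moll_sub [CompleteSpace F] {f : E → F} (hf : MemLp f 2 volume) :
    Tendsto (fun n => eLpNorm (moll n f - f) 2 volume) atTop (𝓝 0) := by
  have : Fact ((1 : ℝ≥0∞) ≤ 2) := ⟨one_le_two⟩
  have hloc : LocallyIntegrable f := hf.locallyIntegrable one_le_two
  have ht := tendsto_eLpNorm_translate ENNReal.ofNat_ne_top hf
  rw [ENNReal.tendsto_nhds_zero] at ht ⊢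
  intro ε hε
  obtain ⟨δ, hδ, hball⟩ := Metric.eventually_nhds_iff.1 (ht ε hε)
  obtain ⟨N, hN⟩ := exists_nat_one_div_lt hδ
  refine eventually_atTop.2 ⟨N, fun n hn => ?_⟩
  have hnδ : 1 / ((n : ℝ) + 1) < δ :=
    lt_of_le_of_lt (one_div_le_one_div_of_le (by positivity) (by exact_mod_cast Nat.succ_le_succ hn)) hN
  have hm : Measurable fun y => ENNReal.ofReal (mollKernel E n y) :=
    (measurable_mollKernel n).ennreal_ofReal
  have hfm := hf.1
  have key : ∫⁻ z, ‖(moll n f - f) z‖ₑ ^ (2 : ℝ) ≤ ε ^ (2 : ℝ) := by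
    calc ∫⁻ z, ‖(moll n f - f) z‖ₑ ^ (2 : ℝ)
        ≤ ∫⁻ z, ∫⁻ y, ENNReal.ofReal (mollKernel E n y) * ‖f (z - y) - f z‖ₑ ^ (2 : ℝ) := by
          -- Mollification reproduces the constant f z, so the pointwise Jensen bound applies to f -
          -- f z.
          refine lintegral_mono fun z => ?_
          have h1 : (moll n f - f) z = moll n (f - fun _ => f z) z := by
            rw [moll_sub n hloc (locallyIntegrable_const _), Pi.sub_apply, Pi.sub_apply,
              moll_const]
          rw [h1]
          exact enorm_moll_rpow_le n (hfm.sub aestronglyMeasurable_const) one_le_two z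
      _ = ∫⁻ y, ∫⁻ z, ENNReal.ofReal (mollKernel E n y) * ‖f (z - y) - f z‖ₑ ^ (2 : ℝ) := by
          refine lintegral_lintegral_swap ?_
          have h2 : AEStronglyMeasurable (fun p : E × E => f (p.1 - p.2))
              ((volume : Measure E).prod volume) :=
            hfm.comp_quasiMeasurePreserving (quasiMeasurePreserving_sub volume volume)
          have h3 : AEStronglyMeasurable (fun p : E × E => f p.1)
              ((volume : Measure E).prod volume) := hfm.comp_fst
          exact (hm.comp measurable_snd).aemeasurable.mul ((h2.sub h3).enorm.pow_const _)
      _ ≤ ∫⁻ y, ENNReal.ofReal (mollKernel E n y) * ε ^ (2 : ℝ) := by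
          refine lintegral_mono fun y => ?_
          simp only
          rw [lintegral_const_mul' _ _ ENNReal.ofReal_ne_top]
          by_cases hy : 1 / ((n : ℝ) + 1) ≤ ‖y‖
          · simp [mollKernel_eq_zero hy]
          · gcongr
            rw [← eLpNorm_two_rpow]
            gcongr
            exact hball (by rw [dist_zero_right]; linarith [not_le.1 hy])
      _ = ε ^ (2 : ℝ) := by
          rw [lintegral_mul_const _ hm, lintegral_mollKernel, one_mul]
  rw [eLpNorm_two_eq]
  calc _ ≤ (ε ^ (2 : ℝ)) ^ (1 / 2 : ℝ) := ENNReal.rpow_le_rpow key (by norm_num)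
    _ = ε := by rw [← ENNReal.rpow_mul]; norm_num

/-- Needed with an n-dependent function: after the mollifier is transposed it falls on a multiplier
already built from a mollification at the same scale. -/
lemma tendsto_eLpNorm_moll_sub_of_tendsto [CompleteSpace F] {h : ℕ → E → F} {f : E → F}
    (hf : MemLp f 2 volume) (hh : ∀ n, MemLp (h n) 2 volume)
    (hlim : Tendsto (fun n => eLpNorm (h n - f) 2 volume) atTop (𝓝 0)) :
    Tendsto (fun n => eLpNorm (moll n (h n) - f) 2 volume) atTop (𝓝 0) := by
  have h2 := hlim.add (tendsto_eLpNorm_moll_sub hf)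
  rw [add_zero] at h2
  refine tendsto_of_tendsto_of_tendsto_of_le_of_le tendsto_const_nhds h2 (fun _ => zero_le) ?_
  intro n
  have hl1 := (hh n).locallyIntegrable one_le_two
  have hl2 := hf.locallyIntegrable one_le_two
  have heq : moll n (h n) - f = moll n (h n - f) + (moll n f - f) := by
    rw [moll_sub n hl1 hl2]; abel
  simp only [heq]
  refine (eLpNorm_add_le ?_ ?_ one_le_two).trans ?_
  · exact (contDiff_moll n (hl1.sub hl2)).continuous.aestronglyMeasurable
  · exact (contDiff_moll n hl2).continuous.aestronglyMeasurable.sub hf.1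
  · gcongr
    exact eLpNorm_moll_two_le n ((hh n).1.sub hf.1)

/-- `f'` is the weak derivative of `f` in the direction `e`. -/
def IsWeakDerivAlong (f f' : E → ℝ) (e : E) : Prop :=
  ∀ φ : E → ℝ, ContDiff ℝ ∞ φ → HasCompactSupport φ →
    ∫ x, f x * fderiv ℝ φ x e = - ∫ x, f' x * φ x

lemma contDiff_fderiv_apply {G : Type*} [NormedAddCommGroup G] [NormedSpace ℝ G] {k : G → ℝ}
    (hk : ContDiff ℝ ∞ k) (e : G) : ContDiff ℝ ∞ fun x => fderiv ℝ k x e :=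
  (hk.fderiv_right (m := ∞) (by norm_num)).clm_apply contDiff_const

lemma hasCompactSupport_fderiv_apply {G : Type*} [NormedAddCommGroup G] [NormedSpace ℝ G]
    {k : G → ℝ} (hk : HasCompactSupport k) (e : G) : HasCompactSupport fun x => fderiv ℝ k x e :=
  hk.fderiv_apply (𝕜 := ℝ) e

lemma hasFDerivAt_comp_sub_left {G : Type*} [NormedAddCommGroup G] [NormedSpace ℝ G]
    {k : G → ℝ} (hk : Differentiable ℝ k) (z y : G) :
    HasFDerivAt (fun y => k (z - y)) (-(fderiv ℝ k (z - y))) y := by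
  have := (hk (z - y)).hasFDerivAt.comp y ((hasFDerivAt_id y).const_sub z)
  refine this.congr_fderiv ?_
  ext
  simp

lemma fderiv_integral_kernel {k f : E → ℝ} (hk : ContDiff ℝ ∞ k) (hkc : HasCompactSupport k)
    (hf : LocallyIntegrable f) (z e : E) :
    fderiv ℝ (fun z => ∫ y, k (z - y) * f y) z e = ∫ y, fderiv ℝ k (z - y) e * f y := by
  have h1 := hkc.hasFDerivAt_convolution_right (lsmul ℝ ℝ).flip hf (hk.of_le (by simp)) z
  have h2 : (fun z => ∫ y, k (z - y) * f y) = f ⋆[(lsmul ℝ ℝ).flip, volume] k := by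
    ext z; simp [convolution]
  rw [h2, h1.fderiv, convolution_precompR_apply _ hf (hkc.fderiv ℝ)
    (hk.continuous_fderiv (by simp))]
  simp [convolution]

/-- The derivative falls on the kernel, and y ↦ k(z - y) is an admissible test function. The sign
from the reflection cancels the one in the definition of the weak derivative. -/
lemma fderiv_moll (n : ℕ) {f f' : E → ℝ} (hf : LocallyIntegrable f) {e : E}
    (h : IsWeakDerivAlong f f' e) (z : E) : fderiv ℝ (moll n f) z e = moll n f' z := by
  have h1 : moll n f = fun z => ∫ y, mollKernel E n (z - y) * f y := by
    ext z; rw [moll_apply']; rfl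
  rw [h1, fderiv_integral_kernel (contDiff_mollKernel n) (hasCompactSupport_mollKernel n) hf,
    moll_apply']
  have hk := contDiff_mollKernel (E := E) n
  have hs : ContDiff ℝ ∞ fun y => mollKernel E n (z - y) := hk.comp (contDiff_const.sub contDiff_id)
  have hc : HasCompactSupport fun y => mollKernel E n (z - y) :=
    (hasCompactSupport_mollKernel n).comp_homeomorph (Homeomorph.subLeft z)
  have h2 := h _ hs hc
  have h3 : ∀ y, fderiv ℝ (fun y => mollKernel E n (z - y)) y e
      = - fderiv ℝ (mollKernel E n) (z - y) e := fun y => by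
    rw [(hasFDerivAt_comp_sub_left (hk.differentiable (by simp)) z y).fderiv]; rfl
  simp only [h3, mul_neg, integral_neg, neg_inj] at h2
  simp only [smul_eq_mul]
  rw [← integral_congr_ae (Eventually.of_forall fun y => mul_comm (f y) _), h2]
  exact integral_congr_ae (Eventually.of_forall fun y => mul_comm _ _)

/-- The kernel is even, so mollification is its own transpose; the rest is Fubini. -/
lemma integral_mul_moll (n : ℕ) {h f : E → ℝ} (hh : Continuous h) (hc : HasCompactSupport h)
    (hf : LocallyIntegrable f) : ∫ z, h z * moll n f z = ∫ z, moll n h z * f z := by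
  simp only [moll_apply', smul_eq_mul, ← integral_const_mul, ← integral_mul_const]
  rw [integral_integral_swap]
  · refine integral_congr_ae (Eventually.of_forall fun y => ?_)
    refine integral_congr_ae (Eventually.of_forall fun z => ?_)
    simp only
    rw [← mollKernel_neg, neg_sub]
    ring
  -- The integrand vanishes unless y lies in supp h + supp k, so f may be replaced by its truncation
  -- to this compact set, which is integrable.
  · have hK : IsCompact (tsupport h + tsupport (mollKernel E n)) :=
      hc.isCompact.add (hasCompactSupport_mollKernel n).isCompact
    set K := tsupport h + tsupport (mollKernel E n) with hKdef
    have hfK : Integrable (K.indicator f) :=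
      (integrable_indicator_iff hK.measurableSet).2 (hf.integrableOn_isCompact hK)
    have hhi : Integrable h := hh.integrable_of_hasCompactSupport hc
    obtain ⟨C, hC⟩ := (hasCompactSupport_mollKernel (E := E) n).exists_bound_of_continuous
      (continuous_mollKernel n)
    have h1 : Integrable (fun p : E × E => (h p.1 * K.indicator f p.2) *
        mollKernel E n (p.1 - p.2)) (volume.prod volume) := by
      refine (hhi.mul_prod hfK).mul_bdd (c := C) ?_ ?_
      · exact ((continuous_mollKernel n).comp (by fun_prop)).aestronglyMeasurable
      · exact Eventually.of_forall fun p => hC _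
    refine h1.congr (Eventually.of_forall fun p => ?_)
    simp only [Function.uncurry]
    by_cases hp : p.2 ∈ K
    · rw [Set.indicator_of_mem hp]; ring
    · rw [Set.indicator_of_notMem hp]
      by_cases h0 : h p.1 = 0
      · simp [h0]
      · have : mollKernel E n (p.1 - p.2) = 0 := by
          by_contra hne
          apply hp
          refine ⟨p.1, subset_tsupport _ h0, p.2 - p.1, ?_, by simp⟩
          refine subset_tsupport _ ?_
          rw [Function.mem_support, ← mollKernel_neg, neg_sub]
          exact hne
        simp [this]

end Mollifier

/-! ### Time slices of mollifications -/

section Slices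

instance : (volume : Measure (ℝ × Space)).IsAddHaarMeasure :=
  inferInstanceAs ((volume : Measure ℝ).prod (volume : Measure Space)).IsAddHaarMeasure

variable {F : Type*} [NormedAddCommGroup F] [NormedSpace ℝ F]

/-- A slice of the space-time mollification is an average of translated slices of f at nearby times,
so a bound uniform in time survives with the same constant. -/
lemma lintegral_slice_moll_le (n : ℕ) {f : ℝ × Space → F} (hf : AEStronglyMeasurable f)
    {C : ℝ≥0∞} (hC : ∀ t, ∫⁻ x, ‖f (t, x)‖ₑ ^ (2 : ℝ) ≤ C) (t : ℝ) :
    ∫⁻ x, ‖moll n f (t, x)‖ₑ ^ (2 : ℝ) ≤ C := by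
  -- Tonelli at a fixed time needs genuine joint measurability. The representative satisfies the
  -- slice bound only for almost every time, which is enough under the average.
  obtain ⟨f', hf'm, hff'⟩ := hf
  have hC' : ∀ᵐ s : ℝ, ∫⁻ x, ‖f' (s, x)‖ₑ ^ (2 : ℝ) ≤ C := by
    have h1 : ∀ᵐ s : ℝ, ∀ᵐ x : Space, f (s, x) = f' (s, x) := Measure.ae_ae_of_ae_prod hff'
    filter_upwards [h1] with s hs
    refine le_trans (le_of_eq (lintegral_congr_ae ?_)) (hC s)
    filter_upwards [hs] with x hx
    rw [hx]
  rw [moll_congr_ae n hff']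
  have hm : Measurable fun y => ENNReal.ofReal (mollKernel (ℝ × Space) n y) :=
    (measurable_mollKernel n).ennreal_ofReal
  calc ∫⁻ x, ‖moll n f' (t, x)‖ₑ ^ (2 : ℝ)
      ≤ ∫⁻ x : Space, ∫⁻ y : ℝ × Space, ENNReal.ofReal (mollKernel (ℝ × Space) n y) *
          ‖f' ((t, x) - y)‖ₑ ^ (2 : ℝ) :=
        lintegral_mono fun x => enorm_moll_rpow_le n hf'm.aestronglyMeasurable one_le_two _
    _ = ∫⁻ y : ℝ × Space, ∫⁻ x : Space, ENNReal.ofReal (mollKernel (ℝ × Space) n y) *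
          ‖f' ((t, x) - y)‖ₑ ^ (2 : ℝ) := by
        refine lintegral_lintegral_swap (Measurable.aemeasurable ?_)
        refine (hm.comp measurable_snd).mul ?_
        have : Measurable fun p : Space × (ℝ × Space) => ((t, p.1) : ℝ × Space) - p.2 := by
          fun_prop
        exact ((hf'm.comp_measurable this).enorm).pow_const _
    _ ≤ ∫⁻ y : ℝ × Space, ENNReal.ofReal (mollKernel (ℝ × Space) n y) * C := by
        refine lintegral_mono_ae ?_
        have h2 : ∀ᵐ y : ℝ × Space, ∫⁻ x, ‖f' (t - y.1, x)‖ₑ ^ (2 : ℝ) ≤ C := by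
          have h3 : ∀ᵐ s : ℝ, ∫⁻ x, ‖f' (t - s, x)‖ₑ ^ (2 : ℝ) ≤ C :=
            (quasiMeasurePreserving_sub_left volume t).ae hC'
          exact Measure.quasiMeasurePreserving_fst.ae h3
        filter_upwards [h2] with y hy
        rw [lintegral_const_mul' _ _ ENNReal.ofReal_ne_top]
        gcongr
        refine le_trans (le_of_eq ?_) hy
        exact lintegral_sub_right_eq_self (fun x => ‖f' (t - y.1, x)‖ₑ ^ (2 : ℝ)) y.2
    _ = C := by rw [lintegral_mul_const _ hm, lintegral_mollKernel, one_mul]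

end Slices

end DefocusingWave

namespace DefocusingWave

/-! ### Hardy and Sobolev inequalities for weak gradients -/

section HardySobolev

/-- The standard basis vectors of `ℝ³`. -/
noncomputable def basisVec (i : Fin 3) : Space := EuclideanSpace.single i 1

lemma sum_apply_smul_basisVec (x : Space) : ∑ i, x i • basisVec i = x := by
  ext j
  simp [basisVec, Fin.sum_univ_three]
  fin_cases j <;> simp

lemma norm_sq_eq_sum (x : Space) : ‖x‖ ^ 2 = x 0 ^ 2 + x 1 ^ 2 + x 2 ^ 2 := by
  rw [EuclideanSpace.real_norm_sq_eq, Fin.sum_univ_three]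

lemma hasFDerivAt_apply (i : Fin 3) (x : Space) :
    HasFDerivAt (fun x : Space => x i) (EuclideanSpace.proj i : Space →L[ℝ] ℝ) x :=
  (EuclideanSpace.proj i : Space →L[ℝ] ℝ).hasFDerivAt

lemma fderiv_apply_mul_inv_norm_sq_add {ε : ℝ} (hε : 0 < ε) (i : Fin 3) (x : Space) :
    DifferentiableAt ℝ (fun x : Space => x i * (‖x‖ ^ 2 + ε)⁻¹) x ∧
    fderiv ℝ (fun x : Space => x i * (‖x‖ ^ 2 + ε)⁻¹) x (basisVec i) =
      (‖x‖ ^ 2 + ε)⁻¹ - 2 * (x i) ^ 2 * ((‖x‖ ^ 2 + ε)⁻¹) ^ 2 := by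
  have hq : ‖x‖ ^ 2 + ε ≠ 0 := by positivity
  have h1 : HasFDerivAt (fun x : Space => ‖x‖ ^ 2 + ε) (2 • innerSL ℝ x) x :=
    (hasStrictFDerivAt_norm_sq x).hasFDerivAt.add_const ε
  have h2 := (hasFDerivAt_apply i x).mul ((hasDerivAt_inv hq).comp_hasFDerivAt x h1)
  refine ⟨h2.differentiableAt, ?_⟩
  refine (congrArg (fun T : Space →L[ℝ] ℝ => T (basisVec i)) h2.fderiv).trans ?_
  simp [basisVec, EuclideanSpace.inner_single_right]
  ring

/-- Integrate f² against the divergence of the smooth field xq, with q = 1/(|x|²+ε). The divergence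
is 3q - 2|x|²q² ≥ q. Integration by parts leaves a cross term, half of which is absorbed on the
left. -/
lemma integral_sq_mul_inv_le {f : Space → ℝ} (hf : ContDiff ℝ ∞ f) (hc : HasCompactSupport f)
    {ε : ℝ} (hε : 0 < ε) :
    ∫ x, f x ^ 2 * (‖x‖ ^ 2 + ε)⁻¹ ≤ 4 * ∫ x, ‖fderiv ℝ f x‖ ^ 2 := by
  set q : Space → ℝ := fun x => (‖x‖ ^ 2 + ε)⁻¹ with hqdef
  have hqpos : ∀ x : Space, 0 < ‖x‖ ^ 2 + ε := fun x => by positivity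
  have hqc : Continuous q := by
    refine Continuous.inv₀ (by fun_prop) fun x => (hqpos x).ne'
  have hfd : Differentiable ℝ f := hf.differentiable (by simp)
  have hf2c : HasCompactSupport fun x => f x ^ 2 := hc.comp_left (g := fun y => y ^ 2) (by simp)
  have hDc : Continuous fun x => fderiv ℝ f x := hf.continuous_fderiv (by simp)
  have hcoord : ∀ i : Fin 3, Continuous fun x : Space => x i := fun i => by fun_prop
  have hIBP : ∀ i : Fin 3, ∫ x, f x ^ 2 * (q x - 2 * (x i) ^ 2 * q x ^ 2)
      = - ∫ x, (2 * f x * fderiv ℝ f x (basisVec i)) * (x i * q x) := by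
    intro i
    have hd : ∀ x, fderiv ℝ (fun x => f x ^ 2) x (basisVec i)
        = 2 * f x * fderiv ℝ f x (basisVec i) := fun x => by
      rw [((hfd x).hasFDerivAt.pow 2).fderiv]
      simp
    have hw := fun x => fderiv_apply_mul_inv_norm_sq_add hε i x
    have h := integral_mul_fderiv_eq_neg_fderiv_mul_of_integrable (μ := (volume : Measure Space))
      (f := fun x => f x ^ 2) (g := fun x : Space => x i * (‖x‖ ^ 2 + ε)⁻¹) (v := basisVec i)
      ?_ ?_ ?_ (fun x _ => (hfd.pow 2) x) (fun x _ => (hw x).1)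
    · simp only [hd, (hw _).2] at h
      exact h
    · simp only [hd]
      refine Continuous.integrable_of_hasCompactSupport ?_ ?_
      · have := hf.continuous
        have := hcoord i
        have h3 : Continuous fun x => fderiv ℝ f x (basisVec i) := hDc.clm_apply continuous_const
        exact ((continuous_const.mul hf.continuous).mul h3).mul ((hcoord i).mul hqc)
      · refine HasCompactSupport.mul_right ?_
        refine HasCompactSupport.mul_right ?_
        exact hc.mul_left
    · simp only [(hw _).2]
      refine Continuous.integrable_of_hasCompactSupport ?_ hf2c.mul_right
      exact (hf.continuous.pow 2).mul
        (hqc.sub ((continuous_const.mul ((hcoord i).pow 2)).mul (hqc.pow 2)))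
    · exact Continuous.integrable_of_hasCompactSupport
        ((hf.continuous.pow 2).mul ((hcoord i).mul hqc)) hf2c.mul_right
  have hint : ∀ k : Space → ℝ, Continuous k → Integrable fun x => f x ^ 2 * k x := fun k hk =>
    Continuous.integrable_of_hasCompactSupport ((hf.continuous.pow 2).mul hk) hf2c.mul_right
  have hint2 : ∀ k : Space → ℝ, Continuous k → Integrable fun x => (2 * f x) * k x := fun k hk =>
    Continuous.integrable_of_hasCompactSupport ((continuous_const.mul hf.continuous).mul hk)
      (HasCompactSupport.mul_right hc.mul_left)
  have hD2 : Integrable fun x => ‖fderiv ℝ f x‖ ^ 2 :=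
    Continuous.integrable_of_hasCompactSupport (hDc.norm.pow 2)
      ((hc.fderiv ℝ).norm.comp_left (g := fun y => y ^ 2) (by simp))
  have hsum : ∫ x, f x ^ 2 * (3 * q x - 2 * ‖x‖ ^ 2 * q x ^ 2)
      = - ∫ x, 2 * f x * (fderiv ℝ f x x * q x) := by
    have e1 : ∀ x, f x ^ 2 * (3 * q x - 2 * ‖x‖ ^ 2 * q x ^ 2)
        = ∑ i : Fin 3, f x ^ 2 * (q x - 2 * (x i) ^ 2 * q x ^ 2) := fun x => by
      rw [Fin.sum_univ_three, norm_sq_eq_sum]; ring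
    have e2 : ∀ x, 2 * f x * (fderiv ℝ f x x * q x)
        = ∑ i : Fin 3, (2 * f x * fderiv ℝ f x (basisVec i)) * (x i * q x) := fun x => by
      conv_lhs => rw [show fderiv ℝ f x x = fderiv ℝ f x (∑ i, x i • basisVec i) by
        rw [sum_apply_smul_basisVec]]
      rw [Fin.sum_univ_three, Fin.sum_univ_three]
      simp only [map_add, map_smul, smul_eq_mul]
      ring
    simp only [e1, e2]
    rw [integral_finsetSum, integral_finsetSum, ← Finset.sum_neg_distrib]
    · exact Finset.sum_congr rfl fun i _ => hIBP i
    · intro i _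
      have h3 : Continuous fun x => fderiv ℝ f x (basisVec i) := hDc.clm_apply continuous_const
      refine (hint2 (fun x => fderiv ℝ f x (basisVec i) * (x i * q x))
        (h3.mul ((hcoord i).mul hqc))).congr (Eventually.of_forall fun x => by ring)
    · intro i _
      exact hint _ (hqc.sub ((continuous_const.mul ((hcoord i).pow 2)).mul (hqc.pow 2)))
  have hI1 : Integrable fun x => f x ^ 2 * q x := hint q hqc
  have hA : ∫ x, f x ^ 2 * q x ≤ ∫ x, f x ^ 2 * (3 * q x - 2 * ‖x‖ ^ 2 * q x ^ 2) := by
    refine integral_mono hI1 (hint _ (by fun_prop)) fun x => ?_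
    refine mul_le_mul_of_nonneg_left ?_ (sq_nonneg _)
    have hq0 : 0 < q x := inv_pos.2 (hqpos x)
    have hq1 : ‖x‖ ^ 2 * q x ≤ 1 := by
      have : (‖x‖ ^ 2 + ε) * q x = 1 := mul_inv_cancel₀ (hqpos x).ne'
      nlinarith
    nlinarith
  -- Expanding q(f + 2∇f·x)² ≥ 0 bounds the cross term by ½f²q + 2q(∇f·x)², and q|x|² ≤ 1.
  have hB : - ∫ x, 2 * f x * (fderiv ℝ f x x * q x)
      ≤ ∫ x, (1 / 2 * (f x ^ 2 * q x) + 2 * ‖fderiv ℝ f x‖ ^ 2) := by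
    rw [← integral_neg]
    refine integral_mono (hint2 _ ((hDc.clm_apply continuous_id).mul hqc)).neg
      ((hI1.const_mul _).add (hD2.const_mul _)) fun x => ?_
    simp only
    have hq0 : 0 < q x := inv_pos.2 (hqpos x)
    have hq1 : ‖x‖ ^ 2 * q x ≤ 1 := by
      have : (‖x‖ ^ 2 + ε) * q x = 1 := mul_inv_cancel₀ (hqpos x).ne'
      nlinarith
    have h1 : (fderiv ℝ f x x) ^ 2 ≤ ‖fderiv ℝ f x‖ ^ 2 * ‖x‖ ^ 2 := by
      have := (fderiv ℝ f x).le_opNorm x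
      rw [← mul_pow, ← sq_abs]
      exact pow_le_pow_left₀ (abs_nonneg _) this 2
    have h2 : (fderiv ℝ f x x) ^ 2 * q x ≤ ‖fderiv ℝ f x‖ ^ 2 := by
      calc _ ≤ ‖fderiv ℝ f x‖ ^ 2 * ‖x‖ ^ 2 * q x := by gcongr
        _ = ‖fderiv ℝ f x‖ ^ 2 * (‖x‖ ^ 2 * q x) := by ring
        _ ≤ ‖fderiv ℝ f x‖ ^ 2 * 1 := by gcongr
        _ = _ := mul_one _
    nlinarith [mul_nonneg hq0.le (sq_nonneg (f x + 2 * fderiv ℝ f x x))]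
  rw [integral_add (hI1.const_mul _) (hD2.const_mul _), integral_const_mul, integral_const_mul]
    at hB
  linarith

lemma hardy_of_contDiff {f : Space → ℝ} (hf : ContDiff ℝ ∞ f) (hc : HasCompactSupport f) :
    ∫⁻ x, ‖f x / ‖x‖‖ₑ ^ (2 : ℝ) ≤ 4 * ∫⁻ x, ‖fderiv ℝ f x‖ₑ ^ (2 : ℝ) := by
  have hDc : Continuous fun x => fderiv ℝ f x := hf.continuous_fderiv (by simp)
  have hD2 : Integrable fun x => ‖fderiv ℝ f x‖ ^ 2 :=
    Continuous.integrable_of_hasCompactSupport (hDc.norm.pow 2)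
      ((hc.fderiv ℝ).norm.comp_left (g := fun y => y ^ 2) (by simp))
  have hf2c : HasCompactSupport fun x => f x ^ 2 := hc.comp_left (g := fun y => y ^ 2) (by simp)
  have hR : ∫⁻ x, ‖fderiv ℝ f x‖ₑ ^ (2 : ℝ) = ENNReal.ofReal (∫ x, ‖fderiv ℝ f x‖ ^ 2) := by
    rw [ofReal_integral_eq_lintegral_ofReal hD2 (Eventually.of_forall fun x => sq_nonneg _)]
    refine lintegral_congr fun x => ?_
    rw [ENNReal.ofReal_pow (norm_nonneg _), ofReal_norm]
    norm_num
  let ε : ℕ → ℝ := fun n => 1 / ((n : ℝ) + 1)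
  have hε : ∀ n, 0 < ε n := fun n => by positivity
  have hcont : ∀ n, Continuous fun x : Space => f x ^ 2 * (‖x‖ ^ 2 + ε n)⁻¹ := fun n =>
    (hf.continuous.pow 2).mul (Continuous.inv₀ (by fun_prop) fun x => by have := hε n; positivity)
  have hn : ∀ n, ∫⁻ x, ENNReal.ofReal (f x ^ 2 * (‖x‖ ^ 2 + ε n)⁻¹)
      ≤ 4 * ∫⁻ x, ‖fderiv ℝ f x‖ₑ ^ (2 : ℝ) := by
    intro n
    rw [hR, ← ofReal_integral_eq_lintegral_ofReal, ← ENNReal.ofReal_ofNat 4,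
      ← ENNReal.ofReal_mul (by norm_num)]
    · exact ENNReal.ofReal_le_ofReal (integral_sq_mul_inv_le hf hc (hε n))
    · exact Continuous.integrable_of_hasCompactSupport (hcont n) hf2c.mul_right
    · exact Eventually.of_forall fun x => by have := hε n; positivity
  refine le_trans ?_ (liminf_le_of_le (f := atTop) (u := fun n =>
    ∫⁻ x, ENNReal.ofReal (f x ^ 2 * (‖x‖ ^ 2 + ε n)⁻¹)) (by isBoundedDefault) fun b hb =>
      let ⟨n, hn'⟩ := hb.exists; hn'.trans (hn n))
  refine le_trans ?_ (lintegral_liminf_le fun n => (hcont n).measurable.ennreal_ofReal)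
  refine lintegral_mono_ae ?_
  have h0 : ∀ᵐ x : Space, x ≠ 0 := by simp [ae_iff]
  filter_upwards [h0] with x hx
  have hlim : Tendsto (fun n => ENNReal.ofReal (f x ^ 2 * (‖x‖ ^ 2 + ε n)⁻¹)) atTop
      (𝓝 (ENNReal.ofReal (f x ^ 2 * (‖x‖ ^ 2 + 0)⁻¹))) := by
    refine ENNReal.tendsto_ofReal (Tendsto.const_mul _ (Tendsto.inv₀ ?_ ?_))
    · exact tendsto_const_nhds.add tendsto_one_div_add_atTop_nhds_zero_nat
    · simpa using hx
  rw [hlim.liminf_eq, add_zero, ← div_eq_mul_inv, ← div_pow, Real.enorm_eq_ofReal_abs,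
    ENNReal.ofReal_rpow_of_nonneg (abs_nonneg _) (by norm_num)]
  norm_num

/-- A smooth cutoff on `ℝ³` at radius `n + 1`. -/
noncomputable def spaceCutoff (n : ℕ) (x : Space) : ℝ :=
  (⟨1, 2, one_pos, one_lt_two⟩ : ContDiffBump (0 : Space)) (((n : ℝ) + 1)⁻¹ • x)

lemma contDiff_spaceCutoff (n : ℕ) : ContDiff ℝ ∞ (spaceCutoff n) :=
  (ContDiffBump.contDiff _).comp (contDiff_const_smul _)

lemma spaceCutoff_nonneg (n : ℕ) (x : Space) : 0 ≤ spaceCutoff n x := ContDiffBump.nonneg _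

lemma spaceCutoff_le_one (n : ℕ) (x : Space) : spaceCutoff n x ≤ 1 := ContDiffBump.le_one _

lemma norm_inv_smul_nat (n : ℕ) (x : Space) : ‖((n : ℝ) + 1)⁻¹ • x‖ = ‖x‖ / ((n : ℝ) + 1) := by
  have : (0 : ℝ) ≤ (n : ℝ) + 1 := by positivity
  rw [norm_smul, norm_inv, Real.norm_of_nonneg this]
  ring

lemma spaceCutoff_eq_one {n : ℕ} {x : Space} (hx : ‖x‖ ≤ (n : ℝ) + 1) : spaceCutoff n x = 1 := by
  apply ContDiffBump.one_of_mem_closedBall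
  rw [mem_closedBall_zero_iff, norm_inv_smul_nat, div_le_one (by positivity)]
  exact hx

lemma spaceCutoff_eq_zero {n : ℕ} {x : Space} (hx : 2 * ((n : ℝ) + 1) ≤ ‖x‖) :
    spaceCutoff n x = 0 := by
  apply ContDiffBump.zero_of_le_dist
  rw [dist_zero_right, norm_inv_smul_nat, le_div_iff₀ (by positivity)]
  exact hx

lemma hasCompactSupport_spaceCutoff (n : ℕ) : HasCompactSupport (spaceCutoff n) := by
  refine HasCompactSupport.intro (isCompact_closedBall (0 : Space) (2 * ((n : ℝ) + 1)))
    fun x hx => ?_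
  rw [mem_closedBall_zero_iff, not_le] at hx
  exact spaceCutoff_eq_zero hx.le

lemma tendsto_spaceCutoff (x : Space) : Tendsto (fun n => spaceCutoff n x) atTop (𝓝 1) := by
  obtain ⟨N, hN⟩ := exists_nat_ge ‖x‖
  refine tendsto_const_nhds.congr' ?_
  filter_upwards [eventually_ge_atTop N] with n hn
  rw [spaceCutoff_eq_one]
  have : (N : ℝ) ≤ n := by exact_mod_cast hn
  linarith

lemma exists_fderiv_spaceCutoff_bound : ∃ C : ℝ, 0 ≤ C ∧ ∀ n x,
    ‖fderiv ℝ (spaceCutoff n) x‖ ≤ C / ((n : ℝ) + 1) := by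
  set B : ContDiffBump (0 : Space) := ⟨1, 2, one_pos, one_lt_two⟩ with hB
  have hBs : ContDiff ℝ ∞ (B : Space → ℝ) := B.contDiff
  obtain ⟨C, hC⟩ := (B.hasCompactSupport.fderiv ℝ).exists_bound_of_continuous
    (hBs.continuous_fderiv (by simp))
  refine ⟨C, (norm_nonneg _).trans (hC 0), fun n x => ?_⟩
  have h1 : HasFDerivAt (spaceCutoff n)
      ((fderiv ℝ B (((n : ℝ) + 1)⁻¹ • x)).comp
        (((n : ℝ) + 1)⁻¹ • ContinuousLinearMap.id ℝ Space)) x := by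
    refine HasFDerivAt.comp x (hBs.differentiable (by simp) _).hasFDerivAt ?_
    exact (((n : ℝ) + 1)⁻¹ • ContinuousLinearMap.id ℝ Space).hasFDerivAt
  rw [h1.fderiv, ContinuousLinearMap.comp_smul, norm_smul, ContinuousLinearMap.comp_id, norm_inv,
    Real.norm_of_nonneg (by positivity), ← div_eq_inv_mul]
  exact div_le_div_of_nonneg_right (hC _) (by positivity)

lemma fderiv_spaceCutoff_eq_zero_of_lt {n : ℕ} {x : Space} (hx : ‖x‖ < (n : ℝ) + 1) :
    fderiv ℝ (spaceCutoff n) x = 0 := by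
  have h : spaceCutoff n =ᶠ[𝓝 x] fun _ => 1 := by
    have : Metric.ball (0 : Space) ((n : ℝ) + 1) ∈ 𝓝 x :=
      Metric.isOpen_ball.mem_nhds (by simpa using hx)
    filter_upwards [this] with y hy
    exact spaceCutoff_eq_one (by simpa using (mem_ball_zero_iff.1 hy).le)
  rw [h.fderiv_eq]
  simp

lemma fderiv_spaceCutoff_eq_zero_of_gt {n : ℕ} {x : Space} (hx : 2 * ((n : ℝ) + 1) < ‖x‖) :
    fderiv ℝ (spaceCutoff n) x = 0 := by
  have h : spaceCutoff n =ᶠ[𝓝 x] fun _ => 0 := by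
    have : (Metric.closedBall (0 : Space) (2 * ((n : ℝ) + 1)))ᶜ ∈ 𝓝 x :=
      Metric.isClosed_closedBall.isOpen_compl.mem_nhds (by simpa using hx)
    filter_upwards [this] with y hy
    exact spaceCutoff_eq_zero (le_of_lt (by simpa using hy))
  rw [h.fderiv_eq]
  simp

/-- In dimension three the L³ norm of a gradient is scale invariant: size 1/n on a set of volume n³.
It is the Hölder partner of L⁶ in L². -/
lemma exists_eLpNorm_fderiv_spaceCutoff_le : ∃ C : ℝ≥0∞, C ≠ ⊤ ∧ ∀ n,
    eLpNorm (fderiv ℝ (spaceCutoff n)) 3 volume ≤ C := by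
  obtain ⟨C, hC0, hC⟩ := exists_fderiv_spaceCutoff_bound
  refine ⟨ENNReal.ofReal (2 * C) * volume (Metric.ball (0 : Space) 1) ^ (1 / 3 : ℝ),
    ENNReal.mul_ne_top ENNReal.ofReal_ne_top (ENNReal.rpow_ne_top_of_nonneg (by norm_num)
      measure_ball_lt_top.ne), fun n => ?_⟩
  set R : ℝ := 2 * ((n : ℝ) + 1) with hR
  have hR0 : 0 < R := by positivity
  have h1 : eLpNorm (fderiv ℝ (spaceCutoff n)) 3 volume
      = eLpNorm (fderiv ℝ (spaceCutoff n)) 3 (volume.restrict (Metric.closedBall 0 R)) := by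
    rw [← eLpNorm_indicator_eq_eLpNorm_restrict (f := fderiv ℝ (spaceCutoff n)) Metric.isClosed_closedBall.measurableSet]
    congr 1
    ext1 x
    by_cases hx : x ∈ Metric.closedBall 0 R
    · rw [Set.indicator_of_mem hx]
    · rw [Set.indicator_of_notMem hx, fderiv_spaceCutoff_eq_zero_of_gt]
      simpa using hx
  rw [h1]
  refine (eLpNorm_le_of_ae_bound (Eventually.of_forall (hC n))).trans ?_
  rw [Measure.restrict_apply_univ, Measure.addHaar_closedBall _ _ hR0.le, finrank_euclideanSpace,
    Fintype.card_fin, ENNReal.mul_rpow_of_nonneg _ _ (by norm_num : (0 : ℝ) ≤ (3 : ℝ≥0∞).toReal⁻¹),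
    ENNReal.ofReal_rpow_of_nonneg (by positivity) (by norm_num)]
  have h2 : (R ^ 3) ^ (3 : ℝ≥0∞).toReal⁻¹ = R := by
    rw [← Real.rpow_natCast, ← Real.rpow_mul hR0.le]
    norm_num
  rw [h2, mul_right_comm, ← ENNReal.ofReal_mul hR0.le]
  have h3 : R * (C / ((n : ℝ) + 1)) = 2 * C := by rw [hR]; field_simp
  rw [h3]
  norm_num

/-- The weak gradient of the mollification is the mollification of the weak gradient. -/
lemma fderiv_moll_eq_inner (n : ℕ) {f : Space → ℝ} {g : Space → Space} (hf : LocallyIntegrable f)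
    (hg : LocallyIntegrable g) (h : IsWeakGradient f g) (x e : Space) :
    fderiv ℝ (moll n f) x e = inner ℝ (moll n g x) e := by
  rw [fderiv_moll n hf (f' := fun x => inner ℝ (g x) e) (fun φ h1 h2 => h φ h1 h2 e), moll_apply,
    moll_apply]
  have hc := (hasCompactSupport_mollKernel (E := Space) n).convolutionExists_left
    (ContinuousLinearMap.lsmul ℝ ℝ) (continuous_mollKernel n) hg x
  have h2 := (innerSL ℝ e).integral_comp_comm hc
  simp only [ContinuousLinearMap.lsmul_apply, map_smul, innerSL_apply_apply] at h2
  rw [real_inner_comm, ← h2]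
  refine integral_congr_ae (Eventually.of_forall fun y => ?_)
  simp only
  rw [real_inner_comm]

lemma norm_fderiv_moll_le (n : ℕ) {f : Space → ℝ} {g : Space → Space} (hf : LocallyIntegrable f)
    (hg : LocallyIntegrable g) (h : IsWeakGradient f g) (x : Space) :
    ‖fderiv ℝ (moll n f) x‖ ≤ ‖moll n g x‖ := by
  refine ContinuousLinearMap.opNorm_le_bound _ (norm_nonneg _) fun e => ?_
  rw [fderiv_moll_eq_inner n hf hg h]
  exact norm_inner_le_norm _ _

lemma tendsto_eLpNorm_indicator_far {f : Space → ℝ} (hf : MemLp f 6 volume) :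
    Tendsto (fun n : ℕ => eLpNorm ({x : Space | (n : ℝ) ≤ ‖x‖}.indicator f) 6 volume)
      atTop (𝓝 0) := by
  have hms : ∀ n : ℕ, MeasurableSet {x : Space | (n : ℝ) ≤ ‖x‖} := fun n =>
    measurableSet_le measurable_const measurable_norm
  have hfin : ∫⁻ x, ‖f x‖ₑ ^ (6 : ℝ) ≠ ⊤ := by
    have := hf.2
    rw [eLpNorm_eq_lintegral_rpow_enorm_toReal (by norm_num) (by norm_num)] at this
    have h2 := ENNReal.rpow_lt_top_iff_of_pos (y := 1 / (6 : ℝ≥0∞).toReal) (by norm_num) |>.1 this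
    simpa using h2.ne
  have h1 : Tendsto (fun n : ℕ => ∫⁻ x, ‖{x : Space | (n : ℝ) ≤ ‖x‖}.indicator f x‖ₑ ^ (6 : ℝ))
      atTop (𝓝 (∫⁻ _ : Space, 0)) := by
    refine tendsto_lintegral_of_dominated_convergence' (fun x => ‖f x‖ₑ ^ (6 : ℝ)) ?_ ?_ hfin ?_
    · exact fun n => (hf.1.indicator (hms n)).enorm.pow_const _
    · intro n
      refine Eventually.of_forall fun x => ?_
      simp only
      gcongr
      exact enorm_indicator_le_enorm_self f x
    · refine Eventually.of_forall fun x => ?_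
      obtain ⟨N, hN⟩ := exists_nat_gt ‖x‖
      refine tendsto_const_nhds.congr' ?_
      filter_upwards [eventually_ge_atTop N] with n hn
      rw [Set.indicator_of_notMem]
      · simp
      · have : (N : ℝ) ≤ n := by exact_mod_cast hn
        simp only [Set.mem_ofPred_eq, not_le]
        linarith
  rw [lintegral_zero] at h1
  have h2 := (ENNReal.continuous_rpow_const (y := 1 / 6)).tendsto 0 |>.comp h1
  rw [ENNReal.zero_rpow_of_pos (by norm_num)] at h2
  refine h2.congr fun n => ?_
  rw [eLpNorm_eq_lintegral_rpow_enorm_toReal (by norm_num) (by norm_num)]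
  simp

/-- A function in `L⁶` with weak gradient in `L²` is an almost everywhere limit of test functions
whose gradients are asymptotically no larger in `L²`. -/
lemma exists_testFunction_approx {f : Space → ℝ} {g : Space → Space} (hf : MemLp f 6 volume)
    (hg : MemLp g 2 volume) (h : IsWeakGradient f g) :
    ∃ (F : ℕ → Space → ℝ) (δ : ℕ → ℝ≥0∞), (∀ n, ContDiff ℝ ∞ (F n)) ∧
      (∀ n, HasCompactSupport (F n)) ∧ (∀ᵐ x, Tendsto (fun n => F n x) atTop (𝓝 (f x))) ∧
      Tendsto δ atTop (𝓝 0) ∧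
      ∀ n, eLpNorm (fderiv ℝ (F n)) 2 volume ≤ eLpNorm g 2 volume + δ n := by
  have hfl : LocallyIntegrable f := hf.locallyIntegrable (by norm_num)
  have hgl : LocallyIntegrable g := hg.locallyIntegrable (by norm_num)
  obtain ⟨C, hC, hCn⟩ := exists_eLpNorm_fderiv_spaceCutoff_le
  have hms : ∀ n : ℕ, MeasurableSet {x : Space | (n : ℝ) ≤ ‖x‖} := fun n =>
    measurableSet_le measurable_const measurable_norm
  refine ⟨fun n x => spaceCutoff n x * moll n f x,
    fun n => eLpNorm ({x : Space | (n : ℝ) ≤ ‖x‖}.indicator f) 6 volume * C, fun n =>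
      (contDiff_spaceCutoff n).mul (contDiff_moll n hfl), fun n =>
      (hasCompactSupport_spaceCutoff n).mul_right, ?_, ?_, fun n => ?_⟩
  · filter_upwards [ae_tendsto_moll hfl] with x hx
    simpa using (tendsto_spaceCutoff x).mul hx
  · simpa using ENNReal.Tendsto.mul_const (tendsto_eLpNorm_indicator_far hf) (Or.inr hC)
  · set a : Space → ℝ := moll n ({x : Space | (n : ℝ) ≤ ‖x‖}.indicator f) with ha
    have hsc := contDiff_spaceCutoff n
    have hmf := contDiff_moll n hfl
    have hil : LocallyIntegrable ({x : Space | (n : ℝ) ≤ ‖x‖}.indicator f) :=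
      hfl.indicator (hms n)
    -- The cutoff has zero gradient for |x| < n+1. Beyond that radius the mollification only sees f
    -- where |x| ≥ n, so f may be replaced there by its tail, whose L⁶ norm tends to 0.
    have hder : fderiv ℝ (fun x => spaceCutoff n x * moll n f x) =
        (fun x => spaceCutoff n x • fderiv ℝ (moll n f) x)
          + fun x => a x • fderiv ℝ (spaceCutoff n) x := by
      ext1 x
      have h1 := ((hsc.differentiable (by simp) x).hasFDerivAt.mul
        (hmf.differentiable (by simp) x).hasFDerivAt)
      refine h1.fderiv.trans ?_
      rw [Pi.add_apply]
      congr 1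
      by_cases hx : ‖x‖ < (n : ℝ) + 1
      · rw [fderiv_spaceCutoff_eq_zero_of_lt hx, smul_zero, smul_zero]
      · congr 1
        refine moll_congr_ball fun y hy => ?_
        rw [Set.indicator_of_mem]
        simp only [Set.mem_ofPred_eq]
        have h2 : 1 / ((n : ℝ) + 1) ≤ 1 := by
          rw [div_le_one (by positivity)]; linarith [Nat.cast_nonneg (α := ℝ) n]
        have h3 := norm_sub_norm_le x y
        rw [norm_sub_rev] at h3
        linarith
    have hDsc : Continuous fun x => fderiv ℝ (spaceCutoff n) x :=
      hsc.continuous_fderiv (by simp)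
    have hDm : Continuous fun x => fderiv ℝ (moll n f) x := hmf.continuous_fderiv (by simp)
    have hac : Continuous a := (contDiff_moll n hil).continuous
    rw [hder]
    refine (eLpNorm_add_le (hsc.continuous.smul hDm).aestronglyMeasurable
      (hac.smul hDsc).aestronglyMeasurable one_le_two).trans (add_le_add ?_ ?_)
    · refine le_trans (eLpNorm_mono fun x => ?_) (eLpNorm_moll_two_le n hg.1)
      change ‖spaceCutoff n x • fderiv ℝ (moll n f) x‖ ≤ _
      rw [norm_smul, Real.norm_of_nonneg (spaceCutoff_nonneg n x)]
      calc _ ≤ 1 * ‖moll n g x‖ := mul_le_mul (spaceCutoff_le_one n x)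
            (norm_fderiv_moll_le n hfl hgl h x) (norm_nonneg _) zero_le_one
        _ = _ := one_mul _
    -- Hölder with 1/2 = 1/6 + 1/3: the tail in L⁶ times the cutoff gradient, bounded in L³.
    · have : ENNReal.HolderTriple 6 3 2 := ⟨by
        rw [← ENNReal.toReal_eq_toReal_iff' (by simp) (by simp)]
        rw [ENNReal.toReal_add (by simp) (by simp)]
        norm_num⟩
      refine (eLpNorm_smul_le_mul_eLpNorm (p := 6) (q := 3) (r := 2)
        hDsc.aestronglyMeasurable hac.aestronglyMeasurable).trans (mul_le_mul' ?_ (hCn n))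
      · rw [eLpNorm_eq_lintegral_rpow_enorm_toReal (by norm_num) (by norm_num),
          eLpNorm_eq_lintegral_rpow_enorm_toReal (by norm_num) (by norm_num)]
        refine ENNReal.rpow_le_rpow ?_ (by norm_num)
        exact lintegral_enorm_moll_rpow_le n hil.aestronglyMeasurable (by norm_num)

/-- The inequality for test functions passes to the limit by lower semicontinuity of the norm under
almost everywhere convergence. -/
lemma hardy_inequality {f : Space → ℝ} {g : Space → Space} (hf : MemLp f 6 volume)
    (hg : MemLp g 2 volume) (h : IsWeakGradient f g) :
    eLpNorm (fun x => f x / ‖x‖) 2 volume ≤ 2 * eLpNorm g 2 volume := by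
  obtain ⟨F, δ, hF, hFc, hlim, hδ, hle⟩ := exists_testFunction_approx hf hg h
  have hm : ∀ n, AEStronglyMeasurable (fun x => F n x / ‖x‖) volume := fun n =>
    ((hF n).continuous.measurable.div measurable_norm).aestronglyMeasurable
  refine (Lp.eLpNorm_lim_le_liminf_eLpNorm hm _ (hlim.mono fun x hx => hx.div_const _)).trans ?_
  have hb : ∀ n, eLpNorm (fun x => F n x / ‖x‖) 2 volume ≤ 2 * (eLpNorm g 2 volume + δ n) := by
    intro n
    refine le_trans ?_ (mul_le_mul_right (hle n) 2)
    rw [eLpNorm_two_eq, eLpNorm_two_eq]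
    calc _ ≤ (4 * ∫⁻ x, ‖fderiv ℝ (F n) x‖ₑ ^ (2 : ℝ)) ^ (1 / 2 : ℝ) :=
          ENNReal.rpow_le_rpow (hardy_of_contDiff (hF n) (hFc n)) (by norm_num)
      _ = _ := by
          rw [ENNReal.mul_rpow_of_nonneg _ _ (by norm_num)]
          congr 1
          rw [show (4 : ℝ≥0∞) = 2 ^ (2 : ℝ) by norm_num, ← ENNReal.rpow_mul]
          norm_num
  have ht : Tendsto (fun n => 2 * (eLpNorm g 2 volume + δ n)) atTop
      (𝓝 (2 * (eLpNorm g 2 volume + 0))) :=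
    ENNReal.Tendsto.const_mul (tendsto_const_nhds.add hδ) (Or.inr (by norm_num))
  rw [add_zero] at ht
  rw [← ht.liminf_eq]
  exact liminf_le_liminf (Eventually.of_forall hb)

/-- Applied to differences u(t) - u(s), this turns continuity of the gradient in L² into continuity
of u in L⁶. -/
lemma exists_sobolev_inequality : ∃ C : ℝ≥0, ∀ (f : Space → ℝ) (g : Space → Space),
    MemLp f 6 volume → MemLp g 2 volume → IsWeakGradient f g →
    eLpNorm f 6 volume ≤ C * eLpNorm g 2 volume := by
  refine ⟨SNormLESNormFDerivOfEqConst ℝ (volume : Measure Space) 2, fun f g hf hg h => ?_⟩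
  set C := SNormLESNormFDerivOfEqConst ℝ (volume : Measure Space) 2
  obtain ⟨F, δ, hF, hFc, hlim, hδ, hle⟩ := exists_testFunction_approx hf hg h
  refine (Lp.eLpNorm_lim_le_liminf_eLpNorm (fun n => (hF n).continuous.aestronglyMeasurable) _
    hlim).trans ?_
  have hb : ∀ n, eLpNorm (F n) 6 volume ≤ C * (eLpNorm g 2 volume + δ n) := by
    intro n
    refine le_trans ?_ (mul_le_mul_right (hle n) _)
    exact eLpNorm_le_eLpNorm_fderiv_of_eq (p := 2) (p' := 6) volume ((hF n).of_le (by simp)) (hFc n)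
      one_le_two (by simp) (by simp; norm_num)
  have ht : Tendsto (fun n => C * (eLpNorm g 2 volume + δ n)) atTop
      (𝓝 (C * (eLpNorm g 2 volume + 0))) :=
    ENNReal.Tendsto.const_mul (tendsto_const_nhds.add hδ) (Or.inr ENNReal.coe_ne_top)
  rw [add_zero] at ht
  rw [← ht.liminf_eq]
  exact liminf_le_liminf (Eventually.of_forall hb)

end HardySobolev

end DefocusingWave

namespace DefocusingWave

/-! ### Directional derivatives and radial test functions on space-time -/

section SmoothIdentities

/-- The time direction in space-time. -/
def timeVec : ℝ × Space := (1, 0)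

/-- The spatial coordinate directions in space-time. -/
noncomputable def spaceVec (i : Fin 3) : ℝ × Space := (0, basisVec i)

/-- The spatial gradient of a function on space-time. -/
noncomputable def spaceGrad (U : ℝ × Space → ℝ) (z : ℝ × Space) : Space :=
  WithLp.toLp 2 fun i => fderiv ℝ U z (spaceVec i)

/-- The time derivative of a function on space-time. -/
noncomputable def timeDer (U : ℝ × Space → ℝ) (z : ℝ × Space) : ℝ := fderiv ℝ U z timeVec

/-- The wave operator `∂ₜ² - Δ`. -/
noncomputable def waveOp (U : ℝ × Space → ℝ) (z : ℝ × Space) : ℝ :=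
  fderiv ℝ (fun y => fderiv ℝ U y timeVec) z timeVec
    - ∑ i, fderiv ℝ (fun y => fderiv ℝ U y (spaceVec i)) z (spaceVec i)

/-- `𝐋₊` for functions on space-time. -/
noncomputable def LplusST (U V : ℝ × Space → ℝ) (G : ℝ × Space → Space) (z : ℝ × Space) : ℝ :=
  Lplus (fun y => U (z.1, y)) (fun y => V (z.1, y)) (fun y => G (z.1, y)) z.2

/-- The angular part of a vector field on space-time. -/
noncomputable def angularST (G : ℝ × Space → Space) (z : ℝ × Space) : Space :=
  angularGrad (fun y => G (z.1, y)) z.2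

/-- `f` is differentiable at `z` and its derivative in the direction `e` is `d`. -/
def HasDirDeriv (f : ℝ × Space → ℝ) (e z : ℝ × Space) (d : ℝ) : Prop :=
  DifferentiableAt ℝ f z ∧ fderiv ℝ f z e = d

namespace HasDirDeriv

variable {f g : ℝ × Space → ℝ} {e z : ℝ × Space} {d d' : ℝ}

lemma mul (hf : HasDirDeriv f e z d) (hg : HasDirDeriv g e z d') :
    HasDirDeriv (fun y => f y * g y) e z (d * g z + f z * d') := by
  refine ⟨hf.1.mul hg.1, ?_⟩
  refine (congrArg (fun T : (ℝ × Space) →L[ℝ] ℝ => T e)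
    (hf.1.hasFDerivAt.mul hg.1.hasFDerivAt).fderiv).trans ?_
  simp [hf.2, hg.2]
  ring

lemma add (hf : HasDirDeriv f e z d) (hg : HasDirDeriv g e z d') :
    HasDirDeriv (fun y => f y + g y) e z (d + d') := by
  refine ⟨hf.1.add hg.1, ?_⟩
  refine (congrArg (fun T : (ℝ × Space) →L[ℝ] ℝ => T e)
    (hf.1.hasFDerivAt.add hg.1.hasFDerivAt).fderiv).trans ?_
  simp [hf.2, hg.2]

lemma sub (hf : HasDirDeriv f e z d) (hg : HasDirDeriv g e z d') :
    HasDirDeriv (fun y => f y - g y) e z (d - d') := by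
  refine ⟨hf.1.sub hg.1, ?_⟩
  refine (congrArg (fun T : (ℝ × Space) →L[ℝ] ℝ => T e)
    (hf.1.hasFDerivAt.sub hg.1.hasFDerivAt).fderiv).trans ?_
  simp [hf.2, hg.2]

lemma const_mul (c : ℝ) (hf : HasDirDeriv f e z d) :
    HasDirDeriv (fun y => c * f y) e z (c * d) := by
  refine ⟨hf.1.const_mul c, ?_⟩
  refine (congrArg (fun T : (ℝ × Space) →L[ℝ] ℝ => T e)
    (hf.1.hasFDerivAt.const_mul c).fderiv).trans ?_
  simp [hf.2]

lemma comp {H : ℝ → ℝ} {H' : ℝ} (hH : HasDerivAt H H' (f z)) (hf : HasDirDeriv f e z d) :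
    HasDirDeriv (fun y => H (f y)) e z (H' * d) := by
  have h := hH.comp_hasFDerivAt z hf.1.hasFDerivAt
  refine ⟨h.differentiableAt, ?_⟩
  refine (congrArg (fun T : (ℝ × Space) →L[ℝ] ℝ => T e) h.fderiv).trans ?_
  simp [hf.2]

end HasDirDeriv

lemma hasDirDeriv_of_contDiff {f : ℝ × Space → ℝ} (hf : ContDiff ℝ ∞ f) (e z : ℝ × Space) :
    HasDirDeriv f e z (fderiv ℝ f z e) :=
  ⟨hf.differentiable (by simp) z, rfl⟩

lemma hasDirDeriv_norm {z : ℝ × Space} (hz : z.2 ≠ 0) (e : ℝ × Space) :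
    HasDirDeriv (fun y => ‖y.2‖) e z (inner ℝ (radialDir z.2) e.2) := by
  have h1 : HasFDerivAt (fun y : ℝ × Space => ‖y.2‖ ^ 2)
      ((2 • innerSL ℝ z.2).comp (ContinuousLinearMap.snd ℝ ℝ Space)) z :=
    (hasStrictFDerivAt_norm_sq z.2).hasFDerivAt.comp z (hasFDerivAt_snd (p := z))
  have hn : ‖z.2‖ ≠ 0 := norm_ne_zero_iff.2 hz
  have h2 := h1.sqrt (by positivity)
  have h3 : (fun y : ℝ × Space => √(‖y.2‖ ^ 2)) = fun y => ‖y.2‖ := by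
    ext y; exact Real.sqrt_sq (norm_nonneg _)
  rw [h3] at h2
  refine ⟨h2.differentiableAt, ?_⟩
  rw [h2.fderiv]
  simp [radialDir, inner_smul_left, Real.sqrt_sq (norm_nonneg _)]
  ring

lemma hasDirDeriv_inv_norm {z : ℝ × Space} (hz : z.2 ≠ 0) (e : ℝ × Space) :
    HasDirDeriv (fun y => ‖y.2‖⁻¹) e z (-(‖z.2‖⁻¹ ^ 2) * inner ℝ (radialDir z.2) e.2) := by
  have := HasDirDeriv.comp (f := fun y : ℝ × Space => ‖y.2‖) (z := z)
    (hasDerivAt_inv (norm_ne_zero_iff.2 hz)) (hasDirDeriv_norm hz e)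
  simpa using this

lemma hasDirDeriv_coord (z e : ℝ × Space) (j : Fin 3) :
    HasDirDeriv (fun y => y.2 j) e z (e.2 j) := by
  have h : HasFDerivAt (fun y : ℝ × Space => y.2 j)
      ((EuclideanSpace.proj j : Space →L[ℝ] ℝ).comp (ContinuousLinearMap.snd ℝ ℝ Space)) z :=
    ((EuclideanSpace.proj j : Space →L[ℝ] ℝ).comp (ContinuousLinearMap.snd ℝ ℝ Space)).hasFDerivAt
  exact ⟨h.differentiableAt, by rw [h.fderiv]; simp⟩

/-- The coordinates of the radial direction as functions on space-time. -/
noncomputable def radialCoord (j : Fin 3) (z : ℝ × Space) : ℝ := ‖z.2‖⁻¹ * z.2 j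

lemma radialDir_apply (z : ℝ × Space) (j : Fin 3) : radialDir z.2 j = radialCoord j z := by
  simp [radialDir, radialCoord]

lemma inner_radialDir_basisVec (z : ℝ × Space) (j : Fin 3) :
    inner ℝ (radialDir z.2) (basisVec j) = radialCoord j z := by
  simp [basisVec, EuclideanSpace.inner_single_right, radialDir_apply]

lemma hasDirDeriv_inv_norm_time {z : ℝ × Space} (hz : z.2 ≠ 0) :
    HasDirDeriv (fun y => ‖y.2‖⁻¹) timeVec z 0 := by
  simpa [timeVec] using hasDirDeriv_inv_norm hz timeVec

lemma hasDirDeriv_inv_norm_space {z : ℝ × Space} (hz : z.2 ≠ 0) (i : Fin 3) :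
    HasDirDeriv (fun y => ‖y.2‖⁻¹) (spaceVec i) z (-(‖z.2‖⁻¹ ^ 2) * radialCoord i z) := by
  simpa [spaceVec, inner_radialDir_basisVec] using hasDirDeriv_inv_norm hz (spaceVec i)

lemma hasDirDeriv_radialCoord_time {z : ℝ × Space} (hz : z.2 ≠ 0) (j : Fin 3) :
    HasDirDeriv (radialCoord j) timeVec z 0 := by
  have := (hasDirDeriv_inv_norm_time hz).mul (hasDirDeriv_coord z timeVec j)
  simpa [timeVec, radialCoord] using! this

lemma hasDirDeriv_radialCoord_space {z : ℝ × Space} (hz : z.2 ≠ 0) (i j : Fin 3) :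
    HasDirDeriv (radialCoord j) (spaceVec i) z
      (‖z.2‖⁻¹ * ((if i = j then 1 else 0) - radialCoord i z * radialCoord j z)) := by
  have := (hasDirDeriv_inv_norm_space hz i).mul (hasDirDeriv_coord z (spaceVec i) j)
  have h2 : (spaceVec i).2 j = if i = j then 1 else 0 := by
    simp [spaceVec, basisVec, eq_comm]
  rw [h2] at this
  refine ⟨this.1, this.2.trans ?_⟩
  unfold radialCoord
  ring

lemma sum_radialCoord_sq {z : ℝ × Space} (hz : z.2 ≠ 0) :
    radialCoord 0 z ^ 2 + radialCoord 1 z ^ 2 + radialCoord 2 z ^ 2 = 1 := by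
  have hn : ‖z.2‖ ≠ 0 := norm_ne_zero_iff.2 hz
  unfold radialCoord
  have := norm_sq_eq_sum z.2
  field_simp
  linarith

lemma inner_radialDir (c : Space) (z : ℝ × Space) : inner ℝ c (radialDir z.2)
    = c 0 * radialCoord 0 z + c 1 * radialCoord 1 z + c 2 * radialCoord 2 z := by
  rw [PiLp.inner_apply, Fin.sum_univ_three]
  simp [radialDir_apply]
  ring

lemma LplusST_eq (U V : ℝ × Space → ℝ) (G : ℝ × Space → Space) (z : ℝ × Space) :
    LplusST U V G z = (G z 0 * radialCoord 0 z + G z 1 * radialCoord 1 z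
      + G z 2 * radialCoord 2 z) + U z * ‖z.2‖⁻¹ + V z := by
  rw [← inner_radialDir, ← div_eq_mul_inv]
  rfl

lemma norm_angularST_sq (G : ℝ × Space → Space) {z : ℝ × Space} (hz : z.2 ≠ 0) :
    ‖angularST G z‖ ^ 2 = (G z 0 ^ 2 + G z 1 ^ 2 + G z 2 ^ 2)
      - (G z 0 * radialCoord 0 z + G z 1 * radialCoord 1 z + G z 2 * radialCoord 2 z) ^ 2 := by
  have h : ∀ j, angularST G z j = G z j - (G z 0 * radialCoord 0 z + G z 1 * radialCoord 1 z
      + G z 2 * radialCoord 2 z) * radialCoord j z := fun j => by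
    rw [← inner_radialDir]
    simp [angularST, angularGrad, radialDir_apply]
  rw [norm_sq_eq_sum, h, h, h]
  have hS := sum_radialCoord_sq hz
  generalize radialCoord 0 z = w0 at *
  generalize radialCoord 1 z = w1 at *
  generalize radialCoord 2 z = w2 at *
  linear_combination (G z 0 * w0 + G z 1 * w1 + G z 2 * w2) ^ 2 * hS

lemma integral_fderiv_eq_zero {P : ℝ × Space → ℝ} (hP : ContDiff ℝ 1 P) (hc : HasCompactSupport P)
    (e : ℝ × Space) : ∫ z, fderiv ℝ P z e = 0 := by
  have hcont : Continuous fun z => fderiv ℝ P z e :=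
    (hP.continuous_fderiv (by simp)).clm_apply continuous_const
  have hi : Integrable fun z => fderiv ℝ P z e :=
    hcont.integrable_of_hasCompactSupport (hc.fderiv_apply (𝕜 := ℝ) e)
  have h := integral_mul_fderiv_eq_neg_fderiv_mul_of_integrable
    (μ := (volume : Measure (ℝ × Space))) (f := fun _ => (1 : ℝ)) (g := P) (v := e)
    (by simp) (by simpa using hi)
    (by simpa using hP.continuous.integrable_of_hasCompactSupport hc)
    (fun _ _ => differentiableAt_const _) (fun x _ => hP.differentiable (by simp) x)
  simpa using h

/-- The coefficients 1/|x| and x/|x| are singular on the axis; a factor vanishing near the axis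
makes products with them smooth on all of space-time. -/
lemma contDiff_mul_of_eventually_zero {n : ℕ∞} {χ Q : ℝ × Space → ℝ} {δ : ℝ} (hδ : 0 < δ)
    (hχ : ContDiff ℝ ∞ χ) (h0 : ∀ z, ‖z.2‖ < δ → χ z = 0)
    (hQ : ∀ z : ℝ × Space, z.2 ≠ 0 → ContDiffAt ℝ n Q z) :
    ContDiff ℝ n fun z => χ z * Q z := by
  rw [contDiff_iff_contDiffAt]
  intro z
  by_cases hz : z.2 = 0
  · have : (fun z => χ z * Q z) =ᶠ[𝓝 z] fun _ => 0 := by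
      have ho : IsOpen {y : ℝ × Space | ‖y.2‖ < δ} :=
        isOpen_lt (by fun_prop) continuous_const
      filter_upwards [ho.mem_nhds (by simpa [hz] using hδ)] with y hy
      rw [h0 y hy, zero_mul]
    exact contDiffAt_const.congr_of_eventuallyEq this
  · exact (hχ.of_le (by exact_mod_cast le_top)).contDiffAt.mul (hQ z hz)

lemma contDiffAt_inv_norm {z : ℝ × Space} (hz : z.2 ≠ 0) {n : ℕ∞} :
    ContDiffAt ℝ n (fun y : ℝ × Space => ‖y.2‖⁻¹) z :=
  (contDiff_snd.contDiffAt.norm ℝ hz).inv (norm_ne_zero_iff.2 hz)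

lemma contDiffAt_radialCoord {z : ℝ × Space} (hz : z.2 ≠ 0) (j : Fin 3) {n : ℕ∞} :
    ContDiffAt ℝ n (radialCoord j) z := by
  have h1 : ContDiff ℝ n fun y : ℝ × Space => y.2 j :=
    ((EuclideanSpace.proj j : Space →L[ℝ] ℝ).comp (ContinuousLinearMap.snd ℝ ℝ Space)).contDiff
  exact (contDiffAt_inv_norm hz).mul h1.contDiffAt

lemma ae_snd_ne_zero : ∀ᵐ z : ℝ × Space, z.2 ≠ 0 := by
  have h : ∀ᵐ x : Space, x ≠ 0 := by simp [ae_iff]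
  exact Measure.quasiMeasurePreserving_snd.ae h

/-- A radial test function: smooth on `ℝ × ℝ` with compact support, and vanishing near the
time axis. -/
structure IsRadialTest (X : ℝ × ℝ → ℝ) : Prop where
  contDiff : ContDiff ℝ ∞ X
  hasCompactSupport : HasCompactSupport X
  vanishes : ∃ δ > 0, ∀ p : ℝ × ℝ, p.2 < δ → X p = 0

/-- The function on space-time defined by a function of time and radius. -/
noncomputable def lift (X : ℝ × ℝ → ℝ) (z : ℝ × Space) : ℝ := X (z.1, ‖z.2‖)

/-- The time derivative of a function of time and radius. -/
noncomputable def dT (X : ℝ × ℝ → ℝ) (p : ℝ × ℝ) : ℝ := fderiv ℝ X p (1, 0)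

/-- The radial derivative of a function of time and radius. -/
noncomputable def dR (X : ℝ × ℝ → ℝ) (p : ℝ × ℝ) : ℝ := fderiv ℝ X p (0, 1)

/-- The norm is not smooth at the origin, but X vanishes for r < δ. -/
lemma IsRadialTest.contDiff_lift {X : ℝ × ℝ → ℝ} (hX : IsRadialTest X) :
    ContDiff ℝ ∞ (lift X) := by
  obtain ⟨δ, hδ, h0⟩ := hX.vanishes
  rw [contDiff_iff_contDiffAt]
  intro z
  by_cases hz : z.2 = 0
  · have : lift X =ᶠ[𝓝 z] fun _ => 0 := by
      have ho : IsOpen {y : ℝ × Space | ‖y.2‖ < δ} :=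
        isOpen_lt (by fun_prop) continuous_const
      filter_upwards [ho.mem_nhds (by simpa [hz] using hδ)] with y hy
      exact h0 _ hy
    exact contDiffAt_const.congr_of_eventuallyEq this
  · exact hX.contDiff.contDiffAt.comp z
      (contDiff_fst.contDiffAt.prodMk (contDiff_snd.contDiffAt.norm ℝ hz))

lemma IsRadialTest.hasCompactSupport_lift {X : ℝ × ℝ → ℝ} (hX : IsRadialTest X) :
    HasCompactSupport (lift X) := by
  obtain ⟨R, hR⟩ := hX.hasCompactSupport.isCompact.isBounded.subset_closedBall 0
  refine HasCompactSupport.intro (isCompact_closedBall (0 : ℝ × Space) R) fun z hz => ?_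
  by_contra hne
  apply hz
  have h1 := hR (subset_tsupport _ (Function.mem_support.2 hne))
  rw [mem_closedBall_zero_iff] at h1 ⊢
  simpa [Prod.norm_def] using h1

lemma hasDirDeriv_lift {X : ℝ × ℝ → ℝ} (hX : ContDiff ℝ ∞ X) {z : ℝ × Space} (hz : z.2 ≠ 0)
    (e : ℝ × Space) : HasDirDeriv (lift X) e z (dT X (z.1, ‖z.2‖) * e.1
      + dR X (z.1, ‖z.2‖) * inner ℝ (radialDir z.2) e.2) := by
  have hn := hasDirDeriv_norm hz e
  have h1 := ((hX.differentiable (by simp) (z.1, ‖z.2‖)).hasFDerivAt).comp z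
    ((hasFDerivAt_fst (p := z)).prodMk hn.1.hasFDerivAt)
  refine ⟨h1.differentiableAt, ?_⟩
  refine (congrArg (fun T : (ℝ × Space) →L[ℝ] ℝ => T e) h1.fderiv).trans ?_
  have h2 : (e.1, inner ℝ (radialDir z.2) e.2)
      = e.1 • ((1 : ℝ), (0 : ℝ)) + (inner ℝ (radialDir z.2) e.2 : ℝ) • ((0 : ℝ), (1 : ℝ)) := by
    simp
  simp only [ContinuousLinearMap.comp_apply, ContinuousLinearMap.prod_apply,
    ContinuousLinearMap.coe_fst', hn.2]
  rw [h2, map_add, map_smul, map_smul]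
  simp only [dT, dR, smul_eq_mul]
  ring

lemma hasDirDeriv_lift_time {X : ℝ × ℝ → ℝ} (hX : ContDiff ℝ ∞ X) {z : ℝ × Space}
    (hz : z.2 ≠ 0) : HasDirDeriv (lift X) timeVec z (lift (dT X) z) := by
  simpa [timeVec] using! hasDirDeriv_lift hX hz timeVec

lemma hasDirDeriv_lift_space {X : ℝ × ℝ → ℝ} (hX : ContDiff ℝ ∞ X) {z : ℝ × Space}
    (hz : z.2 ≠ 0) (i : Fin 3) :
    HasDirDeriv (lift X) (spaceVec i) z (lift (dR X) z * radialCoord i z) := by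
  simpa [spaceVec, inner_radialDir_basisVec] using! hasDirDeriv_lift hX hz (spaceVec i)

end SmoothIdentities

end DefocusingWave

namespace DefocusingWave

/-! ### Multiplier identities for smooth functions -/

section SmoothIdentities

variable {U : ℝ × Space → ℝ}

lemma contDiff_partial (hU : ContDiff ℝ ∞ U) (e : ℝ × Space) :
    ContDiff ℝ ∞ fun y => fderiv ℝ U y e := contDiff_fderiv_apply hU e

lemma fderiv_fderiv_symm (hU : ContDiff ℝ ∞ U) (e e' z : ℝ × Space) :
    fderiv ℝ (fun y => fderiv ℝ U y e) z e' = fderiv ℝ (fun y => fderiv ℝ U y e') z e := by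
  have hd : DifferentiableAt ℝ (fderiv ℝ U) z :=
    (hU.fderiv_right (m := ∞) (by norm_num)).differentiable (by simp) z
  have h : ∀ a b, fderiv ℝ (fun y => fderiv ℝ U y a) z b = fderiv ℝ (fderiv ℝ U) z b a := by
    intro a b
    rw [fderiv_clm_apply hd (differentiableAt_const a)]
    simp
  rw [h, h]
  exact (hU.contDiffAt.isSymmSndFDerivAt (by simpa using! ENat.LEInfty.out)) e' e

lemma integral_divergence_eq_zero {P0 : ℝ × Space → ℝ} {P : Fin 3 → ℝ × Space → ℝ}
    (h0 : ContDiff ℝ 1 P0) (hc0 : HasCompactSupport P0) (h : ∀ i, ContDiff ℝ 1 (P i))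
    (hc : ∀ i, HasCompactSupport (P i)) :
    ∫ z, (fderiv ℝ P0 z timeVec + ∑ i, fderiv ℝ (P i) z (spaceVec i)) = 0 := by
  have hi : ∀ (Q : ℝ × Space → ℝ) (e : ℝ × Space), ContDiff ℝ 1 Q → HasCompactSupport Q →
      Integrable fun z => fderiv ℝ Q z e := fun Q e hQ hQc =>
    ((hQ.continuous_fderiv (by simp)).clm_apply continuous_const).integrable_of_hasCompactSupport
      (hQc.fderiv_apply (𝕜 := ℝ) e)
  rw [integral_add (hi _ _ h0 hc0) (integrable_finsetSum _ fun i _ => hi _ _ (h i) (hc i)),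
    integral_finsetSum _ fun i _ => hi _ _ (h i) (hc i), integral_fderiv_eq_zero h0 hc0]
  simp [integral_fderiv_eq_zero (h _) (hc _)]

/-- The multiplier identity for `∂ₜ U`. -/
lemma integral_energy_identity (hU : ContDiff ℝ ∞ U) {ψ : ℝ × Space → ℝ} (hψ : ContDiff ℝ ∞ ψ)
    (hc : HasCompactSupport ψ) :
    ∫ z, (ψ z * timeDer U z * waveOp U z
      + timeDer ψ z * (1 / 2 * (timeDer U z ^ 2 + ‖spaceGrad U z‖ ^ 2))
      - timeDer U z * inner ℝ (spaceGrad ψ z) (spaceGrad U z)) = 0 := by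
  have ht := contDiff_partial hU timeVec
  have hs := fun i => contDiff_partial hU (spaceVec i)
  set Ut : ℝ × Space → ℝ := fun y => fderiv ℝ U y timeVec with hUt
  set Us : Fin 3 → ℝ × Space → ℝ := fun i y => fderiv ℝ U y (spaceVec i) with hUs
  -- The energy-momentum field: energy density in time, -U_t∇U in space, both multiplied by ψ. The
  -- integral of its divergence is zero.
  let P0 : ℝ × Space → ℝ := fun z => ψ z * (1 / 2 * (Ut z * Ut z +
    (Us 0 z * Us 0 z + Us 1 z * Us 1 z + Us 2 z * Us 2 z)))
  let P : Fin 3 → ℝ × Space → ℝ := fun i z => ψ z * (-1 * (Ut z * Us i z))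
  have hP0 : ContDiff ℝ ∞ P0 := hψ.mul (contDiff_const.mul ((ht.mul ht).add
    ((((hs 0).mul (hs 0)).add ((hs 1).mul (hs 1))).add ((hs 2).mul (hs 2)))))
  have hP : ∀ i, ContDiff ℝ ∞ (P i) := fun i => hψ.mul (contDiff_const.mul (ht.mul (hs i)))
  rw [← integral_divergence_eq_zero (hP0.of_le (by simp)) hc.mul_right
    (fun i => (hP i).of_le (by simp)) (fun i => hc.mul_right)]
  refine integral_congr_ae (Eventually.of_forall fun z => ?_)
  have dψt := hasDirDeriv_of_contDiff hψ timeVec z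
  have dψs := fun i => hasDirDeriv_of_contDiff hψ (spaceVec i) z
  have dt := fun e => hasDirDeriv_of_contDiff ht e z
  have ds := fun i e => hasDirDeriv_of_contDiff (hs i) e z
  have d0 := (dψt.mul (((dt timeVec).mul (dt timeVec)).add
    ((((ds 0 timeVec).mul (ds 0 timeVec)).add ((ds 1 timeVec).mul (ds 1 timeVec))).add
      ((ds 2 timeVec).mul (ds 2 timeVec))) |>.const_mul (1 / 2))).2
  have d := fun i => ((dψs i).mul (((dt (spaceVec i)).mul (ds i (spaceVec i))).const_mul (-1))).2
  have e0 : fderiv ℝ P0 z timeVec = _ := d0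
  have e1 : ∀ i, fderiv ℝ (P i) z (spaceVec i) = _ := d
  have sym : ∀ i, fderiv ℝ Ut z (spaceVec i) = fderiv ℝ (Us i) z timeVec := fun i =>
    fderiv_fderiv_symm hU _ _ z
  simp only [e0, e1, Fin.sum_univ_three, sym]
  have hg : ‖spaceGrad U z‖ ^ 2 = Us 0 z ^ 2 + Us 1 z ^ 2 + Us 2 z ^ 2 := by
    rw [norm_sq_eq_sum]; rfl
  have hin : inner ℝ (spaceGrad ψ z) (spaceGrad U z) = fderiv ℝ ψ z (spaceVec 0) * Us 0 z
      + fderiv ℝ ψ z (spaceVec 1) * Us 1 z + fderiv ℝ ψ z (spaceVec 2) * Us 2 z := by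
    rw [PiLp.inner_apply, Fin.sum_univ_three]
    simp [spaceGrad, hUs]
    ring
  have hw : waveOp U z = fderiv ℝ Ut z timeVec - (fderiv ℝ (Us 0) z (spaceVec 0)
      + fderiv ℝ (Us 1) z (spaceVec 1) + fderiv ℝ (Us 2) z (spaceVec 2)) := by
    rw [waveOp, Fin.sum_univ_three]
  have h1 : timeDer U z = Ut z := rfl
  have h2 : timeDer ψ z = fderiv ℝ ψ z timeVec := rfl
  rw [hg, hin, hw, h1, h2]
  ring

/-- The potential is kept apart from the wave operator because a mollified solution satisfies the
equation with the mollified nonlinearity, not with the nonlinearity of the mollification. A general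
H leaves room for truncations. -/
lemma integral_energy_chain (hU : ContDiff ℝ ∞ U) {ψ : ℝ × Space → ℝ} (hψ : ContDiff ℝ ∞ ψ)
    (hc : HasCompactSupport ψ) {H H' : ℝ → ℝ} (hH : ∀ s, HasDerivAt H (H' s) s)
    (hH' : Continuous H') :
    ∫ z, (ψ z * timeDer U z * H' (U z) + timeDer ψ z * H (U z)) = 0 := by
  have hHc : ContDiff ℝ 1 H := by
    rw [contDiff_one_iff_deriv]
    have : deriv H = H' := funext fun s => (hH s).deriv
    exact ⟨fun s => (hH s).differentiableAt, this ▸ hH'⟩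
  have hP : ContDiff ℝ 1 fun z => ψ z * H (U z) :=
    (hψ.of_le (by simp)).mul (hHc.comp (hU.of_le (by simp)))
  have h := integral_fderiv_eq_zero hP hc.mul_right timeVec
  rw [← h]
  refine integral_congr_ae (Eventually.of_forall fun z => ?_)
  have d := ((hasDirDeriv_of_contDiff hψ timeVec z).mul
    (HasDirDeriv.comp (hH (U z)) (hasDirDeriv_of_contDiff hU timeVec z))).2
  simp only [d, timeDer]
  ring

/-- The multiplier identity for `½ 𝐋₊ U`. -/
lemma integral_inward_identity (hU : ContDiff ℝ ∞ U) {X : ℝ × ℝ → ℝ} (hX : IsRadialTest X) :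
    ∫ z, (lift X z * (1 / 2 * LplusST U (timeDer U) (spaceGrad U) z) * waveOp U z
      + lift (dT X) z * (1 / 4 * LplusST U (timeDer U) (spaceGrad U) z ^ 2
          + 1 / 4 * ‖angularST (spaceGrad U) z‖ ^ 2)
      - lift (dR X) z * (1 / 4 * LplusST U (timeDer U) (spaceGrad U) z ^ 2
          - 1 / 4 * ‖angularST (spaceGrad U) z‖ ^ 2)
      - lift X z * (1 / 2 * ‖angularST (spaceGrad U) z‖ ^ 2 / ‖z.2‖)) = 0 := by
  have ht := contDiff_partial hU timeVec
  have hs := fun i => contDiff_partial hU (spaceVec i)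
  set Ut : ℝ × Space → ℝ := fun y => fderiv ℝ U y timeVec with hUt
  set Us : Fin 3 → ℝ × Space → ℝ := fun i y => fderiv ℝ U y (spaceVec i) with hUs
  let ur : ℝ × Space → ℝ := fun z => Us 0 z * radialCoord 0 z + Us 1 z * radialCoord 1 z
    + Us 2 z * radialCoord 2 z
  let L : ℝ × Space → ℝ := fun z => ur z + U z * ‖z.2‖⁻¹ + Ut z
  let N : ℝ × Space → ℝ := fun z => (Us 0 z * Us 0 z + Us 1 z * Us 1 z + Us 2 z * Us 2 z)
    - ur z * ur z
  -- The field has time component ¼(L² + N) and space component -¼(L² - N)ω - ½L(∇U - U_r ω), with ω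
  -- = x/|x| and N = |∇̸U|². The last part is tangential, so the gradient of the radial weight does
  -- not see it.
  let P0 : ℝ × Space → ℝ := fun z => lift X z * (1 / 4 * (L z * L z + N z))
  let P : Fin 3 → ℝ × Space → ℝ := fun i z => lift X z *
    (-1 * (1 / 4 * ((L z * L z - N z) * radialCoord i z)
      + 1 / 2 * (L z * (Us i z - ur z * radialCoord i z))))
  obtain ⟨δ, hδ, hX0⟩ := hX.vanishes
  have hXl := hX.contDiff_lift
  have hX0' : ∀ z : ℝ × Space, ‖z.2‖ < δ → lift X z = 0 := fun z hz => hX0 _ hz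
  have hXc := hX.hasCompactSupport_lift
  have cur : ∀ z : ℝ × Space, z.2 ≠ 0 → ContDiffAt ℝ (1 : ℕ∞) ur z := fun z hz =>
    (((((hs 0).of_le (by simp)).contDiffAt.mul (contDiffAt_radialCoord hz 0)).add
    (((hs 1).of_le (by simp)).contDiffAt.mul (contDiffAt_radialCoord hz 1))).add
    (((hs 2).of_le (by simp)).contDiffAt.mul (contDiffAt_radialCoord hz 2)))
  have cL : ∀ z : ℝ × Space, z.2 ≠ 0 → ContDiffAt ℝ (1 : ℕ∞) L z := fun z hz =>
    ((cur z hz).add ((hU.of_le (by simp)).contDiffAt.mul (contDiffAt_inv_norm hz))).add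
      (ht.of_le (by simp)).contDiffAt
  have cs : ∀ i z, ContDiffAt ℝ (1 : ℕ∞) (Us i) z := fun i z => ((hs i).of_le (by simp)).contDiffAt
  have cN : ∀ z : ℝ × Space, z.2 ≠ 0 → ContDiffAt ℝ (1 : ℕ∞) N z := fun z hz =>
    ((((cs 0 z).mul (cs 0 z)).add ((cs 1 z).mul (cs 1 z))).add ((cs 2 z).mul (cs 2 z))).sub
      ((cur z hz).mul (cur z hz))
  have hP0 : ContDiff ℝ (1 : ℕ∞) P0 := contDiff_mul_of_eventually_zero hδ hXl hX0' fun z hz =>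
    contDiffAt_const.mul (((cL z hz).mul (cL z hz)).add (cN z hz))
  have hP : ∀ i, ContDiff ℝ (1 : ℕ∞) (P i) := fun i =>
    contDiff_mul_of_eventually_zero hδ hXl hX0' fun z hz =>
    contDiffAt_const.mul ((contDiffAt_const.mul ((((cL z hz).mul (cL z hz)).sub (cN z hz)).mul
      (contDiffAt_radialCoord hz i))).add (contDiffAt_const.mul ((cL z hz).mul
        ((cs i z).sub ((cur z hz).mul (contDiffAt_radialCoord hz i))))))
  rw [← integral_divergence_eq_zero hP0 hXc.mul_right hP (fun i => hXc.mul_right)]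
  refine integral_congr_ae ?_
  filter_upwards [ae_snd_ne_zero] with z hz
  have dt := fun e => hasDirDeriv_of_contDiff ht e z
  have ds : ∀ i e, HasDirDeriv (Us i) e z (fderiv ℝ (Us i) z e) := fun i e =>
    hasDirDeriv_of_contDiff (hs i) e z
  have du := fun e => hasDirDeriv_of_contDiff hU e z
  have dXt := hasDirDeriv_lift_time hX.contDiff hz
  have dXs := hasDirDeriv_lift_space hX.contDiff hz
  have dkt := hasDirDeriv_inv_norm_time hz
  have dks := hasDirDeriv_inv_norm_space hz
  have dwt := hasDirDeriv_radialCoord_time hz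
  have dws := hasDirDeriv_radialCoord_space hz
  have hS := sum_radialCoord_sq hz
  -- derivatives of `ur`, `L`, `N`
  have durt : HasDirDeriv ur timeVec z _ := (((ds 0 timeVec).mul (dwt 0)).add
    ((ds 1 timeVec).mul (dwt 1))).add ((ds 2 timeVec).mul (dwt 2))
  have durs : ∀ i, HasDirDeriv ur (spaceVec i) z _ := fun i =>
    (((ds 0 (spaceVec i)).mul (dws i 0)).add
    ((ds 1 (spaceVec i)).mul (dws i 1))).add ((ds 2 (spaceVec i)).mul (dws i 2))
  have sym : ∀ i, fderiv ℝ Ut z (spaceVec i) = fderiv ℝ (Us i) z timeVec := fun i =>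
    fderiv_fderiv_symm hU _ _ z
  have sym' : ∀ i j, fderiv ℝ (Us i) z (spaceVec j) = fderiv ℝ (Us j) z (spaceVec i) :=
    fun i j => fderiv_fderiv_symm hU _ _ z
  obtain ⟨Dt, hDt, hDtv⟩ : ∃ D, HasDirDeriv ur timeVec z D ∧ D = fderiv ℝ (Us 0) z timeVec *
      radialCoord 0 z + fderiv ℝ (Us 1) z timeVec * radialCoord 1 z
      + fderiv ℝ (Us 2) z timeVec * radialCoord 2 z := ⟨_, durt, by ring⟩
  have hDs' : ∀ i, ∃ D, HasDirDeriv ur (spaceVec i) z D ∧ D =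
      (fderiv ℝ (Us 0) z (spaceVec i) * radialCoord 0 z
        + fderiv ℝ (Us 1) z (spaceVec i) * radialCoord 1 z
        + fderiv ℝ (Us 2) z (spaceVec i) * radialCoord 2 z)
      + ‖z.2‖⁻¹ * (Us i z - ur z * radialCoord i z) := fun i => ⟨_, durs i, by
        fin_cases i <;> simp [ur] <;> ring⟩
  choose Ds hDs hDsv using hDs'
  have dLt : HasDirDeriv L timeVec z _ := (hDt.add ((du timeVec).mul dkt)).add (dt timeVec)
  have dLs : ∀ i, HasDirDeriv L (spaceVec i) z _ := fun i =>
    ((hDs i).add ((du (spaceVec i)).mul (dks i))).add (dt (spaceVec i))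
  have dNt : HasDirDeriv N timeVec z _ := ((((ds 0 timeVec).mul (ds 0 timeVec)).add
    ((ds 1 timeVec).mul (ds 1 timeVec))).add ((ds 2 timeVec).mul (ds 2 timeVec))).sub
    (hDt.mul hDt)
  have dNs : ∀ i, HasDirDeriv N (spaceVec i) z _ := fun i =>
    ((((ds 0 (spaceVec i)).mul (ds 0 (spaceVec i))).add
    ((ds 1 (spaceVec i)).mul (ds 1 (spaceVec i)))).add
    ((ds 2 (spaceVec i)).mul (ds 2 (spaceVec i)))).sub ((hDs i).mul (hDs i))
  obtain ⟨Lt, hLt, hLtv⟩ : ∃ D, HasDirDeriv L timeVec z D ∧ D =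
    Dt + Ut z * ‖z.2‖⁻¹ + fderiv ℝ Ut z timeVec := ⟨_, dLt, by ring⟩
  have hLs' : ∀ i, ∃ D, HasDirDeriv L (spaceVec i) z D ∧ D = Ds i + Us i z * ‖z.2‖⁻¹
      - U z * ‖z.2‖⁻¹ ^ 2 * radialCoord i z + fderiv ℝ (Us i) z timeVec := fun i =>
    ⟨_, dLs i, by rw [sym]; ring⟩
  choose Ls hLs hLsv using hLs'
  obtain ⟨Nt, hNt, hNtv⟩ : ∃ D, HasDirDeriv N timeVec z D ∧ D =
    2 * (Us 0 z * fderiv ℝ (Us 0) z timeVec + Us 1 z * fderiv ℝ (Us 1) z timeVec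
      + Us 2 z * fderiv ℝ (Us 2) z timeVec) - 2 * ur z * Dt := ⟨_, dNt, by ring⟩
  have hNs' : ∀ i, ∃ D, HasDirDeriv N (spaceVec i) z D ∧ D =
    2 * (Us 0 z * fderiv ℝ (Us 0) z (spaceVec i) + Us 1 z * fderiv ℝ (Us 1) z (spaceVec i)
      + Us 2 z * fderiv ℝ (Us 2) z (spaceVec i)) - 2 * ur z * Ds i := fun i => ⟨_, dNs i, by ring⟩
  choose Ns hNs hNsv using hNs'
  have e0 : fderiv ℝ P0 z timeVec = _ :=
    (dXt.mul (((hLt.mul hLt).add hNt).const_mul (1 / 4))).2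
  have e1 : ∀ i, fderiv ℝ (P i) z (spaceVec i) = _ := fun i =>
    ((dXs i).mul ((((((hLs i).mul (hLs i)).sub (hNs i)).mul (dws i i)).const_mul (1 / 4)).add
      (((hLs i).mul ((ds i (spaceVec i)).sub ((hDs i).mul (dws i i)))).const_mul (1 / 2))
      |>.const_mul (-1))).2
  have hw : waveOp U z = fderiv ℝ Ut z timeVec - (fderiv ℝ (Us 0) z (spaceVec 0)
      + fderiv ℝ (Us 1) z (spaceVec 1) + fderiv ℝ (Us 2) z (spaceVec 2)) := by
    rw [waveOp, Fin.sum_univ_three]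
  have hL : LplusST U (timeDer U) (spaceGrad U) z = L z := LplusST_eq _ _ _ _
  have hN : ‖angularST (spaceGrad U) z‖ ^ 2 = N z := by
    rw [norm_angularST_sq _ hz]
    simp only [N, ur, spaceGrad, hUs]
    ring
  rw [hN, hL, hw, e0, Fin.sum_univ_three, e1, e1, e1, div_eq_mul_inv _ ‖z.2‖]
  simp only [if_true]
  have hurv : ur z = Us 0 z * radialCoord 0 z + Us 1 z * radialCoord 1 z
    + Us 2 z * radialCoord 2 z := rfl
  have hLv : L z = ur z + U z * ‖z.2‖⁻¹ + Ut z := rfl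
  have hNv : N z = (Us 0 z * Us 0 z + Us 1 z * Us 1 z + Us 2 z * Us 2 z)
    - ur z * ur z := rfl
  have s10 := sym' 1 0
  have s20 := sym' 2 0
  have s21 := sym' 2 1
  have D0 := hDsv 0
  have D1 := hDsv 1
  have D2 := hDsv 2
  have L0 := hLsv 0
  have L1 := hLsv 1
  have L2 := hLsv 2
  have N0 := hNsv 0
  have N1 := hNsv 1
  have N2 := hNsv 2
  rw [s10, s20] at D0
  rw [s21] at D1
  rw [s10, s20] at N0
  rw [s21] at N1
  -- Once symmetry has reduced the mixed second derivatives to one for each pair, the claim is a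
  -- polynomial identity in the values of the derivatives at z, which become free real variables.
  generalize ‖z.2‖⁻¹ = k at *
  generalize radialCoord 0 z = w0 at *
  generalize radialCoord 1 z = w1 at *
  generalize radialCoord 2 z = w2 at *
  generalize Us 0 z = u0 at *
  generalize Us 1 z = u1 at *
  generalize Us 2 z = u2 at *
  generalize Ut z = ut at *
  generalize ur z = R at *
  generalize L z = Λ at *
  generalize N z = Ν at *
  generalize U z = v at *
  generalize fderiv ℝ Ut z timeVec = htt at *
  generalize fderiv ℝ (Us 0) z timeVec = h0t at *
  generalize fderiv ℝ (Us 1) z timeVec = h1t at *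
  generalize fderiv ℝ (Us 2) z timeVec = h2t at *
  generalize fderiv ℝ (Us 0) z (spaceVec 0) = h00 at *
  generalize fderiv ℝ (Us 1) z (spaceVec 1) = h11 at *
  generalize fderiv ℝ (Us 2) z (spaceVec 2) = h22 at *
  generalize fderiv ℝ (Us 0) z (spaceVec 1) = h01 at *
  generalize fderiv ℝ (Us 0) z (spaceVec 2) = h02 at *
  generalize fderiv ℝ (Us 1) z (spaceVec 2) = h12 at *
  generalize Ds 0 = d0 at *
  generalize Ds 1 = d1 at *
  generalize Ds 2 = d2 at *
  generalize Ls 0 = l0 at *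
  generalize Ls 1 = l1 at *
  generalize Ls 2 = l2 at *
  generalize Ns 0 = n0 at *
  generalize Ns 1 = n1 at *
  generalize Ns 2 = n2 at *
  generalize lift X z = χ at *
  generalize lift (dT X) z = χt at *
  generalize lift (dR X) z = χr at *
  -- Here q = D²U(ω, ω) and p = D²U(∇U, ω). The identities A, B, C give ω-derivatives of U_r, L and
  -- N; E is the derivative of L along the tangential gradient.
  set q := w0 * (h00 * w0 + h01 * w1 + h02 * w2) + w1 * (h01 * w0 + h11 * w1 + h12 * w2)
    + w2 * (h02 * w0 + h12 * w1 + h22 * w2) with hq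
  set p := u0 * (h00 * w0 + h01 * w1 + h02 * w2) + u1 * (h01 * w0 + h11 * w1 + h12 * w2)
    + u2 * (h02 * w0 + h12 * w1 + h22 * w2) with hp
  have A : w0 * d0 + w1 * d1 + w2 * d2 = q := by
    rw [D0, D1, D2, hq]; linear_combination (-k * R) * hS - k * hurv
  have B : w0 * l0 + w1 * l1 + w2 * l2 = q + k * R - v * k ^ 2 + Dt := by
    rw [L0, L1, L2]
    linear_combination A - k * hurv - v * k ^ 2 * hS - hDtv
  have C : w0 * n0 + w1 * n1 + w2 * n2 = 2 * p - 2 * R * q := by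
    rw [N0, N1, N2]
    linear_combination (-2 * R) * A + 2 * hp - 2 * hp
  have E : (u0 - R * w0) * l0 + (u1 - R * w1) * l1 + (u2 - R * w2) * l2
      = p - R * q + 2 * k * Ν + (u0 * h0t + u1 * h1t + u2 * h2t) - R * Dt := by
    have E1 : u0 * l0 + u1 * l1 + u2 * l2 = p + k * (u0 ^ 2 + u1 ^ 2 + u2 ^ 2 - R ^ 2)
        + k * (u0 ^ 2 + u1 ^ 2 + u2 ^ 2) - v * k ^ 2 * R
        + (u0 * h0t + u1 * h1t + u2 * h2t) := by
      rw [L0, L1, L2, D0, D1, D2]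
      linear_combination (k * R + v * k ^ 2) * hurv
    linear_combination E1 - R * B - 2 * k * hNv
  linear_combination χr * (1 / 4 * (Λ ^ 2 - Ν) - 1 / 2 * Λ * R) * hS - 1 / 2 * Λ * χr * hurv
    - 1 / 2 * Λ * χ * hLtv - 1 / 4 * χ * hNtv + 1 / 2 * Λ * χ * B - 1 / 4 * χ * C
    - 1 / 4 * (Λ ^ 2 - Ν) * k * χ * hS + 1 / 2 * χ * E - 1 / 2 * Λ * χ * A
    + 1 / 2 * Λ * R * k * χ * hS + 1 / 2 * k * Λ * χ * hLv

/-- This is the divergence of ½XH(U)(1, ω). Since div ω = 2/|x| it produces XH/|x|, and the term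
U/|x| of L₊U produces the competing ½UH'/|x|. For H = |s|^{p+1}/(p+1) their difference is the
coefficient (p-1)/(2(p+1)) of the loss. -/
lemma integral_inward_chain (hU : ContDiff ℝ ∞ U) {X : ℝ × ℝ → ℝ} (hX : IsRadialTest X)
    {H H' : ℝ → ℝ} (hH : ∀ s, HasDerivAt H (H' s) s) (hH' : Continuous H') :
    ∫ z, (lift X z * (1 / 2 * LplusST U (timeDer U) (spaceGrad U) z) * H' (U z)
      + (lift (dT X) z + lift (dR X) z) * (1 / 2 * H (U z))
      - lift X z * ((1 / 2 * (U z * H' (U z)) - H (U z)) / ‖z.2‖)) = 0 := by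
  have hHc : ContDiff ℝ 1 H := by
    rw [contDiff_one_iff_deriv]
    have : deriv H = H' := funext fun s => (hH s).deriv
    exact ⟨fun s => (hH s).differentiableAt, this ▸ hH'⟩
  have hHU : ContDiff ℝ 1 fun z => H (U z) := hHc.comp (hU.of_le (by simp))
  let P : Fin 3 → ℝ × Space → ℝ := fun i z => lift X z * (1 / 2 * (H (U z) * radialCoord i z))
  obtain ⟨δ, hδ, hX0⟩ := hX.vanishes
  have hXl := hX.contDiff_lift
  have hXc := hX.hasCompactSupport_lift
  have hP0 : ContDiff ℝ 1 fun z => lift X z * (1 / 2 * H (U z)) :=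
    (hXl.of_le (by simp)).mul (contDiff_const.mul hHU)
  have hP : ∀ i, ContDiff ℝ (1 : ℕ∞) (P i) := fun i =>
    contDiff_mul_of_eventually_zero hδ hXl (fun z hz => hX0 _ hz) fun z hz =>
      contDiffAt_const.mul (hHU.contDiffAt.mul (contDiffAt_radialCoord hz i))
  rw [← integral_divergence_eq_zero hP0 hXc.mul_right hP (fun i => hXc.mul_right)]
  refine integral_congr_ae ?_
  filter_upwards [ae_snd_ne_zero] with z hz
  have dXt := hasDirDeriv_lift_time hX.contDiff hz
  have dXs := hasDirDeriv_lift_space hX.contDiff hz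
  have dH := fun e => HasDirDeriv.comp (hH (U z)) (hasDirDeriv_of_contDiff hU e z)
  have dws := hasDirDeriv_radialCoord_space hz
  have hS := sum_radialCoord_sq hz
  have e0 : fderiv ℝ (fun z => lift X z * (1 / 2 * H (U z))) z timeVec = _ :=
    (dXt.mul ((dH timeVec).const_mul (1 / 2))).2
  have e1 : ∀ i, fderiv ℝ (P i) z (spaceVec i) = _ := fun i =>
    ((dXs i).mul (((dH (spaceVec i)).mul (dws i i)).const_mul (1 / 2))).2
  rw [e0, Fin.sum_univ_three, e1, e1, e1, LplusST_eq, div_eq_mul_inv _ ‖z.2‖]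
  simp only [if_true, timeDer, spaceGrad]
  linear_combination (-(1 / 2) * H (U z) * lift (dR X) z
    + 1 / 2 * lift X z * H (U z) * ‖z.2‖⁻¹) * hS

end SmoothIdentities

end DefocusingWave

namespace DefocusingWave

/-! ### Convergence of integrals of products -/

section LimitTools

lemma tendsto_integral_inner_of_tendsto_eLpNorm {α F : Type*} [MeasurableSpace α]
    [NormedAddCommGroup F] [InnerProductSpace ℝ F] {μ : Measure α} {a b : ℕ → α → F} {a₀ b₀ : α → F}
    (ha : ∀ n, MemLp (a n) 2 μ) (hb : ∀ n, MemLp (b n) 2 μ) (ha₀ : MemLp a₀ 2 μ)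
    (hb₀ : MemLp b₀ 2 μ) (hta : Tendsto (fun n => eLpNorm (a n - a₀) 2 μ) atTop (𝓝 0))
    (htb : Tendsto (fun n => eLpNorm (b n - b₀) 2 μ) atTop (𝓝 0)) :
    Tendsto (fun n => ∫ x, inner ℝ (a n x) (b n x) ∂μ) atTop (𝓝 (∫ x, inner ℝ (a₀ x) (b₀ x) ∂μ)) := by
  have h1 := (Lp.tendsto_Lp_iff_tendsto_eLpNorm'' a ha a₀ ha₀).2 hta
  have h2 := (Lp.tendsto_Lp_iff_tendsto_eLpNorm'' b hb b₀ hb₀).2 htb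
  have h3 := h1.inner (𝕜 := ℝ) h2
  have key : ∀ {f g : α → F} (hf : MemLp f 2 μ) (hg : MemLp g 2 μ),
      inner ℝ (hf.toLp f) (hg.toLp g) = ∫ x, inner ℝ (f x) (g x) ∂μ := by
    intro f g hf hg
    rw [L2.inner_def]
    refine integral_congr_ae ?_
    filter_upwards [hf.coeFn_toLp, hg.coeFn_toLp] with x h1 h2
    rw [h1, h2]
  simpa only [key] using h3

/-- Split the product as (aₙ - a₀)bₙ + a₀bₙ: the first part is small in L¹ since bₙ is bounded, the
second converges by dominated convergence. The bounded factor will be a truncated nonlinearity. -/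
lemma tendsto_integral_mul_of_tendsto_eLpNorm_one {α : Type*} [MeasurableSpace α] {μ : Measure α}
    {a b : ℕ → α → ℝ} {a₀ b₀ : α → ℝ} {B : ℝ} (ha : ∀ n, Integrable (a n) μ) (ha₀ : Integrable a₀ μ)
    (hta : Tendsto (fun n => eLpNorm (a n - a₀) 1 μ) atTop (𝓝 0))
    (hb : ∀ n, AEStronglyMeasurable (b n) μ) (hB : ∀ n x, ‖b n x‖ ≤ B)
    (htb : ∀ᵐ x ∂μ, Tendsto (fun n => b n x) atTop (𝓝 (b₀ x))) :
    Tendsto (fun n => ∫ x, a n x * b n x ∂μ) atTop (𝓝 (∫ x, a₀ x * b₀ x ∂μ)) := by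
  have h1 : Tendsto (fun n => ∫ x, a₀ x * b n x ∂μ) atTop (𝓝 (∫ x, a₀ x * b₀ x ∂μ)) := by
    refine tendsto_integral_of_dominated_convergence (fun x => ‖a₀ x‖ * B)
      (fun n => ha₀.1.mul (hb n)) (ha₀.norm.mul_const B) ?_ ?_
    · intro n
      refine Eventually.of_forall fun x => ?_
      rw [norm_mul]
      exact mul_le_mul_of_nonneg_left (hB n x) (norm_nonneg _)
    · filter_upwards [htb] with x hx
      exact hx.const_mul _
  have h2 : Tendsto (fun n => ∫ x, (a n x - a₀ x) * b n x ∂μ) atTop (𝓝 0) := by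
    refine tendsto_zero_iff_norm_tendsto_zero.2 ?_
    have hR : Tendsto (fun n => (eLpNorm (a n - a₀) 1 μ).toReal * B) atTop (𝓝 0) := by
      have := (ENNReal.tendsto_toReal ENNReal.zero_ne_top).comp hta
      simpa using this.mul_const B
    refine squeeze_zero (fun n => norm_nonneg _) (fun n => ?_) hR
    refine (norm_integral_le_integral_norm _).trans ?_
    have hi : Integrable (a n - a₀) μ := (ha n).sub ha₀
    have e : (eLpNorm (a n - a₀) 1 μ).toReal = ∫ x, ‖(a n - a₀) x‖ ∂μ := by
      rw [eLpNorm_one_eq_lintegral_enorm, integral_norm_eq_lintegral_enorm hi.1]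
    rw [e, ← integral_mul_const]
    refine integral_mono_of_nonneg (Eventually.of_forall fun x => norm_nonneg _)
      (hi.norm.mul_const B) (Eventually.of_forall fun x => ?_)
    simp only [norm_mul, Pi.sub_apply]
    exact mul_le_mul_of_nonneg_left (hB n x) (norm_nonneg _)
  have h3 := h2.add h1
  rw [zero_add] at h3
  refine h3.congr fun n => ?_
  have hbi : ∀ f : α → ℝ, Integrable f μ → Integrable (fun x => f x * b n x) μ := fun f hf =>
    hf.mul_bdd (c := B) (hb n) (Eventually.of_forall (hB n))
  have hadd := integral_add (hbi _ ((ha n).sub ha₀)) (hbi _ ha₀)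
  simp only [Pi.sub_apply] at hadd
  rw [← hadd]
  refine integral_congr_ae (Eventually.of_forall fun x => ?_)
  simp only
  ring

/-- The `L²` norm of a time slice of a function on space-time. -/
noncomputable def sliceNorm {F : Type*} [NormedAddCommGroup F] (f : ℝ × Space → F) (t : ℝ) :
    ℝ≥0∞ := (∫⁻ x, ‖f (t, x)‖ₑ ^ (2 : ℝ)) ^ (1 / 2 : ℝ)

lemma aemeasurable_sliceNorm {F : Type*} [NormedAddCommGroup F] {f : ℝ × Space → F}
    (hf : AEStronglyMeasurable f) : AEMeasurable (sliceNorm f) volume := by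
  refine AEMeasurable.pow_const ?_ _
  exact AEMeasurable.lintegral_prod_right' (f := fun z : ℝ × Space => ‖f z‖ₑ ^ (2 : ℝ))
    (hf.enorm.pow_const _)

lemma ae_aestronglyMeasurable_slice {F : Type*} [NormedAddCommGroup F] {f : ℝ × Space → F}
    (hf : AEStronglyMeasurable f) :
    ∀ᵐ t : ℝ, AEStronglyMeasurable (fun x => f (t, x)) volume :=
  AEStronglyMeasurable.prodMk_left hf

lemma lintegral_sliceNorm_sq {F : Type*} [NormedAddCommGroup F] {f : ℝ × Space → F}
    (hf : AEStronglyMeasurable f) : ∫⁻ t, sliceNorm f t ^ (2 : ℝ) = eLpNorm f 2 volume ^ (2 : ℝ) := by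
  rw [eLpNorm_two_rpow]
  have := lintegral_prod (μ := (volume : Measure ℝ)) (ν := (volume : Measure Space))
    (fun z : ℝ × Space => ‖f z‖ₑ ^ (2 : ℝ)) (hf.enorm.pow_const _)
  refine Eq.trans ?_ this.symm
  refine lintegral_congr fun t => ?_
  rw [sliceNorm, ← ENNReal.rpow_mul]
  norm_num

lemma lintegral_mul_le_sliceNorm {F F' : Type*} [NormedAddCommGroup F] [NormedAddCommGroup F']
    {f : ℝ × Space → F} {k : ℝ × Space → F'} (hf : AEStronglyMeasurable f)
    (hk : AEStronglyMeasurable k) :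
    ∫⁻ z, ‖f z‖ₑ * ‖k z‖ₑ ≤ ∫⁻ t, sliceNorm f t * sliceNorm k t := by
  have h1 := lintegral_prod (μ := (volume : Measure ℝ)) (ν := (volume : Measure Space))
    (fun z : ℝ × Space => ‖f z‖ₑ * ‖k z‖ₑ) (hf.enorm.mul hk.enorm)
  refine h1.le.trans (lintegral_mono_ae ?_)
  filter_upwards [ae_aestronglyMeasurable_slice hf, ae_aestronglyMeasurable_slice hk] with t h2 h3
  have := ENNReal.lintegral_mul_le_Lp_mul_Lq (volume : Measure Space)
    (Real.HolderConjugate.two_two) h2.enorm h3.enorm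
  exact this

/-- Convergence of pairings of `Lᵗ^∞ Lₓ²`-bounded, `L²`-convergent sequences with `Lₜ¹ Lₓ²`. -/
lemma tendsto_lintegral_pairing {D : ℕ → ℝ × Space → ℝ} {F : ℝ × Space → ℝ} {C : ℝ≥0∞} {T : ℝ}
    (hC : C ≠ ⊤) (hD : ∀ n, AEStronglyMeasurable (D n)) (hF : AEStronglyMeasurable F)
    (hlim : Tendsto (fun n => eLpNorm (D n) 2 volume) atTop (𝓝 0))
    (hb : ∀ n, ∀ᵐ t, sliceNorm (D n) t ≤ C) (hT : ∀ n z, z.1 ∉ Set.Icc (-T) T → D n z = 0)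
    (hFi : ∫⁻ t in Set.Icc (-T) T, sliceNorm F t ≠ ⊤) :
    Tendsto (fun n => ∫⁻ z, ‖D n z‖ₑ * ‖F z‖ₑ) atTop (𝓝 0) := by
  set I : Set ℝ := Set.Icc (-T) T with hI
  have hIm : MeasurableSet I := measurableSet_Icc
  have hFm := aemeasurable_sliceNorm hF
  have hDm := fun n => aemeasurable_sliceNorm (hD n)
  have hz : ∀ n t, t ∉ I → sliceNorm (D n) t = 0 := fun n t ht => by
    simp [sliceNorm, hT n (t, _) ht]
  -- The slice norm of F is cut at height M. The excess is paired with the uniform bound C; below M,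
  -- Cauchy-Schwarz in time uses the L² convergence of D n. M is chosen first, then n.
  have hle : ∀ (M : ℕ) n, ∫⁻ z, ‖D n z‖ₑ * ‖F z‖ₑ ≤ C * (∫⁻ t in I, (sliceNorm F t - M))
      + M * (eLpNorm (D n) 2 volume * volume I ^ (1 / 2 : ℝ)) := by
    intro M n
    calc ∫⁻ z, ‖D n z‖ₑ * ‖F z‖ₑ ≤ ∫⁻ t, sliceNorm (D n) t * sliceNorm F t :=
          lintegral_mul_le_sliceNorm (hD n) hF
      _ = ∫⁻ t in I, sliceNorm (D n) t * sliceNorm F t := by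
          rw [← lintegral_indicator hIm]
          refine lintegral_congr fun t => ?_
          by_cases ht : t ∈ I
          · rw [Set.indicator_of_mem ht]
          · rw [Set.indicator_of_notMem ht, hz n t ht, zero_mul]
      _ ≤ ∫⁻ t in I, (C * (sliceNorm F t - M) + M * (sliceNorm (D n) t * 1)) := by
          refine lintegral_mono_ae ?_
          filter_upwards [ae_restrict_of_ae (hb n)] with t htb
          calc sliceNorm (D n) t * sliceNorm F t
              ≤ sliceNorm (D n) t * ((sliceNorm F t - M) + M) := by gcongr; exact le_tsub_add
            _ = sliceNorm (D n) t * (sliceNorm F t - M) + M * (sliceNorm (D n) t * 1) := by ring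
            _ ≤ _ := by gcongr
      _ = C * (∫⁻ t in I, (sliceNorm F t - M)) + M * ∫⁻ t in I, sliceNorm (D n) t * 1 := by
          rw [lintegral_add_right', lintegral_const_mul' _ _ hC,
            lintegral_const_mul' _ _ (ENNReal.natCast_ne_top M)]
          exact (((hDm n).mul_const 1).const_mul _).restrict
      _ ≤ _ := by
          gcongr
          have h := ENNReal.lintegral_mul_le_Lp_mul_Lq (volume.restrict I)
            (Real.HolderConjugate.two_two) (hDm n).restrict (aemeasurable_const (b := (1 : ℝ≥0∞)))
          refine h.trans ?_
          have h2 : eLpNorm (D n) 2 volume = (∫⁻ t, sliceNorm (D n) t ^ (2 : ℝ)) ^ (1 / 2 : ℝ) := by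
            rw [lintegral_sliceNorm_sq (hD n), ← ENNReal.rpow_mul]; norm_num
          rw [h2]
          gcongr
          · exact Measure.restrict_le_self
          · simp
  have htail : Tendsto (fun M : ℕ => C * ∫⁻ t in I, (sliceNorm F t - M)) atTop (𝓝 0) := by
    have h1 : Tendsto (fun M : ℕ => ∫⁻ t in I, (sliceNorm F t - M)) atTop
        (𝓝 (∫⁻ t in I, 0)) := by
      refine tendsto_lintegral_of_dominated_convergence' (sliceNorm F) ?_ ?_ hFi ?_
      · exact fun M => (hFm.restrict.sub aemeasurable_const)
      · exact fun M => Eventually.of_forall fun t => tsub_le_self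
      · filter_upwards [ae_lt_top' hFm.restrict hFi] with t ht
        obtain ⟨N, hN⟩ := ENNReal.exists_nat_gt ht.ne
        refine tendsto_const_nhds.congr' ?_
        filter_upwards [eventually_ge_atTop N] with M hM
        have : (N : ℝ≥0∞) ≤ M := by exact_mod_cast hM
        exact (tsub_eq_zero_of_le (hN.le.trans this)).symm
    rw [lintegral_zero] at h1
    simpa using ENNReal.Tendsto.const_mul h1 (Or.inr hC)
  rw [ENNReal.tendsto_nhds_zero]
  intro ε hε
  have hε2 : (0 : ℝ≥0∞) < ε / 2 := ENNReal.half_pos hε.ne'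
  obtain ⟨M, hM⟩ := (ENNReal.tendsto_nhds_zero.1 htail (ε / 2) hε2).exists
  have h2 : Tendsto (fun n => M * (eLpNorm (D n) 2 volume * volume I ^ (1 / 2 : ℝ))) atTop (𝓝 0) := by
    have hv : volume I ^ (1 / 2 : ℝ) ≠ ⊤ :=
      ENNReal.rpow_ne_top_of_nonneg (by norm_num) (by simp [hI])
    have := ENNReal.Tendsto.const_mul (a := (M : ℝ≥0∞)) (ENNReal.Tendsto.mul_const hlim (Or.inr hv))
      (Or.inr (ENNReal.natCast_ne_top M))
    simpa using this
  filter_upwards [ENNReal.tendsto_nhds_zero.1 h2 (ε / 2) hε2] with n hn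
  calc _ ≤ _ := hle M n
    _ ≤ ε / 2 + ε / 2 := add_le_add hM hn
    _ = ε := ENNReal.add_halves ε

end LimitTools

/-! ### Functions locally bounded in time with values in L² -/

section LocSlice

variable {F : Type*} [NormedAddCommGroup F]

/-- Functions on space-time whose time slices are locally uniformly in `L²_loc`. -/
structure LocSliceL2 (f : ℝ × Space → F) : Prop where
  aesm : AEStronglyMeasurable f
  bound : ∀ R : ℝ, ∃ C : ℝ≥0∞, C ≠ ⊤ ∧
    ∀ t, sliceNorm ((Metric.closedBall (0 : ℝ × Space) R).indicator f) t ≤ C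

lemma mem_closedBall_zero_prod {R : ℝ} {z : ℝ × Space} :
    z ∈ Metric.closedBall (0 : ℝ × Space) R ↔ |z.1| ≤ R ∧ ‖z.2‖ ≤ R := by
  rw [mem_closedBall_zero_iff, Prod.norm_def, sup_le_iff, Real.norm_eq_abs]

lemma memLp_of_sliceNorm_le {f : ℝ × Space → F} (hf : AEStronglyMeasurable f) {C : ℝ≥0∞} {T : ℝ}
    (hC : C ≠ ⊤) (hb : ∀ t, sliceNorm f t ≤ C) (hT : ∀ z, z.1 ∉ Set.Icc (-T) T → f z = 0) :
    MemLp f 2 volume := by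
  refine ⟨hf, ?_⟩
  have h1 : eLpNorm f 2 volume ^ (2 : ℝ) < ⊤ := by
    rw [← lintegral_sliceNorm_sq hf]
    calc ∫⁻ t, sliceNorm f t ^ (2 : ℝ) ≤ ∫⁻ t, (Set.Icc (-T) T).indicator (fun _ => C ^ (2 : ℝ)) t := by
          refine lintegral_mono fun t => ?_
          by_cases ht : t ∈ Set.Icc (-T) T
          · rw [Set.indicator_of_mem ht]
            exact ENNReal.rpow_le_rpow (hb t) (by norm_num)
          · have : sliceNorm f t = 0 := by simp [sliceNorm, hT (t, _) ht]
            simp [this]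
      _ = C ^ (2 : ℝ) * volume (Set.Icc (-T) T) := by
          rw [lintegral_indicator measurableSet_Icc, setLIntegral_const]
      _ < ⊤ := ENNReal.mul_lt_top (ENNReal.rpow_lt_top_of_nonneg (by norm_num) hC) (by simp)
  exact (ENNReal.rpow_lt_top_iff_of_pos (by norm_num)).1 h1

lemma LocSliceL2.memLp_indicator {f : ℝ × Space → F} (hf : LocSliceL2 f) (R : ℝ) :
    MemLp ((Metric.closedBall (0 : ℝ × Space) R).indicator f) 2 volume := by
  obtain ⟨C, hC, hb⟩ := hf.bound R
  refine memLp_of_sliceNorm_le (T := R) (hf.aesm.indicator Metric.isClosed_closedBall.measurableSet)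
    hC hb fun z hz => ?_
  rw [Set.indicator_of_notMem]
  rw [mem_closedBall_zero_prod]
  rw [Set.mem_Icc, ← abs_le] at hz
  tauto

lemma LocSliceL2.locallyIntegrable [NormedSpace ℝ F] {f : ℝ × Space → F} (hf : LocSliceL2 f) :
    LocallyIntegrable f := by
  rw [locallyIntegrable_iff]
  intro k hk
  obtain ⟨R, hR⟩ := hk.isBounded.subset_closedBall 0
  have h1 := (hf.memLp_indicator R).locallyIntegrable one_le_two
  have h2 := h1.integrableOn_isCompact hk
  refine h2.congr ?_
  filter_upwards [ae_restrict_mem hk.measurableSet] with z hz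
  rw [Set.indicator_of_mem (hR hz)]

/-- Every kernel has radius at most 1, so on the ball of radius R only the values of f in the ball
of radius R + 1 matter. -/
lemma indicator_moll_eq [NormedSpace ℝ F] (n : ℕ) (f : ℝ × Space → F) (R : ℝ) :
    (Metric.closedBall (0 : ℝ × Space) R).indicator (moll n f) =
      (Metric.closedBall (0 : ℝ × Space) R).indicator
        (moll n ((Metric.closedBall (0 : ℝ × Space) (R + 1)).indicator f)) := by
  ext1 z
  by_cases hz : z ∈ Metric.closedBall (0 : ℝ × Space) R
  · rw [Set.indicator_of_mem hz, Set.indicator_of_mem hz]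
    refine moll_congr_ball fun y hy => ?_
    rw [Set.indicator_of_mem]
    rw [mem_closedBall_zero_iff] at hz ⊢
    have h2 : 1 / ((n : ℝ) + 1) ≤ 1 := by
      rw [div_le_one (by positivity)]; linarith [Nat.cast_nonneg (α := ℝ) n]
    have h3 := norm_sub_norm_le y z
    linarith
  · rw [Set.indicator_of_notMem hz, Set.indicator_of_notMem hz]

lemma LocSliceL2.exists_moll_bound [NormedSpace ℝ F] {f : ℝ × Space → F} (hf : LocSliceL2 f)
    (R : ℝ) : ∃ C : ℝ≥0∞, C ≠ ⊤ ∧ ∀ n t,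
      sliceNorm ((Metric.closedBall (0 : ℝ × Space) R).indicator (moll n f)) t ≤ C := by
  obtain ⟨C, hC, hb⟩ := hf.bound (R + 1)
  refine ⟨C, hC, fun n t => ?_⟩
  rw [indicator_moll_eq]
  have h1 : ∀ s, ∫⁻ x, ‖(Metric.closedBall (0 : ℝ × Space) (R + 1)).indicator f (s, x)‖ₑ ^ (2 : ℝ)
      ≤ C ^ (2 : ℝ) := fun s => by
    have := ENNReal.rpow_le_rpow (z := 2) (hb s) (by norm_num)
    rwa [sliceNorm, ← ENNReal.rpow_mul, one_div, inv_mul_cancel₀ two_ne_zero,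
      ENNReal.rpow_one] at this
  have h2 := lintegral_slice_moll_le n
    (hf.aesm.indicator Metric.isClosed_closedBall.measurableSet) h1 t
  calc _ ≤ (C ^ (2 : ℝ)) ^ (1 / 2 : ℝ) := by
        refine ENNReal.rpow_le_rpow (le_trans (lintegral_mono fun x => ?_) h2) (by norm_num)
        simp only
        gcongr
        exact enorm_indicator_le_enorm_self _ _
    _ = C := by rw [← ENNReal.rpow_mul]; norm_num

lemma LocSliceL2.tendsto_moll [NormedSpace ℝ F] [CompleteSpace F] {f : ℝ × Space → F}
    (hf : LocSliceL2 f) (R : ℝ) :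
    Tendsto (fun n => eLpNorm (moll n f - f) 2 (volume.restrict (Metric.closedBall 0 R)))
      atTop (𝓝 0) := by
  have h := tendsto_eLpNorm_moll_sub (hf.memLp_indicator (R + 1))
  refine tendsto_of_tendsto_of_tendsto_of_le_of_le tendsto_const_nhds h (fun _ => zero_le) ?_
  intro n
  have hm : MeasurableSet (Metric.closedBall (0 : ℝ × Space) R) :=
    Metric.isClosed_closedBall.measurableSet
  simp only
  rw [← eLpNorm_indicator_eq_eLpNorm_restrict hm]
  refine eLpNorm_mono fun z => ?_
  by_cases hz : z ∈ Metric.closedBall (0 : ℝ × Space) R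
  · have h1 := congrFun (indicator_moll_eq n f R) z
    rw [Set.indicator_of_mem hz, Set.indicator_of_mem hz] at h1
    have hz' : z ∈ Metric.closedBall (0 : ℝ × Space) (R + 1) :=
      Metric.closedBall_subset_closedBall (by linarith) hz
    rw [Set.indicator_of_mem hz, Pi.sub_apply, Pi.sub_apply, h1, Set.indicator_of_mem hz']
  · rw [Set.indicator_of_notMem hz]
    simp

end LocSlice

end DefocusingWave

namespace DefocusingWave

/-! ### The wave operator in coordinates -/

section WaveOperator

lemma fderiv_slice_time {φ : ℝ × Space → ℝ} (hφ : Differentiable ℝ φ) (z : ℝ × Space) :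
    deriv (fun s => φ (s, z.2)) z.1 = fderiv ℝ φ z timeVec := by
  have h := (hφ (z.1, z.2)).hasFDerivAt.comp_hasDerivAt z.1
    ((hasDerivAt_id z.1).prodMk (hasDerivAt_const z.1 z.2))
  exact h.deriv

lemma fderiv_slice_space {φ : ℝ × Space → ℝ} (hφ : Differentiable ℝ φ) (z : ℝ × Space)
    (e : Space) : fderiv ℝ (fun x => φ (z.1, x)) z.2 e = fderiv ℝ φ z (0, e) := by
  have h := (hφ (z.1, z.2)).hasFDerivAt.comp z.2
    ((hasFDerivAt_const z.1 z.2).prodMk (hasFDerivAt_id z.2))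
  refine (congrArg (fun T : Space →L[ℝ] ℝ => T e) h.fderiv).trans ?_
  simp

/-- Translates the slicewise operators of `SolvesWaveEq` into iterated directional derivatives on
space-time, the form in which the mollifications are differentiated. -/
lemma waveOp_eq {φ : ℝ × Space → ℝ} (hφ : ContDiff ℝ ∞ φ) (z : ℝ × Space) :
    iteratedDeriv 2 (fun s => φ (s, z.2)) z.1 - Laplacian.laplacian (fun y => φ (z.1, y)) z.2
      = waveOp φ z := by
  have hd := hφ.differentiable (by simp)
  have hde : ∀ e, Differentiable ℝ fun y => fderiv ℝ φ y e := fun e =>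
    (contDiff_partial hφ e).differentiable (by simp)
  rw [waveOp]
  congr 1
  · rw [iteratedDeriv_succ, iteratedDeriv_one]
    have h1 : (deriv fun s => φ (s, z.2)) = fun s => (fun y => fderiv ℝ φ y timeVec) (s, z.2) := by
      ext s
      exact fderiv_slice_time hd (s, z.2)
    rw [h1, fderiv_slice_time (hde _)]
  · rw [InnerProductSpace.laplacian_eq_iteratedFDeriv_orthonormalBasis _
      (EuclideanSpace.basisFun (Fin 3) ℝ)]
    refine Finset.sum_congr rfl fun i _ => ?_
    rw [iteratedFDeriv_two_apply]
    have hs : ContDiff ℝ ∞ fun y => φ (z.1, y) := hφ.comp (contDiff_const.prodMk contDiff_id)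
    have hdd : DifferentiableAt ℝ (fderiv ℝ fun y => φ (z.1, y)) z.2 :=
      (hs.fderiv_right (m := ∞) (by norm_num)).differentiable (by simp) z.2
    have h2 : ∀ e, fderiv ℝ (fderiv ℝ fun y => φ (z.1, y)) z.2 e e
        = fderiv ℝ (fun x => fderiv ℝ (fun y => φ (z.1, y)) x e) z.2 e := fun e => by
      rw [fderiv_clm_apply hdd (differentiableAt_const e)]
      simp
    simp only [Matrix.cons_val_zero, Matrix.cons_val_one, EuclideanSpace.basisFun_apply]
    rw [h2]
    have h3 : ∀ e : Space, (fun x => fderiv ℝ (fun y => φ (z.1, y)) x e)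
        = fun x => (fun y => fderiv ℝ φ y (0, e)) (z.1, x) := fun e => by
      ext x
      exact fderiv_slice_space hd (z.1, x) e
    rw [h3, fderiv_slice_space (hde _)]
    rfl

/-- The operator has pure second order, so the two signs from the reflection cancel. -/
lemma waveOp_comp_sub_left {k : ℝ × Space → ℝ} (hk : ContDiff ℝ ∞ k) (z y : ℝ × Space) :
    waveOp (fun y => k (z - y)) y = waveOp k (z - y) := by
  have h1 : ∀ {f : ℝ × Space → ℝ}, ContDiff ℝ ∞ f → ∀ y e,
      fderiv ℝ (fun y => f (z - y)) y e = - fderiv ℝ f (z - y) e := fun hf y e => by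
    rw [(hasFDerivAt_comp_sub_left (hf.differentiable (by simp)) z y).fderiv]; rfl
  have h2 : ∀ e, fderiv ℝ (fun y => fderiv ℝ (fun y => k (z - y)) y e) y e
      = fderiv ℝ (fun y => fderiv ℝ k y e) (z - y) e := fun e => by
    simp only [h1 hk]
    rw [fderiv_fun_neg]
    simp only [neg_apply]
    rw [h1 (contDiff_partial hk e), neg_neg]
  simp only [waveOp, h2]

end WaveOperator

/-- Values of `(u, ∂ₜ u, ∇ u)` at a point. -/
abbrev Jet : Type := ℝ × ℝ × Space

/-- `J = (u, ∂ₜ u, ∇ u)` in the weak sense, and `∂ₜ² u - Δ u = - F` in the sense of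
distributions, with local bounds `J ∈ Lₜ^∞ Lₓ²` and `F ∈ Lₜ¹ Lₓ²`. -/
structure IsWeakWave (J : ℝ × Space → Jet) (F : ℝ × Space → ℝ) : Prop where
  locSlice : LocSliceL2 J
  timeDeriv : IsWeakDerivAlong (fun z => (J z).1) (fun z => (J z).2.1) timeVec
  spaceDeriv : ∀ i, IsWeakDerivAlong (fun z => (J z).1) (fun z => (J z).2.2 i) (spaceVec i)
  aesm_source : AEStronglyMeasurable F
  source_integrable : ∀ T : ℝ, ∫⁻ t in Set.Icc (-T) T, sliceNorm F t ≠ ⊤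
  wave : ∀ φ : ℝ × Space → ℝ, ContDiff ℝ ∞ φ → HasCompactSupport φ →
    ∫ z, (J z).1 * waveOp φ z = - ∫ z, F z * φ z

/-! ### Mollified weak solutions and the limit of the wave operator term -/

section MollifiedJets

variable {J : ℝ × Space → Jet} {F : ℝ × Space → ℝ}

lemma convolutionExistsAt_moll {E G : Type*} [NormedAddCommGroup E] [NormedSpace ℝ E]
    [FiniteDimensional ℝ E] [MeasureSpace E] [BorelSpace E] [(volume : Measure E).IsAddHaarMeasure]
    [NormedAddCommGroup G] [NormedSpace ℝ G] (n : ℕ) {f : E → G} (hf : LocallyIntegrable f) (z : E) :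
    Integrable fun y => mollKernel E n y • f (z - y) :=
  (hasCompactSupport_mollKernel (E := E) n).convolutionExists_left
    (ContinuousLinearMap.lsmul ℝ ℝ) (continuous_mollKernel n) hf z

lemma moll_comp_clm {E G G' : Type*} [NormedAddCommGroup E] [NormedSpace ℝ E]
    [FiniteDimensional ℝ E] [MeasureSpace E] [BorelSpace E] [(volume : Measure E).IsAddHaarMeasure]
    [NormedAddCommGroup G] [NormedSpace ℝ G] [NormedAddCommGroup G'] [NormedSpace ℝ G']
    [CompleteSpace G] [CompleteSpace G'] (T : G →L[ℝ] G') (n : ℕ) {f : E → G}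
    (hf : LocallyIntegrable f) (z : E) : T (moll n f z) = moll n (fun y => T (f y)) z := by
  rw [moll_apply, moll_apply, ← T.integral_comp_comm (convolutionExistsAt_moll n hf z)]
  simp

lemma locallyIntegrable_clm {G G' : Type*} [NormedAddCommGroup G] [NormedSpace ℝ G]
    [NormedAddCommGroup G'] [NormedSpace ℝ G'] (T : G →L[ℝ] G') {f : ℝ × Space → G}
    (hf : LocallyIntegrable f) : LocallyIntegrable fun y => T (f y) := by
  rw [locallyIntegrable_iff] at hf ⊢
  exact fun k hk => T.integrable_comp (hf k hk)

namespace IsWeakWave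

lemma locallyIntegrable_jet (h : IsWeakWave J F) : LocallyIntegrable J :=
  h.locSlice.locallyIntegrable

lemma locallyIntegrable_fst (h : IsWeakWave J F) : LocallyIntegrable fun z => (J z).1 :=
  locallyIntegrable_clm (ContinuousLinearMap.fst ℝ ℝ (ℝ × Space)) h.locallyIntegrable_jet

lemma moll_fst (h : IsWeakWave J F) (n : ℕ) (z : ℝ × Space) :
    (moll n J z).1 = moll n (fun z => (J z).1) z :=
  moll_comp_clm (ContinuousLinearMap.fst ℝ ℝ (ℝ × Space)) n h.locallyIntegrable_jet z

lemma contDiff_moll_fst (h : IsWeakWave J F) (n : ℕ) :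
    ContDiff ℝ ∞ (moll n fun z => (J z).1) := contDiff_moll n h.locallyIntegrable_fst

lemma moll_time (h : IsWeakWave J F) (n : ℕ) (z : ℝ × Space) :
    (moll n J z).2.1 = timeDer (moll n fun z => (J z).1) z := by
  rw [timeDer, fderiv_moll n h.locallyIntegrable_fst h.timeDeriv]
  exact moll_comp_clm ((ContinuousLinearMap.fst ℝ ℝ Space).comp
    (ContinuousLinearMap.snd ℝ ℝ (ℝ × Space))) n h.locallyIntegrable_jet z

lemma moll_space (h : IsWeakWave J F) (n : ℕ) (z : ℝ × Space) :
    (moll n J z).2.2 = spaceGrad (moll n fun z => (J z).1) z := by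
  ext i
  change _ = fderiv ℝ (moll n fun z => (J z).1) z (spaceVec i)
  rw [fderiv_moll n h.locallyIntegrable_fst (h.spaceDeriv i)]
  exact moll_comp_clm ((EuclideanSpace.proj i : Space →L[ℝ] ℝ).comp
    ((ContinuousLinearMap.snd ℝ ℝ Space).comp
    (ContinuousLinearMap.snd ℝ ℝ (ℝ × Space)))) n h.locallyIntegrable_jet z

/-- Both derivatives fall on the kernel, and y ↦ k(z - y) is a test function for the weak equation.
-/
lemma waveOp_moll (h : IsWeakWave J F) (n : ℕ) (z : ℝ × Space) :
    waveOp (moll n fun z => (J z).1) z = - moll n F z := by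
  have hk := contDiff_mollKernel (E := ℝ × Space) n
  have hkc := hasCompactSupport_mollKernel (E := ℝ × Space) n
  have hl := h.locallyIntegrable_fst
  set f : ℝ × Space → ℝ := fun z => (J z).1 with hf
  have h1 : moll n f = fun z => ∫ y, mollKernel (ℝ × Space) n (z - y) * f y := by
    ext z; rw [moll_apply']; rfl
  have h2 : ∀ e, fderiv ℝ (fun y => fderiv ℝ (moll n f) y e) z e
      = ∫ y, fderiv ℝ (fun y => fderiv ℝ (mollKernel (ℝ × Space) n) y e) (z - y) e * f y := by
    intro e
    rw [h1]
    have : (fun y => fderiv ℝ (fun z => ∫ y, mollKernel (ℝ × Space) n (z - y) * f y) y e)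
        = fun z => ∫ y, (fun y => fderiv ℝ (mollKernel (ℝ × Space) n) y e) (z - y) * f y := by
      ext z
      exact fderiv_integral_kernel hk hkc hl z e
    rw [this, fderiv_integral_kernel (contDiff_partial hk e)
      (hasCompactSupport_fderiv_apply hkc e) hl]
  have hint : ∀ e, Integrable fun y =>
      fderiv ℝ (fun y => fderiv ℝ (mollKernel (ℝ × Space) n) y e) (z - y) e * f y := by
    intro e
    have hc := contDiff_partial (contDiff_partial hk e) e
    have hcc := hasCompactSupport_fderiv_apply (hasCompactSupport_fderiv_apply hkc e) e
    have := hl.integrable_smul_left_of_hasCompactSupport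
      (g := fun y => fderiv ℝ (fun y => fderiv ℝ (mollKernel (ℝ × Space) n) y e) (z - y) e)
      (hc.continuous.comp (by fun_prop)) (hcc.comp_homeomorph (Homeomorph.subLeft z))
    exact this
  have h3 := h.wave (fun y => mollKernel (ℝ × Space) n (z - y))
    (hk.comp (contDiff_const.sub contDiff_id)) (hkc.comp_homeomorph (Homeomorph.subLeft z))
  simp only [waveOp_comp_sub_left hk] at h3
  have h4 : moll n F z = ∫ y, F y * mollKernel (ℝ × Space) n (z - y) := by
    rw [moll_apply']
    exact integral_congr_ae (Eventually.of_forall fun y => mul_comm _ _)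
  rw [h4, ← h3, waveOp, h2]
  simp only [h2]
  rw [← integral_finsetSum _ fun i _ => hint _, ← integral_sub (hint _)
    (integrable_finsetSum _ fun i _ => hint _)]
  refine integral_congr_ae (Eventually.of_forall fun y => ?_)
  simp only [waveOp, hf]
  rw [← Finset.sum_mul]
  ring

lemma continuous_moll_jet (h : IsWeakWave J F) (n : ℕ) : Continuous (moll n J) :=
  (contDiff_moll n h.locallyIntegrable_jet).continuous

end IsWeakWave

/-- A bounded family of linear functionals of jets, supported in a ball. -/
structure IsJetMultiplier (Φ : ℝ × Space → Jet →L[ℝ] ℝ) (C R : ℝ) : Prop where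
  meas : ∀ J : ℝ × Space → Jet, AEStronglyMeasurable J → AEStronglyMeasurable fun z => Φ z (J z)
  cont : ∀ J : ℝ × Space → Jet, Continuous J → Continuous fun z => Φ z (J z)
  bound : ∀ z, ‖Φ z‖ ≤ C
  supp : ∀ z, z ∉ Metric.closedBall 0 R → Φ z = 0

namespace IsJetMultiplier

variable {Φ : ℝ × Space → Jet →L[ℝ] ℝ} {C R : ℝ}

lemma norm_apply_le (hΦ : IsJetMultiplier Φ C R) (J : ℝ × Space → Jet) (z : ℝ × Space) :
    ‖Φ z (J z)‖ ≤ C * ‖(Metric.closedBall (0 : ℝ × Space) R).indicator J z‖ := by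
  by_cases hz : z ∈ Metric.closedBall (0 : ℝ × Space) R
  · rw [Set.indicator_of_mem hz]
    exact (Φ z).le_of_opNorm_le (hΦ.bound z) _
  · rw [hΦ.supp z hz, Set.indicator_of_notMem hz]
    simp

lemma sliceNorm_le (hΦ : IsJetMultiplier Φ C R) (J : ℝ × Space → Jet) (t : ℝ) :
    sliceNorm (fun z => Φ z (J z)) t
      ≤ ENNReal.ofReal C * sliceNorm ((Metric.closedBall (0 : ℝ × Space) R).indicator J) t := by
  unfold sliceNorm
  rw [← eLpNorm_two_eq (fun x => Φ (t, x) (J (t, x))),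
    ← eLpNorm_two_eq (fun x => (Metric.closedBall (0 : ℝ × Space) R).indicator J (t, x))]
  exact eLpNorm_le_mul_eLpNorm_of_ae_le_mul
    (Eventually.of_forall fun x => hΦ.norm_apply_le J (t, x)) 2

lemma eLpNorm_le (hΦ : IsJetMultiplier Φ C R) (J : ℝ × Space → Jet) :
    eLpNorm (fun z => Φ z (J z)) 2 volume
      ≤ ENNReal.ofReal C * eLpNorm J 2 (volume.restrict (Metric.closedBall 0 R)) := by
  rw [← eLpNorm_indicator_eq_eLpNorm_restrict Metric.isClosed_closedBall.measurableSet]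
  exact eLpNorm_le_mul_eLpNorm_of_ae_le_mul
    (Eventually.of_forall fun z => hΦ.norm_apply_le J z) 2

lemma eq_zero_of_time (hΦ : IsJetMultiplier Φ C R) (J : ℝ × Space → Jet) {z : ℝ × Space}
    (hz : z.1 ∉ Set.Icc (-R) R) : Φ z (J z) = 0 := by
  rw [hΦ.supp z]
  · rfl
  · rw [mem_closedBall_zero_prod]
    rw [Set.mem_Icc, ← abs_le] at hz
    tauto

lemma hasCompactSupport (hΦ : IsJetMultiplier Φ C R) (J : ℝ × Space → Jet) :
    HasCompactSupport fun z => Φ z (J z) := by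
  refine HasCompactSupport.intro (isCompact_closedBall (0 : ℝ × Space) R) fun z hz => ?_
  rw [hΦ.supp z hz]; rfl

variable {J : ℝ × Space → Jet} {F : ℝ × Space → ℝ}

lemma tendsto_eLpNorm (hΦ : IsJetMultiplier Φ C R) (h : IsWeakWave J F) :
    Tendsto (fun n => eLpNorm ((fun z => Φ z (moll n J z)) - fun z => Φ z (J z)) 2 volume)
      atTop (𝓝 0) := by
  have h1 := ENNReal.Tendsto.const_mul (a := ENNReal.ofReal C) (h.locSlice.tendsto_moll R)
    (Or.inr ENNReal.ofReal_ne_top)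
  rw [mul_zero] at h1
  refine tendsto_of_tendsto_of_tendsto_of_le_of_le tendsto_const_nhds h1 (fun _ => zero_le) ?_
  intro n
  have h2 : ((fun z => Φ z (moll n J z)) - fun z => Φ z (J z))
      = fun z => Φ z ((moll n J - J) z) := by
    ext z; simp
  simp only [h2]
  exact hΦ.eLpNorm_le _

lemma memLp (hΦ : IsJetMultiplier Φ C R) (h : IsWeakWave J F) :
    MemLp (fun z => Φ z (J z)) 2 volume := by
  refine ⟨hΦ.meas J h.locSlice.aesm, (hΦ.eLpNorm_le J).trans_lt ?_⟩
  refine ENNReal.mul_lt_top ENNReal.ofReal_lt_top ?_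
  rw [← eLpNorm_indicator_eq_eLpNorm_restrict Metric.isClosed_closedBall.measurableSet]
  exact (h.locSlice.memLp_indicator R).2

lemma memLp_moll (hΦ : IsJetMultiplier Φ C R) (h : IsWeakWave J F) (n : ℕ) :
    MemLp (fun z => Φ z (moll n J z)) 2 volume :=
  (hΦ.cont _ (h.continuous_moll_jet n)).memLp_of_hasCompactSupport (hΦ.hasCompactSupport _)

lemma sliceNorm_sub_le {f k : ℝ × Space → ℝ} (t : ℝ)
    (hft : AEStronglyMeasurable (fun x => f (t, x)))
    (hkt : AEStronglyMeasurable (fun x => k (t, x))) :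
    sliceNorm (f - k) t ≤ sliceNorm f t + sliceNorm k t := by
  unfold sliceNorm
  rw [← eLpNorm_two_eq (fun x => (f - k) (t, x)), ← eLpNorm_two_eq (fun x => f (t, x)),
    ← eLpNorm_two_eq (fun x => k (t, x))]
  exact eLpNorm_sub_le hft hkt one_le_two

lemma exists_sliceNorm_le (hΦ : IsJetMultiplier Φ C R) (h : IsWeakWave J F) :
    ∃ B : ℝ≥0∞, B ≠ ⊤ ∧ (∀ t, sliceNorm (fun z => Φ z (J z)) t ≤ B) ∧
      ∀ n t, sliceNorm (fun z => Φ z (moll n J z)) t ≤ B := by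
  obtain ⟨B₁, hB₁, h1⟩ := h.locSlice.bound R
  obtain ⟨B₂, hB₂, h2⟩ := h.locSlice.exists_moll_bound R
  refine ⟨ENNReal.ofReal C * (B₁ + B₂),
    ENNReal.mul_ne_top ENNReal.ofReal_ne_top (ENNReal.add_ne_top.2 ⟨hB₁, hB₂⟩), fun t => ?_,
    fun n t => ?_⟩
  · exact (hΦ.sliceNorm_le J t).trans (mul_le_mul_right ((h1 t).trans le_self_add) _)
  · exact (hΦ.sliceNorm_le _ t).trans (mul_le_mul_right ((h2 n t).trans le_add_self) _)

end IsJetMultiplier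

/-- Pairing of L^∞_t L²_x with L¹_t L²_x: Cauchy-Schwarz on each slice, then the uniform bound in
time. -/
lemma IsWeakWave.integrable_mul_source (h : IsWeakWave J F) {k : ℝ × Space → ℝ} {B : ℝ≥0∞} {T : ℝ}
    (hk : AEStronglyMeasurable k) (hB : B ≠ ⊤) (hb : ∀ t, sliceNorm k t ≤ B)
    (hT : ∀ z, z.1 ∉ Set.Icc (-T) T → k z = 0) : Integrable fun z => k z * F z := by
  refine ⟨hk.mul h.aesm_source, ?_⟩
  rw [hasFiniteIntegral_iff_enorm]
  simp only [enorm_mul]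
  refine (lintegral_mul_le_sliceNorm hk h.aesm_source).trans_lt ?_
  calc ∫⁻ t, sliceNorm k t * sliceNorm F t
      ≤ ∫⁻ t, (Set.Icc (-T) T).indicator (fun t => B * sliceNorm F t) t := by
        refine lintegral_mono fun t => ?_
        by_cases ht : t ∈ Set.Icc (-T) T
        · rw [Set.indicator_of_mem ht]
          exact mul_le_mul_left (hb t) _
        · have : sliceNorm k t = 0 := by simp [sliceNorm, hT (t, _) ht]
          simp [this]
    _ = B * ∫⁻ t in Set.Icc (-T) T, sliceNorm F t := by
        rw [lintegral_indicator measurableSet_Icc, lintegral_const_mul' _ _ hB]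
    _ < ⊤ := ENNReal.mul_lt_top hB.lt_top (h.source_integrable T).lt_top

lemma IsWeakWave.locallyIntegrable_source (h : IsWeakWave J F) : LocallyIntegrable F := by
  rw [locallyIntegrable_iff]
  intro K hK
  obtain ⟨R, hR⟩ := hK.isBounded.subset_closedBall 0
  set S : Set (ℝ × Space) := Metric.closedBall 0 R
  have hS : MeasurableSet S := Metric.isClosed_closedBall.measurableSet
  set B : ℝ≥0∞ := (volume (Metric.closedBall (0 : Space) R)) ^ (1 / 2 : ℝ)
  have h1 : Integrable fun z => S.indicator (fun _ => (1 : ℝ)) z * F z := by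
    refine h.integrable_mul_source (B := B) (T := R)
      (aestronglyMeasurable_const.indicator hS)
      (ENNReal.rpow_ne_top_of_nonneg (by norm_num) measure_closedBall_lt_top.ne) (fun t => ?_)
      fun z hz => ?_
    · refine ENNReal.rpow_le_rpow ?_ (by norm_num)
      calc ∫⁻ x, ‖S.indicator (fun _ => (1 : ℝ)) (t, x)‖ₑ ^ (2 : ℝ)
          ≤ ∫⁻ x, (Metric.closedBall (0 : Space) R).indicator 1 x := by
            refine lintegral_mono fun x => ?_
            by_cases hx : (t, x) ∈ S
            · have hx2 : x ∈ Metric.closedBall (0 : Space) R := by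
                simpa using (mem_closedBall_zero_prod.1 hx).2
              simp [Set.indicator_of_mem hx, Set.indicator_of_mem hx2]
            · simp [Set.indicator_of_notMem hx]
        _ = _ := by
            rw [lintegral_indicator_one Metric.isClosed_closedBall.measurableSet]
    · rw [Set.indicator_of_notMem]
      rw [mem_closedBall_zero_prod]
      rw [Set.mem_Icc, ← abs_le] at hz
      tauto
  refine (h1.integrableOn (s := K)).congr ?_
  filter_upwards [ae_restrict_mem hK.measurableSet] with z hz
  rw [Set.indicator_of_mem (hR hz), one_mul]

/-- Passage to the limit in the pairing of a multiplier with the mollified wave equation. -/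
lemma IsJetMultiplier.tendsto_integral_waveOp {Φ : ℝ × Space → Jet →L[ℝ] ℝ} {C R : ℝ}
    (hΦ : IsJetMultiplier Φ C R) (h : IsWeakWave J F) :
    Tendsto (fun n => ∫ z, Φ z (moll n J z) * waveOp (moll n fun z => (J z).1) z) atTop
      (𝓝 (-∫ z, Φ z (J z) * F z)) := by
  set k : ℕ → ℝ × Space → ℝ := fun n z => Φ z (moll n J z) with hk
  set k₀ : ℝ × Space → ℝ := fun z => Φ z (J z) with hk₀
  have hkc : ∀ n, Continuous (k n) := fun n => hΦ.cont _ (h.continuous_moll_jet n)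
  have hks : ∀ n, HasCompactSupport (k n) := fun n => hΦ.hasCompactSupport _
  have hFl := h.locallyIntegrable_source
  -- The mollifier on F is transposed onto the multiplier. F is only L¹ in time with values in L²,
  -- so all convergence has to be carried by the other factor.
  have h1 : ∀ n, ∫ z, k n z * waveOp (moll n fun z => (J z).1) z = -∫ z, moll n (k n) z * F z := by
    intro n
    rw [← integral_mul_moll n (hkc n) (hks n) hFl, ← integral_neg]
    refine integral_congr_ae (Eventually.of_forall fun z => ?_)
    simp only
    rw [h.waveOp_moll]
    ring
  refine Tendsto.congr (fun n => (h1 n).symm) ?_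
  refine Tendsto.neg ?_
  obtain ⟨B, hB, hb₀, hbn⟩ := hΦ.exists_sliceNorm_le h
  have hmk : ∀ n, Continuous (moll n (k n)) := fun n =>
    (contDiff_moll n (hkc n).locallyIntegrable).continuous
  have hmb : ∀ n t, sliceNorm (moll n (k n)) t ≤ B := by
    intro n t
    have h2 : ∀ s, ∫⁻ x, ‖k n (s, x)‖ₑ ^ (2 : ℝ) ≤ B ^ (2 : ℝ) := fun s => by
      have := ENNReal.rpow_le_rpow (z := 2) (hbn n s) (by norm_num)
      rwa [sliceNorm, ← ENNReal.rpow_mul, one_div, inv_mul_cancel₀ two_ne_zero,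
        ENNReal.rpow_one] at this
    calc _ ≤ (B ^ (2 : ℝ)) ^ (1 / 2 : ℝ) := ENNReal.rpow_le_rpow
          (lintegral_slice_moll_le n (hkc n).aestronglyMeasurable h2 t) (by norm_num)
      _ = B := by rw [← ENNReal.rpow_mul]; norm_num
  have hk₀m : AEStronglyMeasurable k₀ := hΦ.meas J h.locSlice.aesm
  have hk₀T : ∀ z : ℝ × Space, z.1 ∉ Set.Icc (-(R + 1)) (R + 1) → k₀ z = 0 := fun z hz =>
    hΦ.eq_zero_of_time J fun hz' => hz ⟨by linarith [hz'.1], by linarith [hz'.2]⟩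
  have hmT : ∀ n (z : ℝ × Space), z.1 ∉ Set.Icc (-(R + 1)) (R + 1) → moll n (k n) z = 0 := by
    intro n z hz
    have : moll n (k n) z = moll n (fun _ => (0 : ℝ)) z := by
      refine moll_congr_ball fun y hy => hΦ.eq_zero_of_time _ fun hy' => hz ?_
      have h2 : 1 / ((n : ℝ) + 1) ≤ 1 := by
        rw [div_le_one (by positivity)]; linarith [Nat.cast_nonneg (α := ℝ) n]
      have h3 : |y.1 - z.1| ≤ ‖y - z‖ := by
        rw [← Real.norm_eq_abs]; exact norm_fst_le (y - z)
      have h4 := abs_le.1 (h3.trans (hy.le.trans h2))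
      exact ⟨by linarith [hy'.1, h4.2], by linarith [hy'.2, h4.1]⟩
    rw [this, moll_const]
  -- Convergence in L² and uniform slice bounds together compensate for the weak time integrability
  -- of F. The time window R + 1 allows for the spreading of supports by mollification.
  have hD : Tendsto (fun n => ∫⁻ z, ‖(moll n (k n) - k₀) z‖ₑ * ‖F z‖ₑ) atTop (𝓝 0) := by
    refine tendsto_lintegral_pairing (C := B + B) (T := R + 1) (ENNReal.add_ne_top.2 ⟨hB, hB⟩)
      (fun n => (hmk n).aestronglyMeasurable.sub hk₀m) h.aesm_source ?_ ?_ ?_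
      (h.source_integrable _)
    · exact tendsto_eLpNorm_moll_sub_of_tendsto (hΦ.memLp h) (hΦ.memLp_moll h)
        (hΦ.tendsto_eLpNorm h)
    · intro n
      filter_upwards [ae_aestronglyMeasurable_slice hk₀m] with t ht
      exact (IsJetMultiplier.sliceNorm_sub_le t
        ((hmk n).comp (by fun_prop)).aestronglyMeasurable ht).trans (add_le_add (hmb n t) (hb₀ t))
    · intro n z hz
      rw [Pi.sub_apply, hmT n z hz, hk₀T z hz, sub_zero]
  have hi₀ : Integrable fun z => k₀ z * F z := h.integrable_mul_source hk₀m hB hb₀ hk₀T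
  have hin : ∀ n, Integrable fun z => moll n (k n) z * F z := fun n =>
    h.integrable_mul_source (hmk n).aestronglyMeasurable hB (hmb n) (hmT n)
  refine tendsto_iff_norm_sub_tendsto_zero.2 ?_
  have hR := (ENNReal.tendsto_toReal ENNReal.zero_ne_top).comp hD
  refine squeeze_zero (fun n => norm_nonneg _) (fun n => ?_) hR
  rw [← integral_sub (hin n) hi₀]
  refine (norm_integral_le_integral_norm _).trans (le_of_eq ?_)
  refine (integral_norm_eq_lintegral_enorm ((hin n).sub hi₀).1).trans (congrArg _ ?_)
  refine lintegral_congr fun z => ?_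
  rw [← enorm_mul]
  exact congrArg _ (sub_mul _ _ _).symm

end MollifiedJets

end DefocusingWave

namespace DefocusingWave

/-! ### Limits of quadratic densities and of the potential energy -/

section NonlinearLimits

variable {J : ℝ × Space → Jet} {F : ℝ × Space → ℝ}

/-- A function of space-time and jets, supported in a ball of space-time, with at most quadratic
growth in the jet. -/
structure IsQuadraticDensity (Q : ℝ × Space → Jet → ℝ) (C R : ℝ) : Prop where
  aesm : ∀ J : ℝ × Space → Jet, AEStronglyMeasurable J → AEStronglyMeasurable fun z => Q z (J z)
  zero : ∀ z, Q z 0 = 0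
  lip : ∀ z a b, |Q z a - Q z b| ≤ C * (‖a - b‖ * (1 + ‖a‖ + ‖b‖))
  supp : ∀ z, z ∉ Metric.closedBall 0 R → ∀ a, Q z a = 0

lemma LocSliceL2.memLp_restrict {G : Type*} [NormedAddCommGroup G] {f : ℝ × Space → G}
    (hf : LocSliceL2 f) (R : ℝ) :
    MemLp f 2 (volume.restrict (Metric.closedBall (0 : ℝ × Space) R)) := by
  rw [← memLp_indicator_iff_restrict Metric.isClosed_closedBall.measurableSet]
  exact hf.memLp_indicator R

lemma IsWeakWave.memLp_moll_restrict (h : IsWeakWave J F) (n : ℕ) (R : ℝ) :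
    MemLp (moll n J) 2 (volume.restrict (Metric.closedBall (0 : ℝ × Space) R)) := by
  obtain ⟨B, hB⟩ := (isCompact_closedBall (0 : ℝ × Space) R).exists_bound_of_continuousOn
    (h.continuous_moll_jet n).continuousOn
  have : IsFiniteMeasure (volume.restrict (Metric.closedBall (0 : ℝ × Space) R)) :=
    ⟨by simpa using measure_closedBall_lt_top⟩
  refine MemLp.of_bound (h.continuous_moll_jet n).aestronglyMeasurable.restrict B ?_
  filter_upwards [ae_restrict_mem Metric.isClosed_closedBall.measurableSet] with z hz using hB z hz

namespace IsQuadraticDensity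

variable {Q : ℝ × Space → Jet → ℝ} {C R : ℝ}

lemma integrable_of_memLp (hQ : IsQuadraticDensity Q C R) (hJ : AEStronglyMeasurable J)
    (hJ2 : MemLp J 2 (volume.restrict (Metric.closedBall (0 : ℝ × Space) R))) :
    Integrable fun z => Q z (J z) := by
  have : IsFiniteMeasure (volume.restrict (Metric.closedBall (0 : ℝ × Space) R)) :=
    ⟨by simpa using measure_closedBall_lt_top⟩
  have hon : IntegrableOn (fun z => Q z (J z)) (Metric.closedBall 0 R) := by
    have h1 : Integrable (fun z => C * (‖J z‖ * (1 + ‖J z‖)))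
        (volume.restrict (Metric.closedBall (0 : ℝ × Space) R)) := by
      have h2 := (hJ2.integrable one_le_two).norm
      have h3 := hJ2.integrable_norm_pow two_ne_zero
      refine ((h2.add h3).const_mul C).congr (Eventually.of_forall fun z => ?_)
      simp only [Pi.add_apply]
      ring
    refine h1.mono' (hQ.aesm J hJ).restrict (Eventually.of_forall fun z => ?_)
    have := hQ.lip z (J z) 0
    simpa [hQ.zero] using this
  refine (integrableOn_iff_integrable_of_support_subset fun z hz => ?_).1 hon
  by_contra hne
  exact hz (hQ.supp z hne _)

/-- Integrals of quadratic densities pass to the limit along mollifications. -/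
lemma tendsto_integral (hQ : IsQuadraticDensity Q C R) (h : IsWeakWave J F) :
    Tendsto (fun n => ∫ z, Q z (moll n J z)) atTop (𝓝 (∫ z, Q z (J z))) := by
  set μ : Measure (ℝ × Space) := volume.restrict (Metric.closedBall (0 : ℝ × Space) R) with hμ
  have : IsFiniteMeasure μ := ⟨by simpa [hμ] using measure_closedBall_lt_top⟩
  have hJ := h.locSlice.memLp_restrict R
  have hn := fun n => h.memLp_moll_restrict n R
  have hlim := h.locSlice.tendsto_moll R
  have hJm := h.locSlice.aesm
  have hi := hQ.integrable_of_memLp hJm hJ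
  have hin := fun n => hQ.integrable_of_memLp (h.continuous_moll_jet n).aestronglyMeasurable (hn n)
  have hw : ∀ n, MemLp (fun z => 1 + ‖moll n J z‖ + ‖J z‖) 2 μ := fun n =>
    ((memLp_const (1 : ℝ)).add (hn n).norm).add hJ.norm
  have hw0 : MemLp (fun z => 1 + ‖J z‖ + ‖J z‖) 2 μ :=
    ((memLp_const (1 : ℝ)).add hJ.norm).add hJ.norm
  have hd : ∀ n, MemLp (fun z => ‖moll n J z - J z‖) 2 μ := fun n => ((hn n).sub hJ).norm
  -- The local Lipschitz bound splits into a factor tending to 0 in L² and a factor converging in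
  -- L².
  have key : Tendsto (fun n => ∫ z, inner ℝ (‖moll n J z - J z‖) (1 + ‖moll n J z‖ + ‖J z‖) ∂μ)
      atTop (𝓝 (∫ z, inner ℝ (0 : ℝ) (1 + ‖J z‖ + ‖J z‖) ∂μ)) := by
    refine tendsto_integral_inner_of_tendsto_eLpNorm hd hw (MemLp.zero' (p := 2)) hw0 ?_ ?_
    · refine hlim.congr fun n => ?_
      refine (eLpNorm_congr_norm_ae (Eventually.of_forall fun z => ?_))
      simp
    · refine tendsto_of_tendsto_of_tendsto_of_le_of_le tendsto_const_nhds hlim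
        (fun _ => zero_le) fun n => ?_
      refine eLpNorm_mono fun z => ?_
      simp only [Pi.sub_apply, Real.norm_eq_abs]
      have : 1 + ‖moll n J z‖ + ‖J z‖ - (1 + ‖J z‖ + ‖J z‖) = ‖moll n J z‖ - ‖J z‖ := by ring
      rw [this]
      exact abs_norm_sub_norm_le _ _
  have key2 : Tendsto (fun n => C * ∫ z, inner ℝ (‖moll n J z - J z‖) (1 + ‖moll n J z‖ + ‖J z‖) ∂μ)
      atTop (𝓝 0) := by simpa using key.const_mul C
  refine tendsto_iff_norm_sub_tendsto_zero.2 ?_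
  refine squeeze_zero (fun n => norm_nonneg _) (fun n => ?_) key2
  have hinn : Integrable (fun z => ‖moll n J z - J z‖ * (1 + ‖moll n J z‖ + ‖J z‖)) μ :=
    (hd n).integrable_mul (hw n)
  rw [← integral_sub (hin n) hi, ← setIntegral_eq_integral_of_forall_compl_eq_zero
    (s := Metric.closedBall (0 : ℝ × Space) R) fun z hz => by
      rw [hQ.supp z hz, hQ.supp z hz, sub_zero], ← integral_const_mul]
  refine norm_integral_le_of_norm_le (by simpa [mul_comm] using hinn.const_mul C)
    (Eventually.of_forall fun z => ?_)
  have := hQ.lip z (moll n J z) (J z)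
  simpa [mul_comm] using this

end IsQuadraticDensity

/-- A potential density: the truncations of `s ↦ |s|^{p-1} s`. -/
noncomputable def truncPower (p : ℝ) (N : ℕ) (s : ℝ) : ℝ :=
  max (-(N : ℝ)) (min N (|s| ^ (p - 1) * s))

/-- The antiderivative of `truncPower`. -/
noncomputable def truncPotential (p : ℝ) (N : ℕ) (s : ℝ) : ℝ := ∫ τ in (0 : ℝ)..s, truncPower p N τ

section Trunc

variable {p : ℝ}

lemma abs_abs_rpow_mul (hp : 1 ≤ p) (s : ℝ) : |(|s| ^ (p - 1) * s)| = |s| ^ p := by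
  rw [abs_mul, abs_of_nonneg (Real.rpow_nonneg (abs_nonneg s) _)]
  rcases eq_or_ne s 0 with rfl | hs
  · rw [abs_zero, mul_zero, Real.zero_rpow (by linarith)]
  · rw [Real.rpow_sub_one (abs_ne_zero.2 hs), div_mul_cancel₀ _ (abs_ne_zero.2 hs)]

lemma abs_rpow_mul_self_mul (hp : 1 ≤ p) (s : ℝ) : s * (|s| ^ (p - 1) * s) = |s| ^ (p + 1) := by
  have h : s * (|s| ^ (p - 1) * s) = |s| ^ (p - 1) * |s| ^ 2 := by rw [sq_abs]; ring
  rcases eq_or_ne s 0 with rfl | hs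
  · rw [abs_zero, zero_mul, Real.zero_rpow (by linarith)]
  · rw [h, ← Real.rpow_natCast, ← Real.rpow_add (abs_pos.2 hs)]
    norm_num
    congr 1
    ring

lemma continuous_truncPower (hp : 1 ≤ p) (N : ℕ) : Continuous (truncPower p N) := by
  have : Continuous fun s : ℝ => |s| ^ (p - 1) :=
    continuous_abs.rpow_const fun _ => Or.inr (by linarith)
  unfold truncPower
  fun_prop

lemma abs_truncPower_le (N : ℕ) (s : ℝ) : |truncPower p N s| ≤ N := by
  rw [abs_le]
  exact ⟨le_max_left _ _, max_le (by linarith [Nat.cast_nonneg (α := ℝ) N]) (min_le_left _ _)⟩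

lemma abs_truncPower_le_rpow (hp : 1 ≤ p) (N : ℕ) (s : ℝ) : |truncPower p N s| ≤ |s| ^ p := by
  rw [← abs_abs_rpow_mul hp]
  have hN := Nat.cast_nonneg (α := ℝ) N
  rw [truncPower, abs_le]
  constructor
  · refine (le_min ?_ (neg_abs_le _)).trans (le_max_right _ _)
    linarith [abs_nonneg (|s| ^ (p - 1) * s)]
  · exact max_le (by linarith [abs_nonneg (|s| ^ (p - 1) * s)])
      ((min_le_right _ _).trans (le_abs_self _))

lemma truncPower_eq (hp : 1 ≤ p) {N : ℕ} {s : ℝ} (h : |s| ^ p ≤ N) :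
    truncPower p N s = |s| ^ (p - 1) * s := by
  rw [← abs_abs_rpow_mul hp, abs_le] at h
  rw [truncPower, min_eq_right h.2, max_eq_right h.1]

lemma hasDerivAt_truncPotential (hp : 1 ≤ p) (N : ℕ) (s : ℝ) :
    HasDerivAt (truncPotential p N) (truncPower p N s) s :=
  (continuous_truncPower hp N).integral_hasStrictDerivAt 0 s |>.hasDerivAt

/-- This is the gain from truncating: the potential becomes globally Lipschitz, so it passes to the
limit under L¹ convergence of u without any bound on |u|^{p+1}. -/
lemma abs_truncPotential_sub_le (hp : 1 ≤ p) (N : ℕ) (s s' : ℝ) :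
    |truncPotential p N s - truncPotential p N s'| ≤ N * |s - s'| := by
  have hc := continuous_truncPower hp N
  rw [truncPotential, truncPotential, intervalIntegral.integral_interval_sub_left
    (hc.intervalIntegrable _ _) (hc.intervalIntegrable _ _)]
  exact intervalIntegral.norm_integral_le_of_norm_le_const (f := truncPower p N)
    fun x _ => abs_truncPower_le N x

lemma abs_truncPotential_le (hp : 1 ≤ p) (N : ℕ) (s : ℝ) :
    |truncPotential p N s| ≤ |s| ^ (p + 1) := by
  have h : |truncPotential p N s| ≤ |s| ^ p * |s - 0| := by
    refine intervalIntegral.norm_integral_le_of_norm_le_const (f := truncPower p N) fun x hx => ?_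
    refine (abs_truncPower_le_rpow hp N x).trans (Real.rpow_le_rpow (abs_nonneg _) ?_ (by linarith))
    rcases Set.mem_uIoc.1 hx with h | h
    · rw [abs_of_pos h.1]; exact h.2.trans (le_abs_self _)
    · rw [abs_of_nonpos h.2, abs_of_neg (h.1.trans_le h.2)]; linarith [h.1]
  rw [sub_zero] at h
  refine h.trans (le_of_eq ?_)
  rcases eq_or_ne s 0 with rfl | hs
  · rw [abs_zero, mul_zero, Real.zero_rpow (by linarith)]
  · rw [Real.rpow_add_one (abs_ne_zero.2 hs)]

lemma truncPotential_eq (hp : 1 ≤ p) {N : ℕ} {s : ℝ} (h : |s| ^ p ≤ N) :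
    truncPotential p N s = |s| ^ (p + 1) / (p + 1) := by
  have hd : ∀ x : ℝ, HasDerivAt (fun x : ℝ => |x| ^ (p + 1) / (p + 1)) (|x| ^ (p - 1) * x) x := by
    intro x
    have := (hasDerivAt_abs_rpow x (p := p + 1) (by linarith)).div_const (p + 1)
    refine this.congr_deriv ?_
    have : p + 1 - 2 = p - 1 := by ring
    rw [this]
    field_simp
  have hcont : Continuous fun s : ℝ => |s| ^ (p - 1) * s :=
    (continuous_abs.rpow_const fun _ => Or.inr (by linarith)).mul continuous_id
  have h2 : truncPotential p N s = ∫ τ in (0 : ℝ)..s, |τ| ^ (p - 1) * τ := by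
    refine intervalIntegral.integral_congr fun x hx => ?_
    refine truncPower_eq hp (le_trans ?_ h)
    refine Real.rpow_le_rpow (abs_nonneg _) ?_ (by linarith)
    rcases Set.mem_uIcc.1 hx with h | h
    · rw [abs_of_nonneg h.1]; exact h.2.trans (le_abs_self _)
    · rw [abs_of_nonpos h.2, abs_of_nonpos (h.1.trans h.2)]; linarith [h.1]
  rw [h2, intervalIntegral.integral_eq_sub_of_hasDerivAt (fun x _ => hd x)
    (hcont.intervalIntegrable _ _), abs_zero, Real.zero_rpow (by linarith)]
  ring

end Trunc

lemma integral_add_three {α : Type*} [MeasurableSpace α] {μ : Measure α} {f g k : α → ℝ}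
    (hf : Integrable f μ) (hg : Integrable g μ) (hk : Integrable k μ) :
    ∫ x, (f x + g x + k x) ∂μ = ∫ x, f x ∂μ + ∫ x, g x ∂μ + ∫ x, k x ∂μ := by
  have hfg : Integrable (fun x => f x + g x) μ := hf.add hg
  rw [integral_add hfg hk, integral_add hf hg]

/-- Passage to the limit in a chain rule identity, first along mollifications and then along
truncations of the nonlinearity. -/
lemma IsJetMultiplier.integral_mul_source_eq {Φ : ℝ × Space → Jet →L[ℝ] ℝ} {C R p : ℝ}
    (hΦ : IsJetMultiplier Φ C R) (h : IsWeakWave J F) (hp : 1 ≤ p)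
    (hF : ∀ z, F z = |(J z).1| ^ (p - 1) * (J z).1) {a b : ℝ × Space → ℝ} {A : ℝ}
    (ha : AEStronglyMeasurable a) (hb : AEStronglyMeasurable b) (haA : ∀ z, |a z| ≤ A)
    (hbA : ∀ z, |b z| ≤ A) (has : ∀ z, z ∉ Metric.closedBall 0 R → a z = 0)
    (hbs : ∀ z, z ∉ Metric.closedBall 0 R → b z = 0)
    (hchain : ∀ (n : ℕ) (H H' : ℝ → ℝ), (∀ s, HasDerivAt H (H' s) s) → Continuous H' →
      ∫ z, (Φ z (moll n J z) * H' (moll n J z).1 + a z * H (moll n J z).1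
        + b z * ((moll n J z).1 * H' (moll n J z).1)) = 0) :
    Integrable (fun z => |(J z).1| ^ (p + 1))
        (volume.restrict (Metric.closedBall (0 : ℝ × Space) R)) ∧
      ∫ z, (Φ z (J z) * F z + (a z / (p + 1) + b z) * |(J z).1| ^ (p + 1)) = 0 := by
  set S : Set (ℝ × Space) := Metric.closedBall (0 : ℝ × Space) R with hS
  have hSm : MeasurableSet S := Metric.isClosed_closedBall.measurableSet
  set μ : Measure (ℝ × Space) := volume.restrict S with hμ
  have hμf : IsFiniteMeasure μ := ⟨by simpa [hμ] using measure_closedBall_lt_top⟩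
  have hJm := h.locSlice.aesm
  have hum : AEStronglyMeasurable (fun z => (J z).1) := continuous_fst.comp_aestronglyMeasurable hJm
  have hJ2 := h.locSlice.memLp_restrict R
  have hJn2 := fun n => h.memLp_moll_restrict n R
  have hlim := h.locSlice.tendsto_moll R
  have hlim1 : Tendsto (fun n => eLpNorm (moll n J - J) 1 μ) atTop (𝓝 0) := by
    have h1 := ENNReal.Tendsto.mul_const (b := μ Set.univ ^ (1 / (1 : ℝ≥0∞).toReal
      - 1 / (2 : ℝ≥0∞).toReal)) hlim
      (Or.inr (ENNReal.rpow_ne_top_of_nonneg (by norm_num) (measure_ne_top _ _)))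
    rw [zero_mul] at h1
    refine tendsto_of_tendsto_of_tendsto_of_le_of_le tendsto_const_nhds h1 (fun _ => zero_le) fun n => ?_
    exact eLpNorm_le_eLpNorm_mul_rpow_measure_univ one_le_two
      ((hJn2 n).1.sub hJ2.1)
  have hae : ∀ᵐ z ∂μ, Tendsto (fun n => moll n J z) atTop (𝓝 (J z)) :=
    ae_restrict_of_ae (ae_tendsto_moll h.locallyIntegrable_jet)
  have hC : 0 ≤ C := (norm_nonneg _).trans (hΦ.bound 0)
  have hA : 0 ≤ A := (abs_nonneg _).trans (haA 0)
  have hΦm := hΦ.meas J hJm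
  have hΦi : Integrable (fun z => Φ z (J z)) μ := (hΦ.memLp h).restrict S |>.integrable one_le_two
  have hΦin : ∀ n, Integrable (fun z => Φ z (moll n J z)) μ := fun n =>
    (hΦ.memLp_moll h n).restrict S |>.integrable one_le_two
  have hui : Integrable (fun z => (J z).1) μ := by
    refine (hJ2.integrable one_le_two).mono hum.restrict (Eventually.of_forall fun z => norm_fst_le _)
  have huin : ∀ n, Integrable (fun z => (moll n J z).1) μ := fun n => by
    refine ((hJn2 n).integrable one_le_two).mono
      (continuous_fst.comp (h.continuous_moll_jet n)).aestronglyMeasurable.restrict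
      (Eventually.of_forall fun z => norm_fst_le _)
  have hbi : ∀ f : ℝ × Space → ℝ, Integrable f μ → Integrable (fun z => b z * f z) μ := fun f hf =>
    hf.bdd_mul hb.restrict (Eventually.of_forall hbA)
  have hai : ∀ f : ℝ × Space → ℝ, Integrable f μ → Integrable (fun z => a z * f z) μ := fun f hf =>
    hf.bdd_mul ha.restrict (Eventually.of_forall haA)
  have hscale : ∀ {f : ℝ × Space → ℝ} {k : ℕ → ℝ × Space → ℝ} {c : ℝ},
      (∀ n z, ‖k n z - f z‖ ≤ c * ‖moll n J z - J z‖) →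
      Tendsto (fun n => eLpNorm (k n - f) 1 μ) atTop (𝓝 0) := by
    intro f k c hk
    have h1 := ENNReal.Tendsto.const_mul (a := ENNReal.ofReal c) hlim1 (Or.inr ENNReal.ofReal_ne_top)
    rw [mul_zero] at h1
    refine tendsto_of_tendsto_of_tendsto_of_le_of_le tendsto_const_nhds h1 (fun _ => zero_le) fun n => ?_
    exact eLpNorm_le_mul_eLpNorm_of_ae_le_mul (Eventually.of_forall (hk n)) 1
  have hfst : ∀ n z, |(moll n J z).1 - (J z).1| ≤ ‖moll n J z - J z‖ := fun n z =>
    norm_fst_le (moll n J z - J z)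
  have hoff : ∀ (K : Jet) (x y : ℝ) z, z ∉ S → Φ z K * x + a z * y + b z * (K.1 * x) = 0 := by
    intro K x y z hz
    rw [hΦ.supp z hz, has z hz, hbs z hz]
    simp
  -- With the truncation level fixed, the jets converge in L¹ on the ball, while the truncated
  -- nonlinearity is bounded by N and converges almost everywhere.
  have step : ∀ N : ℕ, ∫ z, (Φ z (J z) * truncPower p N (J z).1
      + a z * truncPotential p N (J z).1 + b z * ((J z).1 * truncPower p N (J z).1)) ∂μ = 0 := by
    intro N
    have hc := continuous_truncPower hp N
    have hHc : Continuous (truncPotential p N) :=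
      continuous_iff_continuousAt.2 fun s => (hasDerivAt_truncPotential hp N s).continuousAt
    have hH0 : truncPotential p N 0 = 0 := by simp [truncPotential]
    have hHi : ∀ f : ℝ × Space → ℝ, Integrable f μ →
        Integrable (fun z => truncPotential p N (f z)) μ := fun f hf => by
      refine (hf.norm.const_mul (N : ℝ)).mono' (hHc.comp_aestronglyMeasurable hf.1)
        (Eventually.of_forall fun z => ?_)
      have := abs_truncPotential_sub_le hp N (f z) 0
      simpa [hH0] using this
    have hbd : ∀ n z, ‖truncPower p N (moll n J z).1‖ ≤ N := fun n z => abs_truncPower_le N _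
    have hbm : ∀ n, AEStronglyMeasurable (fun z => truncPower p N (moll n J z).1) μ := fun n =>
      (hc.comp (continuous_fst.comp (h.continuous_moll_jet n))).aestronglyMeasurable.restrict
    have hbt : ∀ᵐ z ∂μ, Tendsto (fun n => truncPower p N (moll n J z).1) atTop
        (𝓝 (truncPower p N (J z).1)) := by
      filter_upwards [hae] with z hz
      exact (hc.tendsto _).comp ((continuous_fst.tendsto _).comp hz)
    have t1 := tendsto_integral_mul_of_tendsto_eLpNorm_one hΦin hΦi
      (hscale (c := C) fun n z => by
        rw [← map_sub]; exact (Φ z).le_of_opNorm_le (hΦ.bound z) _) hbm hbd hbt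
    have t3 := tendsto_integral_mul_of_tendsto_eLpNorm_one (fun n => hbi _ (huin n)) (hbi _ hui)
      (hscale (c := A) fun n z => by
        rw [← mul_sub, norm_mul]
        exact mul_le_mul (hbA z) (hfst n z) (norm_nonneg _) hA) hbm hbd hbt
    have t2 := tendsto_integral_mul_of_tendsto_eLpNorm_one (μ := μ) (b := fun _ _ => 1)
      (b₀ := fun _ => 1) (B := 1)
      (fun n => hai _ (hHi _ (huin n))) (hai _ (hHi _ hui))
      (hscale (c := A * N) fun n z => by
        rw [← mul_sub, norm_mul, mul_assoc]
        refine mul_le_mul (haA z) ?_ (norm_nonneg _) hA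
        exact (abs_truncPotential_sub_le hp N _ _).trans
          (mul_le_mul_of_nonneg_left (hfst n z) (Nat.cast_nonneg _)))
      (fun n => aestronglyMeasurable_const) (by simp) (by simp)
    have hpi : ∀ f k : ℝ × Space → ℝ, Integrable f μ → AEStronglyMeasurable k μ →
        (∀ z, ‖k z‖ ≤ N) → Integrable (fun z => f z * k z) μ := fun f k hf hk hkN =>
      hf.mul_bdd (c := N) hk (Eventually.of_forall hkN)
    have hbm0 : AEStronglyMeasurable (fun z => truncPower p N (J z).1) μ :=
      hc.comp_aestronglyMeasurable hum.restrict
    have T := (t1.add t2).add t3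
    have e0 : ∀ n, (∫ z, Φ z (moll n J z) * truncPower p N (moll n J z).1 ∂μ)
        + (∫ z, a z * truncPotential p N (moll n J z).1 * 1 ∂μ)
        + (∫ z, b z * (moll n J z).1 * truncPower p N (moll n J z).1 ∂μ) = 0 := by
      intro n
      have i1 := hpi _ _ (hΦin n) (hbm n) (hbd n)
      have i2 := (hai _ (hHi _ (huin n))).mul_const 1
      have i3 := hpi _ _ (hbi _ (huin n)) (hbm n) (hbd n)
      rw [← integral_add_three i1 i2 i3,
        ← hchain n _ _ (hasDerivAt_truncPotential hp N) hc,
        ← setIntegral_eq_integral_of_forall_compl_eq_zero (s := S) fun z hz => hoff _ _ _ z hz]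
      refine integral_congr_ae (Eventually.of_forall fun z => ?_)
      ring
    simp only [e0] at T
    have T0 := tendsto_nhds_unique tendsto_const_nhds T
    have i1 := hpi _ _ hΦi hbm0 fun z => abs_truncPower_le N _
    have i2 := (hai _ (hHi _ hui)).mul_const 1
    have i3 := hpi _ _ (hbi _ hui) hbm0 fun z => abs_truncPower_le N _
    rw [T0, ← integral_add_three i1 i2 i3]
    refine integral_congr_ae (Eventually.of_forall fun z => ?_)
    ring
  obtain ⟨B, hB, hBt⟩ := h.locSlice.bound R
  -- On the ball u·F = |u|^{p+1}, and the pairing of u in L^∞_t L²_x with F in L¹_t L²_x makes it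
  -- integrable. This provides the majorant for removing the truncation.
  have huF : Integrable fun z => S.indicator (fun z => (J z).1) z * F z := by
    refine h.integrable_mul_source (B := B) (T := R) (hum.indicator hSm) hB (fun t => ?_)
      fun z hz => ?_
    · refine le_trans (ENNReal.rpow_le_rpow (lintegral_mono fun x => ?_) (by norm_num)) (hBt t)
      refine ENNReal.rpow_le_rpow ?_ (by norm_num)
      by_cases hx : (t, x) ∈ S
      · rw [Set.indicator_of_mem hx, Set.indicator_of_mem hx, ← ofReal_norm, ← ofReal_norm]
        exact ENNReal.ofReal_le_ofReal (norm_fst_le _)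
      · simp [Set.indicator_of_notMem hx]
    · rw [Set.indicator_of_notMem]
      rw [mem_closedBall_zero_prod]
      rw [Set.mem_Icc, ← abs_le] at hz
      tauto
  obtain ⟨B', hB', hB't, -⟩ := hΦ.exists_sliceNorm_le h
  have hΦF : Integrable fun z => Φ z (J z) * F z :=
    h.integrable_mul_source (T := R) hΦm hB' hB't fun z hz => hΦ.eq_zero_of_time J hz
  have hpot : Integrable (fun z => |(J z).1| ^ (p + 1)) μ := by
    refine huF.restrict (s := S) |>.congr ?_
    filter_upwards [ae_restrict_mem hSm] with z hz
    rw [Set.indicator_of_mem hz, hF, abs_rpow_mul_self_mul hp]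
  refine ⟨hpot, ?_⟩
  rw [← setIntegral_eq_integral_of_forall_compl_eq_zero (s := S) fun z hz => by
    rw [hΦ.supp z hz, has z hz, hbs z hz]; simp]
  -- At each point the truncation is inactive once N ≥ |u|^p, so the integrand is eventually
  -- constant and dominated convergence applies.
  have T : Tendsto (fun N : ℕ => ∫ z, (Φ z (J z) * truncPower p N (J z).1
      + a z * truncPotential p N (J z).1 + b z * ((J z).1 * truncPower p N (J z).1)) ∂μ) atTop
      (𝓝 (∫ z, (Φ z (J z) * F z + (a z / (p + 1) + b z) * |(J z).1| ^ (p + 1)) ∂μ)) := by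
    refine tendsto_integral_of_dominated_convergence (fun z => ‖Φ z (J z) * F z‖
      + 2 * (A * |(J z).1| ^ (p + 1))) (fun N => ?_)
      (hΦF.restrict.norm.add ((hpot.const_mul A).const_mul 2)) (fun N => ?_) ?_
    · have hc := continuous_truncPower hp N
      have hHc : Continuous (truncPotential p N) :=
        continuous_iff_continuousAt.2 fun s => (hasDerivAt_truncPotential hp N s).continuousAt
      have k1 := hc.comp_aestronglyMeasurable hum.restrict (μ := μ)
      have k2 := hHc.comp_aestronglyMeasurable hum.restrict (μ := μ)
      exact ((hΦm.restrict.mul k1).add (ha.restrict.mul k2)).add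
        (hb.restrict.mul (hum.restrict.mul k1))
    · refine Eventually.of_forall fun z => ?_
      have h1 : ‖Φ z (J z) * truncPower p N (J z).1‖ ≤ ‖Φ z (J z) * F z‖ := by
        rw [norm_mul, norm_mul, hF, Real.norm_eq_abs (|(J z).1| ^ (p - 1) * (J z).1),
          abs_abs_rpow_mul hp]
        exact mul_le_mul_of_nonneg_left (abs_truncPower_le_rpow hp N _) (norm_nonneg _)
      have h2 : ‖a z * truncPotential p N (J z).1‖ ≤ A * |(J z).1| ^ (p + 1) := by
        rw [norm_mul]
        exact mul_le_mul (haA z) (abs_truncPotential_le hp N _) (norm_nonneg _) hA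
      have h3 : ‖b z * ((J z).1 * truncPower p N (J z).1)‖ ≤ A * |(J z).1| ^ (p + 1) := by
        rw [norm_mul]
        refine mul_le_mul (hbA z) ?_ (norm_nonneg _) hA
        rw [norm_mul, ← abs_rpow_mul_self_mul hp, Real.norm_eq_abs, Real.norm_eq_abs]
        have : (J z).1 * (|(J z).1| ^ (p - 1) * (J z).1) = |(J z).1| * |(J z).1| ^ p := by
          rw [← abs_abs_rpow_mul hp, ← abs_mul, abs_rpow_mul_self_mul hp,
            abs_of_nonneg (Real.rpow_nonneg (abs_nonneg _) _)]
        rw [this]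
        exact mul_le_mul_of_nonneg_left (abs_truncPower_le_rpow hp N _) (abs_nonneg _)
      refine (norm_add₃_le).trans ?_
      linarith
    · refine Eventually.of_forall fun z => ?_
      obtain ⟨M, hM⟩ := exists_nat_ge (|(J z).1| ^ p)
      refine tendsto_const_nhds.congr' ?_
      filter_upwards [eventually_ge_atTop M] with N hN
      have hN' : |(J z).1| ^ p ≤ N := hM.trans (by exact_mod_cast hN)
      rw [truncPower_eq hp hN', truncPotential_eq hp hN', hF, abs_rpow_mul_self_mul hp]
      ring
  simp only [step] at T
  exact tendsto_nhds_unique T tendsto_const_nhds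

end NonlinearLimits

end DefocusingWave

namespace DefocusingWave

/-! ### Balance laws for weak solutions -/

section BalanceLaws

variable {J : ℝ × Space → Jet} {F : ℝ × Space → ℝ}

/-- With zero multiplier and zero coefficients the chain rule identity is trivial, and only the
integrability half of the statement is kept. -/
lemma IsWeakWave.integrable_potential (h : IsWeakWave J F) {p : ℝ} (hp : 1 ≤ p)
    (hF : ∀ z, F z = |(J z).1| ^ (p - 1) * (J z).1) (R : ℝ) :
    Integrable (fun z => |(J z).1| ^ (p + 1))
        (volume.restrict (Metric.closedBall (0 : ℝ × Space) R)) :=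
  (IsJetMultiplier.integral_mul_source_eq (Φ := 0) (C := 0) (a := 0) (b := 0) (A := 0)
    ⟨fun _ _ => by simpa using aestronglyMeasurable_const, fun _ _ => by simpa using continuous_const,
      by simp, by simp⟩ h hp hF aestronglyMeasurable_const aestronglyMeasurable_const
    (by simp) (by simp) (by simp) (by simp) (by simp)).1

/-- Combination of a multiplier identity for the wave operator and a chain rule identity. -/
lemma IsWeakWave.integral_balance (h : IsWeakWave J F) {Φ : ℝ × Space → Jet →L[ℝ] ℝ}
    {Q : ℝ × Space → Jet → ℝ} {C C' R p : ℝ}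
    (hΦ : IsJetMultiplier Φ C R) (hQ : IsQuadraticDensity Q C' R) (hp : 1 ≤ p)
    (hF : ∀ z, F z = |(J z).1| ^ (p - 1) * (J z).1) {a b : ℝ × Space → ℝ} {A : ℝ}
    (ha : AEStronglyMeasurable a) (hb : AEStronglyMeasurable b) (haA : ∀ z, |a z| ≤ A)
    (hbA : ∀ z, |b z| ≤ A) (has : ∀ z, z ∉ Metric.closedBall 0 R → a z = 0)
    (hbs : ∀ z, z ∉ Metric.closedBall 0 R → b z = 0)
    (hid : ∀ n : ℕ, ∫ z, (Φ z (moll n J z) * waveOp (moll n fun z => (J z).1) z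
      + Q z (moll n J z)) = 0)
    (hchain : ∀ (n : ℕ) (H H' : ℝ → ℝ), (∀ s, HasDerivAt H (H' s) s) → Continuous H' →
      ∫ z, (Φ z (moll n J z) * H' (moll n J z).1 + a z * H (moll n J z).1
        + b z * ((moll n J z).1 * H' (moll n J z).1)) = 0) :
    ∫ z, (Q z (J z) + (a z / (p + 1) + b z) * |(J z).1| ^ (p + 1)) = 0 := by
  have hJm := h.locSlice.aesm
  have hpot := h.integrable_potential hp hF R
  have h1 := (hΦ.integral_mul_source_eq h hp hF ha hb haA hbA has hbs hchain).2
  have h2 := hΦ.tendsto_integral_waveOp h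
  have h3 := hQ.tendsto_integral h
  have hwc : ∀ n, Continuous (waveOp (moll n fun z => (J z).1)) := fun n => by
    have := h.contDiff_moll_fst n
    exact ((contDiff_partial (contDiff_partial this _) _).continuous).sub
      (continuous_finsetSum _ fun i _ => (contDiff_partial (contDiff_partial this _) _).continuous)
  have hi1 : ∀ n, Integrable fun z => Φ z (moll n J z) * waveOp (moll n fun z => (J z).1) z :=
    fun n => ((hΦ.cont _ (h.continuous_moll_jet n)).mul (hwc n)).integrable_of_hasCompactSupport
      (hΦ.hasCompactSupport _).mul_right
  have hi2 : ∀ n, Integrable fun z => Q z (moll n J z) := fun n =>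
    hQ.integrable_of_memLp (h.continuous_moll_jet n).aestronglyMeasurable (h.memLp_moll_restrict n R)
  have hT := h2.add h3
  have h4 : ∀ n, (∫ z, Φ z (moll n J z) * waveOp (moll n fun z => (J z).1) z)
      + ∫ z, Q z (moll n J z) = 0 := fun n => by
    rw [← hid n, integral_add (hi1 n) (hi2 n)]
  simp only [h4] at hT
  have h5 := tendsto_nhds_unique hT tendsto_const_nhds
  obtain ⟨B', hB', hB't, -⟩ := hΦ.exists_sliceNorm_le h
  have hΦF : Integrable fun z => Φ z (J z) * F z :=
    h.integrable_mul_source (T := R) (hΦ.meas J hJm) hB' hB't fun z hz => hΦ.eq_zero_of_time J hz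
  have hQi := hQ.integrable_of_memLp hJm (h.locSlice.memLp_restrict R)
  have hP : Integrable fun z => (a z / (p + 1) + b z) * |(J z).1| ^ (p + 1) := by
    have hon : IntegrableOn (fun z => (a z / (p + 1) + b z) * |(J z).1| ^ (p + 1))
        (Metric.closedBall (0 : ℝ × Space) R) := by
      refine hpot.bdd_mul (c := A / (p + 1) + A)
        (((by simpa only [div_eq_mul_inv] using ha.mul_const (p + 1)⁻¹ :
          AEStronglyMeasurable fun z => a z / (p + 1)).add hb).restrict) (Eventually.of_forall fun z => ?_)
      refine (abs_add_le _ _).trans (add_le_add ?_ (hbA z))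
      rw [abs_div, abs_of_pos (by linarith : 0 < p + 1)]
      exact div_le_div_of_nonneg_right (haA z) (by linarith)
    refine (integrableOn_iff_integrable_of_support_subset fun z hz => ?_).1 hon
    by_contra hne
    exact hz (by simp [has z hne, hbs z hne])
  -- The limit of the multiplier identity contains -∫Φ(J)F and the chain rule identity contains
  -- +∫Φ(J)F; adding them removes the source.
  rw [integral_add hΦF hP] at h1
  rw [integral_add hQi hP]
  linarith

/-- The jet of a function, its time derivative and its spatial gradient. -/
def jet (u v : ℝ → Space → ℝ) (g : ℝ → Space → Space) (z : ℝ × Space) : Jet :=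
  (u z.1 z.2, v z.1 z.2, g z.1 z.2)

lemma norm_radialDir_le (x : Space) : ‖radialDir x‖ ≤ 1 := by
  rw [radialDir, norm_smul, norm_inv, norm_norm]
  exact inv_mul_le_one

lemma measurable_radialDir : Measurable radialDir := by
  unfold radialDir
  fun_prop

/-- `𝐋₊` as a linear functional of jets. -/
noncomputable def lplusJet (z : ℝ × Space) : Jet →L[ℝ] ℝ :=
  (innerSL ℝ (radialDir z.2)).comp ((ContinuousLinearMap.snd ℝ ℝ Space).comp
      (ContinuousLinearMap.snd ℝ ℝ (ℝ × Space)))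
    + ‖z.2‖⁻¹ • ContinuousLinearMap.fst ℝ ℝ (ℝ × Space)
    + (ContinuousLinearMap.fst ℝ ℝ Space).comp (ContinuousLinearMap.snd ℝ ℝ (ℝ × Space))

lemma lplusJet_apply (z : ℝ × Space) (k : Jet) :
    lplusJet z k = inner ℝ k.2.2 (radialDir z.2) + k.1 / ‖z.2‖ + k.2.1 := by
  rw [real_inner_comm, div_eq_inv_mul]
  simp [lplusJet]

/-- The coefficient 1/|x| is bounded only away from the axis, hence the constant depends on the
distance δ at which the test function starts. -/
lemma abs_lplusJet_le {z : ℝ × Space} {δ : ℝ} (hδ : 0 < δ) (hz : δ ≤ ‖z.2‖) (k : Jet) :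
    |lplusJet z k| ≤ (2 + δ⁻¹) * ‖k‖ := by
  have h1 : ‖k.1‖ ≤ ‖k‖ := norm_fst_le k
  have h2 : ‖k.2.1‖ ≤ ‖k‖ := (norm_fst_le k.2).trans (norm_snd_le k)
  have h3 : ‖k.2.2‖ ≤ ‖k‖ := (norm_snd_le k.2).trans (norm_snd_le k)
  rw [lplusJet_apply]
  refine (abs_add_three _ _ _).trans ?_
  have h4 : ‖inner ℝ k.2.2 (radialDir z.2)‖ ≤ ‖k‖ := by
    refine (norm_inner_le_norm _ _).trans ?_
    calc _ ≤ ‖k‖ * 1 := mul_le_mul h3 (norm_radialDir_le _) (norm_nonneg _) (norm_nonneg _)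
      _ = _ := mul_one _
  have h5 : ‖k.1 / ‖z.2‖‖ ≤ δ⁻¹ * ‖k‖ := by
    rw [norm_div, norm_norm, div_eq_inv_mul]
    exact mul_le_mul (inv_anti₀ hδ hz) h1 (norm_nonneg _) (by positivity)
  rw [Real.norm_eq_abs] at h1 h2 h4 h5
  linarith

/-- The angular component of the gradient in a jet. -/
noncomputable def angularJet (z : ℝ × Space) (k : Jet) : Space :=
  k.2.2 - inner ℝ k.2.2 (radialDir z.2) • radialDir z.2

lemma angularJet_sub (z : ℝ × Space) (k l : Jet) :
    angularJet z (k - l) = angularJet z k - angularJet z l := by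
  simp only [angularJet, Prod.snd_sub, inner_sub_left, sub_smul]
  abel

lemma norm_angularJet_le (z : ℝ × Space) (k : Jet) : ‖angularJet z k‖ ≤ 2 * ‖k‖ := by
  have h3 : ‖k.2.2‖ ≤ ‖k‖ := (norm_snd_le k.2).trans (norm_snd_le k)
  refine (norm_sub_le _ _).trans ?_
  rw [norm_smul]
  have h1 := norm_radialDir_le z.2
  have h2 : ‖inner ℝ k.2.2 (radialDir z.2)‖ ≤ ‖k.2.2‖ * 1 :=
    (norm_inner_le_norm _ _).trans (mul_le_mul_of_nonneg_left h1 (norm_nonneg _))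
  nlinarith [norm_nonneg (radialDir z.2), norm_nonneg k.2.2, mul_le_mul h2 h1 (norm_nonneg _) (by positivity)]

lemma aestronglyMeasurable_lplusJet {K : ℝ × Space → Jet} (hK : AEStronglyMeasurable K) :
    AEStronglyMeasurable fun z => lplusJet z (K z) := by
  simp only [lplusJet_apply]
  have hω : AEStronglyMeasurable (fun z : ℝ × Space => radialDir z.2) :=
    (measurable_radialDir.comp measurable_snd).aestronglyMeasurable
  have hn : AEStronglyMeasurable (fun z : ℝ × Space => ‖z.2‖⁻¹) :=
    (measurable_snd.norm.inv).aestronglyMeasurable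
  have h1 : AEStronglyMeasurable fun z => (K z).1 := continuous_fst.comp_aestronglyMeasurable hK
  have h2 : AEStronglyMeasurable fun z => (K z).2.1 :=
    (continuous_fst.comp continuous_snd).comp_aestronglyMeasurable hK
  have h3 : AEStronglyMeasurable fun z => (K z).2.2 :=
    (continuous_snd.comp continuous_snd).comp_aestronglyMeasurable hK
  simp only [div_eq_mul_inv]
  exact ((h3.inner hω).add (h1.mul hn)).add h2

lemma aestronglyMeasurable_angularJet {K : ℝ × Space → Jet} (hK : AEStronglyMeasurable K) :
    AEStronglyMeasurable fun z => angularJet z (K z) := by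
  have hω : AEStronglyMeasurable (fun z : ℝ × Space => radialDir z.2) :=
    (measurable_radialDir.comp measurable_snd).aestronglyMeasurable
  have h3 : AEStronglyMeasurable fun z => (K z).2.2 :=
    (continuous_snd.comp continuous_snd).comp_aestronglyMeasurable hK
  exact h3.sub ((h3.inner (𝕜 := ℝ) hω).smul hω)

lemma continuousAt_radialDir {z : ℝ × Space} (hz : z.2 ≠ 0) :
    ContinuousAt (fun z : ℝ × Space => radialDir z.2) z := by
  unfold radialDir
  exact (continuous_snd.norm.continuousAt.inv₀ (norm_ne_zero_iff.2 hz)).smul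
    continuous_snd.continuousAt

/-- The integrand of the flux of inward energy through spheres. -/
noncomputable def fluxDensity (p : ℝ) (f h : Space → ℝ) (g : Space → Space) (x : Space) : ℝ :=
  1 / 4 * |Lplus f h g x| ^ 2 - 1 / 4 * ‖angularGrad g x‖ ^ 2 - 1 / (2 * (p + 1)) * |f x| ^ (p + 1)

/-- The density of the loss of inward energy. -/
noncomputable def bulkDensity (p : ℝ) (f : Space → ℝ) (g : Space → Space) (x : Space) : ℝ :=
  (1 / 2 * ‖angularGrad g x‖ ^ 2 + (p - 1) / (2 * (p + 1)) * |f x| ^ (p + 1)) / ‖x‖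

lemma Lplus_eq_lplusJet (u v : ℝ → Space → ℝ) (g : ℝ → Space → Space) (z : ℝ × Space) :
    Lplus (u z.1) (v z.1) (g z.1) z.2 = lplusJet z (jet u v g z) := by
  rw [lplusJet_apply]; rfl

lemma angularGrad_eq_angularJet (u v : ℝ → Space → ℝ) (g : ℝ → Space → Space) (z : ℝ × Space) :
    angularGrad (g z.1) z.2 = angularJet z (jet u v g z) := rfl

namespace IsRadialTest

variable {X : ℝ × ℝ → ℝ}

lemma continuous_dT (hX : ContDiff ℝ ∞ X) : Continuous (dT X) :=
  (hX.continuous_fderiv (by simp)).clm_apply continuous_const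

lemma continuous_dR (hX : ContDiff ℝ ∞ X) : Continuous (dR X) :=
  (hX.continuous_fderiv (by simp)).clm_apply continuous_const

lemma continuous_lift {Y : ℝ × ℝ → ℝ} (hY : Continuous Y) : Continuous (lift Y) :=
  hY.comp (continuous_fst.prodMk continuous_snd.norm)

/-- Uniform bounds and support properties of a radial test function and its derivatives. -/
lemma exists_bounds (hX : IsRadialTest X) : ∃ δ > 0, ∃ B R : ℝ, 0 ≤ B ∧
    (∀ z, |lift X z| ≤ B ∧ |lift (dT X) z| ≤ B ∧ |lift (dR X) z| ≤ B) ∧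
    (∀ z : ℝ × Space, (‖z.2‖ < δ ∨ z ∉ Metric.closedBall (0 : ℝ × Space) R) →
      lift X z = 0 ∧ lift (dT X) z = 0 ∧ lift (dR X) z = 0) := by
  obtain ⟨δ, hδ, h0⟩ := hX.vanishes
  obtain ⟨R, hR⟩ := hX.hasCompactSupport.isCompact.isBounded.subset_closedBall 0
  have hb : ∀ {Y : ℝ × ℝ → ℝ}, Continuous Y → HasCompactSupport Y → ∃ B, ∀ p, |Y p| ≤ B :=
    fun hc hs => hs.exists_bound_of_continuous hc
  obtain ⟨B₁, h1⟩ := hb hX.contDiff.continuous hX.hasCompactSupport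
  obtain ⟨B₂, h2⟩ := hb (continuous_dT hX.contDiff) (hX.hasCompactSupport.fderiv_apply (𝕜 := ℝ) _)
  obtain ⟨B₃, h3⟩ := hb (continuous_dR hX.contDiff) (hX.hasCompactSupport.fderiv_apply (𝕜 := ℝ) _)
  refine ⟨δ, hδ, max B₁ (max B₂ B₃), R, (abs_nonneg _).trans ((h1 0).trans (le_max_left _ _)),
    fun z => ⟨(h1 _).trans (le_max_left _ _),
      (h2 _).trans ((le_max_left _ _).trans (le_max_right _ _)),
      (h3 _).trans ((le_max_right _ _).trans (le_max_right _ _))⟩, ?_⟩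
  have key : ∀ q : ℝ × ℝ, X =ᶠ[𝓝 q] 0 → X q = 0 ∧ dT X q = 0 ∧ dR X q = 0 := fun q hq => by
    refine ⟨hq.eq_of_nhds, ?_, ?_⟩ <;> simp [dT, dR, hq.fderiv_eq]
  rintro z (hz | hz)
  · refine key _ ?_
    have ho : IsOpen {q : ℝ × ℝ | q.2 < δ} := isOpen_lt continuous_snd continuous_const
    filter_upwards [ho.mem_nhds hz] with q hq using h0 q hq
  · refine key (z.1, ‖z.2‖) (notMem_tsupport_iff_eventuallyEq.1 fun hm => hz ?_)
    have := hR hm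
    rw [mem_closedBall_zero_iff, Prod.norm_def] at this ⊢
    simpa using this

end IsRadialTest

lemma IsWeakWave.lplusJet_moll (h : IsWeakWave J F) (n : ℕ) (z : ℝ × Space) :
    LplusST (moll n fun z => (J z).1) (timeDer (moll n fun z => (J z).1))
      (spaceGrad (moll n fun z => (J z).1)) z = lplusJet z (moll n J z) := by
  rw [lplusJet_apply, h.moll_fst, h.moll_time, h.moll_space]
  rfl

lemma IsWeakWave.angularJet_moll (h : IsWeakWave J F) (n : ℕ) (z : ℝ × Space) :
    angularST (spaceGrad (moll n fun z => (J z).1)) z = angularJet z (moll n J z) := by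
  rw [angularJet, h.moll_space]
  rfl

lemma abs_sq_sub_sq_le {M s t d a b : ℝ} (hd : |s - t| ≤ M * d) (hs : |s| ≤ M * a)
    (ht : |t| ≤ M * b) (hM : 0 ≤ M) (hd0 : 0 ≤ d) :
    |s ^ 2 - t ^ 2| ≤ M ^ 2 * (d * (1 + a + b)) := by
  have h1 : s ^ 2 - t ^ 2 = (s - t) * (s + t) := by ring
  rw [h1, abs_mul]
  calc |s - t| * |s + t| ≤ (M * d) * (M * a + M * b) :=
        mul_le_mul hd ((abs_add_le _ _).trans (add_le_add hs ht)) (abs_nonneg _)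
          (mul_nonneg hM hd0)
    _ ≤ M ^ 2 * (d * (1 + a + b)) := by nlinarith [mul_nonneg (mul_nonneg hM hM) hd0]

/-- The balance law of the inward energy, tested against radial test functions. -/
lemma IsWeakWave.inward_balance {p : ℝ} (hp : 1 ≤ p) {u v : ℝ → Space → ℝ}
    {g : ℝ → Space → Space}
    (h : IsWeakWave (jet u v g) fun z => |u z.1 z.2| ^ (p - 1) * u z.1 z.2)
    {X : ℝ × ℝ → ℝ} (hX : IsRadialTest X) :
    ∫ z : ℝ × Space, (lift (dT X) z * inwardDensity p (u z.1) (v z.1) (g z.1) z.2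
      - lift (dR X) z * fluxDensity p (u z.1) (v z.1) (g z.1) z.2
      - lift X z * bulkDensity p (u z.1) (g z.1) z.2) = 0 := by
  obtain ⟨δ, hδ, B, R, hB0, hB, hsupp⟩ := hX.exists_bounds
  set M : ℝ := 2 + δ⁻¹ with hM
  have hM0 : 0 < M := by positivity
  have hM2 : 2 ≤ M := by have := inv_pos.2 hδ; linarith
  have hXc : Continuous (lift X) := IsRadialTest.continuous_lift hX.contDiff.continuous
  have hTc : Continuous (lift (dT X)) :=
    IsRadialTest.continuous_lift (IsRadialTest.continuous_dT hX.contDiff)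
  have hRc : Continuous (lift (dR X)) :=
    IsRadialTest.continuous_lift (IsRadialTest.continuous_dR hX.contDiff)
  have hin : AEStronglyMeasurable (fun z : ℝ × Space => ‖z.2‖⁻¹) :=
    (measurable_snd.norm.inv).aestronglyMeasurable
  have hXr : ∀ z : ℝ × Space, |lift X z * ‖z.2‖⁻¹| ≤ B * δ⁻¹ := by
    intro z
    by_cases hz : ‖z.2‖ < δ
    · rw [(hsupp z (Or.inl hz)).1]
      simp only [zero_mul, abs_zero]
      positivity
    · rw [abs_mul, abs_inv, abs_norm]
      exact mul_le_mul (hB z).1 (inv_anti₀ hδ (not_lt.1 hz)) (by positivity) hB0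
  -- The multiplier ½X L₊ is continuous across the axis because X vanishes there identically.
  have hΦ : IsJetMultiplier (fun z => (lift X z * (1 / 2)) • lplusJet z) (B * M) R := by
    refine ⟨fun K hK => ?_, fun K hK => ?_, fun z => ?_, fun z hz => ?_⟩
    · exact (hXc.aestronglyMeasurable.mul_const _).mul (aestronglyMeasurable_lplusJet hK)
    · rw [continuous_iff_continuousAt]
      intro z
      by_cases hz : z.2 = 0
      · have : (fun z => ((lift X z * (1 / 2)) • lplusJet z) (K z)) =ᶠ[𝓝 z] fun _ => 0 := by
          have ho : IsOpen {y : ℝ × Space | ‖y.2‖ < δ} := isOpen_lt (by fun_prop) continuous_const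
          filter_upwards [ho.mem_nhds (by simpa [hz] using hδ)] with y hy
          rw [(hsupp y (Or.inl hy)).1]
          simp
        exact continuousAt_const.congr this.symm
      · have hω := continuousAt_radialDir hz
        simp only [smul_apply, lplusJet_apply, smul_eq_mul]
        have hn : ‖z.2‖ ≠ 0 := norm_ne_zero_iff.2 hz
        have c1 : ContinuousAt (fun z => (K z).2.2) z := hK.snd.snd.continuousAt
        have c2 : ContinuousAt (fun z => (K z).2.1) z := hK.snd.fst.continuousAt
        have c3 : ContinuousAt (fun z => (K z).1) z := hK.fst.continuousAt
        exact (hXc.continuousAt.mul continuousAt_const).mul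
          (((c1.inner (𝕜 := ℝ) hω).add (c3.div continuous_snd.norm.continuousAt hn)).add c2)
    · by_cases hz : ‖z.2‖ < δ
      · rw [(hsupp z (Or.inl hz)).1]
        simp only [zero_mul, zero_smul, norm_zero]
        positivity
      · refine ContinuousLinearMap.opNorm_le_bound _ (by positivity) fun k => ?_
        rw [smul_apply, norm_smul, norm_mul]
        have h1 := abs_lplusJet_le hδ (not_lt.1 hz) k
        have h2 : ‖lift X z‖ * ‖(1 / 2 : ℝ)‖ ≤ B := by
          have := (hB z).1
          rw [Real.norm_eq_abs]
          norm_num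
          linarith [abs_nonneg (lift X z)]
        calc _ ≤ B * (M * ‖k‖) := mul_le_mul h2 h1 (abs_nonneg _) hB0
          _ = _ := by ring
    · rw [(hsupp z (Or.inr hz)).1]
      simp
  have hQ : IsQuadraticDensity (fun z k => lift (dT X) z * (1 / 4 * lplusJet z k ^ 2
        + 1 / 4 * ‖angularJet z k‖ ^ 2)
      - lift (dR X) z * (1 / 4 * lplusJet z k ^ 2 - 1 / 4 * ‖angularJet z k‖ ^ 2)
      - lift X z * (1 / 2 * ‖angularJet z k‖ ^ 2 / ‖z.2‖)) ((B + B * δ⁻¹) * M ^ 2) R := by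
    refine ⟨fun K hK => ?_, fun z => ?_, fun z k l => ?_, fun z hz k => ?_⟩
    · have hL := (aestronglyMeasurable_lplusJet hK).pow 2
      have hA := (aestronglyMeasurable_angularJet hK).norm.pow 2
      simp only [div_eq_mul_inv]
      exact ((hTc.aestronglyMeasurable.mul ((hL.const_mul _).add (hA.const_mul _))).sub
        (hRc.aestronglyMeasurable.mul ((hL.const_mul _).sub (hA.const_mul _)))).sub
        (hXc.aestronglyMeasurable.mul ((hA.const_mul _).mul hin))
    · simp [angularJet]
    · by_cases hz : ‖z.2‖ < δ
      · obtain ⟨h1, h2, h3⟩ := hsupp z (Or.inl hz)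
        simp only [h1, h2, h3]
        simp only [zero_mul, sub_self, abs_zero]
        positivity
      · have hz' := not_lt.1 hz
        have hL : |lplusJet z k ^ 2 - lplusJet z l ^ 2| ≤ M ^ 2 * (‖k - l‖ * (1 + ‖k‖ + ‖l‖)) :=
          abs_sq_sub_sq_le (by rw [← map_sub]; exact abs_lplusJet_le hδ hz' _)
            (abs_lplusJet_le hδ hz' _) (abs_lplusJet_le hδ hz' _) hM0.le (norm_nonneg _)
        have hle : ∀ k, ‖angularJet z k‖ ≤ M * ‖k‖ := fun k =>
          (norm_angularJet_le z k).trans (mul_le_mul_of_nonneg_right hM2 (norm_nonneg _))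
        have hA : |‖angularJet z k‖ ^ 2 - ‖angularJet z l‖ ^ 2|
            ≤ M ^ 2 * (‖k - l‖ * (1 + ‖k‖ + ‖l‖)) :=
          abs_sq_sub_sq_le ((abs_norm_sub_norm_le _ _).trans (by
              rw [← angularJet_sub]; exact hle _))
            (by rw [abs_norm]; exact hle _) (by rw [abs_norm]; exact hle _) hM0.le (norm_nonneg _)
        set D : ℝ := M ^ 2 * (‖k - l‖ * (1 + ‖k‖ + ‖l‖)) with hD
        set α := lplusJet z k ^ 2 - lplusJet z l ^ 2 with hα
        set β := ‖angularJet z k‖ ^ 2 - ‖angularJet z l‖ ^ 2 with hβ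
        have e : ∀ x y w : ℝ, x * (1 / 4 * lplusJet z k ^ 2 + 1 / 4 * ‖angularJet z k‖ ^ 2)
            - y * (1 / 4 * lplusJet z k ^ 2 - 1 / 4 * ‖angularJet z k‖ ^ 2)
            - w * (1 / 2 * ‖angularJet z k‖ ^ 2 / ‖z.2‖)
            - (x * (1 / 4 * lplusJet z l ^ 2 + 1 / 4 * ‖angularJet z l‖ ^ 2)
              - y * (1 / 4 * lplusJet z l ^ 2 - 1 / 4 * ‖angularJet z l‖ ^ 2)
              - w * (1 / 2 * ‖angularJet z l‖ ^ 2 / ‖z.2‖))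
            = 1 / 4 * (x * α) + 1 / 4 * (x * β) + (-1 / 4 * (y * α) + 1 / 4 * (y * β))
              + -1 / 2 * ((w * ‖z.2‖⁻¹) * β) := by
          intro x y w
          rw [hα, hβ]
          ring
        rw [e]
        have hD0 : 0 ≤ D := by positivity
        have b : ∀ {x c y : ℝ}, |x| ≤ c → |y| ≤ D → -(c * D) ≤ x * y ∧ x * y ≤ c * D := by
          intro x c y hx hy
          rw [← abs_le, abs_mul]
          exact mul_le_mul hx hy (abs_nonneg _) ((abs_nonneg _).trans hx)
        have b1 := b (hB z).2.1 hL
        have b2 := b (hB z).2.1 hA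
        have b3 := b (hB z).2.2 hL
        have b4 := b (hB z).2.2 hA
        have b5 := b (hXr z) hA
        have hgoal : (B + B * δ⁻¹) * M ^ 2 * (‖k - l‖ * (1 + ‖k‖ + ‖l‖))
            = B * D + B * δ⁻¹ * D := by rw [hD]; ring
        rw [hgoal, abs_le]
        have : 0 ≤ B * δ⁻¹ * D := by positivity
        constructor <;> linarith
    · obtain ⟨h1, h2, h3⟩ := hsupp z (Or.inr hz)
      simp [h1, h2, h3]
  -- The coefficients come from `integral_inward_chain`: ½(X_t + X_r) + X/|x| multiplies H(u), and
  -- -½X/|x| multiplies uH'(u).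
  have hbal := h.integral_balance hΦ hQ hp (fun _ => rfl)
    (a := fun z => 1 / 2 * (lift (dT X) z + lift (dR X) z) + lift X z * ‖z.2‖⁻¹)
    (b := fun z => -1 / 2 * (lift X z * ‖z.2‖⁻¹)) (A := B + B * δ⁻¹)
    (((hTc.add hRc).aestronglyMeasurable.const_mul _).add (hXc.aestronglyMeasurable.mul hin))
    ((hXc.aestronglyMeasurable.mul hin).const_mul _)
    (fun z => by
      have h1 := abs_le.1 (hB z).2.1
      have h2 := abs_le.1 (hB z).2.2
      have h3 := abs_le.1 (hXr z)
      rw [abs_le]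
      constructor <;> linarith)
    (fun z => by
      have h3 := abs_le.1 (hXr z)
      have : 0 ≤ B * δ⁻¹ := by positivity
      rw [abs_le]
      constructor <;> linarith)
    (fun z hz => by obtain ⟨h1, h2, h3⟩ := hsupp z (Or.inr hz); simp [h1, h2, h3])
    (fun z hz => by obtain ⟨h1, h2, h3⟩ := hsupp z (Or.inr hz); simp [h1])
    (fun n => by
      have := integral_inward_identity (h.contDiff_moll_fst n) hX
      rw [← this]
      refine integral_congr_ae (Eventually.of_forall fun z => ?_)
      simp only [h.lplusJet_moll, h.angularJet_moll, smul_apply, smul_eq_mul]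
      ring)
    (fun n H H' hH hH' => by
      have := integral_inward_chain (h.contDiff_moll_fst n) hX hH hH'
      rw [← this]
      refine integral_congr_ae (Eventually.of_forall fun z => ?_)
      simp only [h.lplusJet_moll, h.moll_fst, smul_apply, smul_eq_mul]
      ring)
  rw [← hbal]
  refine integral_congr_ae (Eventually.of_forall fun z => ?_)
  simp only [inwardDensity, fluxDensity, bulkDensity, Lplus_eq_lplusJet,
    angularGrad_eq_angularJet u v g, sq_abs]
  have e : (jet u v g z).1 = u z.1 z.2 := rfl
  rw [e]
  have hp1 : p + 1 ≠ 0 := by linarith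
  field_simp
  ring

/-- The balance law of the energy, tested against test functions on space-time. -/
lemma IsWeakWave.energy_balance {p : ℝ} (hp : 1 ≤ p) {u v : ℝ → Space → ℝ}
    {g : ℝ → Space → Space}
    (h : IsWeakWave (jet u v g) fun z => |u z.1 z.2| ^ (p - 1) * u z.1 z.2)
    {ψ : ℝ × Space → ℝ} (hψ : ContDiff ℝ ∞ ψ) (hc : HasCompactSupport ψ) :
    ∫ z : ℝ × Space, (timeDer ψ z * (1 / 2 * v z.1 z.2 ^ 2 + 1 / 2 * ‖g z.1 z.2‖ ^ 2)
      - v z.1 z.2 * inner ℝ (spaceGrad ψ z) (g z.1 z.2)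
      + timeDer ψ z / (p + 1) * |u z.1 z.2| ^ (p + 1)) = 0 := by
  obtain ⟨R, hR⟩ := hc.isCompact.isBounded.subset_closedBall 0
  have hTc : Continuous (timeDer ψ) := (contDiff_partial hψ timeVec).continuous
  have hGc : Continuous (spaceGrad ψ) := (PiLp.continuous_toLp 2 _).comp
    (continuous_pi fun i => (contDiff_partial hψ (spaceVec i)).continuous)
  have hsupp : ∀ z, z ∉ Metric.closedBall (0 : ℝ × Space) R →
      ψ z = 0 ∧ timeDer ψ z = 0 ∧ spaceGrad ψ z = 0 := by
    intro z hz
    have hq := notMem_tsupport_iff_eventuallyEq.1 fun hm => hz (hR hm)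
    refine ⟨hq.eq_of_nhds, by simp [timeDer, hq.fderiv_eq], ?_⟩
    ext i
    simp [spaceGrad, hq.fderiv_eq]
  have hb : ∀ {G : Type} [NormedAddCommGroup G] {Y : ℝ × Space → G}, Continuous Y →
      (∀ z, z ∉ Metric.closedBall (0 : ℝ × Space) R → Y z = 0) → ∃ B, ∀ z, ‖Y z‖ ≤ B :=
    fun hY hs => (HasCompactSupport.intro (isCompact_closedBall (0 : ℝ × Space) R)
      fun z hz => hs z hz).exists_bound_of_continuous hY
  obtain ⟨B₁, h1⟩ := hb hψ.continuous fun z hz => (hsupp z hz).1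
  obtain ⟨B₂, h2⟩ := hb hTc fun z hz => (hsupp z hz).2.1
  obtain ⟨B₃, h3⟩ := hb hGc fun z hz => (hsupp z hz).2.2
  have hB1 : 0 ≤ B₁ := (norm_nonneg _).trans (h1 0)
  have hB2 : 0 ≤ B₂ := (norm_nonneg _).trans (h2 0)
  have hB3 : 0 ≤ B₃ := (norm_nonneg _).trans (h3 0)
  have hn2 : ∀ k : Jet, ‖k.2.1‖ ≤ ‖k‖ := fun k => (norm_fst_le k.2).trans (norm_snd_le k)
  have hn3 : ∀ k : Jet, ‖k.2.2‖ ≤ ‖k‖ := fun k => (norm_snd_le k.2).trans (norm_snd_le k)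
  have hΦ : IsJetMultiplier (fun z => ψ z • (ContinuousLinearMap.fst ℝ ℝ Space).comp
      (ContinuousLinearMap.snd ℝ ℝ (ℝ × Space))) B₁ R := by
    refine ⟨fun K hK => ?_, fun K hK => ?_, fun z => ?_, fun z hz => ?_⟩
    · exact hψ.continuous.aestronglyMeasurable.mul
        ((continuous_fst.comp continuous_snd).comp_aestronglyMeasurable hK)
    · exact hψ.continuous.mul hK.snd.fst
    · refine ContinuousLinearMap.opNorm_le_bound _ hB1 fun k => ?_
      rw [smul_apply, norm_smul]
      exact mul_le_mul (h1 z) (hn2 k) (norm_nonneg _) hB1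
    · rw [(hsupp z hz).1, zero_smul]
  have hQ : IsQuadraticDensity (fun z k => timeDer ψ z * (1 / 2 * (k.2.1 ^ 2 + ‖k.2.2‖ ^ 2))
      - k.2.1 * inner ℝ (spaceGrad ψ z) k.2.2) (B₂ + B₃) R := by
    refine ⟨fun K hK => ?_, fun z => by simp, fun z k l => ?_, fun z hz k => ?_⟩
    · have c2 := (continuous_fst.comp continuous_snd).comp_aestronglyMeasurable hK
      have c3 := (continuous_snd.comp continuous_snd).comp_aestronglyMeasurable hK
      exact (hTc.aestronglyMeasurable.mul (((c2.pow 2).add (c3.norm.pow 2)).const_mul _)).sub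
        (c2.mul (hGc.aestronglyMeasurable.inner (𝕜 := ℝ) c3))
    · have hv : |k.2.1 ^ 2 - l.2.1 ^ 2| ≤ 1 ^ 2 * (‖k - l‖ * (1 + ‖k‖ + ‖l‖)) :=
        abs_sq_sub_sq_le (by rw [one_mul]; exact hn2 (k - l)) (by rw [one_mul]; exact hn2 k)
          (by rw [one_mul]; exact hn2 l) zero_le_one (norm_nonneg _)
      have hg : |‖k.2.2‖ ^ 2 - ‖l.2.2‖ ^ 2| ≤ 1 ^ 2 * (‖k - l‖ * (1 + ‖k‖ + ‖l‖)) :=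
        abs_sq_sub_sq_le ((abs_norm_sub_norm_le _ _).trans (by rw [one_mul]; exact hn3 (k - l)))
          (by rw [abs_norm, one_mul]; exact hn3 k) (by rw [abs_norm, one_mul]; exact hn3 l)
          zero_le_one (norm_nonneg _)
      have hi : ∀ w : Space, |inner ℝ (spaceGrad ψ z) w| ≤ B₃ * ‖w‖ := fun w =>
        (abs_real_inner_le_norm _ _).trans (mul_le_mul_of_nonneg_right (h3 z) (norm_nonneg _))
      have hm : |k.2.1 * inner ℝ (spaceGrad ψ z) k.2.2 - l.2.1 * inner ℝ (spaceGrad ψ z) l.2.2|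
          ≤ B₃ * (‖k - l‖ * (1 + ‖k‖ + ‖l‖)) := by
        have e : k.2.1 * inner ℝ (spaceGrad ψ z) k.2.2 - l.2.1 * inner ℝ (spaceGrad ψ z) l.2.2
            = (k - l).2.1 * inner ℝ (spaceGrad ψ z) k.2.2
              + l.2.1 * inner ℝ (spaceGrad ψ z) (k - l).2.2 := by
          simp only [Prod.snd_sub, Prod.fst_sub, inner_sub_right]
          ring
        rw [e]
        have a1 : |(k - l).2.1 * inner ℝ (spaceGrad ψ z) k.2.2| ≤ ‖k - l‖ * (B₃ * ‖k‖) := by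
          rw [abs_mul]
          exact mul_le_mul (hn2 _) ((hi _).trans (mul_le_mul_of_nonneg_left (hn3 k) hB3))
            (abs_nonneg _) (norm_nonneg _)
        have a2 : |l.2.1 * inner ℝ (spaceGrad ψ z) (k - l).2.2| ≤ ‖l‖ * (B₃ * ‖k - l‖) := by
          rw [abs_mul]
          exact mul_le_mul (hn2 _) ((hi _).trans (mul_le_mul_of_nonneg_left (hn3 _) hB3))
            (abs_nonneg _) (norm_nonneg _)
        refine (abs_add_le _ _).trans ((add_le_add a1 a2).trans ?_)
        nlinarith [mul_nonneg hB3 (norm_nonneg (k - l))]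
      set D : ℝ := ‖k - l‖ * (1 + ‖k‖ + ‖l‖) with hD
      have hD0 : 0 ≤ D := by positivity
      have e : timeDer ψ z * (1 / 2 * (k.2.1 ^ 2 + ‖k.2.2‖ ^ 2))
          - k.2.1 * inner ℝ (spaceGrad ψ z) k.2.2
          - (timeDer ψ z * (1 / 2 * (l.2.1 ^ 2 + ‖l.2.2‖ ^ 2))
          - l.2.1 * inner ℝ (spaceGrad ψ z) l.2.2)
          = timeDer ψ z * (1 / 2 * ((k.2.1 ^ 2 - l.2.1 ^ 2) + (‖k.2.2‖ ^ 2 - ‖l.2.2‖ ^ 2)))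
          - (k.2.1 * inner ℝ (spaceGrad ψ z) k.2.2 - l.2.1 * inner ℝ (spaceGrad ψ z) l.2.2) := by
        ring
      rw [e, add_mul]
      refine (abs_sub _ _).trans (add_le_add ?_ hm)
      rw [abs_mul]
      refine mul_le_mul (h2 z) ?_ (abs_nonneg _) hB2
      rw [one_pow, one_mul, abs_le] at hv hg
      rw [abs_le]
      constructor <;> linarith
    · obtain ⟨-, h5, h6⟩ := hsupp z hz
      simp [h5, h6]
  have hbal := h.integral_balance hΦ hQ hp (fun _ => rfl) (a := timeDer ψ) (b := fun _ => 0)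
    (A := B₂) hTc.aestronglyMeasurable aestronglyMeasurable_const h2 (by simpa using hB2)
    (fun z hz => (hsupp z hz).2.1) (fun _ _ => rfl)
    (fun n => by
      refine Eq.trans ?_ (integral_energy_identity (h.contDiff_moll_fst n) hψ hc)
      refine integral_congr_ae (Eventually.of_forall fun z => ?_)
      have e : ((ψ z • (ContinuousLinearMap.fst ℝ ℝ Space).comp
        (ContinuousLinearMap.snd ℝ ℝ (ℝ × Space)) : Jet →L[ℝ] ℝ) (moll n (jet u v g) z))
          = ψ z * (moll n (jet u v g) z).2.1 := rfl
      simp only [e, h.moll_time, h.moll_space]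
      ring)
    (fun n H H' hH hH' => by
      refine Eq.trans ?_ (integral_energy_chain (h.contDiff_moll_fst n) hψ hc hH hH')
      refine integral_congr_ae (Eventually.of_forall fun z => ?_)
      have e : ((ψ z • (ContinuousLinearMap.fst ℝ ℝ Space).comp
        (ContinuousLinearMap.snd ℝ ℝ (ℝ × Space)) : Jet →L[ℝ] ℝ) (moll n (jet u v g) z))
          = ψ z * (moll n (jet u v g) z).2.1 := rfl
      simp only [e, h.moll_time, h.moll_fst]
      ring)
  rw [← hbal]
  refine integral_congr_ae (Eventually.of_forall fun z => ?_)
  simp only [jet]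
  ring

end BalanceLaws

end DefocusingWave

namespace DefocusingWave

/-! ### Continuous curves in L² and finite-energy solutions as weak waves -/

section Curves

variable {G G' : Type*} [NormedAddCommGroup G] [NormedAddCommGroup G']

/-- Continuous curves in `L²(ℝ³)`. -/
structure IsL2Curve (f : ℝ → Space → G) : Prop where
  memLp : ∀ t, MemLp (f t) 2 volume
  tendsto : ∀ s, Tendsto (fun t => eLpNorm (f t - f s) 2 volume) (𝓝 s) (𝓝 0)

namespace IsL2Curve

variable {f : ℝ → Space → G} {k : ℝ → Space → G'}

lemma continuous_toLp (hf : IsL2Curve f) : Continuous fun t => (hf.memLp t).toLp (f t) :=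
  continuous_iff_continuousAt.2 fun s =>
    (Lp.tendsto_Lp_iff_tendsto_eLpNorm'' f hf.memLp (f s) (hf.memLp s)).2 (hf.tendsto s)

/-- Pointwise Lipschitz images of continuous curves in `L²`. -/
lemma of_bound (hf : IsL2Curve f) {C : ℝ} (hk : ∀ t, AEStronglyMeasurable (k t) volume)
    (h0 : ∀ t x, ‖k t x‖ ≤ C * ‖f t x‖) (h1 : ∀ t s x, ‖k t x - k s x‖ ≤ C * ‖f t x - f s x‖) :
    IsL2Curve k := by
  refine ⟨fun t => (hf.memLp t).of_le_mul (hk t) (Eventually.of_forall (h0 t)), fun s => ?_⟩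
  have h2 := ENNReal.Tendsto.const_mul (a := ENNReal.ofReal C) (hf.tendsto s)
    (Or.inr ENNReal.ofReal_ne_top)
  rw [mul_zero] at h2
  refine tendsto_of_tendsto_of_tendsto_of_le_of_le tendsto_const_nhds h2 (fun _ => zero_le) ?_
  exact fun t => eLpNorm_le_mul_eLpNorm_of_ae_le_mul (Eventually.of_forall (h1 t s)) 2

lemma add {f k : ℝ → Space → G} (hf : IsL2Curve f) (hk : IsL2Curve k) :
    IsL2Curve fun t x => f t x + k t x := by
  refine ⟨fun t => (hf.memLp t).add (hk.memLp t), fun s => ?_⟩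
  have h2 := (hf.tendsto s).add (hk.tendsto s)
  rw [add_zero] at h2
  refine tendsto_of_tendsto_of_tendsto_of_le_of_le tendsto_const_nhds h2 (fun _ => zero_le) ?_
  intro t
  have e : ((fun x => f t x + k t x) - fun x => f s x + k s x) = (f t - f s) + (k t - k s) := by
    ext x; simp only [Pi.sub_apply, Pi.add_apply]; abel
  simp only [e]
  exact eLpNorm_add_le ((hf.memLp t).1.sub (hf.memLp s).1) ((hk.memLp t).1.sub (hk.memLp s).1)
    one_le_two

lemma continuous_integral_inner {H : Type*} [NormedAddCommGroup H] [InnerProductSpace ℝ H]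
    {f k : ℝ → Space → H} (hf : IsL2Curve f) (hk : IsL2Curve k) :
    Continuous fun t => ∫ x, (inner ℝ (f t x) (k t x) : ℝ) := by
  have h := hf.continuous_toLp.inner (𝕜 := ℝ) hk.continuous_toLp
  refine h.congr fun t => ?_
  rw [L2.inner_def]
  refine integral_congr_ae ?_
  filter_upwards [(hf.memLp t).coeFn_toLp, (hk.memLp t).coeFn_toLp] with x h1 h2
  rw [h1, h2]

lemma continuous_integral_mul_norm_sq {H : Type*} [NormedAddCommGroup H] [InnerProductSpace ℝ H]
    {f : ℝ → Space → H} (hf : IsL2Curve f) {w : Space → ℝ} (hw : Measurable w) {B : ℝ}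
    (hB : ∀ x, |w x| ≤ B) : Continuous fun t => ∫ x, w x * ‖f t x‖ ^ 2 := by
  have hk : IsL2Curve fun t x => w x • f t x := by
    refine hf.of_bound (C := B) (fun t => hw.aestronglyMeasurable.smul (hf.memLp t).1) ?_ ?_
    · intro t x
      rw [norm_smul]
      exact mul_le_mul_of_nonneg_right (hB x) (norm_nonneg _)
    · intro t s x
      rw [← smul_sub, norm_smul]
      exact mul_le_mul_of_nonneg_right (hB x) (norm_nonneg _)
  refine (hk.continuous_integral_inner hf).congr fun t => ?_
  refine integral_congr_ae (Eventually.of_forall fun x => ?_)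
  simp only [inner_smul_left, real_inner_self_eq_norm_sq]
  rfl

lemma exists_bound (hf : IsL2Curve f) (T : ℝ) :
    ∃ C : ℝ≥0∞, C ≠ ⊤ ∧ ∀ t ∈ Set.Icc (-T) T, eLpNorm (f t) 2 volume ≤ C := by
  obtain ⟨C, hC⟩ := (isCompact_Icc (a := -T) (b := T)).exists_bound_of_continuousOn
    hf.continuous_toLp.continuousOn
  refine ⟨ENNReal.ofReal C, ENNReal.ofReal_ne_top, fun t ht => ?_⟩
  have := hC t ht
  rw [Lp.norm_toLp] at this
  exact ENNReal.le_ofReal_iff_toReal_le (hf.memLp t).2.ne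
    (ENNReal.toReal_nonneg.trans this) |>.2 this

end IsL2Curve

lemma eLpNorm_two_eq_sliceNorm (f : ℝ × Space → G) (t : ℝ) :
    sliceNorm f t = eLpNorm (fun x => f (t, x)) 2 volume := by
  rw [sliceNorm, eLpNorm_two_eq]

end Curves

namespace IsFiniteEnergySolution

variable {p : ℝ} {u v : ℝ → Space → ℝ} {g : ℝ → Space → Space}

lemma curve_v (h : IsFiniteEnergySolution p u v g) : IsL2Curve v :=
  ⟨fun t => (h.memEnergySpace t).memLp_velocity, h.continuous_velocity⟩

lemma curve_g (h : IsFiniteEnergySolution p u v g) : IsL2Curve g :=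
  ⟨fun t => (h.memEnergySpace t).memLp_grad, h.continuous_grad⟩

end IsFiniteEnergySolution

lemma _root_.MeasureTheory.MemLp.integrable_mul_test {f : Space → ℝ} {q : ℝ≥0∞} (hf : MemLp f q volume)
    (hq : 1 ≤ q) {ψ : Space → ℝ} (hψ : Continuous ψ) (hc : HasCompactSupport ψ) :
    Integrable fun x => f x * ψ x := by
  have := (hf.locallyIntegrable hq).integrable_smul_left_of_hasCompactSupport hψ hc
  simpa [mul_comm] using this

lemma IsWeakGradient.sub {f f' : Space → ℝ} {g g' : Space → Space} (hf : MemLp f 6 volume)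
    (hf' : MemLp f' 6 volume) (hg : MemLp g 2 volume) (hg' : MemLp g' 2 volume)
    (h : IsWeakGradient f g) (h' : IsWeakGradient f' g') : IsWeakGradient (f - f') (g - g') := by
  intro ψ hψ hc e
  have h6 : (1 : ℝ≥0∞) ≤ 6 := by norm_num
  have c1 : Continuous fun x => fderiv ℝ ψ x e := (contDiff_fderiv_apply hψ e).continuous
  have s1 := hasCompactSupport_fderiv_apply hc e
  have i1 := hf.integrable_mul_test h6 c1 s1
  have i2 := hf'.integrable_mul_test h6 c1 s1
  have i3 := (hg.inner_const (𝕜 := ℝ) e).integrable_mul_test one_le_two hψ.continuous hc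
  have i4 := (hg'.inner_const (𝕜 := ℝ) e).integrable_mul_test one_le_two hψ.continuous hc
  simp only [Pi.sub_apply, sub_mul, inner_sub_left]
  rw [integral_sub i1 i2, integral_sub i3 i4, h ψ hψ hc e, h' ψ hψ hc e]
  ring

namespace IsFiniteEnergySolution

variable {p : ℝ} {u v : ℝ → Space → ℝ} {g : ℝ → Space → Space}

lemma isWeakGradient_sub (h : IsFiniteEnergySolution p u v g) (t s : ℝ) :
    IsWeakGradient (u t - u s) (g t - g s) :=
  IsWeakGradient.sub (h.memEnergySpace t).memLp_six (h.memEnergySpace s).memLp_six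
    (h.memEnergySpace t).memLp_grad (h.memEnergySpace s).memLp_grad
    (h.memEnergySpace t).isWeakGradient (h.memEnergySpace s).isWeakGradient

/-- Hardy applied to u(t) - u(s) transfers continuity in time from the gradient to u/|x|. -/
lemma curve_hardy (h : IsFiniteEnergySolution p u v g) : IsL2Curve fun t x => u t x / ‖x‖ := by
  have hm : ∀ t, AEStronglyMeasurable (fun x => u t x / ‖x‖) := fun t => by
    simp only [div_eq_mul_inv]
    exact (h.memEnergySpace t).memLp_six.1.mul measurable_norm.inv.aestronglyMeasurable
  refine ⟨fun t => ⟨hm t, ?_⟩, fun s => ?_⟩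
  · exact (hardy_inequality (h.memEnergySpace t).memLp_six (h.memEnergySpace t).memLp_grad
      (h.memEnergySpace t).isWeakGradient).trans_lt
      (ENNReal.mul_lt_top (by norm_num) (h.memEnergySpace t).memLp_grad.2)
  · have h1 := ENNReal.Tendsto.const_mul (a := 2) (h.continuous_grad s) (Or.inr (by norm_num))
    rw [mul_zero] at h1
    refine tendsto_of_tendsto_of_tendsto_of_le_of_le tendsto_const_nhds h1 (fun _ => zero_le) ?_
    intro t
    have h2 := hardy_inequality
      ((h.memEnergySpace t).memLp_six.sub (h.memEnergySpace s).memLp_six)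
      ((h.memEnergySpace t).memLp_grad.sub (h.memEnergySpace s).memLp_grad)
      (h.isWeakGradient_sub t s)
    simpa only [Pi.sub_apply, sub_div] using! h2

lemma tendsto_six (h : IsFiniteEnergySolution p u v g) (s : ℝ) :
    Tendsto (fun t => eLpNorm (u t - u s) 6 volume) (𝓝 s) (𝓝 0) := by
  obtain ⟨C, hC⟩ := exists_sobolev_inequality
  have h1 := ENNReal.Tendsto.const_mul (a := (C : ℝ≥0∞)) (h.continuous_grad s)
    (Or.inr ENNReal.coe_ne_top)
  rw [mul_zero] at h1
  refine tendsto_of_tendsto_of_tendsto_of_le_of_le tendsto_const_nhds h1 (fun _ => zero_le) ?_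
  exact fun t => hC _ _ ((h.memEnergySpace t).memLp_six.sub (h.memEnergySpace s).memLp_six)
      ((h.memEnergySpace t).memLp_grad.sub (h.memEnergySpace s).memLp_grad)
      (h.isWeakGradient_sub t s)

lemma aestronglyMeasurable_jet (h : IsFiniteEnergySolution p u v g) :
    AEStronglyMeasurable (jet u v g) :=
  h.aestronglyMeasurable_u.prodMk (h.aestronglyMeasurable_v.prodMk h.aestronglyMeasurable_g)

/-- Membership in the energy space puts u in L⁶, not in L². On the ball of radius R one has |u| ≤ R
|u/|x||, so the continuous curve u/|x| in L² supplies the bound. -/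
lemma locSlice (h : IsFiniteEnergySolution p u v g) : LocSliceL2 (jet u v g) := by
  refine ⟨h.aestronglyMeasurable_jet, fun R => ?_⟩
  obtain ⟨C₁, hC1, h1⟩ := h.curve_hardy.exists_bound R
  obtain ⟨C₂, hC2, h2⟩ := h.curve_v.exists_bound R
  obtain ⟨C₃, hC3, h3⟩ := h.curve_g.exists_bound R
  refine ⟨ENNReal.ofReal |R| * C₁ + C₂ + C₃, by
    simp [ENNReal.mul_eq_top, hC1, hC2, hC3], fun t => ?_⟩
  rw [eLpNorm_two_eq_sliceNorm]
  by_cases ht : t ∈ Set.Icc (-R) R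
  · have m1 := (h.curve_hardy.memLp t).1
    have m2 := (h.curve_v.memLp t).1
    have m3 := (h.curve_g.memLp t).1
    have hle : eLpNorm (fun x => (Metric.closedBall (0 : ℝ × Space) R).indicator (jet u v g) (t, x)) 2
        volume ≤ eLpNorm (fun x => |R| * ‖u t x / ‖x‖‖ + ‖v t x‖ + ‖g t x‖) 2 volume := by
      refine eLpNorm_mono_ae_real ?_
      have h0 : ∀ᵐ x : Space, x ≠ 0 := by simp [ae_iff]
      filter_upwards [h0] with x hx
      have hp : 0 ≤ |R| * ‖u t x / ‖x‖‖ := by positivity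
      by_cases hz : (t, x) ∈ Metric.closedBall (0 : ℝ × Space) R
      · rw [Set.indicator_of_mem hz]
        have hxR : ‖x‖ ≤ |R| := (mem_closedBall_zero_prod.1 hz).2.trans (le_abs_self R)
        have hu : ‖u t x‖ ≤ |R| * ‖u t x / ‖x‖‖ := by
          have hx' := norm_pos_iff.2 hx
          rw [norm_div, norm_norm, mul_div_assoc', le_div_iff₀ hx', mul_comm]
          exact mul_le_mul_of_nonneg_right hxR (norm_nonneg _)
        rw [jet, Prod.norm_def, Prod.norm_def]
        refine max_le ?_ (max_le ?_ ?_) <;> simp only <;>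
          linarith [norm_nonneg (v t x), norm_nonneg (g t x)]
      · rw [Set.indicator_of_notMem hz, norm_zero]
        positivity
    refine hle.trans ?_
    refine (eLpNorm_add_le (((m1.norm.const_mul _)).add m2.norm) m3.norm one_le_two).trans ?_
    refine add_le_add ((eLpNorm_add_le (m1.norm.const_mul _) m2.norm one_le_two).trans ?_) ?_
    · refine add_le_add ?_ (by rw [eLpNorm_norm]; exact h2 t ht)
      refine (eLpNorm_le_mul_eLpNorm_of_ae_le_mul (c := |R|) (g := fun x => u t x / ‖x‖)
        (Eventually.of_forall fun x => ?_) 2).trans (mul_le_mul_right (h1 t ht) _)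
      rw [norm_mul, norm_norm, Real.norm_eq_abs, abs_abs]
    · rw [eLpNorm_norm]; exact h3 t ht
  · have e : (fun x => (Metric.closedBall (0 : ℝ × Space) R).indicator (jet u v g) (t, x)) = 0 := by
      ext1 x
      rw [Set.indicator_of_notMem]
      · rfl
      · rw [mem_closedBall_zero_prod]
        rw [Set.mem_Icc, ← abs_le] at ht
        tauto
    rw [e, eLpNorm_zero]
    exact zero_le

/-- A finite-energy solution is a weak solution with the regularity required of `IsWeakWave`. -/
lemma isWeakWave (h : IsFiniteEnergySolution p u v g) (hp : 3 ≤ p) (hp' : p < 5) :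
    IsWeakWave (jet u v g) fun z => |u z.1 z.2| ^ (p - 1) * u z.1 z.2 := by
  have hloc := h.locSlice
  have hli := hloc.locallyIntegrable
  have hp1 : 1 ≤ p := by linarith
  refine ⟨hloc, ?_, fun i φ hφ hc => ?_, ?_, fun T => ?_, fun φ hφ hc => ?_⟩
  · intro φ hφ hc
    refine Eq.trans ?_ (h.isWeakTimeDeriv φ hφ hc)
    refine integral_congr_ae (Eventually.of_forall fun z => ?_)
    simp only
    rw [fderiv_slice_time (hφ.differentiable (by simp))]
    rfl
  · have hd := contDiff_partial hφ (spaceVec i)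
    have hds := hasCompactSupport_fderiv_apply hc (spaceVec i)
    have iu : Integrable fun z : ℝ × Space => (jet u v g z).1 * fderiv ℝ φ z (spaceVec i) := by
      have := (locallyIntegrable_clm (ContinuousLinearMap.fst ℝ ℝ (ℝ × Space))
        hli).integrable_smul_left_of_hasCompactSupport hd.continuous hds
      simpa [mul_comm] using this
    have ig : Integrable fun z : ℝ × Space => (jet u v g z).2.2 i * φ z := by
      have := (locallyIntegrable_clm ((EuclideanSpace.proj i : Space →L[ℝ] ℝ).comp
        ((ContinuousLinearMap.snd ℝ ℝ Space).comp (ContinuousLinearMap.snd ℝ ℝ (ℝ × Space))))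
        hli).integrable_smul_left_of_hasCompactSupport hφ.continuous hc
      simpa [mul_comm] using this
    have e1 := integral_prod _ iu
    have e2 := integral_prod _ ig
    refine e1.trans ?_
    refine Eq.trans ?_ (congrArg Neg.neg e2.symm)
    rw [← integral_neg]
    refine integral_congr_ae (Eventually.of_forall fun t => ?_)
    have hs : ContDiff ℝ ∞ fun x => φ (t, x) := hφ.comp (contDiff_const.prodMk contDiff_id)
    have hsc : HasCompactSupport fun x => φ (t, x) := by
      refine HasCompactSupport.intro (hc.isCompact.image continuous_snd) fun x hx => ?_
      by_contra hne
      exact hx ⟨(t, x), subset_tsupport _ hne, rfl⟩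
    have := (h.memEnergySpace t).isWeakGradient _ hs hsc (basisVec i)
    refine Eq.trans ?_ (this.trans ?_)
    · refine integral_congr_ae (Eventually.of_forall fun x => ?_)
      simp only
      rw [fderiv_slice_space (hφ.differentiable (by simp)) (t, x)]
      rfl
    · refine congrArg Neg.neg (integral_congr_ae (Eventually.of_forall fun x => ?_))
      simp [jet, basisVec, EuclideanSpace.inner_single_right]
  · have hc : Continuous fun s : ℝ => |s| ^ (p - 1) * s :=
      (continuous_abs.rpow_const fun _ => Or.inr (by linarith)).mul continuous_id
    exact hc.comp_aestronglyMeasurable h.aestronglyMeasurable_u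
  · have h2p : 0 < 2 * p := by linarith
    have hq : ENNReal.ofReal (2 * p) ≠ 0 := by simpa using h2p
    -- The L² norm of |u|^p is the p-th power of the L^{2p} norm of u, so the source is in L¹_t L²_x
    -- locally once u is in L^p_t L^{2p}_x locally.
    have e1 : ∀ t, sliceNorm (fun z : ℝ × Space => |u z.1 z.2| ^ (p - 1) * u z.1 z.2) t
        = eLpNorm (u t) (ENNReal.ofReal (2 * p)) volume ^ p := by
      intro t
      rw [sliceNorm, eLpNorm_eq_lintegral_rpow_enorm_toReal hq ENNReal.ofReal_ne_top,
        ENNReal.toReal_ofReal h2p.le, ← ENNReal.rpow_mul]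
      congr 1
      · refine lintegral_congr fun x => ?_
        have : ‖|u t x| ^ (p - 1) * u t x‖ = ‖u t x‖ ^ p := abs_abs_rpow_mul hp1 _
        rw [← ofReal_norm, this, ← ofReal_norm,
          ENNReal.ofReal_rpow_of_nonneg (by positivity) (by norm_num),
          ENNReal.ofReal_rpow_of_nonneg (by positivity) h2p.le, ← Real.rpow_mul (norm_nonneg _)]
        congr 2
        ring
      · field_simp
    simp only [e1]
    rcases lt_or_ge T 0 with hT | hT
    · rw [Set.Icc_eq_empty (by linarith)]
      simp
    -- The interval is enlarged because the hypothesis needs a < b and the exponent comparison uses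
    -- positive length, while T = 0 is allowed.
    have hst := h.spaceTimeNorm (-T - 1) (T + 1) (by linarith)
    set N : ℝ → ℝ≥0∞ := fun t => eLpNorm (u t) (ENNReal.ofReal (2 * p)) volume with hN
    set μ : Measure ℝ := volume.restrict (Set.Icc (-T - 1) (T + 1)) with hμ
    have hNm : AEMeasurable N μ := by
      have : N = fun t => (∫⁻ x, ‖u t x‖ₑ ^ (2 * p)) ^ (1 / (2 * p)) := by
        ext t
        simp only [hN]
        rw [eLpNorm_eq_lintegral_rpow_enorm_toReal hq ENNReal.ofReal_ne_top,
          ENNReal.toReal_ofReal h2p.le]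
      rw [this]
      refine AEMeasurable.restrict (AEMeasurable.pow_const ?_ _)
      exact AEMeasurable.lintegral_prod_right' (f := fun z : ℝ × Space => ‖u z.1 z.2‖ₑ ^ (2 * p))
        (h.aestronglyMeasurable_u.enorm.pow_const _)
    -- This amounts to p - 3 ≤ 2, so it uses p < 5. For p = 3 the quotient is ∞, as intended.
    have hpq : ENNReal.ofReal p ≤ ENNReal.ofReal (2 * p) / ENNReal.ofReal (p - 3) := by
      refine ENNReal.le_div_iff_mul_le (Or.inr hq) (Or.inr ENNReal.ofReal_ne_top) |>.2 ?_
      rw [← ENNReal.ofReal_mul (by linarith)]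
      exact ENNReal.ofReal_le_ofReal (by nlinarith)
    have h3 := eLpNorm_le_eLpNorm_mul_rpow_measure_univ hpq hNm.aestronglyMeasurable
    have hp0 : ENNReal.ofReal p ≠ 0 := by simpa using (by linarith : 0 < p)
    have h4 : eLpNorm N (ENNReal.ofReal p) μ < ⊤ := by
      refine h3.trans_lt (ENNReal.mul_lt_top hst ?_)
      refine lt_of_le_of_ne le_top ?_
      have hfin : μ Set.univ ≠ ⊤ := by simp [hμ]
      have hpos : μ Set.univ ≠ 0 := by simp [hμ]; linarith
      exact ENNReal.rpow_ne_top_of_ne_zero hpos hfin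
    have h5 := lintegral_rpow_enorm_lt_top_of_eLpNorm_lt_top hp0 ENNReal.ofReal_ne_top h4
    rw [ENNReal.toReal_ofReal (by linarith)] at h5
    refine ((lintegral_mono_set ?_).trans_lt h5).ne
    exact Set.Icc_subset_Icc (by linarith) (by linarith)
  · refine Eq.trans ?_ (h.solvesWaveEq φ hφ hc)
    refine integral_congr_ae (Eventually.of_forall fun z => ?_)
    simp only [waveOp_eq hφ]
    rfl

end IsFiniteEnergySolution

end DefocusingWave

namespace DefocusingWave

/-! ### From weak to classical derivatives on the line -/

section OneDimensional

/-- A continuous function with continuous weak derivative is differentiable. -/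
lemma hasDerivAt_of_integral_test {a b : ℝ → ℝ} (ha : Continuous a) (hb : Continuous b)
    (h : ∀ θ : ℝ → ℝ, ContDiff ℝ ∞ θ → HasCompactSupport θ →
      ∫ t, (deriv θ t * a t + θ t * b t) = 0) (t : ℝ) : HasDerivAt a (b t) t := by
  set B : ℝ → ℝ := fun t => ∫ s in (0 : ℝ)..t, b s with hB
  have hBd : ∀ t, HasDerivAt B (b t) t := fun t => (hb.integral_hasStrictDerivAt 0 t).hasDerivAt
  have hBc : Continuous B := continuous_iff_continuousAt.2 fun t => (hBd t).continuousAt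
  -- Subtracting a primitive of b leaves a function with zero weak derivative. Its mollifications
  -- are constant, so it is constant almost everywhere, hence everywhere by continuity.
  set c : ℝ → ℝ := fun t => a t - B t with hc
  have hcc : Continuous c := ha.sub hBc
  have hw : IsWeakDerivAlong c (fun _ => (0 : ℝ)) (1 : ℝ) := by
    intro θ hθ hs
    have hθ' : Continuous (deriv θ) := hθ.continuous_deriv (by simp)
    have hs' : HasCompactSupport (deriv θ) := hs.deriv
    have i1 : Integrable fun t => deriv θ t * a t :=
      (hθ'.mul ha).integrable_of_hasCompactSupport hs'.mul_right
    have i2 : Integrable fun t => θ t * b t :=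
      (hθ.continuous.mul hb).integrable_of_hasCompactSupport hs.mul_right
    have i3 : Integrable fun t => deriv θ t * B t :=
      (hθ'.mul hBc).integrable_of_hasCompactSupport hs'.mul_right
    have i4 : Integrable fun t => θ t * B t :=
      (hθ.continuous.mul hBc).integrable_of_hasCompactSupport hs.mul_right
    have h1 := h θ hθ hs
    rw [integral_add i1 i2] at h1
    have h2 := integral_mul_deriv_eq_deriv_mul_of_integrable (u := θ) (v := B)
      (u' := deriv θ) (v' := b)
      (fun x _ => (hθ.differentiable (by simp) x).hasDerivAt) (fun x _ => hBd x) i2 i3 i4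
    have e : ∀ t, c t * fderiv ℝ θ t 1 = deriv θ t * a t - deriv θ t * B t := fun t => by
      rw [fderiv_apply_one_eq_deriv, hc]; ring
    simp only [e]
    rw [integral_sub i1 i3]
    simp only [zero_mul, integral_zero, neg_zero]
    linarith
  have hm : ∀ n, ∀ s t, moll n c s = moll n c t := by
    intro n s t
    refine is_const_of_fderiv_eq_zero (𝕜 := ℝ)
      ((contDiff_moll n hcc.locallyIntegrable).differentiable (by simp)) (fun x => ?_) s t
    ext
    rw [fderiv_moll n hcc.locallyIntegrable hw]
    simp [moll_const]
  have hae := ae_tendsto_moll hcc.locallyIntegrable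
  obtain ⟨t₀, ht₀⟩ := hae.exists
  have hconst : c =ᵐ[volume] fun _ => c t₀ := by
    filter_upwards [hae] with s hs
    refine tendsto_nhds_unique hs ?_
    simpa only [fun n => hm n t₀ s] using ht₀
  have hall := hcc.ae_eq_iff_eq volume continuous_const |>.1 hconst
  have ha' : a = fun t => B t + c t₀ := by
    ext t
    have := congrFun hall t
    simp only [hc] at this ⊢
    linarith
  rw [ha']
  exact (hBd t).add_const _

end OneDimensional

/-! ### Non-negative densities weakly continuous in time -/

section Densities

/-- Non-negative densities on space-time which depend continuously on time, weakly in space. -/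
structure IsContDensity (ρ : ℝ → Space → ℝ) : Prop where
  aesm : AEStronglyMeasurable fun z : ℝ × Space => ρ z.1 z.2
  nonneg : ∀ t x, 0 ≤ ρ t x
  integrable : ∀ t, Integrable (ρ t)
  continuous : ∀ w : Space → ℝ, Measurable w → (∃ B, ∀ x, |w x| ≤ B) →
    Continuous fun t => ∫ x, w x * ρ t x

namespace IsContDensity

variable {ρ σ : ℝ → Space → ℝ}

lemma continuous_mass (h : IsContDensity ρ) : Continuous fun t => ∫ x, ρ t x := by
  simpa using h.continuous (fun _ => 1) measurable_const ⟨1, by simp⟩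

lemma integrable_mul (h : IsContDensity ρ) {w : Space → ℝ} (hw : AEStronglyMeasurable w) {B : ℝ}
    (hB : ∀ x, |w x| ≤ B) (t : ℝ) : Integrable fun x => w x * ρ t x :=
  (h.integrable t).bdd_mul hw (Eventually.of_forall hB)

lemma add (h : IsContDensity ρ) (h' : IsContDensity σ) :
    IsContDensity fun t x => ρ t x + σ t x := by
  refine ⟨h.aesm.add h'.aesm, fun t x => add_nonneg (h.nonneg t x) (h'.nonneg t x),
    fun t => (h.integrable t).add (h'.integrable t), fun w hw ⟨B, hB⟩ => ?_⟩
  refine ((h.continuous w hw ⟨B, hB⟩).add (h'.continuous w hw ⟨B, hB⟩)).congr fun t => ?_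
  refine (integral_add (h.integrable_mul hw.aestronglyMeasurable hB t)
    (h'.integrable_mul hw.aestronglyMeasurable hB t)).symm.trans ?_
  simp only [mul_add]

lemma mul_fixed (h : IsContDensity ρ) {k : Space → ℝ} (hk : Measurable k) (h0 : ∀ x, 0 ≤ k x)
    {B : ℝ} (hB : ∀ x, k x ≤ B) : IsContDensity fun t x => k x * ρ t x := by
  have hB' : ∀ x, |k x| ≤ B := fun x => by rw [abs_of_nonneg (h0 x)]; exact hB x
  refine ⟨(hk.comp measurable_snd).aestronglyMeasurable.mul h.aesm,
    fun t x => mul_nonneg (h0 x) (h.nonneg t x),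
    fun t => h.integrable_mul hk.aestronglyMeasurable hB' t, fun w hw ⟨A, hA⟩ => ?_⟩
  refine (h.continuous (fun x => w x * k x) (hw.mul hk) ⟨A * B, fun x => ?_⟩).congr fun t => ?_
  · rw [abs_mul]
    exact mul_le_mul (hA x) (hB' x) (abs_nonneg _) ((abs_nonneg _).trans (hA x))
  · simp only [mul_assoc]

lemma const_mul (h : IsContDensity ρ) {c : ℝ} (hc : 0 ≤ c) :
    IsContDensity fun t x => c * ρ t x :=
  h.mul_fixed measurable_const (fun _ => hc) (fun _ => le_rfl)

lemma exists_mass_le (h : IsContDensity ρ) (s : ℝ) : ∃ M, 0 < M ∧ ∀ᶠ t in 𝓝 s, ∫ x, ρ t x ≤ M := by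
  refine ⟨|∫ x, ρ s x| + 1, by positivity, ?_⟩
  have hlt : ∫ x, ρ s x < |∫ x, ρ s x| + 1 := by linarith [le_abs_self (∫ x, ρ s x)]
  filter_upwards [(h.continuous_mass.tendsto s).eventually (Iio_mem_nhds hlt)] with t ht
    using le_of_lt ht

/-- Weights depending uniformly continuously on time. -/
lemma continuous_integral (h : IsContDensity ρ) {w : ℝ → Space → ℝ} (hw : ∀ t, Measurable (w t))
    (hb : ∀ t, ∃ B, ∀ x, |w t x| ≤ B)
    (hwc : ∀ s, ∀ ε > 0, ∀ᶠ t in 𝓝 s, ∀ x, |w t x - w s x| ≤ ε) :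
    Continuous fun t => ∫ x, w t x * ρ t x := by
  have hi : ∀ t s, Integrable fun x => w s x * ρ t x := fun t s => by
    obtain ⟨B, hB⟩ := hb s
    exact h.integrable_mul (hw s).aestronglyMeasurable hB t
  rw [continuous_iff_continuousAt]
  intro s
  have h1 := (h.continuous (w s) (hw s) (hb s)).continuousAt (x := s)
  have h2 : Tendsto (fun t => ∫ x, (w t x - w s x) * ρ t x) (𝓝 s) (𝓝 0) := by
    obtain ⟨M, hM, hMt⟩ := h.exists_mass_le s
    rw [Metric.tendsto_nhds]
    intro ε hε
    filter_upwards [hMt, hwc s (ε / (2 * M)) (by positivity)] with t ht1 ht2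
    rw [dist_zero_right]
    have h3 : ‖∫ x, (w t x - w s x) * ρ t x‖ ≤ ∫ x, ε / (2 * M) * ρ t x := by
      refine norm_integral_le_of_norm_le ((h.integrable t).const_mul _)
        (Eventually.of_forall fun x => ?_)
      rw [norm_mul, Real.norm_of_nonneg (h.nonneg t x)]
      exact mul_le_mul_of_nonneg_right (ht2 x) (h.nonneg t x)
    rw [integral_const_mul] at h3
    have h4 : ε / (2 * M) * ∫ x, ρ t x ≤ ε / (2 * M) * M :=
      mul_le_mul_of_nonneg_left ht1 (by positivity)
    have h5 : ε / (2 * M) * M = ε / 2 := by field_simp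
    linarith
  have h3 := h2.add h1
  rw [zero_add] at h3
  refine h3.congr fun t => ?_
  rw [← integral_add ((by simpa only [sub_mul] using! (hi t t).sub (hi t s))) (hi t s)]
  refine integral_congr_ae (Eventually.of_forall fun x => ?_)
  simp only
  ring

/-- Integrability on space-time slabs. -/
lemma integrable_prod (h : IsContDensity ρ) {k : ℝ × Space → ℝ} (hk : AEStronglyMeasurable k)
    {B T : ℝ} (hB : ∀ z, |k z| ≤ B) (hT : ∀ z, z.1 ∉ Set.Icc (-T) T → k z = 0) :
    Integrable fun z : ℝ × Space => k z * ρ z.1 z.2 := by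
  have hB0 : 0 ≤ B := (abs_nonneg _).trans (hB 0)
  have hbig : Integrable fun z : ℝ × Space =>
      (Set.Icc (-T) T).indicator (fun _ => B) z.1 * ρ z.1 z.2 := by
    have hm : AEStronglyMeasurable fun z : ℝ × Space =>
        (Set.Icc (-T) T).indicator (fun _ => B) z.1 * ρ z.1 z.2 :=
      ((measurable_const.indicator measurableSet_Icc).comp
        measurable_fst).aestronglyMeasurable.mul h.aesm
    refine (integrable_prod_iff hm).2 ⟨Eventually.of_forall fun t =>
      by simpa using! (h.integrable t).const_mul ((Set.Icc (-T) T).indicator (fun _ => B) t), ?_⟩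
    have e : (fun t => ∫ x, ‖(Set.Icc (-T) T).indicator (fun _ => B) t * ρ t x‖)
        = (Set.Icc (-T) T).indicator fun t => B * ∫ x, ρ t x := by
      ext t
      have : ∀ x, ‖(Set.Icc (-T) T).indicator (fun _ => B) t * ρ t x‖
          = (Set.Icc (-T) T).indicator (fun _ => B) t * ρ t x := fun x =>
        Real.norm_of_nonneg (mul_nonneg (Set.indicator_nonneg (fun _ _ => hB0) _) (h.nonneg t x))
      simp only [this, integral_const_mul]
      by_cases ht : t ∈ Set.Icc (-T) T <;> simp [ht]
    rw [e]
    exact (((continuous_const.mul h.continuous_mass).integrableOn_Icc).integrable_indicator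
      measurableSet_Icc)
  refine hbig.mono' (hk.mul h.aesm) (Eventually.of_forall fun z => ?_)
  rw [norm_mul, Real.norm_of_nonneg (h.nonneg _ _)]
  refine mul_le_mul_of_nonneg_right ?_ (h.nonneg _ _)
  by_cases hz : z.1 ∈ Set.Icc (-T) T
  · rw [Set.indicator_of_mem hz]; exact hB z
  · rw [Set.indicator_of_notMem hz, hT z hz, norm_zero]

end IsContDensity

lemma IsL2Curve.isContDensity {H : Type*} [NormedAddCommGroup H] [InnerProductSpace ℝ H]
    {f : ℝ → Space → H} (hf : IsL2Curve f)
    (hm : AEStronglyMeasurable fun z : ℝ × Space => f z.1 z.2) :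
    IsContDensity fun t x => ‖f t x‖ ^ 2 :=
  ⟨hm.norm.pow 2, fun _ _ => by positivity, fun t => (hf.memLp t).integrable_norm_pow two_ne_zero,
    fun _ hw ⟨_, hB⟩ => hf.continuous_integral_mul_norm_sq hw hB⟩

/-- Continuous curves in `L^q` of a finite set define continuous densities. -/
lemma isContDensity_indicator_rpow {f : ℝ → Space → ℝ} {q : ℝ} (hq : 1 ≤ q) (hq6 : q ≤ 6)
    (hm : AEStronglyMeasurable fun z : ℝ × Space => f z.1 z.2) (hf : ∀ t, MemLp (f t) 6 volume)
    (ht : ∀ s, Tendsto (fun t => eLpNorm (f t - f s) 6 volume) (𝓝 s) (𝓝 0))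
    {S : Set Space} (hS : MeasurableSet S) (hSf : volume S ≠ ⊤) :
    IsContDensity fun t x => S.indicator (fun _ => 1) x * |f t x| ^ q := by
  have hq0 : 0 < q := by linarith
  set Q : ℝ≥0∞ := ENNReal.ofReal q with hQ
  have hQ0 : Q ≠ 0 := by simpa [hQ] using hq0
  have hQt : Q ≠ ⊤ := ENNReal.ofReal_ne_top
  have hQr : Q.toReal = q := ENNReal.toReal_ofReal hq0.le
  have hQ1 : Fact (1 ≤ Q) := ⟨by rw [hQ, ← ENNReal.ofReal_one]; exact ENNReal.ofReal_le_ofReal hq⟩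
  have hQ6 : Q ≤ 6 := by
    have : (6 : ℝ≥0∞) = ENNReal.ofReal 6 := by simp
    rw [hQ, this]; exact ENNReal.ofReal_le_ofReal hq6
  have hfin : IsFiniteMeasure (volume.restrict S) := ⟨by simpa using hSf.lt_top⟩
  have hQm : ∀ t, MemLp (f t) Q (volume.restrict S) := fun t =>
    ((hf t).restrict S).mono_exponent hQ6
  have hQc : ∀ s, Tendsto (fun t => eLpNorm (f t - f s) Q (volume.restrict S)) (𝓝 s) (𝓝 0) := by
    intro s
    have h1 := ENNReal.Tendsto.mul_const (b := (volume.restrict S) Set.univ ^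
      (1 / Q.toReal - 1 / (6 : ℝ≥0∞).toReal)) (ht s)
      (Or.inr (ENNReal.rpow_ne_top_of_nonneg (by
        rw [hQr, sub_nonneg]
        simpa using inv_anti₀ hq0 hq6) (measure_ne_top _ _)))
    rw [zero_mul] at h1
    refine tendsto_of_tendsto_of_tendsto_of_le_of_le tendsto_const_nhds h1 (fun _ => zero_le) fun t => ?_
    refine (eLpNorm_le_eLpNorm_mul_rpow_measure_univ hQ6
      ((hf t).1.sub (hf s).1).restrict).trans ?_
    exact mul_le_mul_left (eLpNorm_mono_measure _ Measure.restrict_le_self) _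
  have hint : ∀ t, IntegrableOn (fun x => |f t x| ^ q) S := fun t => by
    have := (hQm t).integrable_norm_rpow hQ0 hQt
    rwa [hQr] at this
  -- A non-negative weight is absorbed as w^{1/q}f; the integral becomes the q-th power of the norm
  -- of a continuous curve in L^q.
  have hpos : ∀ w : Space → ℝ, Measurable w → (∃ B, ∀ x, |w x| ≤ B) → (∀ x, 0 ≤ w x) →
      Continuous fun t => ∫ x in S, w x * |f t x| ^ q := by
    rintro w hw ⟨B, hB⟩ h0
    have hw' : Measurable fun x => w x ^ (1 / q) := hw.pow_const _
    have hB' : ∀ x, |w x ^ (1 / q)| ≤ B ^ (1 / q) := fun x => by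
      rw [abs_of_nonneg (Real.rpow_nonneg (h0 x) _)]
      exact Real.rpow_le_rpow (h0 x) ((le_abs_self _).trans (hB x)) (by positivity)
    have hkm : ∀ t, MemLp (fun x => w x ^ (1 / q) * f t x) Q (volume.restrict S) := fun t =>
      (hQm t).of_le_mul (c := B ^ (1 / q)) (hw'.aestronglyMeasurable.mul (hQm t).1)
        (Eventually.of_forall fun x => by
          rw [norm_mul]; exact mul_le_mul_of_nonneg_right (hB' x) (norm_nonneg _))
    have hkc : Continuous fun t => (hkm t).toLp (fun x => w x ^ (1 / q) * f t x) := by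
      refine continuous_iff_continuousAt.2 fun s =>
        (Lp.tendsto_Lp_iff_tendsto_eLpNorm'' _ hkm _ (hkm s)).2 ?_
      have h2 := ENNReal.Tendsto.const_mul (a := ENNReal.ofReal (B ^ (1 / q))) (hQc s)
        (Or.inr ENNReal.ofReal_ne_top)
      rw [mul_zero] at h2
      refine tendsto_of_tendsto_of_tendsto_of_le_of_le tendsto_const_nhds h2 (fun _ => zero_le) ?_
      refine fun t => eLpNorm_le_mul_eLpNorm_of_ae_le_mul (Eventually.of_forall fun x => ?_) Q
      simp only [Pi.sub_apply, ← mul_sub, norm_mul]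
      exact mul_le_mul_of_nonneg_right (hB' x) (norm_nonneg _)
    refine (hkc.norm.rpow_const (p := q) fun _ => Or.inr hq0.le).congr fun t => ?_
    rw [Lp.norm_toLp, (hkm t).eLpNorm_eq_integral_rpow_norm hQ0 hQt, ENNReal.toReal_ofReal
      (by positivity), hQr, ← Real.rpow_mul (integral_nonneg fun x => by positivity),
      inv_mul_cancel₀ hq0.ne', Real.rpow_one]
    refine integral_congr_ae (Eventually.of_forall fun x => ?_)
    simp only [norm_mul]
    rw [Real.mul_rpow (norm_nonneg _) (norm_nonneg _),
      Real.norm_of_nonneg (Real.rpow_nonneg (h0 x) _), ← Real.rpow_mul (h0 x),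
      one_div, inv_mul_cancel₀ hq0.ne', Real.rpow_one]
    rfl
  have hmeas : Measurable (S.indicator fun _ => (1 : ℝ)) := measurable_const.indicator hS
  have hconv : ∀ (w : Space → ℝ) t, ∫ x, w x * (S.indicator (fun _ => 1) x * |f t x| ^ q)
      = ∫ x in S, w x * |f t x| ^ q := by
    intro w t
    rw [← integral_indicator hS]
    refine integral_congr_ae (Eventually.of_forall fun x => ?_)
    by_cases hx : x ∈ S <;> simp [hx]
  refine ⟨(hmeas.comp measurable_snd).aestronglyMeasurable.mul ?_, fun t x => ?_, fun t => ?_,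
    fun w hw ⟨B, hB⟩ => ?_⟩
  · have hc : Continuous fun s : ℝ => |s| ^ q := continuous_abs.rpow_const fun _ => Or.inr hq0.le
    exact hc.comp_aestronglyMeasurable hm
  · exact mul_nonneg (Set.indicator_nonneg (fun _ _ => zero_le_one) _)
      (Real.rpow_nonneg (abs_nonneg _) _)
  · refine ((hint t).integrable_indicator hS).congr (Eventually.of_forall fun x => ?_)
    by_cases hx : x ∈ S <;> simp [hx]
  · simp only [hconv]
    -- Signed weights are split into positive and negative parts.
    have h1 := hpos (fun x => max (w x) 0) (hw.max measurable_const) ⟨B, fun x => by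
      rw [abs_of_nonneg (le_max_right _ _)]
      exact max_le ((le_abs_self _).trans (hB x)) ((abs_nonneg _).trans (hB x))⟩
      fun x => le_max_right _ _
    have h2 := hpos (fun x => max (-w x) 0) (hw.neg.max measurable_const) ⟨B, fun x => by
      rw [abs_of_nonneg (le_max_right _ _)]
      exact max_le ((neg_le_abs _).trans (hB x)) ((abs_nonneg _).trans (hB x))⟩
      fun x => le_max_right _ _
    refine (h1.sub h2).congr fun t => ?_
    have hi : ∀ k : Space → ℝ, Measurable k → (∀ x, |k x| ≤ B) →
        Integrable (fun x => k x * |f t x| ^ q) (volume.restrict S) := fun k hk hkB =>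
      (hint t).bdd_mul hk.aestronglyMeasurable (Eventually.of_forall hkB)
    refine (integral_sub (hi (fun x => max (w x) 0) (hw.max measurable_const) fun x => by
        rw [abs_of_nonneg (le_max_right _ _)]
        exact max_le ((le_abs_self _).trans (hB x)) ((abs_nonneg _).trans (hB x)))
      (hi (fun x => max (-w x) 0) (hw.neg.max measurable_const) fun x => by
        rw [abs_of_nonneg (le_max_right _ _)]
        exact max_le ((neg_le_abs _).trans (hB x)) ((abs_nonneg _).trans (hB x)))).symm.trans ?_
    refine integral_congr_ae (Eventually.of_forall fun x => ?_)
    simp only [← sub_mul]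
    congr 1
    rcases le_total 0 (w x) with h | h
    · rw [max_eq_left h, max_eq_right (by linarith)]; ring
    · rw [max_eq_right h, max_eq_left (by linarith)]; ring

end Densities

end DefocusingWave

namespace DefocusingWave

/-! ### Conservation of energy and continuity of the potential energy -/

section EnergyConservation

/-- A density exhausted by continuous densities on balls is continuous if its mass is. -/
lemma IsContDensity.of_exhaustion {ρ : ℝ → Space → ℝ}
    (hm : AEStronglyMeasurable fun z : ℝ × Space => ρ z.1 z.2) (h0 : ∀ t x, 0 ≤ ρ t x)
    (hi : ∀ t, Integrable (ρ t)) (hc : Continuous fun t => ∫ x, ρ t x)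
    (hloc : ∀ n : ℕ, IsContDensity fun t x =>
      (Metric.closedBall (0 : Space) n).indicator (fun _ => 1) x * ρ t x) : IsContDensity ρ := by
  refine ⟨hm, h0, hi, fun w hw ⟨B, hB⟩ => continuous_iff_continuousAt.2 fun s => ?_⟩
  have hB0 : 0 ≤ B := (abs_nonneg _).trans (hB 0)
  refine continuousAt_of_locally_uniform_approx_of_continuousAt fun U hU => ?_
  obtain ⟨ε, hε, hεU⟩ := Metric.mem_uniformity_dist.1 hU
  set χ : ℕ → Space → ℝ := fun n => (Metric.closedBall (0 : Space) n).indicator fun _ => 1 with hχ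
  have hχ1 : ∀ n x, 0 ≤ χ n x ∧ χ n x ≤ 1 := fun n x => by
    by_cases hx : x ∈ Metric.closedBall (0 : Space) n <;> simp [hχ, hx]
  have hχm : ∀ n, Measurable (χ n) := fun n =>
    measurable_const.indicator Metric.isClosed_closedBall.measurableSet
  have hχi : ∀ n t, Integrable fun x => χ n x * ρ t x := fun n t => (hloc n).integrable t
  have htail : Tendsto (fun n => (∫ x, ρ s x) - ∫ x, χ n x * ρ s x) atTop (𝓝 0) := by
    have h1 : Tendsto (fun n => ∫ x, χ n x * ρ s x) atTop (𝓝 (∫ x, ρ s x)) := by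
      refine tendsto_integral_of_dominated_convergence (ρ s) (fun n => (hχi n s).1) (hi s)
        (fun n => Eventually.of_forall fun x => ?_) (Eventually.of_forall fun x => ?_)
      · rw [norm_mul, Real.norm_of_nonneg (hχ1 n x).1, Real.norm_of_nonneg (h0 s x)]
        exact mul_le_of_le_one_left (h0 s x) (hχ1 n x).2
      · obtain ⟨N, hN⟩ := exists_nat_ge ‖x‖
        refine tendsto_const_nhds.congr' ?_
        filter_upwards [eventually_ge_atTop N] with n hn
        have : x ∈ Metric.closedBall (0 : Space) n := by
          rw [mem_closedBall_zero_iff]; exact hN.trans (by exact_mod_cast hn)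
        simp [hχ, this]
    simpa using (tendsto_const_nhds (x := ∫ x, ρ s x)).sub h1
  have hB1 : 0 < ε / (B + 1) := by positivity
  obtain ⟨n, hn⟩ := (htail.eventually (Iio_mem_nhds hB1)).exists
  -- The mass outside the ball is a difference of continuous functions of time. Smallness at time s
  -- therefore persists nearby, which gives a locally uniform approximation.
  have hcn : Continuous fun t => (∫ x, ρ t x) - ∫ x, χ n x * ρ t x :=
    hc.sub (hloc n).continuous_mass
  refine ⟨_, (hcn.tendsto s).eventually (Iio_mem_nhds hn), fun t => ∫ x, w x * (χ n x * ρ t x),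
    ((hloc n).continuous w hw ⟨B, hB⟩).continuousAt, fun t ht => hεU ?_⟩
  have hlt : (∫ x, ρ t x) - ∫ x, χ n x * ρ t x < ε / (B + 1) := ht
  have hwi : Integrable fun x => w x * ρ t x :=
    (hi t).bdd_mul hw.aestronglyMeasurable (Eventually.of_forall hB)
  have hwi' : Integrable fun x => w x * (χ n x * ρ t x) :=
    (hχi n t).bdd_mul hw.aestronglyMeasurable (Eventually.of_forall hB)
  rw [Real.dist_eq, ← integral_sub hwi hwi']
  have hle : ‖∫ x, (w x * ρ t x - w x * (χ n x * ρ t x))‖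
      ≤ ∫ x, B * (ρ t x - χ n x * ρ t x) := by
    refine norm_integral_le_of_norm_le (((hi t).sub (hχi n t)).const_mul B)
      (Eventually.of_forall fun x => ?_)
    rw [← mul_sub, norm_mul, Real.norm_of_nonneg (r := ρ t x - χ n x * ρ t x)
      (sub_nonneg.2 (mul_le_of_le_one_left (h0 t x) (hχ1 n x).2))]
    exact mul_le_mul_of_nonneg_right (hB x)
      (sub_nonneg.2 (mul_le_of_le_one_left (h0 t x) (hχ1 n x).2))
  rw [integral_const_mul, integral_sub (hi t) (hχi n t)] at hle
  refine hle.trans_lt ?_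
  calc B * ((∫ x, ρ t x) - ∫ x, χ n x * ρ t x) ≤ B * (ε / (B + 1)) :=
        mul_le_mul_of_nonneg_left hlt.le hB0
    _ < ε := by
        rw [mul_div_assoc', div_lt_iff₀ (by linarith)]
        nlinarith

namespace IsFiniteEnergySolution

variable {p : ℝ} {u v : ℝ → Space → ℝ} {g : ℝ → Space → Space}

lemma density_v (h : IsFiniteEnergySolution p u v g) : IsContDensity fun t x => ‖v t x‖ ^ 2 :=
  h.curve_v.isContDensity h.aestronglyMeasurable_v

lemma density_g (h : IsFiniteEnergySolution p u v g) : IsContDensity fun t x => ‖g t x‖ ^ 2 :=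
  h.curve_g.isContDensity h.aestronglyMeasurable_g

/-- On a bounded set L⁶ controls L^{p+1} because p + 1 < 6, so continuity in L⁶ suffices. Globally
L^{p+1} is not controlled this way, which is why conservation of energy is needed below. -/
lemma density_potential_ball (h : IsFiniteEnergySolution p u v g) (hp : 3 ≤ p) (hp' : p < 5)
    (R : ℝ) : IsContDensity fun t x =>
      (Metric.closedBall (0 : Space) R).indicator (fun _ => 1) x * |u t x| ^ (p + 1) :=
  isContDensity_indicator_rpow (by linarith) (by linarith) h.aestronglyMeasurable_u
    (fun t => (h.memEnergySpace t).memLp_six) h.tendsto_six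
    Metric.isClosed_closedBall.measurableSet measure_closedBall_lt_top.ne

/-- The energy density. -/
noncomputable def energyDensity (p : ℝ) (u v : ℝ → Space → ℝ) (g : ℝ → Space → Space) (t : ℝ)
    (x : Space) : ℝ :=
  1 / 2 * ‖g t x‖ ^ 2 + 1 / 2 * |v t x| ^ 2 + 1 / (p + 1) * |u t x| ^ (p + 1)

lemma density_energy_ball (h : IsFiniteEnergySolution p u v g) (hp : 3 ≤ p) (hp' : p < 5)
    (R : ℝ) : IsContDensity fun t x =>
      (Metric.closedBall (0 : Space) R).indicator (fun _ => 1) x * energyDensity p u v g t x := by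
  have hS : MeasurableSet (Metric.closedBall (0 : Space) R) :=
    Metric.isClosed_closedBall.measurableSet
  have hχm : Measurable ((Metric.closedBall (0 : Space) R).indicator fun _ => (1 : ℝ)) :=
    measurable_const.indicator hS
  have h0 : ∀ x, 0 ≤ (Metric.closedBall (0 : Space) R).indicator (fun _ => (1 : ℝ)) x := fun x =>
    Set.indicator_nonneg (fun _ _ => zero_le_one) _
  have h1 : ∀ x, (Metric.closedBall (0 : Space) R).indicator (fun _ => (1 : ℝ)) x ≤ 1 := fun x =>
    Set.indicator_apply_le' (fun _ => le_rfl) fun _ => zero_le_one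
  have key := (((h.density_g.const_mul (c := 1 / 2) (by norm_num)).mul_fixed hχm h0 h1).add
    ((h.density_v.const_mul (c := 1 / 2) (by norm_num)).mul_fixed hχm h0 h1)).add
    ((h.density_potential_ball hp hp' R).const_mul (c := 1 / (p + 1))
      (by have : 0 < p + 1 := by linarith
          positivity))
  convert key using 3 with t x
  simp only [energyDensity, Real.norm_eq_abs]
  ring

/-- The local energy is differentiable in time. -/
lemma hasDerivAt_cutoff_energy (h : IsFiniteEnergySolution p u v g) (hp : 3 ≤ p) (hp' : p < 5)
    (n : ℕ) (t : ℝ) : HasDerivAt (fun t => ∫ x, spaceCutoff n x * energyDensity p u v g t x)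
      (-∫ x, (inner ℝ (v t x) (fderiv ℝ (spaceCutoff n) x (g t x)) : ℝ)) t := by
  obtain ⟨C, hC0, hC⟩ := exists_fderiv_spaceCutoff_bound
  set χ := spaceCutoff n with hχ
  have hχs : ContDiff ℝ ∞ χ := contDiff_spaceCutoff n
  have hχb : ∀ x, |χ x| ≤ 1 := fun x => by
    rw [abs_of_nonneg (spaceCutoff_nonneg n x)]; exact spaceCutoff_le_one n x
  have hD : ∀ x, ‖fderiv ℝ χ x‖ ≤ C := fun x => (hC n x).trans (by
    rw [div_le_iff₀ (by positivity)]
    nlinarith [Nat.cast_nonneg (α := ℝ) n])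
  have hDc : Continuous (fderiv ℝ χ) := hχs.continuous_fderiv (by simp)
  set S : Set Space := Metric.closedBall (0 : Space) (2 * ((n : ℝ) + 1)) with hS
  have hDS : IsContDensity fun t x => S.indicator (fun _ => 1) x * energyDensity p u v g t x :=
    h.density_energy_ball hp hp' (2 * ((n : ℝ) + 1))
  have eS : ∀ t x, χ x * (S.indicator (fun _ => 1) x * energyDensity p u v g t x)
      = χ x * energyDensity p u v g t x := by
    intro t x
    by_cases hx : x ∈ S
    · rw [Set.indicator_of_mem hx, one_mul]
    · rw [mem_closedBall_zero_iff, not_le] at hx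
      rw [hχ, spaceCutoff_eq_zero hx.le, zero_mul, zero_mul]
  have hac : Continuous fun t => ∫ x, χ x * energyDensity p u v g t x := by
    have := hDS.continuous χ hχs.continuous.measurable ⟨1, hχb⟩
    simpa only [eS] using this
  set k : ℝ → Space → ℝ := fun t x => fderiv ℝ χ x (g t x) with hk
  have happ : Continuous fun q : (Space →L[ℝ] ℝ) × Space => q.1 q.2 := by fun_prop
  have hkm : AEStronglyMeasurable fun z : ℝ × Space => k z.1 z.2 :=
    happ.comp_aestronglyMeasurable
      ((hDc.comp continuous_snd).aestronglyMeasurable.prodMk h.aestronglyMeasurable_g)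
  have hkc : IsL2Curve k := h.curve_g.of_bound (C := C)
    (fun t => happ.comp_aestronglyMeasurable
      (hDc.aestronglyMeasurable.prodMk (h.curve_g.memLp t).1))
    (fun t x => (fderiv ℝ χ x).le_of_opNorm_le (hD x) _)
    (fun t s x => by
      simp only [hk]
      rw [← map_sub]; exact (fderiv ℝ χ x).le_of_opNorm_le (hD x) _)
  have hbc := h.curve_v.continuous_integral_inner hkc
  refine hasDerivAt_of_integral_test hac hbc.neg (fun θ hθ hs => ?_) t
  -- Product test functions turn the space-time balance law into a weak derivative in time, which
  -- `hasDerivAt_of_integral_test` upgrades.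
  set ψ : ℝ × Space → ℝ := fun z => θ z.1 * χ z.2 with hψ
  have hψs : ContDiff ℝ ∞ ψ := (hθ.comp contDiff_fst).mul (hχs.comp contDiff_snd)
  have hψc : HasCompactSupport ψ := by
    refine HasCompactSupport.intro (hs.isCompact.prod (hasCompactSupport_spaceCutoff n).isCompact)
      fun z hz => ?_
    by_contra hne
    exact hz ⟨subset_tsupport _ (left_ne_zero_of_mul hne), subset_tsupport _ (right_ne_zero_of_mul hne)⟩
  have hθd : Differentiable ℝ θ := hθ.differentiable (by simp)
  have hχd : Differentiable ℝ χ := hχs.differentiable (by simp)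
  have hT : ∀ z : ℝ × Space, timeDer ψ z = deriv θ z.1 * χ z.2 := fun z => by
    rw [timeDer, ← fderiv_slice_time (hψs.differentiable (by simp))]
    exact ((hθd z.1).hasDerivAt.mul_const (χ z.2)).deriv
  have hG : ∀ (z : ℝ × Space) (w : Space), inner ℝ (spaceGrad ψ z) w
      = θ z.1 * fderiv ℝ χ z.2 w := fun z w => by
    have e : ∀ i, fderiv ℝ ψ z (spaceVec i) = θ z.1 * fderiv ℝ χ z.2 (basisVec i) := fun i => by
      rw [spaceVec, ← fderiv_slice_space (hψs.differentiable (by simp))]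
      have := ((hχd z.2).hasFDerivAt.const_mul (θ z.1)).fderiv
      refine (congrArg (fun T : Space →L[ℝ] ℝ => T (basisVec i)) this).trans ?_
      simp
    conv_rhs => rw [← sum_apply_smul_basisVec w]
    rw [PiLp.inner_apply, map_sum, Finset.mul_sum]
    refine Finset.sum_congr rfl fun i _ => ?_
    simp only [spaceGrad, e, map_smul, smul_eq_mul]
    simp
    ring
  have hbal := (h.isWeakWave hp hp').energy_balance (by linarith) hψs hψc
  obtain ⟨T, hTs⟩ := hs.isCompact.isBounded.subset_closedBall 0
  have hθ' : Continuous (deriv θ) := hθ.continuous_deriv (by simp)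
  obtain ⟨B₁, hB1⟩ := hs.exists_bound_of_continuous hθ.continuous
  obtain ⟨B₂, hB2⟩ := hs.deriv.exists_bound_of_continuous hθ'
  have hTz : ∀ t, t ∉ Set.Icc (-T) T → θ t = 0 ∧ deriv θ t = 0 := fun t ht => by
    have hn : t ∉ tsupport θ := fun hm => ht (by
      have := hTs hm
      rwa [Real.closedBall_eq_Icc, zero_sub, zero_add] at this)
    exact ⟨image_eq_zero_of_notMem_tsupport hn,
      image_eq_zero_of_notMem_tsupport fun hm => hn (tsupport_deriv_subset (𝕜 := ℝ) hm)⟩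
  have i1 : Integrable fun z : ℝ × Space => deriv θ z.1 * χ z.2
      * (S.indicator (fun _ => 1) z.2 * energyDensity p u v g z.1 z.2) :=
    hDS.integrable_prod (k := fun z => deriv θ z.1 * χ z.2) (B := B₂ * 1) (T := T)
      ((hθ'.comp continuous_fst).mul (hχs.continuous.comp continuous_snd)).aestronglyMeasurable
      (fun z => by
        rw [abs_mul]
        exact mul_le_mul (hB2 _) (hχb _) (abs_nonneg _) ((norm_nonneg _).trans (hB2 0)))
      (fun z hz => by rw [(hTz _ hz).2, zero_mul])
  have iθ : ∀ {ρ : ℝ → Space → ℝ}, IsContDensity ρ → Integrable fun z : ℝ × Space =>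
      |θ z.1| * ρ z.1 z.2 := fun hρ =>
    hρ.integrable_prod (k := fun z => |θ z.1|) (B := B₁) (T := T)
      (hθ.continuous.comp continuous_fst).abs.aestronglyMeasurable
      (fun z => by rw [abs_abs]; exact hB1 _) (fun z hz => by rw [(hTz _ hz).1, abs_zero])
  have i2 : Integrable fun z : ℝ × Space => θ z.1 * inner ℝ (v z.1 z.2) (k z.1 z.2) := by
    refine ((iθ h.density_v).add (iθ (hkc.isContDensity hkm))).mono'
      ((hθ.continuous.comp continuous_fst).aestronglyMeasurable.mul
        (h.aestronglyMeasurable_v.inner (𝕜 := ℝ) hkm)) (Eventually.of_forall fun z => ?_)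
    rw [norm_mul]
    refine (mul_le_mul_of_nonneg_left (norm_inner_le_norm _ _) (norm_nonneg _)).trans ?_
    simp only [Pi.add_apply, ← mul_add, Real.norm_eq_abs (θ z.1)]
    refine mul_le_mul_of_nonneg_left ?_ (abs_nonneg _)
    nlinarith [sq_nonneg (‖v z.1 z.2‖ - ‖k z.1 z.2‖), sq_nonneg (‖v z.1 z.2‖ + ‖k z.1 z.2‖)]
  have e1 : ∫ z : ℝ × Space, (deriv θ z.1 * χ z.2
      * (S.indicator (fun _ => 1) z.2 * energyDensity p u v g z.1 z.2)
        - θ z.1 * inner ℝ (v z.1 z.2) (k z.1 z.2)) = 0 := by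
    rw [← hbal]
    refine integral_congr_ae (Eventually.of_forall fun z => ?_)
    simp only [hT, hG]
    rw [mul_assoc, eS]
    simp only [energyDensity, sq_abs, hk]
    have : inner ℝ (v z.1 z.2) (fderiv ℝ χ z.2 (g z.1 z.2))
        = v z.1 z.2 * fderiv ℝ χ z.2 (g z.1 z.2) := by simp [mul_comm]
    rw [this]
    ring
  rw [← e1]
  refine ((integral_prod _ (i1.sub i2)).trans ?_).symm
  refine integral_congr_ae (Eventually.of_forall fun t => ?_)
  have j1 : Integrable fun x => deriv θ t * (χ x * energyDensity p u v g t x) := by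
    have := (hDS.integrable_mul hχs.continuous.aestronglyMeasurable hχb t).const_mul (deriv θ t)
    simpa only [eS] using this
  have j2 : Integrable fun x => θ t * inner ℝ (v t x) (k t x) :=
    Integrable.const_mul (by simpa [mul_comm] using! (h.curve_v.memLp t).integrable_mul (hkc.memLp t)) _
  have j3 := integral_sub j1 j2
  rw [integral_const_mul, integral_const_mul] at j3
  simp only [Pi.neg_apply, mul_neg]
  rw [← sub_eq_add_neg]
  refine Eq.trans ?_ j3
  refine integral_congr_ae (Eventually.of_forall fun x => ?_)
  simp only [Pi.sub_apply, mul_assoc, eS]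

lemma aestronglyMeasurable_energyDensity (h : IsFiniteEnergySolution p u v g) (hp : 3 ≤ p) (t : ℝ) :
    AEStronglyMeasurable (energyDensity p u v g t) := by
  have hc : Continuous fun s : ℝ => |s| ^ (p + 1) :=
    continuous_abs.rpow_const fun _ => Or.inr (by linarith)
  have h1 := (h.memEnergySpace t).memLp_six.1
  have h2 := (h.memEnergySpace t).memLp_velocity.1
  have h3 := (h.memEnergySpace t).memLp_grad.1
  exact (((h3.norm.pow 2).const_mul _).add ((h2.norm.pow 2).const_mul _)).add
    ((hc.comp_aestronglyMeasurable h1).const_mul _)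

lemma energyDensity_nonneg (hp : 3 ≤ p) (t : ℝ) (x : Space) : 0 ≤ energyDensity p u v g t x := by
  have : 0 < p + 1 := by linarith
  unfold energyDensity
  positivity

/-- Conservation of energy. -/
lemma energy_conservation (h : IsFiniteEnergySolution p u v g) (hp : 3 ≤ p) (hp' : p < 5) (t : ℝ) :
    Integrable (energyDensity p u v g t) ∧
      ∫ x, energyDensity p u v g t x = ∫ x, energyDensity p u v g 0 x := by
  set e := energyDensity p u v g with he
  have hem := h.aestronglyMeasurable_energyDensity hp
  have he0 : ∀ t x, 0 ≤ e t x := fun t x => energyDensity_nonneg hp t x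
  have hint0 : Integrable (e 0) := by
    refine ⟨hem 0, ?_⟩
    rw [hasFiniteIntegral_iff_ofReal (Eventually.of_forall (he0 0))]
    exact h.energy_lt_top
  have hχ : ∀ n x, 0 ≤ spaceCutoff n x ∧ spaceCutoff n x ≤ 1 := fun n x =>
    ⟨spaceCutoff_nonneg n x, spaceCutoff_le_one n x⟩
  have hlim : ∀ t, Integrable (e t) →
      Tendsto (fun n => ∫ x, spaceCutoff n x * e t x) atTop (𝓝 (∫ x, e t x)) := by
    intro t hi
    refine tendsto_integral_of_dominated_convergence (e t)
      (fun n => (contDiff_spaceCutoff n).continuous.aestronglyMeasurable.mul (hem t)) hi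
      (fun n => Eventually.of_forall fun x => ?_) (Eventually.of_forall fun x => ?_)
    · rw [norm_mul, Real.norm_of_nonneg (hχ n x).1, Real.norm_of_nonneg (he0 t x)]
      exact mul_le_of_le_one_left (he0 t x) (hχ n x).2
    · simpa using (tendsto_spaceCutoff x).mul_const (e t x)
  obtain ⟨C, hC0, hC⟩ := exists_fderiv_spaceCutoff_bound
  set M : ℝ → ℝ := fun t => (∫ x, ‖v t x‖ ^ 2) + ∫ x, ‖g t x‖ ^ 2 with hM
  have hMc : Continuous M := h.density_v.continuous_mass.add h.density_g.continuous_mass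
  obtain ⟨K, hK⟩ := (isCompact_uIcc (a := (0 : ℝ)) (b := t)).exists_bound_of_continuousOn
    hMc.continuousOn
  -- The flux through the cutoff is at most the cutoff gradient, O(1/(n+1)), times a bound on ‖v‖² +
  -- ‖g‖² over the time interval, so it vanishes in the limit.
  have hdiff : ∀ n : ℕ, |(∫ x, spaceCutoff n x * e t x) - ∫ x, spaceCutoff n x * e 0 x|
      ≤ C / ((n : ℝ) + 1) * K * |t - 0| := by
    intro n
    rw [← Real.norm_eq_abs, ← Real.norm_eq_abs]
    refine Convex.norm_image_sub_le_of_norm_hasDerivWithin_le (s := Set.uIcc 0 t)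
      (f := fun t => ∫ x, spaceCutoff n x * e t x) (fun s _ =>
        (h.hasDerivAt_cutoff_energy hp hp' n s).hasDerivWithinAt) (fun s hs => ?_)
      (convex_uIcc _ _) Set.left_mem_uIcc Set.right_mem_uIcc
    rw [norm_neg]
    have hCn : 0 ≤ C / ((n : ℝ) + 1) := by positivity
    have hiv := (h.density_v.integrable s)
    have hig := (h.density_g.integrable s)
    have h1 : ‖∫ x, (inner ℝ (v s x) (fderiv ℝ (spaceCutoff n) x (g s x)) : ℝ)‖
        ≤ ∫ x, C / ((n : ℝ) + 1) * (‖v s x‖ ^ 2 + ‖g s x‖ ^ 2) := by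
      refine norm_integral_le_of_norm_le ((hiv.add hig).const_mul _)
        (Eventually.of_forall fun x => ?_)
      refine (norm_inner_le_norm _ _).trans ?_
      have h2 : ‖fderiv ℝ (spaceCutoff n) x (g s x)‖ ≤ C / ((n : ℝ) + 1) * ‖g s x‖ :=
        (fderiv ℝ (spaceCutoff n) x).le_of_opNorm_le (hC n x) _
      refine (mul_le_mul_of_nonneg_left h2 (norm_nonneg _)).trans ?_
      nlinarith [mul_nonneg hCn (sq_nonneg (‖v s x‖ - ‖g s x‖)),
        mul_nonneg hCn (sq_nonneg (‖v s x‖ + ‖g s x‖))]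
    rw [integral_const_mul, integral_add hiv hig] at h1
    refine h1.trans (mul_le_mul_of_nonneg_left ?_ hCn)
    exact (le_abs_self _).trans (hK s hs)
  have hz : Tendsto (fun n : ℕ => C / ((n : ℝ) + 1) * K * |t - 0|) atTop (𝓝 0) := by
    have h1 : Tendsto (fun n : ℕ => C / ((n : ℝ) + 1)) atTop (𝓝 0) := by
      have := (tendsto_one_div_add_atTop_nhds_zero_nat (𝕜 := ℝ)).const_mul C
      simpa [div_eq_mul_inv] using this
    simpa using (h1.mul_const K).mul_const |t - 0|
  have hconv : Tendsto (fun n => ∫ x, spaceCutoff n x * e t x) atTop (𝓝 (∫ x, e 0 x)) := by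
    have h1 : Tendsto (fun n => (∫ x, spaceCutoff n x * e t x) - ∫ x, spaceCutoff n x * e 0 x)
        atTop (𝓝 0) := squeeze_zero_norm hdiff hz
    simpa using h1.add (hlim 0 hint0)
  have hcut : ∀ n, Integrable fun x => spaceCutoff n x * e t x := fun n => by
    have hDS := h.density_energy_ball hp hp' (2 * ((n : ℝ) + 1))
    have := hDS.integrable_mul (contDiff_spaceCutoff n).continuous.aestronglyMeasurable (B := 1)
      (fun x => by rw [abs_of_nonneg (hχ n x).1]; exact (hχ n x).2) t
    refine this.congr (Eventually.of_forall fun x => ?_)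
    simp only
    by_cases hx : x ∈ Metric.closedBall (0 : Space) (2 * ((n : ℝ) + 1))
    · rw [Set.indicator_of_mem hx, one_mul]
    · rw [mem_closedBall_zero_iff, not_le] at hx
      rw [spaceCutoff_eq_zero hx.le, zero_mul, zero_mul]
  -- Finiteness at time t is not assumed: Fatou gives it from the convergence of the cutoff energies
  -- to the initial energy.
  have hint : Integrable (e t) := by
    refine ⟨hem t, ?_⟩
    rw [hasFiniteIntegral_iff_ofReal (Eventually.of_forall (he0 t))]
    have h1 : ∀ x, ENNReal.ofReal (e t x)
        = liminf (fun n => ENNReal.ofReal (spaceCutoff n x * e t x)) atTop := fun x => by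
      have := (ENNReal.continuous_ofReal.tendsto _).comp ((tendsto_spaceCutoff x).mul_const (e t x))
      rw [one_mul] at this
      exact this.liminf_eq.symm
    simp only [h1]
    refine (lintegral_liminf_le' fun n => (hcut n).1.aemeasurable.ennreal_ofReal).trans_lt ?_
    have h2 : ∀ n, ∫⁻ x, ENNReal.ofReal (spaceCutoff n x * e t x)
        = ENNReal.ofReal (∫ x, spaceCutoff n x * e t x) := fun n =>
      (ofReal_integral_eq_lintegral_ofReal (hcut n)
        (Eventually.of_forall fun x => mul_nonneg (hχ n x).1 (he0 t x))).symm
    simp only [h2]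
    exact ((ENNReal.continuous_ofReal.tendsto _).comp hconv).liminf_eq.trans_lt
      ENNReal.ofReal_lt_top
  exact ⟨hint, tendsto_nhds_unique (hlim t hint) hconv⟩

lemma integrable_potential (h : IsFiniteEnergySolution p u v g) (hp : 3 ≤ p) (hp' : p < 5) (t : ℝ) :
    Integrable fun x => |u t x| ^ (p + 1) := by
  have hp1 : 0 < p + 1 := by linarith
  have h1 := (h.energy_conservation hp hp' t).1
  have h2 := ((h1.sub ((h.density_g.integrable t).const_mul (1 / 2))).sub
    ((h.density_v.integrable t).const_mul (1 / 2))).const_mul (p + 1)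
  refine h2.congr (Eventually.of_forall fun x => ?_)
  simp only [Pi.sub_apply, energyDensity, Real.norm_eq_abs]
  field_simp
  ring

/-- The potential energy density is a continuous density. -/
lemma density_potential (h : IsFiniteEnergySolution p u v g) (hp : 3 ≤ p) (hp' : p < 5) :
    IsContDensity fun t x => |u t x| ^ (p + 1) := by
  have hp1 : 0 < p + 1 := by linarith
  have hc : Continuous fun s : ℝ => |s| ^ (p + 1) :=
    continuous_abs.rpow_const fun _ => Or.inr hp1.le
  refine IsContDensity.of_exhaustion (hc.comp_aestronglyMeasurable h.aestronglyMeasurable_u)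
    (fun t x => Real.rpow_nonneg (abs_nonneg _) _) (h.integrable_potential hp hp') ?_
    fun n => h.density_potential_ball hp hp' n
  -- By conservation the potential energy is a constant minus the kinetic and gradient energies,
  -- both continuous in time.
  have hcont : Continuous fun t => (p + 1) * ((∫ x, energyDensity p u v g 0 x)
      - 1 / 2 * (∫ x, ‖g t x‖ ^ 2) - 1 / 2 * ∫ x, ‖v t x‖ ^ 2) :=
    continuous_const.mul ((continuous_const.sub (continuous_const.mul
      h.density_g.continuous_mass)).sub (continuous_const.mul h.density_v.continuous_mass))
  refine hcont.congr fun t => ?_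
  have i1 := (h.density_g.integrable t).const_mul (1 / 2)
  have i2 := (h.density_v.integrable t).const_mul (1 / 2)
  have i3 := (h.integrable_potential hp hp' t).const_mul (1 / (p + 1))
  rw [← (h.energy_conservation hp hp' t).2]
  simp only [energyDensity, ← Real.norm_eq_abs (v t _)]
  rw [integral_add_three i1 i2 i3, integral_const_mul, integral_const_mul, integral_const_mul]
  field_simp
  ring

end IsFiniteEnergySolution

end EnergyConservation

end DefocusingWave

namespace DefocusingWave

/-! ### Abstract inward flow: weights supported away from the axis -/

section InwardFlow

/-- Abstract form of the balance law of the inward energy: `α + β` is the energy density,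
`α - β` the flux density, `N / |x|` the density of the loss. -/
structure IsInwardFlow (α β N : ℝ → Space → ℝ) : Prop where
  density_α : IsContDensity α
  density_β : IsContDensity β
  density_N : IsContDensity N
  le_N : ∀ t x, 2 * β t x ≤ N t x
  N_le : ∀ t x, N t x ≤ 4 * β t x
  bounded : ∃ M, ∀ t, ∫ x, (α t x + β t x) ≤ M
  balance : ∀ X : ℝ × ℝ → ℝ, IsRadialTest X →
    ∫ z : ℝ × Space, (lift (dT X) z * (α z.1 z.2 + β z.1 z.2)
      - lift (dR X) z * (α z.1 z.2 - β z.1 z.2) - lift X z * (N z.1 z.2 / ‖z.2‖)) = 0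

lemma eventually_abs_sub_le {Z : ℝ × ℝ → ℝ} (hZ : Continuous Z) {R : ℝ}
    (hR : ∀ t r, R < r → Z (t, r) = 0) (s : ℝ) {ε : ℝ} (hε : 0 < ε) :
    ∀ᶠ t in 𝓝 s, ∀ r, 0 ≤ r → |Z (t, r) - Z (s, r)| ≤ ε := by
  have h1 : ∀ᶠ t in 𝓝 s, ∀ r ∈ Set.Icc 0 R, |Z (t, r) - Z (s, r)| < ε := by
    refine (isCompact_Icc (a := (0 : ℝ)) (b := R)).eventually_forall_of_forall_eventually
      fun r _ => ?_
    have hc : Continuous fun q : ℝ × ℝ => |Z (q.1, q.2) - Z (s, q.2)| := by fun_prop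
    have h2 : (fun q : ℝ × ℝ => |Z (q.1, q.2) - Z (s, q.2)|) (s, r) < ε := by simpa using hε
    exact hc.continuousAt.eventually (Iio_mem_nhds h2)
  filter_upwards [h1] with t ht r hr
  rcases le_or_gt r R with hrR | hrR
  · exact (ht r ⟨hr, hrR⟩).le
  · rw [hR t r hrR, hR s r hrR, sub_zero, abs_zero]; exact hε.le

lemma exists_radial_bound {Z : ℝ × ℝ → ℝ} (hZ : Continuous Z) {R : ℝ}
    (hR : ∀ t r, R < r → Z (t, r) = 0) (T : ℝ) :
    ∃ B, ∀ t ∈ Set.Icc (-T) T, ∀ r, 0 ≤ r → |Z (t, r)| ≤ B := by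
  obtain ⟨B, hB⟩ := ((isCompact_Icc (a := -T) (b := T)).prod
    (isCompact_Icc (a := (0 : ℝ)) (b := R))).exists_bound_of_continuousOn hZ.continuousOn
  refine ⟨max B 0, fun t ht r hr => ?_⟩
  rcases le_or_gt r R with hrR | hrR
  · exact (hB (t, r) ⟨ht, hr, hrR⟩).trans (le_max_left _ _)
  · rw [hR t r hrR, abs_zero]; exact le_max_right _ _

namespace IsContDensity

variable {ρ : ℝ → Space → ℝ}

lemma continuous_integral_radial (h : IsContDensity ρ) {Z : ℝ × ℝ → ℝ} (hZ : Continuous Z) {R : ℝ}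
    (hR : ∀ t r, R < r → Z (t, r) = 0) : Continuous fun t => ∫ x, Z (t, ‖x‖) * ρ t x := by
  refine h.continuous_integral (w := fun t x => Z (t, ‖x‖)) (fun t => ?_) (fun t => ?_)
    fun s ε hε => ?_
  · exact (hZ.comp (continuous_const.prodMk continuous_norm)).measurable
  · obtain ⟨B, hB⟩ := exists_radial_bound hZ hR |t|
    exact ⟨B, fun x => hB t (abs_le.1 le_rfl) _ (norm_nonneg _)⟩
  · filter_upwards [eventually_abs_sub_le hZ hR s hε] with t ht x using ht _ (norm_nonneg _)

lemma integrable_radial (h : IsContDensity ρ) {Z : ℝ × ℝ → ℝ} (hZ : Continuous Z) {R : ℝ}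
    (hR : ∀ t r, R < r → Z (t, r) = 0) (t : ℝ) : Integrable fun x => Z (t, ‖x‖) * ρ t x := by
  obtain ⟨B, hB⟩ := exists_radial_bound hZ hR |t|
  exact h.integrable_mul (hZ.comp (continuous_const.prodMk continuous_norm)).aestronglyMeasurable
    (fun x => hB t (abs_le.1 le_rfl) _ (norm_nonneg _)) t

lemma integrable_prod_radial (h : IsContDensity ρ) {Z : ℝ × ℝ → ℝ} (hZ : Continuous Z) {R : ℝ}
    (hR : ∀ t r, R < r → Z (t, r) = 0) {θ : ℝ → ℝ} (hθ : Continuous θ) (hs : HasCompactSupport θ) :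
    Integrable fun z : ℝ × Space => θ z.1 * Z (z.1, ‖z.2‖) * ρ z.1 z.2 := by
  obtain ⟨T, hT⟩ := hs.isCompact.isBounded.subset_closedBall 0
  obtain ⟨A, hA⟩ := hs.exists_bound_of_continuous hθ
  obtain ⟨B, hB⟩ := exists_radial_bound hZ hR T
  have hT' : ∀ t, t ∉ Set.Icc (-T) T → θ t = 0 := fun t ht => by
    refine image_eq_zero_of_notMem_tsupport fun hm => ht ?_
    have := hT hm
    rwa [Real.closedBall_eq_Icc, zero_sub, zero_add] at this
  have hA0 : 0 ≤ A := (norm_nonneg _).trans (hA 0)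
  refine h.integrable_prod (k := fun z => θ z.1 * Z (z.1, ‖z.2‖)) (B := A * |B|) (T := T)
    ((hθ.comp continuous_fst).mul
      (hZ.comp (continuous_fst.prodMk continuous_snd.norm))).aestronglyMeasurable (fun z => ?_)
    fun z hz => by rw [hT' _ hz, zero_mul]
  by_cases hz : z.1 ∈ Set.Icc (-T) T
  · rw [abs_mul]
    exact mul_le_mul (hA _) ((hB _ hz _ (norm_nonneg _)).trans (le_abs_self B)) (abs_nonneg _) hA0
  · rw [hT' _ hz, zero_mul, abs_zero]; positivity

end IsContDensity

namespace IsInwardFlow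

variable {α β N : ℝ → Space → ℝ}

/-- The balance law for radial weights supported away from the time axis. -/
lemma hasDerivAt_cutoff (h : IsInwardFlow α β N) {Y : ℝ × ℝ → ℝ} (hY : ContDiff ℝ ∞ Y) {δ R : ℝ}
    (hδ : 0 < δ) (h0 : ∀ t r, r < δ → Y (t, r) = 0) (hR : ∀ t r, R < r → Y (t, r) = 0) (t : ℝ) :
    (Continuous fun t => ∫ x, ((dT Y (t, ‖x‖) - dR Y (t, ‖x‖)) * α t x
      + (dT Y (t, ‖x‖) + dR Y (t, ‖x‖)) * β t x + -(Y (t, ‖x‖) / ‖x‖) * N t x)) ∧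
    HasDerivAt (fun t => ∫ x, Y (t, ‖x‖) * (α t x + β t x))
      (∫ x, ((dT Y (t, ‖x‖) - dR Y (t, ‖x‖)) * α t x
        + (dT Y (t, ‖x‖) + dR Y (t, ‖x‖)) * β t x + -(Y (t, ‖x‖) / ‖x‖) * N t x)) t := by
  have hTc := IsRadialTest.continuous_dT hY
  have hRc := IsRadialTest.continuous_dR hY
  have hTR : ∀ t r, R < r → dT Y (t, r) = 0 ∧ dR Y (t, r) = 0 := fun t r hr => by
    have hq : Y =ᶠ[𝓝 (t, r)] 0 := by
      have ho : IsOpen {q : ℝ × ℝ | R < q.2} := isOpen_lt continuous_const continuous_snd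
      filter_upwards [ho.mem_nhds hr] with q hq using hR q.1 q.2 hq
    constructor <;> simp [dT, dR, hq.fderiv_eq]
  have hdens := h.density_α.add h.density_β
  have e1 : ∀ t r, (dT Y - dR Y) (t, r) = dT Y (t, r) - dR Y (t, r) := fun _ _ => rfl
  have Z1c : Continuous (dT Y - dR Y) := hTc.sub hRc
  have Z1R : ∀ t r, R < r → (dT Y - dR Y) (t, r) = 0 := fun t r hr => by
    rw [e1, (hTR t r hr).1, (hTR t r hr).2, sub_zero]
  have e2 : ∀ t r, (dT Y + dR Y) (t, r) = dT Y (t, r) + dR Y (t, r) := fun _ _ => rfl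
  have Z2c : Continuous (dT Y + dR Y) := hTc.add hRc
  have Z2R : ∀ t r, R < r → (dT Y + dR Y) (t, r) = 0 := fun t r hr => by
    rw [e2, (hTR t r hr).1, (hTR t r hr).2, add_zero]
  -- Replacing r by max r δ changes nothing where Y is non-zero and makes Y/r a continuous weight on
  -- the whole plane.
  set Z3 : ℝ × ℝ → ℝ := fun q => -(Y q * (max q.2 δ)⁻¹) with hZ3
  have e3 : ∀ t r, Z3 (t, r) = -(Y (t, r) / r) := fun t r => by
    simp only [hZ3]
    rcases lt_or_ge r δ with hr | hr
    · rw [h0 t r hr]; simp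
    · rw [max_eq_left hr, div_eq_mul_inv]
  have Z3c : Continuous Z3 := (hY.continuous.mul ((continuous_snd.max continuous_const).inv₀
    fun q => (lt_max_of_lt_right hδ).ne')).neg
  have Z3R : ∀ t r, R < r → Z3 (t, r) = 0 := fun t r hr => by rw [e3, hR t r hr]; simp
  have i1 := fun t => h.density_α.integrable_radial Z1c Z1R t
  have i2 := fun t => h.density_β.integrable_radial Z2c Z2R t
  have i3 := fun t => h.density_N.integrable_radial Z3c Z3R t
  have hsum : ∀ t, ∫ x, ((dT Y (t, ‖x‖) - dR Y (t, ‖x‖)) * α t x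
      + (dT Y (t, ‖x‖) + dR Y (t, ‖x‖)) * β t x + -(Y (t, ‖x‖) / ‖x‖) * N t x)
      = (∫ x, (dT Y - dR Y) (t, ‖x‖) * α t x) + (∫ x, (dT Y + dR Y) (t, ‖x‖) * β t x)
        + ∫ x, Z3 (t, ‖x‖) * N t x := fun t => by
    rw [← integral_add_three (i1 t) (i2 t) (i3 t)]
    simp only [e1, e2, e3]
  have hbc : Continuous fun t => ∫ x, ((dT Y (t, ‖x‖) - dR Y (t, ‖x‖)) * α t x
      + (dT Y (t, ‖x‖) + dR Y (t, ‖x‖)) * β t x + -(Y (t, ‖x‖) / ‖x‖) * N t x) := by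
    simp only [hsum]
    exact ((h.density_α.continuous_integral_radial Z1c Z1R).add
      (h.density_β.continuous_integral_radial Z2c Z2R)).add
      (h.density_N.continuous_integral_radial Z3c Z3R)
  refine ⟨hbc, ?_⟩
  refine hasDerivAt_of_integral_test (hdens.continuous_integral_radial hY.continuous hR) hbc
    (fun θ hθ hs => ?_) t
  -- Y need not have compact support in time; the factor θ makes an admissible test function and
  -- yields the weak time derivative.
  set X : ℝ × ℝ → ℝ := fun q => θ q.1 * Y q with hX
  have hXs : ContDiff ℝ ∞ X := (hθ.comp contDiff_fst).mul hY
  obtain ⟨T, hTs⟩ := hs.isCompact.isBounded.subset_closedBall 0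
  have hXt : IsRadialTest X := by
    refine ⟨hXs, ?_, δ, hδ, fun q hq => by simp only [hX]; rw [h0 q.1 q.2 hq, mul_zero]⟩
    refine HasCompactSupport.intro (hs.isCompact.prod (isCompact_Icc (a := δ) (b := R))) fun q hq => ?_
    by_contra hne
    refine hq ⟨subset_tsupport _ (left_ne_zero_of_mul hne), ?_⟩
    have := right_ne_zero_of_mul hne
    constructor
    · by_contra hlt; exact this (h0 q.1 q.2 (not_le.1 hlt))
    · by_contra hlt; exact this (hR q.1 q.2 (not_le.1 hlt))
  have hθd : Differentiable ℝ θ := hθ.differentiable (by simp)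
  have hYd : Differentiable ℝ Y := hY.differentiable (by simp)
  have hfd : ∀ q w, fderiv ℝ X q w = deriv θ q.1 * w.1 * Y q + θ q.1 * fderiv ℝ Y q w := by
    intro q w
    have h1 : HasFDerivAt (fun q : ℝ × ℝ => θ q.1)
        (deriv θ q.1 • ContinuousLinearMap.fst ℝ ℝ ℝ) q :=
      (hθd q.1).hasDerivAt.comp_hasFDerivAt q hasFDerivAt_fst
    refine (congrArg (fun T : ℝ × ℝ →L[ℝ] ℝ => T w) (h1.mul (hYd q).hasFDerivAt).fderiv).trans ?_
    simp
    ring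
  have hθ' : Continuous (deriv θ) := hθ.continuous_deriv (by simp)
  have j0 := hdens.integrable_prod_radial hY.continuous hR hθ' hs.deriv
  have j1 := h.density_α.integrable_prod_radial Z1c Z1R hθ.continuous hs
  have j2 := h.density_β.integrable_prod_radial Z2c Z2R hθ.continuous hs
  have j3 := h.density_N.integrable_prod_radial Z3c Z3R hθ.continuous hs
  have hbal := h.balance X hXt
  have e4 : ∫ z : ℝ × Space, (deriv θ z.1 * Y (z.1, ‖z.2‖) * (α z.1 z.2 + β z.1 z.2)
      + (θ z.1 * (dT Y - dR Y) (z.1, ‖z.2‖) * α z.1 z.2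
        + θ z.1 * (dT Y + dR Y) (z.1, ‖z.2‖) * β z.1 z.2
        + θ z.1 * Z3 (z.1, ‖z.2‖) * N z.1 z.2)) = 0 := by
    rw [← hbal]
    refine integral_congr_ae (Eventually.of_forall fun z => ?_)
    simp only [lift, dT, dR, hfd, e3, Pi.sub_apply, Pi.add_apply]
    simp only [hX]
    ring
  rw [← e4]
  refine ((integral_prod _ (j0.add ((j1.add j2).add j3))).trans ?_).symm
  refine integral_congr_ae (Eventually.of_forall fun t => ?_)
  have k0 : Integrable fun x => deriv θ t * (Y (t, ‖x‖) * (α t x + β t x)) :=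
    (hdens.integrable_radial hY.continuous hR t).const_mul _
  have k1 : Integrable fun x => θ t * ((dT Y - dR Y) (t, ‖x‖) * α t x
      + (dT Y + dR Y) (t, ‖x‖) * β t x + Z3 (t, ‖x‖) * N t x) :=
    (((i1 t).add (i2 t)).add (i3 t)).const_mul _
  have k2 := integral_add k0 k1
  rw [integral_const_mul, integral_const_mul, integral_add_three (i1 t) (i2 t) (i3 t), ← hsum] at k2
  refine Eq.trans ?_ k2
  refine integral_congr_ae (Eventually.of_forall fun x => ?_)
  simp only [Pi.add_apply, Pi.sub_apply]
  ring

end IsInwardFlow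

end InwardFlow

end DefocusingWave

namespace DefocusingWave

/-! ### Logarithmic cutoffs at the axis and at infinity -/

section LogCutoff

/-- A fixed smooth bump on the line. -/
noncomputable def lineBump : ContDiffBump (0 : ℝ) := ⟨1, 2, one_pos, one_lt_two⟩

/-- Smooth cutoff to `e^{-2(n+1)} < r < e^{2(n+1)}`, slowly varying on the logarithmic scale. -/
noncomputable def logCutoff (n : ℕ) (r : ℝ) : ℝ :=
  if r ≤ 0 then 0 else lineBump (Real.log r / ((n : ℝ) + 1))

lemma logCutoff_of_pos (n : ℕ) {r : ℝ} (hr : 0 < r) :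
    logCutoff n r = lineBump (Real.log r / ((n : ℝ) + 1)) := if_neg (not_le.2 hr)

lemma logCutoff_nonneg (n : ℕ) (r : ℝ) : 0 ≤ logCutoff n r := by
  unfold logCutoff
  split_ifs
  · exact le_rfl
  · exact lineBump.nonneg

lemma logCutoff_le_one (n : ℕ) (r : ℝ) : logCutoff n r ≤ 1 := by
  unfold logCutoff
  split_ifs
  · exact zero_le_one
  · exact lineBump.le_one

lemma logCutoff_eq_zero_of_lt (n : ℕ) {r : ℝ} (hr : r < Real.exp (-(2 * ((n : ℝ) + 1)))) :
    logCutoff n r = 0 := by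
  rcases le_or_gt r 0 with h | h
  · exact if_pos h
  · rw [logCutoff_of_pos n h]
    refine lineBump.zero_of_le_dist ?_
    have hn : 0 < (n : ℝ) + 1 := by positivity
    have h1 : Real.log r < -(2 * ((n : ℝ) + 1)) := (Real.log_lt_iff_lt_exp h).2 hr
    rw [dist_zero_right, Real.norm_eq_abs, abs_div, abs_of_pos hn, le_div_iff₀ hn]
    change 2 * _ ≤ _
    linarith [neg_le_abs (Real.log r)]

lemma logCutoff_eq_zero_of_gt (n : ℕ) {r : ℝ} (hr : Real.exp (2 * ((n : ℝ) + 1)) < r) :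
    logCutoff n r = 0 := by
  have h : 0 < r := (Real.exp_pos _).trans hr
  rw [logCutoff_of_pos n h]
  refine lineBump.zero_of_le_dist ?_
  have hn : 0 < (n : ℝ) + 1 := by positivity
  have h1 : 2 * ((n : ℝ) + 1) < Real.log r := (Real.lt_log_iff_exp_lt h).2 hr
  rw [dist_zero_right, Real.norm_eq_abs, abs_div, abs_of_pos hn, le_div_iff₀ hn]
  change 2 * _ ≤ _
  linarith [le_abs_self (Real.log r)]

lemma contDiff_logCutoff (n : ℕ) : ContDiff ℝ ∞ (logCutoff n) := by
  rw [contDiff_iff_contDiffAt]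
  intro r
  rcases le_or_gt r 0 with h | h
  · have : logCutoff n =ᶠ[𝓝 r] fun _ => 0 := by
      filter_upwards [Iio_mem_nhds (h.trans_lt (Real.exp_pos (-(2 * ((n : ℝ) + 1)))))] with s hs
      exact logCutoff_eq_zero_of_lt n hs
    exact contDiffAt_const.congr_of_eventuallyEq this
  · have : logCutoff n =ᶠ[𝓝 r] fun s => lineBump (Real.log s / ((n : ℝ) + 1)) := by
      filter_upwards [Ioi_mem_nhds h] with s hs using logCutoff_of_pos n hs
    refine ContDiffAt.congr_of_eventuallyEq ?_ this
    exact lineBump.contDiffAt.comp r ((Real.contDiffAt_log.2 h.ne').div_const _)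

lemma tendsto_logCutoff {r : ℝ} (hr : 0 < r) : Tendsto (fun n => logCutoff n r) atTop (𝓝 1) := by
  refine tendsto_const_nhds.congr' ?_
  obtain ⟨M, hM⟩ := exists_nat_ge |Real.log r|
  filter_upwards [eventually_ge_atTop M] with n hn
  have h1 : (M : ℝ) ≤ n := by exact_mod_cast hn
  rw [logCutoff_of_pos n hr, lineBump.one_of_mem_closedBall]
  have hn : 0 < (n : ℝ) + 1 := by positivity
  rw [mem_closedBall_zero_iff, Real.norm_eq_abs, abs_div, abs_of_pos hn, div_le_iff₀ hn]
  change _ ≤ 1 * _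
  linarith

/-- On the logarithmic scale r·d/dr is an ordinary derivative, and the bump is stretched by n + 1.
Weights bounded by a multiple of r can thus be cut off at both ends with an error that vanishes
uniformly. -/
lemma exists_deriv_logCutoff_bound : ∃ C, 0 ≤ C ∧ ∀ n r, 0 ≤ r →
    |r * deriv (logCutoff n) r| ≤ C / ((n : ℝ) + 1) := by
  have hs : ContDiff ℝ ∞ (lineBump : ℝ → ℝ) := lineBump.contDiff
  obtain ⟨C, hC⟩ := lineBump.hasCompactSupport.deriv.exists_bound_of_continuous
    (hs.continuous_deriv (by simp))
  have hC0 : 0 ≤ C := (norm_nonneg _).trans (hC 0)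
  refine ⟨C, hC0, fun n r hr => ?_⟩
  have hn : 0 < (n : ℝ) + 1 := by positivity
  rcases hr.eq_or_lt with rfl | hr
  · rw [zero_mul, abs_zero]; positivity
  have he : logCutoff n =ᶠ[𝓝 r] fun s => lineBump (Real.log s / ((n : ℝ) + 1)) := by
    filter_upwards [Ioi_mem_nhds hr] with s hs using logCutoff_of_pos n hs
  have hd := (hs.differentiable (by simp) (Real.log r / ((n : ℝ) + 1))).hasDerivAt.comp r
    ((Real.hasDerivAt_log hr.ne').div_const ((n : ℝ) + 1))
  rw [he.deriv_eq, show deriv (fun s => lineBump (Real.log s / ((n : ℝ) + 1))) r = _ from hd.deriv]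
  have : r * (deriv lineBump (Real.log r / ((n : ℝ) + 1)) * (r⁻¹ / ((n : ℝ) + 1)))
      = deriv lineBump (Real.log r / ((n : ℝ) + 1)) / ((n : ℝ) + 1) := by
    field_simp
  rw [this, abs_div, abs_of_pos hn]
  exact div_le_div_of_nonneg_right (hC _) hn.le

end LogCutoff

/-! ### The balance law for weights vanishing on the axis -/

namespace IsInwardFlow

variable {α β N : ℝ → Space → ℝ}

/-- The integrand of the balance law with a radial weight. -/
noncomputable def balanceIntegrand (α β N : ℝ → Space → ℝ) (X : ℝ × ℝ → ℝ) (t : ℝ) (x : Space) : ℝ :=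
  (dT X (t, ‖x‖) - dR X (t, ‖x‖)) * α t x + (dT X (t, ‖x‖) + dR X (t, ‖x‖)) * β t x
    + -(X (t, ‖x‖) / ‖x‖) * N t x

lemma density_energy (h : IsInwardFlow α β N) : IsContDensity fun t x => α t x + β t x :=
  h.density_α.add h.density_β

/-- The coefficients of α and β are at most 2C, and N/|x| times X is at most CN ≤ 4Cβ, whence the
factor 6. -/
lemma abs_balanceIntegrand_le (h : IsInwardFlow α β N) {X : ℝ × ℝ → ℝ} {C t : ℝ} {x : Space}
    (h1 : |dT X (t, ‖x‖)| ≤ C) (h2 : |dR X (t, ‖x‖)| ≤ C) (h3 : |X (t, ‖x‖)| ≤ C * ‖x‖) :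
    ‖balanceIntegrand α β N X t x‖ ≤ 6 * C * (α t x + β t x) := by
  have hα := h.density_α.nonneg t x
  have hβ := h.density_β.nonneg t x
  have hN := h.density_N.nonneg t x
  have hN4 := h.N_le t x
  have hC : 0 ≤ C := (abs_nonneg _).trans h1
  have h4 : |X (t, ‖x‖) / ‖x‖| ≤ C := by
    rw [abs_div, abs_norm]
    rcases (norm_nonneg x).eq_or_lt with h0 | h0
    · rw [← h0, div_zero]; exact hC
    · rwa [div_le_iff₀ h0]
  rw [abs_le] at h1 h2 h4
  rw [balanceIntegrand, Real.norm_eq_abs, abs_le]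
  constructor
  · nlinarith [mul_nonneg hα (by linarith : 0 ≤ 2 * C + (dT X (t, ‖x‖) - dR X (t, ‖x‖))),
      mul_nonneg hβ (by linarith : 0 ≤ 2 * C + (dT X (t, ‖x‖) + dR X (t, ‖x‖))),
      mul_nonneg hN (by linarith : 0 ≤ C + -(X (t, ‖x‖) / ‖x‖)),
      mul_nonneg hC (by linarith : 0 ≤ 4 * β t x - N t x), mul_nonneg hC hα]
  · nlinarith [mul_nonneg hα (by linarith : 0 ≤ 2 * C - (dT X (t, ‖x‖) - dR X (t, ‖x‖))),
      mul_nonneg hβ (by linarith : 0 ≤ 2 * C - (dT X (t, ‖x‖) + dR X (t, ‖x‖))),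
      mul_nonneg hN (by linarith : 0 ≤ C - -(X (t, ‖x‖) / ‖x‖)),
      mul_nonneg hC (by linarith : 0 ≤ 4 * β t x - N t x), mul_nonneg hC hα]

lemma aestronglyMeasurable_balanceIntegrand (h : IsInwardFlow α β N) {X : ℝ × ℝ → ℝ}
    (hX : ContDiff ℝ ∞ X) (t : ℝ) : AEStronglyMeasurable (balanceIntegrand α β N X t) := by
  have hn : Continuous fun x : Space => (t, ‖x‖) := by fun_prop
  have c1 := (IsRadialTest.continuous_dT hX).comp hn
  have c2 := (IsRadialTest.continuous_dR hX).comp hn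
  have c3 : Measurable fun x : Space => -(X (t, ‖x‖) / ‖x‖) :=
    ((hX.continuous.comp hn).measurable.div measurable_norm).neg
  exact (((c1.sub c2).aestronglyMeasurable.mul (h.density_α.integrable t).1).add
    ((c1.add c2).aestronglyMeasurable.mul (h.density_β.integrable t).1)).add
    (c3.aestronglyMeasurable.mul (h.density_N.integrable t).1)

/-- The balance law for radial weights which vanish on the time axis. -/
lemma integral_balance (h : IsInwardFlow α β N) {X : ℝ × ℝ → ℝ} (hX : ContDiff ℝ ∞ X)
    {t₁ t₂ C : ℝ} (ht : t₁ ≤ t₂) (h0 : ∀ t ∈ Set.Icc t₁ t₂, ∀ r, 0 ≤ r → |X (t, r)| ≤ C)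
    (h1 : ∀ t ∈ Set.Icc t₁ t₂, ∀ r, 0 ≤ r → |X (t, r)| ≤ C * r)
    (h2 : ∀ t ∈ Set.Icc t₁ t₂, ∀ r, 0 ≤ r → |dT X (t, r)| ≤ C)
    (h3 : ∀ t ∈ Set.Icc t₁ t₂, ∀ r, 0 ≤ r → |dR X (t, r)| ≤ C) :
    IntervalIntegrable (fun t => ∫ x, balanceIntegrand α β N X t x) volume t₁ t₂ ∧
    (∫ x, X (t₂, ‖x‖) * (α t₂ x + β t₂ x)) - ∫ x, X (t₁, ‖x‖) * (α t₁ x + β t₁ x)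
      = ∫ t in t₁..t₂, ∫ x, balanceIntegrand α β N X t x := by
  obtain ⟨C', hC'0, hC'⟩ := exists_deriv_logCutoff_bound
  obtain ⟨M, hM⟩ := h.bounded
  have hC : 0 ≤ C := (abs_nonneg _).trans (h0 t₁ ⟨le_rfl, ht⟩ 0 le_rfl)
  -- The only new term in the balance is X times the derivative of the cutoff. Since |X| ≤ Cr it is
  -- O(1/(n+1)), so no boundary contribution remains at the axis.
  set Y : ℕ → ℝ × ℝ → ℝ := fun n q => X q * logCutoff n q.2 with hY
  have hYs : ∀ n, ContDiff ℝ ∞ (Y n) := fun n => hX.mul ((contDiff_logCutoff n).comp contDiff_snd)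
  have hXd : Differentiable ℝ X := hX.differentiable (by simp)
  have hfd : ∀ n q w, fderiv ℝ (Y n) q w = fderiv ℝ X q w * logCutoff n q.2
      + X q * (deriv (logCutoff n) q.2 * w.2) := by
    intro n q w
    have h1 : HasFDerivAt (fun q : ℝ × ℝ => logCutoff n q.2)
        (deriv (logCutoff n) q.2 • ContinuousLinearMap.snd ℝ ℝ ℝ) q :=
      ((contDiff_logCutoff n).differentiable (by simp) q.2).hasDerivAt.comp_hasFDerivAt q
        hasFDerivAt_snd
    refine (congrArg (fun T : ℝ × ℝ →L[ℝ] ℝ => T w) ((hXd q).hasFDerivAt.mul h1).fderiv).trans ?_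
    simp
    ring
  have hYT : ∀ n q, dT (Y n) q = dT X q * logCutoff n q.2 := fun n q => by
    simp [dT, hfd]
  have hYR : ∀ n q, dR (Y n) q = dR X q * logCutoff n q.2 + X q * deriv (logCutoff n) q.2 :=
    fun n q => by simp [dR, hfd]
  -- One constant dominates all the cut-off weights and their derivatives; with the uniform bound on
  -- the energy it serves for dominated convergence in space and in time.
  set K : ℝ := C * (1 + C') with hK
  have hCK : C ≤ K := by rw [hK]; nlinarith
  have hcut := fun n t => h.hasDerivAt_cutoff (hYs n) (Real.exp_pos (-(2 * ((n : ℝ) + 1))))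
    (R := Real.exp (2 * ((n : ℝ) + 1)))
    (fun t r hr => by simp only [hY]; rw [logCutoff_eq_zero_of_lt n hr, mul_zero])
    (fun t r hr => by simp only [hY]; rw [logCutoff_eq_zero_of_gt n hr, mul_zero]) t
  have hlc : ∀ n r, |logCutoff n r| ≤ 1 := fun n r => by
    rw [abs_of_nonneg (logCutoff_nonneg n r)]; exact logCutoff_le_one n r
  have hXder : ∀ n t, t ∈ Set.Icc t₁ t₂ → ∀ r, 0 ≤ r →
      |X (t, r) * deriv (logCutoff n) r| ≤ C * (C' / ((n : ℝ) + 1)) := fun n t ht r hr => by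
    rw [abs_mul]
    calc |X (t, r)| * |deriv (logCutoff n) r| ≤ C * r * |deriv (logCutoff n) r| :=
          mul_le_mul_of_nonneg_right (h1 t ht r hr) (abs_nonneg _)
      _ = C * |r * deriv (logCutoff n) r| := by rw [abs_mul, abs_of_nonneg hr]; ring
      _ ≤ _ := mul_le_mul_of_nonneg_left (hC' n r hr) hC
  have hbound : ∀ n, ∀ t ∈ Set.Icc t₁ t₂, ∀ x,
      ‖balanceIntegrand α β N (Y n) t x‖ ≤ 6 * K * (α t x + β t x) := by
    intro n t ht x
    have hr := norm_nonneg x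
    refine h.abs_balanceIntegrand_le ?_ ?_ ?_
    · rw [hYT, abs_mul]
      exact (mul_le_of_le_one_right (abs_nonneg _) (hlc n _)).trans ((h2 t ht _ hr).trans hCK)
    · rw [hYR]
      refine (abs_add_le _ _).trans ?_
      rw [hK, mul_add, mul_one]
      refine add_le_add ?_ ((hXder n t ht _ hr).trans (mul_le_mul_of_nonneg_left ?_ hC))
      · rw [abs_mul]
        exact (mul_le_of_le_one_right (abs_nonneg _) (hlc n _)).trans (h3 t ht _ hr)
      · rw [div_le_iff₀ (by positivity)]
        nlinarith [Nat.cast_nonneg (α := ℝ) n]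
    · simp only [hY]
      rw [abs_mul]
      refine (mul_le_of_le_one_right (abs_nonneg _) (hlc n _)).trans ((h1 t ht _ hr).trans ?_)
      exact mul_le_mul_of_nonneg_right hCK hr
  have hae : ∀ᵐ x : Space, x ≠ 0 := by simp [ae_iff]
  have hb : ∀ t ∈ Set.Icc t₁ t₂, Tendsto (fun n => ∫ x, balanceIntegrand α β N (Y n) t x) atTop
      (𝓝 (∫ x, balanceIntegrand α β N X t x)) := by
    intro t ht
    refine tendsto_integral_of_dominated_convergence (fun x => 6 * K * (α t x + β t x))
      (fun n => h.aestronglyMeasurable_balanceIntegrand (hYs n) t)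
      ((h.density_energy.integrable t).const_mul _)
      (fun n => Eventually.of_forall (hbound n t ht)) ?_
    filter_upwards [hae] with x hx
    have hx' := norm_pos_iff.2 hx
    have l1 := tendsto_logCutoff hx'
    have l2 : Tendsto (fun n => X (t, ‖x‖) * deriv (logCutoff n) ‖x‖) atTop (𝓝 0) := by
      refine squeeze_zero_norm (fun n => hXder n t ht _ hx'.le) ?_
      have := (tendsto_one_div_add_atTop_nhds_zero_nat (𝕜 := ℝ)).const_mul (C * C')
      simpa [div_eq_mul_inv, mul_assoc] using this
    have l3 : Tendsto (fun n => dT (Y n) (t, ‖x‖)) atTop (𝓝 (dT X (t, ‖x‖))) := by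
      simp only [hYT]
      simpa using l1.const_mul (dT X (t, ‖x‖))
    have l4 : Tendsto (fun n => dR (Y n) (t, ‖x‖)) atTop (𝓝 (dR X (t, ‖x‖))) := by
      simp only [hYR]
      simpa using (l1.const_mul (dR X (t, ‖x‖))).add l2
    have l5 : Tendsto (fun n => Y n (t, ‖x‖)) atTop (𝓝 (X (t, ‖x‖))) := by
      simpa using l1.const_mul (X (t, ‖x‖))
    exact (((l3.sub l4).mul_const _).add ((l3.add l4).mul_const _)).add
      ((l5.div_const _).neg.mul_const _)
  have ha : ∀ t ∈ Set.Icc t₁ t₂, Tendsto (fun n => ∫ x, Y n (t, ‖x‖) * (α t x + β t x)) atTop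
      (𝓝 (∫ x, X (t, ‖x‖) * (α t x + β t x))) := by
    intro t ht
    have hn : Continuous fun x : Space => (t, ‖x‖) := by fun_prop
    refine tendsto_integral_of_dominated_convergence (fun x => C * (α t x + β t x))
      (fun n => ((hYs n).continuous.comp hn).aestronglyMeasurable.mul
        (h.density_energy.integrable t).1)
      ((h.density_energy.integrable t).const_mul _)
      (fun n => Eventually.of_forall fun x => ?_) ?_
    · rw [norm_mul, Real.norm_of_nonneg (h.density_energy.nonneg t x)]
      refine mul_le_mul_of_nonneg_right ?_ (h.density_energy.nonneg t x)
      simp only [hY]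
      rw [norm_mul]
      exact (mul_le_of_le_one_right (abs_nonneg _) (hlc n _)).trans (h0 t ht _ (norm_nonneg _))
    · filter_upwards [hae] with x hx
      have l1 := tendsto_logCutoff (norm_pos_iff.2 hx)
      have l5 : Tendsto (fun n => Y n (t, ‖x‖)) atTop (𝓝 (X (t, ‖x‖))) := by
        simpa using l1.const_mul (X (t, ‖x‖))
      exact l5.mul_const _
  have hsub : Set.uIoc t₁ t₂ ⊆ Set.Icc t₁ t₂ := by
    rw [Set.uIoc_of_le ht]; exact Set.Ioc_subset_Icc_self
  have hbM : ∀ n, ∀ t ∈ Set.Icc t₁ t₂, ‖∫ x, balanceIntegrand α β N (Y n) t x‖ ≤ 6 * K * M := by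
    intro n t ht
    refine (norm_integral_le_of_norm_le ((h.density_energy.integrable t).const_mul (6 * K))
      (Eventually.of_forall (hbound n t ht))).trans ?_
    rw [integral_const_mul]
    exact mul_le_mul_of_nonneg_left (hM t) (by positivity)
  have hT := intervalIntegral.tendsto_integral_filter_of_dominated_convergence
    (μ := volume) (a := t₁) (b := t₂) (l := atTop)
    (F := fun n t => ∫ x, balanceIntegrand α β N (Y n) t x)
    (f := fun t => ∫ x, balanceIntegrand α β N X t x) (fun _ => 6 * K * M)
    (Eventually.of_forall fun n => (hcut n 0).1.aestronglyMeasurable)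
    (Eventually.of_forall fun n => Eventually.of_forall fun t ht => hbM n t (hsub ht))
    intervalIntegrable_const (Eventually.of_forall fun t ht => hb t (hsub ht))
  have heq : ∀ n, ∫ t in t₁..t₂, ∫ x, balanceIntegrand α β N (Y n) t x
      = (∫ x, Y n (t₂, ‖x‖) * (α t₂ x + β t₂ x)) - ∫ x, Y n (t₁, ‖x‖) * (α t₁ x + β t₁ x) := fun n =>
    intervalIntegral.integral_eq_sub_of_hasDerivAt (fun t _ => (hcut n t).2)
      ((hcut n 0).1.intervalIntegrable _ _)
  refine ⟨?_, ?_⟩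
  · rw [intervalIntegrable_iff]
    refine IntegrableOn.of_bound (by simp) ?_ (6 * K * M) ?_
    · refine aestronglyMeasurable_of_tendsto_ae (μ := volume.restrict (Set.uIoc t₁ t₂))
        (atTop : Filter ℕ)
        (fun n => (hcut n 0).1.aestronglyMeasurable) ?_
      filter_upwards [ae_restrict_mem measurableSet_uIoc] with t ht using hb t (hsub ht)
    · filter_upwards [ae_restrict_mem measurableSet_uIoc] with t ht
      exact le_of_tendsto (hb t (hsub ht)).norm (Eventually.of_forall fun n => hbM n t (hsub ht))
  · refine tendsto_nhds_unique ?_ hT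
    simp only [heq]
    exact (ha t₂ ⟨ht, le_rfl⟩).sub (ha t₁ ⟨le_rfl, ht⟩)

end IsInwardFlow

end DefocusingWave

/-! ### Loss of inward energy and its monotonicity -/

namespace DefocusingWave

lemma dT_comp_snd {f : ℝ → ℝ} (hf : Differentiable ℝ f) (q : ℝ × ℝ) :
    dT (fun q => f q.2) q = 0 := by
  have h := (hf q.2).hasDerivAt.comp_hasFDerivAt q (hasFDerivAt_snd (𝕜 := ℝ) (E := ℝ) (F := ℝ))
  refine (congrArg (fun T : ℝ × ℝ →L[ℝ] ℝ => T (1, 0)) h.fderiv).trans ?_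
  simp

lemma dR_comp_snd {f : ℝ → ℝ} (hf : Differentiable ℝ f) (q : ℝ × ℝ) :
    dR (fun q => f q.2) q = deriv f q.2 := by
  have h := (hf q.2).hasDerivAt.comp_hasFDerivAt q (hasFDerivAt_snd (𝕜 := ℝ) (E := ℝ) (F := ℝ))
  refine (congrArg (fun T : ℝ × ℝ →L[ℝ] ℝ => T (0, 1)) h.fderiv).trans ?_
  simp

/-- The regularised indicator function of `r > 0`. -/
noncomputable def softStep (δ r : ℝ) : ℝ := r ^ 2 / (r ^ 2 + δ ^ 2)

section SoftStep

variable {δ : ℝ}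

lemma contDiff_softStep (hδ : 0 < δ) : ContDiff ℝ ∞ (softStep δ) :=
  (contDiff_id.pow 2).div ((contDiff_id.pow 2).add contDiff_const) fun r => by positivity

lemma deriv_softStep (hδ : 0 < δ) (r : ℝ) :
    deriv (softStep δ) r = 2 * r * δ ^ 2 / (r ^ 2 + δ ^ 2) ^ 2 := by
  have hne : r ^ 2 + δ ^ 2 ≠ 0 := by positivity
  have h := (hasDerivAt_pow 2 r).div ((hasDerivAt_pow 2 r).add_const (δ ^ 2)) hne
  refine h.deriv.trans ?_
  field_simp
  push_cast
  ring

lemma softStep_nonneg (δ r : ℝ) : 0 ≤ softStep δ r := by unfold softStep; positivity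

lemma softStep_le_one (δ r : ℝ) : softStep δ r ≤ 1 :=
  div_le_one_of_le₀ (by nlinarith [sq_nonneg δ]) (by positivity)

/-- Linear vanishing at the axis, with a constant that may depend on δ, is what `integral_balance`
requires of a weight. -/
lemma softStep_le_mul (hδ : 0 < δ) {r : ℝ} (hr : 0 ≤ r) : softStep δ r ≤ δ⁻¹ * r := by
  rw [softStep, div_le_iff₀ (by positivity), ← sub_nonneg]
  have : δ⁻¹ * r * (r ^ 2 + δ ^ 2) - r ^ 2 = δ⁻¹ * r * (r ^ 2 + δ ^ 2 - δ * r) := by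
    field_simp
  rw [this]
  have : 0 ≤ r ^ 2 + δ ^ 2 - δ * r := by nlinarith [sq_nonneg (r - δ)]
  positivity

lemma deriv_softStep_mem (hδ : 0 < δ) {r : ℝ} (hr : 0 ≤ r) :
    0 ≤ deriv (softStep δ) r ∧ deriv (softStep δ) r ≤ δ⁻¹ := by
  rw [deriv_softStep hδ]
  refine ⟨by positivity, ?_⟩
  rw [div_le_iff₀ (by positivity), inv_mul_eq_div, le_div_iff₀ hδ]
  nlinarith [sq_nonneg (r - δ), sq_nonneg (r ^ 2 - δ ^ 2), mul_nonneg hr hδ.le,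
    mul_nonneg (mul_nonneg hr hδ.le) (sq_nonneg (r - δ)), sq_nonneg (r ^ 2), sq_nonneg (r * δ)]

lemma tendsto_softStep {r : ℝ} (hr : 0 < r) :
    Tendsto (fun n : ℕ => softStep (1 / ((n : ℝ) + 1)) r) atTop (𝓝 1) := by
  have h1 := (tendsto_one_div_add_atTop_nhds_zero_nat (𝕜 := ℝ)).pow 2
  have h2 := (tendsto_const_nhds (x := r ^ 2)).div ((tendsto_const_nhds (x := r ^ 2)).add h1)
    (by positivity)
  have : r ^ 2 / (r ^ 2 + 0 ^ 2) = 1 := by field_simp; simp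
  rw [this] at h2
  exact h2

end SoftStep

/-- The mass of a continuous density. -/
noncomputable def mass (ρ : ℝ → Space → ℝ) (t : ℝ) : ℝ := ∫ x, ρ t x

/-- Space-time restricted to a time interval. -/
noncomputable def slab (t₁ t₂ : ℝ) : Measure (ℝ × Space) :=
  (volume.restrict (Set.Icc t₁ t₂)).prod volume

instance (t₁ t₂ : ℝ) : SFinite (slab t₁ t₂) := by unfold slab; infer_instance

lemma slab_eq_restrict (t₁ t₂ : ℝ) :
    slab t₁ t₂ = (volume : Measure (ℝ × Space)).restrict (Set.Icc t₁ t₂ ×ˢ Set.univ) := by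
  rw [slab, Measure.volume_eq_prod, ← Measure.prod_restrict, Measure.restrict_univ]

lemma integral_slab {f : ℝ × Space → ℝ} {t₁ t₂ : ℝ} (ht : t₁ ≤ t₂) (hf : Integrable f (slab t₁ t₂)) :
    ∫ z, f z ∂slab t₁ t₂ = ∫ t in t₁..t₂, ∫ x, f (t, x) := by
  rw [intervalIntegral.integral_of_le ht, ← integral_Icc_eq_integral_Ioc]
  exact integral_prod f hf

lemma IsContDensity.integrable_slab {ρ : ℝ → Space → ℝ} (h : IsContDensity ρ) (t₁ t₂ : ℝ)
    {w : ℝ × Space → ℝ} (hw : AEStronglyMeasurable w) {B : ℝ} (hB : ∀ z, |w z| ≤ B) :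
    Integrable (fun z => w z * ρ z.1 z.2) (slab t₁ t₂) := by
  set S : Set (ℝ × Space) := Set.Icc t₁ t₂ ×ˢ Set.univ
  have hS : MeasurableSet S := measurableSet_Icc.prod MeasurableSet.univ
  have hB0 : 0 ≤ B := (abs_nonneg _).trans (hB 0)
  have h1 := h.integrable_prod (k := S.indicator w) (B := B) (T := max |t₁| |t₂|)
    (hw.indicator hS) (fun z => by
      by_cases hz : z ∈ S
      · rw [Set.indicator_of_mem hz]; exact hB z
      · rw [Set.indicator_of_notMem hz, abs_zero]; exact hB0) fun z hz => by
      rw [Set.indicator_of_notMem]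
      intro hzS
      refine hz ⟨?_, ?_⟩
      · linarith [hzS.1.1, neg_abs_le t₁, le_max_left |t₁| |t₂|]
      · linarith [hzS.1.2, le_abs_self t₂, le_max_right |t₁| |t₂|]
  rw [slab_eq_restrict]
  refine h1.restrict (s := S) |>.congr ?_
  filter_upwards [ae_restrict_mem hS] with z hz
  rw [Set.indicator_of_mem hz]

namespace IsInwardFlow

variable {α β N : ℝ → Space → ℝ}

lemma continuous_mass (h : IsInwardFlow α β N) : Continuous (mass fun t x => α t x + β t x) :=
  h.density_energy.continuous_mass

lemma tendsto_softStep_mass (h : IsInwardFlow α β N) (t : ℝ) :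
    Tendsto (fun n : ℕ => ∫ x, softStep (1 / ((n : ℝ) + 1)) ‖x‖ * (α t x + β t x)) atTop
      (𝓝 (mass (fun t x => α t x + β t x) t)) := by
  have hn : ∀ n : ℕ, 0 < 1 / ((n : ℝ) + 1) := fun n => by positivity
  have h0 := h.density_energy.nonneg t
  refine tendsto_integral_of_dominated_convergence (fun x => α t x + β t x)
    (fun n => ((contDiff_softStep (hn n)).continuous.comp continuous_norm).aestronglyMeasurable.mul
      (h.density_energy.integrable t).1) (h.density_energy.integrable t)
    (fun n => Eventually.of_forall fun x => ?_) ?_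
  · rw [norm_mul, Real.norm_of_nonneg (h0 x), Real.norm_of_nonneg (softStep_nonneg _ _)]
    exact mul_le_of_le_one_left (h0 x) (softStep_le_one _ _)
  · have hae : ∀ᵐ x : Space, x ≠ 0 := by simp [ae_iff]
    filter_upwards [hae] with x hx
    simpa using (tendsto_softStep (norm_pos_iff.2 hx)).mul_const (α t x + β t x)

/-- The regularised weight of the loss term. -/
noncomputable def softWeight (δ r : ℝ) : ℝ := r ^ 3 / (r ^ 2 + δ ^ 2) ^ 2

lemma softWeight_mem {δ r : ℝ} (hδ : 0 < δ) (hr : 0 ≤ r) :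
    0 ≤ softWeight δ r ∧ softWeight δ r ≤ δ⁻¹ := by
  unfold softWeight
  refine ⟨by positivity, ?_⟩
  rw [div_le_iff₀ (by positivity), inv_mul_eq_div, le_div_iff₀ hδ]
  nlinarith [mul_nonneg (sq_nonneg r) (sq_nonneg (r - δ)), mul_nonneg hr hδ.le, sq_nonneg (r ^ 2),
    sq_nonneg (r * δ), sq_nonneg (δ ^ 2)]

lemma continuous_softWeight {δ : ℝ} (hδ : 0 < δ) : Continuous (softWeight δ) := by
  unfold softWeight
  exact (continuous_id.pow 3).div (by fun_prop) fun r => by positivity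

/-- For a weight X(r) with X' ≥ 0 the α term has the good sign, and 2β ≤ N bounds the β term by
½X'N. What is left of the loss has the weight X/r - ½X', non-negative for this step function. -/
lemma integral_softWeight_le (h : IsInwardFlow α β N) {δ : ℝ} (hδ : 0 < δ) {t₁ t₂ : ℝ}
    (ht : t₁ ≤ t₂) : ∫ t in t₁..t₂, ∫ x, softWeight δ ‖x‖ * N t x
      ≤ (∫ x, softStep δ ‖x‖ * (α t₁ x + β t₁ x)) - ∫ x, softStep δ ‖x‖ * (α t₂ x + β t₂ x) := by
  have hs := contDiff_softStep hδ
  have hsd : Differentiable ℝ (softStep δ) := hs.differentiable (by simp)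
  have hδ' : 0 < δ⁻¹ := inv_pos.2 hδ
  have hwc := continuous_softWeight hδ
  have hwB : ∀ x : Space, |softWeight δ ‖x‖| ≤ δ⁻¹ := fun x => by
    have := softWeight_mem hδ (norm_nonneg x)
    rw [abs_of_nonneg this.1]; exact this.2
  obtain ⟨hi, hb⟩ := h.integral_balance (X := fun q => softStep δ q.2) (hs.comp contDiff_snd)
    (C := 1 + δ⁻¹) ht
    (fun t _ r hr => by
      simp only
      rw [abs_of_nonneg (softStep_nonneg _ _)]
      linarith [softStep_le_one δ r])
    (fun t _ r hr => by
      simp only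
      rw [abs_of_nonneg (softStep_nonneg _ _)]
      nlinarith [softStep_le_mul hδ hr])
    (fun t _ r hr => by rw [dT_comp_snd hsd, abs_zero]; positivity)
    (fun t _ r hr => by
      rw [dR_comp_snd hsd, abs_of_nonneg (deriv_softStep_mem hδ hr).1]
      linarith [(deriv_softStep_mem hδ hr).2])
  have hcont : Continuous fun t => ∫ x, softWeight δ ‖x‖ * N t x :=
    h.density_N.continuous _ (hwc.comp continuous_norm).measurable ⟨_, hwB⟩
  have hmono : ∫ t in t₁..t₂, ∫ x, balanceIntegrand α β N (fun q => softStep δ q.2) t x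
      ≤ ∫ t in t₁..t₂, -∫ x, softWeight δ ‖x‖ * N t x := by
    refine intervalIntegral.integral_mono_on ht hi (hcont.neg.intervalIntegrable _ _) fun t _ => ?_
    rw [← integral_neg]
    have hbi : Integrable (balanceIntegrand α β N (fun q => softStep δ q.2) t) := by
      refine ((h.density_energy.integrable t).const_mul (6 * (1 + δ⁻¹))).mono'
        (h.aestronglyMeasurable_balanceIntegrand (hs.comp contDiff_snd) t)
        (Eventually.of_forall fun x => h.abs_balanceIntegrand_le ?_ ?_ ?_)
      · rw [dT_comp_snd hsd, abs_zero]; positivity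
      · rw [dR_comp_snd hsd, abs_of_nonneg (deriv_softStep_mem hδ (norm_nonneg x)).1]
        linarith [(deriv_softStep_mem hδ (norm_nonneg x)).2]
      · simp only
        rw [abs_of_nonneg (softStep_nonneg _ _)]
        nlinarith [softStep_le_mul hδ (norm_nonneg x), norm_nonneg x]
    refine integral_mono hbi (h.density_N.integrable_mul
      (hwc.comp continuous_norm).aestronglyMeasurable hwB t).neg fun x => ?_
    have hr := norm_nonneg x
    simp only [balanceIntegrand, dT_comp_snd hsd, dR_comp_snd hsd, zero_sub, zero_add]
    have h1 := mul_nonneg (deriv_softStep_mem hδ hr).1 (h.density_α.nonneg t x)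
    have h2 := mul_le_mul_of_nonneg_left (h.le_N t x) (deriv_softStep_mem hδ hr).1
    -- r/(r²+δ²) - rδ²/(r²+δ²)² = r³/(r²+δ²)², which tends to 1/r as δ → 0.
    have h3 : softStep δ ‖x‖ / ‖x‖ - 1 / 2 * deriv (softStep δ) ‖x‖ = softWeight δ ‖x‖ := by
      rw [deriv_softStep hδ, softStep, softWeight]
      rcases hr.eq_or_lt with h0 | h0
      · rw [← h0]; simp
      · field_simp
        ring
    rw [← h3]
    linarith
  rw [intervalIntegral.integral_neg] at hmono
  linarith

/-- The loss of inward energy is controlled by its decrease. -/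
lemma lintegral_bulk_le (h : IsInwardFlow α β N) {t₁ t₂ : ℝ} (ht : t₁ ≤ t₂) :
    ∫⁻ t in Set.Icc t₁ t₂, ∫⁻ x, ENNReal.ofReal (N t x / ‖x‖)
      ≤ ENNReal.ofReal (mass (fun t x => α t x + β t x) t₁ - mass (fun t x => α t x + β t x) t₂) := by
  set δ : ℕ → ℝ := fun n => 1 / ((n : ℝ) + 1) with hδd
  have hδ : ∀ n, 0 < δ n := fun n => by simp only [hδd]; positivity
  have hN0 := h.density_N.nonneg
  have hwN : ∀ n t x, 0 ≤ softWeight (δ n) ‖x‖ * N t x := fun n t x =>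
    mul_nonneg (softWeight_mem (hδ n) (norm_nonneg x)).1 (hN0 t x)
  have hwB : ∀ n (x : Space), |softWeight (δ n) ‖x‖| ≤ (δ n)⁻¹ := fun n x => by
    have := softWeight_mem (hδ n) (norm_nonneg x)
    rw [abs_of_nonneg this.1]; exact this.2
  have hwi : ∀ n t, Integrable fun x => softWeight (δ n) ‖x‖ * N t x := fun n t =>
    h.density_N.integrable_mul
      ((continuous_softWeight (hδ n)).comp continuous_norm).aestronglyMeasurable (hwB n) t
  have hcont : ∀ n, Continuous fun t => ∫ x, softWeight (δ n) ‖x‖ * N t x := fun n =>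
    h.density_N.continuous _ ((continuous_softWeight (hδ n)).comp continuous_norm).measurable
      ⟨_, hwB n⟩
  have hinner : ∀ n t, ∫⁻ x, ENNReal.ofReal (softWeight (δ n) ‖x‖ * N t x)
      = ENNReal.ofReal (∫ x, softWeight (δ n) ‖x‖ * N t x) := fun n t =>
    (ofReal_integral_eq_lintegral_ofReal (hwi n t) (Eventually.of_forall (hwN n t))).symm
  have hlim : ∀ t x, ENNReal.ofReal (N t x / ‖x‖)
      = liminf (fun n => ENNReal.ofReal (softWeight (δ n) ‖x‖ * N t x)) atTop := by
    intro t x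
    have h1 : Tendsto (fun n => softWeight (δ n) ‖x‖ * N t x) atTop (𝓝 (N t x / ‖x‖)) := by
      rcases (norm_nonneg x).eq_or_lt with h0 | h0
      · rw [← h0]; simp [softWeight]
      · have h2 := (tendsto_softStep h0).pow 2
        have h3 := (h2.mul_const (‖x‖⁻¹)).mul_const (N t x)
        refine (h3.congr fun n => ?_).trans (le_of_eq ?_)
        · simp only [softStep, softWeight, hδd]
          field_simp
        · congr 1
          field_simp
    exact ((ENNReal.continuous_ofReal.tendsto _).comp h1).liminf_eq.symm
  calc ∫⁻ t in Set.Icc t₁ t₂, ∫⁻ x, ENNReal.ofReal (N t x / ‖x‖)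
      ≤ ∫⁻ t in Set.Icc t₁ t₂, liminf (fun n =>
          ENNReal.ofReal (∫ x, softWeight (δ n) ‖x‖ * N t x)) atTop := by
        refine lintegral_mono fun t => ?_
        simp only [hlim, ← hinner]
        exact lintegral_liminf_le' fun n => (hwi n t).1.aemeasurable.ennreal_ofReal
    _ ≤ liminf (fun n => ∫⁻ t in Set.Icc t₁ t₂,
          ENNReal.ofReal (∫ x, softWeight (δ n) ‖x‖ * N t x)) atTop :=
        lintegral_liminf_le fun n => (hcont n).measurable.ennreal_ofReal
    _ ≤ liminf (fun n => ENNReal.ofReal ((∫ x, softStep (δ n) ‖x‖ * (α t₁ x + β t₁ x))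
          - ∫ x, softStep (δ n) ‖x‖ * (α t₂ x + β t₂ x))) atTop := by
        refine liminf_le_liminf (Eventually.of_forall fun n => ?_)
        rw [← ofReal_integral_eq_lintegral_ofReal ((hcont n).integrableOn_Icc)
          (Eventually.of_forall fun t => integral_nonneg (hwN n t)), integral_Icc_eq_integral_Ioc,
          ← intervalIntegral.integral_of_le ht]
        exact ENNReal.ofReal_le_ofReal (h.integral_softWeight_le (hδ n) ht)
    _ = _ := ((ENNReal.continuous_ofReal.tendsto _).comp
        ((h.tendsto_softStep_mass t₁).sub (h.tendsto_softStep_mass t₂))).liminf_eq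

lemma aestronglyMeasurable_bulk (h : IsInwardFlow α β N) :
    AEStronglyMeasurable fun z : ℝ × Space => N z.1 z.2 / ‖z.2‖ := by
  simp only [div_eq_mul_inv]
  exact h.density_N.aesm.mul (measurable_snd.norm.inv).aestronglyMeasurable

lemma bulk_nonneg (h : IsInwardFlow α β N) (t : ℝ) (x : Space) : 0 ≤ N t x / ‖x‖ :=
  div_nonneg (h.density_N.nonneg t x) (norm_nonneg x)

lemma mass_nonneg (h : IsInwardFlow α β N) (t : ℝ) : 0 ≤ mass (fun t x => α t x + β t x) t :=
  integral_nonneg (h.density_energy.nonneg t)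

lemma lintegral_slab_bulk {t₁ t₂ : ℝ}
    (hm : AEStronglyMeasurable (fun z : ℝ × Space => N z.1 z.2 / ‖z.2‖) (slab t₁ t₂)) :
    ∫⁻ z, ENNReal.ofReal (N z.1 z.2 / ‖z.2‖) ∂slab t₁ t₂
      = ∫⁻ t in Set.Icc t₁ t₂, ∫⁻ x, ENNReal.ofReal (N t x / ‖x‖) :=
  lintegral_prod (fun z : ℝ × Space => ENNReal.ofReal (N z.1 z.2 / ‖z.2‖))
    hm.aemeasurable.ennreal_ofReal

lemma integrable_bulk (h : IsInwardFlow α β N) {t₁ t₂ : ℝ} (ht : t₁ ≤ t₂) :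
    Integrable (fun z : ℝ × Space => N z.1 z.2 / ‖z.2‖) (slab t₁ t₂) := by
  have hm : AEStronglyMeasurable (fun z : ℝ × Space => N z.1 z.2 / ‖z.2‖) (slab t₁ t₂) := by
    rw [slab_eq_restrict]; exact h.aestronglyMeasurable_bulk.restrict
  refine ⟨hm, ?_⟩
  have h0 : ∀ z : ℝ × Space, 0 ≤ N z.1 z.2 / ‖z.2‖ := fun z => h.bulk_nonneg z.1 z.2
  rw [hasFiniteIntegral_iff_ofReal (Eventually.of_forall h0), lintegral_slab_bulk hm]
  exact (h.lintegral_bulk_le ht).trans_lt ENNReal.ofReal_lt_top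

lemma intervalIntegrable_bulk (h : IsInwardFlow α β N) (a b : ℝ) :
    IntervalIntegrable (fun t => ∫ x, N t x / ‖x‖) volume a b := by
  have key : ∀ {a b : ℝ}, a ≤ b → IntervalIntegrable (fun t => ∫ x, N t x / ‖x‖) volume a b := by
    intro a b hab
    rw [intervalIntegrable_iff_integrableOn_Icc_of_le hab]
    exact (h.integrable_bulk hab).integral_prod_left
  rcases le_total a b with hab | hab
  · exact key hab
  · exact (key hab).symm

lemma integral_bulk_le (h : IsInwardFlow α β N) {t₁ t₂ : ℝ} (ht : t₁ ≤ t₂) :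
    ∫ t in t₁..t₂, ∫ x, N t x / ‖x‖
      ≤ mass (fun t x => α t x + β t x) t₁ - mass (fun t x => α t x + β t x) t₂ := by
  have hi := h.integrable_bulk ht
  have h0 : ∀ z : ℝ × Space, 0 ≤ N z.1 z.2 / ‖z.2‖ := fun z => h.bulk_nonneg z.1 z.2
  have hle := h.lintegral_bulk_le ht
  have heq : ENNReal.ofReal (∫ t in t₁..t₂, ∫ x, N t x / ‖x‖)
      = ∫⁻ t in Set.Icc t₁ t₂, ∫⁻ x, ENNReal.ofReal (N t x / ‖x‖) := by
    rw [← integral_slab ht hi, ofReal_integral_eq_lintegral_ofReal hi (Eventually.of_forall h0),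
      lintegral_slab_bulk hi.1]
  rw [← heq] at hle
  by_contra hcon
  rw [not_le] at hcon
  -- The inequality between `ENNReal.ofReal` values forgets the sign of the right-hand side, so a
  -- non-positive difference of masses is treated directly with the regularised steps.
  rcases le_or_gt (mass (fun t x => α t x + β t x) t₁ - mass (fun t x => α t x + β t x) t₂) 0
    with hm | hm
  · rw [ENNReal.ofReal_of_nonpos hm, nonpos_iff_eq_zero, ENNReal.ofReal_eq_zero] at hle
    have hpos : ∀ n : ℕ, 0 ≤ (∫ x, softStep (1 / ((n : ℝ) + 1)) ‖x‖ * (α t₁ x + β t₁ x))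
        - ∫ x, softStep (1 / ((n : ℝ) + 1)) ‖x‖ * (α t₂ x + β t₂ x) := fun n =>
      le_trans (intervalIntegral.integral_nonneg ht fun t _ => integral_nonneg fun x =>
        mul_nonneg (softWeight_mem (by positivity) (norm_nonneg x)).1 (h.density_N.nonneg t x))
        (h.integral_softWeight_le (δ := 1 / ((n : ℝ) + 1)) (by positivity) ht)
    have := ge_of_tendsto ((h.tendsto_softStep_mass t₁).sub (h.tendsto_softStep_mass t₂))
      (Eventually.of_forall hpos)
    linarith
  · exact absurd (ENNReal.ofReal_le_ofReal_iff hm.le |>.1 hle) (not_le.2 hcon)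

/-- The inward energy plus the accumulated loss. -/
noncomputable def totalLoss (α β N : ℝ → Space → ℝ) (t : ℝ) : ℝ :=
  mass (fun t x => α t x + β t x) t + ∫ s in (0 : ℝ)..t, ∫ x, N s x / ‖x‖

lemma continuous_totalLoss (h : IsInwardFlow α β N) : Continuous (totalLoss α β N) :=
  h.continuous_mass.add (intervalIntegral.continuous_primitive h.intervalIntegrable_bulk 0)

lemma totalLoss_sub (h : IsInwardFlow α β N) (t₁ t₂ : ℝ) :
    totalLoss α β N t₁ - totalLoss α β N t₂ = mass (fun t x => α t x + β t x) t₁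
      - mass (fun t x => α t x + β t x) t₂ - ∫ t in t₁..t₂, ∫ x, N t x / ‖x‖ := by
  have := intervalIntegral.integral_interval_sub_left (h.intervalIntegrable_bulk 0 t₂)
    (h.intervalIntegrable_bulk 0 t₁)
  unfold totalLoss
  linarith

/-- The decrease of this function is the part of the energy loss not explained by the bulk term,
namely what reaches the axis; its sign makes the flux measure positive. -/
lemma antitone_totalLoss (h : IsInwardFlow α β N) : Antitone (totalLoss α β N) := by
  intro t₁ t₂ ht
  linarith [h.totalLoss_sub t₁ t₂, h.integral_bulk_le ht]

lemma totalLoss_nonneg (h : IsInwardFlow α β N) (t : ℝ) : 0 ≤ totalLoss α β N t := by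
  have key : ∀ t, 0 ≤ t → 0 ≤ totalLoss α β N t := fun t ht =>
    add_nonneg (h.mass_nonneg t) (intervalIntegral.integral_nonneg ht fun s _ =>
      integral_nonneg (h.bulk_nonneg s))
  rcases le_total 0 t with ht | ht
  · exact key t ht
  · exact (key 0 le_rfl).trans (h.antitone_totalLoss ht)

/-- For t ≤ 0 the accumulated loss counts with a negative sign, so the energy bound suffices there;
for t ≥ 0 monotonicity compares with t = 0. -/
lemma exists_totalLoss_le (h : IsInwardFlow α β N) : ∃ M, ∀ t, totalLoss α β N t ≤ M := by
  obtain ⟨M, hM⟩ := h.bounded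
  refine ⟨M, fun t => ?_⟩
  rcases le_total 0 t with ht | ht
  · refine (h.antitone_totalLoss ht).trans ?_
    rw [totalLoss, intervalIntegral.integral_same, add_zero]
    exact hM 0
  · have h1 : 0 ≤ ∫ s in t..0, ∫ x, N s x / ‖x‖ :=
      intervalIntegral.integral_nonneg ht fun s _ => integral_nonneg (h.bulk_nonneg s)
    rw [totalLoss, intervalIntegral.integral_symm]
    have := hM t
    unfold mass
    linarith

end IsInwardFlow

end DefocusingWave

namespace DefocusingWave

/-! ### Polar coordinates and cylinders -/

section Polar

/-- The radial part `r² dr` of Lebesgue measure in polar coordinates. -/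
noncomputable def radialMeasure : Measure ℝ :=
  (volume.restrict (Set.Ioi 0)).withDensity fun r => ENNReal.ofReal (r ^ 2)

instance : SFinite radialMeasure := by unfold radialMeasure; infer_instance

lemma map_volumeIoiPow :
    (Measure.volumeIoiPow 2).map (Subtype.val : Set.Ioi (0 : ℝ) → ℝ) = radialMeasure := by
  ext s hs
  rw [Measure.map_apply measurable_subtype_coe hs, Measure.volumeIoiPow,
    withDensity_apply _ (measurable_subtype_coe hs), radialMeasure, withDensity_apply _ hs,
    Measure.restrict_restrict hs,
    setLIntegral_subtype measurableSet_Ioi _ fun a : ℝ => ENNReal.ofReal (a ^ 2)]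
  congr 2
  ext r
  simp [and_comm]

lemma integral_radialMeasure (f : ℝ → ℝ) :
    ∫ r, f r ∂radialMeasure = ∫ r in Set.Ioi 0, f r * r ^ 2 := by
  rw [radialMeasure, integral_withDensity_eq_integral_toReal_smul (by fun_prop) (by simp)]
  refine integral_congr_ae (Eventually.of_forall fun r => ?_)
  simp only [smul_eq_mul]
  rw [ENNReal.toReal_ofReal (sq_nonneg r), mul_comm]

lemma integrable_radialMeasure {f : ℝ → ℝ} (hf : Integrable f radialMeasure) :
    IntegrableOn (fun r => f r * r ^ 2) (Set.Ioi 0) := by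
  rw [radialMeasure, integrable_withDensity_iff_integrable_smul' (by fun_prop) (by simp)] at hf
  refine hf.congr (Eventually.of_forall fun r => ?_)
  simp only [smul_eq_mul]
  rw [ENNReal.toReal_ofReal (sq_nonneg r), mul_comm]

lemma ae_radialMeasure : ∀ᵐ r ∂radialMeasure, 0 < r :=
  (withDensity_absolutelyContinuous _ _).ae_le (ae_restrict_mem measurableSet_Ioi)

lemma measurePreserving_polar :
    MeasurePreserving (fun q : Metric.sphere (0 : Space) 1 × ℝ => q.2 • (q.1 : Space))
      ((volume : Measure Space).toSphere.prod radialMeasure) volume := by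
  have hm : Measurable fun q : Metric.sphere (0 : Space) 1 × ℝ => q.2 • (q.1 : Space) := by fun_prop
  refine ⟨hm, ?_⟩
  have h1 := (volume : Measure Space).measurePreserving_homeomorphUnitSphereProd
  have hd : Module.finrank ℝ Space - 1 = 2 := by simp
  rw [hd] at h1
  have h2 : MeasurePreserving (homeomorphUnitSphereProd Space).symm
      ((volume : Measure Space).toSphere.prod (Measure.volumeIoiPow 2))
      ((volume : Measure Space).comap (Subtype.val : ({0}ᶜ : Set Space) → Space)) :=
    MeasurePreserving.symm (homeomorphUnitSphereProd Space).toMeasurableEquiv h1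
  have h3 : MeasurePreserving (Subtype.val : ({0}ᶜ : Set Space) → Space)
      ((volume : Measure Space).comap Subtype.val) (volume.restrict {0}ᶜ) :=
    measurePreserving_subtype_coe (measurableSet_singleton _).compl
  rw [restrict_compl_singleton] at h3
  have h4 := (h3.comp h2).map_eq
  have h5 : MeasurePreserving (Prod.map id Subtype.val)
      ((volume : Measure Space).toSphere.prod (Measure.volumeIoiPow 2))
      ((volume : Measure Space).toSphere.prod radialMeasure) :=
    (MeasurePreserving.id _).prod ⟨measurable_subtype_coe, map_volumeIoiPow⟩
  rw [← h5.map_eq, Measure.map_map hm h5.measurable]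
  refine Eq.trans ?_ h4
  congr 1

lemma measurePreserving_polar_slab (t₁ t₂ : ℝ) :
    MeasurePreserving
      (fun q : ℝ × ℝ × Metric.sphere (0 : Space) 1 => (q.2.1, q.1 • (q.2.2 : Space)))
      (radialMeasure.prod ((volume.restrict (Set.Icc t₁ t₂)).prod (volume : Measure Space).toSphere))
      (slab t₁ t₂) :=
  (((MeasurePreserving.id _).prod measurePreserving_polar).comp
    (measurePreserving_prodAssoc _ _ _)).comp Measure.measurePreserving_swap

/-- The integral of `f` over the cylinder of radius `r`. -/
noncomputable def cylinderIntegral (f : ℝ × Space → ℝ) (t₁ t₂ r : ℝ) : ℝ :=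
  ∫ t in Set.Icc t₁ t₂, ∫ θ : Metric.sphere (0 : Space) 1, f (t, r • (θ : Space))
    ∂(volume : Measure Space).toSphere

/-- Fubini on the cylinder is available only for radii on which f is integrable, that is for almost
every r. The iterated form is the one in the definition of the flux. -/
lemma cylinderIntegral_ae_eq {f : ℝ × Space → ℝ} {t₁ t₂ : ℝ} (hf : Integrable f (slab t₁ t₂)) :
    (fun r => ∫ q : ℝ × Metric.sphere (0 : Space) 1, f (q.1, r • (q.2 : Space))
      ∂((volume.restrict (Set.Icc t₁ t₂)).prod (volume : Measure Space).toSphere))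
      =ᵐ[radialMeasure] cylinderIntegral f t₁ t₂ := by
  have h1 := ((measurePreserving_polar_slab t₁ t₂).integrable_comp hf.1).2 hf
  filter_upwards [h1.prod_right_ae] with r hr
  exact integral_prod _ hr

lemma integrable_cylinderIntegral {f : ℝ × Space → ℝ} {t₁ t₂ : ℝ}
    (hf : Integrable f (slab t₁ t₂)) : Integrable (cylinderIntegral f t₁ t₂) radialMeasure :=
  (((measurePreserving_polar_slab t₁ t₂).integrable_comp hf.1).2 hf).integral_prod_left.congr
    (cylinderIntegral_ae_eq hf)

lemma integral_slab_eq_cylinderIntegral {f : ℝ × Space → ℝ} {t₁ t₂ : ℝ}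
    (hf : Integrable f (slab t₁ t₂)) :
    ∫ z, f z ∂slab t₁ t₂ = ∫ r, cylinderIntegral f t₁ t₂ r ∂radialMeasure := by
  have hP := measurePreserving_polar_slab t₁ t₂
  have h1 := (hP.integrable_comp hf.1).2 hf
  rw [← integral_congr_ae (cylinderIntegral_ae_eq hf), ← hP.map_eq,
    integral_map hP.aemeasurable (by rw [hP.map_eq]; exact hf.1)]
  exact integral_prod _ h1

lemma integral_radial_slab {f : ℝ × Space → ℝ} {t₁ t₂ : ℝ} (hf : Integrable f (slab t₁ t₂))
    {w : ℝ → ℝ} (hw : Measurable w) {B : ℝ} (hB : ∀ r, |w r| ≤ B) :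
    ∫ z, w ‖z.2‖ * f z ∂slab t₁ t₂
      = ∫ r in Set.Ioi 0, w r * (cylinderIntegral f t₁ t₂ r * r ^ 2) := by
  have hi : Integrable (fun z : ℝ × Space => w ‖z.2‖ * f z) (slab t₁ t₂) :=
    hf.bdd_mul (c := B) (hw.comp measurable_snd.norm).aestronglyMeasurable
      (Eventually.of_forall fun z => hB _)
  have h1 : cylinderIntegral (fun z => w ‖z.2‖ * f z) t₁ t₂
      =ᵐ[radialMeasure] fun r => w r * cylinderIntegral f t₁ t₂ r := by
    filter_upwards [ae_radialMeasure] with r hr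
    have h2 : ∀ θ : Metric.sphere (0 : Space) 1, ‖r • (θ : Space)‖ = r := fun θ => by
      rw [norm_smul, Real.norm_of_nonneg hr.le, norm_eq_of_mem_sphere, mul_one]
    simp only [cylinderIntegral, h2, integral_const_mul]
  rw [integral_slab_eq_cylinderIntegral hi, integral_congr_ae h1, integral_radialMeasure]
  simp only [mul_assoc]

end Polar

/-! ### Integrals over superlevel sets -/

section Tail

variable {Y : Type*} [MeasurableSpace Y] {m : Measure Y} {R ρ : Y → ℝ}

/-- The integral of `ρ` over the region where `R > s`. -/
noncomputable def tailIntegral (m : Measure Y) (R ρ : Y → ℝ) (s : ℝ) : ℝ :=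
  ∫ y, {y | s < R y}.indicator ρ y ∂m

lemma integrable_tail_prod (hR : Measurable R) (hρ : Integrable ρ m) {φ : ℝ → ℝ}
    (hφ : Integrable φ) :
    Integrable (fun q : ℝ × Y => φ q.1 * {y | q.1 < R y}.indicator ρ q.2) (volume.prod m) := by
  have hS : MeasurableSet {q : ℝ × Y | q.1 < R q.2} :=
    measurableSet_lt measurable_fst (hR.comp measurable_snd)
  refine ((hφ.mul_prod hρ).indicator hS).congr (Eventually.of_forall fun q => ?_)
  by_cases hq : q.1 < R q.2
  · simp [Set.indicator, hq]
  · simp [Set.indicator, hq]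

lemma integrable_mul_tailIntegral [SFinite m] (hR : Measurable R) (hρ : Integrable ρ m) {φ : ℝ → ℝ}
    (hφ : Integrable φ) : Integrable fun s => φ s * tailIntegral m R ρ s := by
  refine (integrable_tail_prod hR hρ hφ).integral_prod_left.congr (Eventually.of_forall fun s => ?_)
  simp only [integral_const_mul, tailIntegral]

/-- Fubini on {s < R(y)}: the inner integral is the primitive of φ at R(y). A weight given by a
primitive is thus a superposition of sharp cutoffs. -/
lemma integral_mul_tailIntegral [SFinite m] (hR : Measurable R) (hρ : Integrable ρ m) {φ : ℝ → ℝ}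
    (hφ : Integrable φ) : ∫ s, φ s * tailIntegral m R ρ s
      = ∫ y, (∫ s, (Set.Iio (R y)).indicator φ s) * ρ y ∂m := by
  have h := integral_integral_swap (f := fun s y => φ s * {y | s < R y}.indicator ρ y)
    (integrable_tail_prod hR hρ hφ)
  simp only [integral_const_mul] at h
  refine h.trans (integral_congr_ae (Eventually.of_forall fun y => ?_))
  simp only
  rw [← integral_mul_const]
  refine integral_congr_ae (Eventually.of_forall fun s => ?_)
  by_cases hs : s < R y
  · simp [Set.indicator, hs]
  · simp [Set.indicator, hs]

lemma locallyIntegrable_tailIntegral [SFinite m] (hR : Measurable R) (hρ : Integrable ρ m) :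
    LocallyIntegrable (tailIntegral m R ρ) := by
  rw [locallyIntegrable_iff]
  intro K hK
  have hi : Integrable (K.indicator fun _ => (1 : ℝ)) :=
    (integrable_indicator_iff hK.measurableSet).2 (integrableOn_const hK.measure_lt_top.ne)
  refine (integrable_indicator_iff hK.measurableSet).1
    ((integrable_mul_tailIntegral hR hρ hi).congr (Eventually.of_forall fun s => ?_))
  by_cases hs : s ∈ K <;> simp [hs]

lemma tendsto_tailIntegral (hR : Measurable R) (hR0 : ∀ᵐ y ∂m, 0 < R y) (hρ : Integrable ρ m) :
    Tendsto (tailIntegral m R ρ) (𝓝[>] 0) (𝓝 (∫ y, ρ y ∂m)) := by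
  refine tendsto_integral_filter_of_dominated_convergence (fun y => ‖ρ y‖)
    (Eventually.of_forall fun s => hρ.1.indicator (measurableSet_lt measurable_const hR))
    (Eventually.of_forall fun s => Eventually.of_forall fun y => norm_indicator_le_norm_self _ _)
    hρ.norm ?_
  filter_upwards [hR0] with y hy
  refine tendsto_const_nhds.congr' ?_
  filter_upwards [mem_nhdsWithin_of_mem_nhds (Iio_mem_nhds hy)] with s hs
  exact (Set.indicator_of_mem (s := {y | s < R y}) hs ρ).symm

end Tail

section Primitive

variable {φ : ℝ → ℝ}

lemma contDiff_primitive (hφ : ContDiff ℝ ∞ φ) : ContDiff ℝ ∞ fun r => ∫ s in (0 : ℝ)..r, φ s := by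
  rw [contDiff_infty_iff_deriv]
  have hd : ∀ r, HasDerivAt (fun r => ∫ s in (0 : ℝ)..r, φ s) (φ r) r := fun r =>
    hφ.continuous.integral_hasStrictDerivAt 0 r |>.hasDerivAt
  refine ⟨fun r => (hd r).differentiableAt, ?_⟩
  rwa [funext fun r => (hd r).deriv]

lemma deriv_primitive (hφ : Continuous φ) (r : ℝ) :
    deriv (fun r => ∫ s in (0 : ℝ)..r, φ s) r = φ r :=
  (hφ.integral_hasStrictDerivAt 0 r).hasDerivAt.deriv

lemma abs_primitive_le {B : ℝ} (hB : ∀ s, |φ s| ≤ B) {r : ℝ} (hr : 0 ≤ r) :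
    |∫ s in (0 : ℝ)..r, φ s| ≤ B * r := by
  have := intervalIntegral.norm_integral_le_of_norm_le_const (a := 0) (b := r) (f := φ) (C := B)
    fun s _ => hB s
  rwa [sub_zero, abs_of_nonneg hr] at this

lemma abs_primitive_le_integral (hi : Integrable φ) (r : ℝ) :
    |∫ s in (0 : ℝ)..r, φ s| ≤ ∫ s, |φ s| :=
  (intervalIntegral.norm_integral_le_integral_norm_uIoc).trans
    (setIntegral_le_integral hi.norm (Eventually.of_forall fun _ => norm_nonneg _))

lemma primitive_eq_integral_indicator (h0 : ∀ s, s ≤ 0 → φ s = 0) {r : ℝ} (hr : 0 ≤ r) :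
    ∫ s in (0 : ℝ)..r, φ s = ∫ s, (Set.Iio r).indicator φ s := by
  rw [integral_indicator measurableSet_Iio, intervalIntegral.integral_of_le hr,
    integral_Ioc_eq_integral_Ioo]
  refine (setIntegral_eq_of_subset_of_forall_sdiff_eq_zero measurableSet_Iio
    (fun s hs => hs.2) fun s hs => h0 s ?_).symm
  by_contra h
  exact hs.2 ⟨not_le.1 h, hs.1⟩

end Primitive

/-! ### The flux through small cylinders and the flux measure -/

namespace IsInwardFlow

variable {α β N : ℝ → Space → ℝ}

lemma integrable_flux (h : IsInwardFlow α β N) (t₁ t₂ : ℝ) :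
    Integrable (fun z : ℝ × Space => α z.1 z.2 - β z.1 z.2) (slab t₁ t₂) := by
  have h1 := h.density_α.integrable_slab t₁ t₂ (w := fun _ => 1) (B := 1)
    aestronglyMeasurable_const (by simp)
  have h2 := h.density_β.integrable_slab t₁ t₂ (w := fun _ => 1) (B := 1)
    aestronglyMeasurable_const (by simp)
  simpa only [one_mul] using! h1.sub h2

/-- The flux through the cylinder of radius `r`. -/
noncomputable def flux (α β : ℝ → Space → ℝ) (t₁ t₂ r : ℝ) : ℝ :=
  cylinderIntegral (fun z => α z.1 z.2 - β z.1 z.2) t₁ t₂ r * r ^ 2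

/-- The weight ζ(r) = ∫₀^r φ vanishes on the axis and has X_r = φ. The balance law then gives the
φ-average of the flux, while the terms weighted by ζ become tail integrals. -/
lemma integral_mul_flux (h : IsInwardFlow α β N) {t₁ t₂ : ℝ} (ht : t₁ ≤ t₂) {φ : ℝ → ℝ}
    (hφ : ContDiff ℝ ∞ φ) (hc : HasCompactSupport φ) (h0 : ∀ s, s ≤ 0 → φ s = 0) :
    ∫ s in Set.Ioi 0, φ s * flux α β t₁ t₂ s
      = (∫ s, φ s * tailIntegral volume norm (fun x => α t₁ x + β t₁ x) s)
        - (∫ s, φ s * tailIntegral volume norm (fun x => α t₂ x + β t₂ x) s)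
        - ∫ s, φ s * tailIntegral (slab t₁ t₂) (fun z => ‖z.2‖) (fun z => N z.1 z.2 / ‖z.2‖) s := by
  obtain ⟨B, hB⟩ := hc.exists_bound_of_continuous hφ.continuous
  have hφi : Integrable φ := hφ.continuous.integrable_of_hasCompactSupport hc
  set ζ : ℝ → ℝ := fun r => ∫ s in (0 : ℝ)..r, φ s with hζ
  have hζs : ContDiff ℝ ∞ ζ := contDiff_primitive hφ
  have hζd : Differentiable ℝ ζ := hζs.differentiable (by simp)
  have hB0 : 0 ≤ B := (abs_nonneg _).trans (hB 0)
  set I : ℝ := ∫ s, |φ s| with hI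
  have hI0 : 0 ≤ I := integral_nonneg fun _ => abs_nonneg _
  obtain ⟨hi, hb⟩ := h.integral_balance (X := fun q => ζ q.2) (hζs.comp contDiff_snd)
    (C := B + I) ht
    (fun t _ r hr => (abs_primitive_le_integral hφi r).trans (by linarith))
    (fun t _ r hr => (abs_primitive_le hB hr).trans (by nlinarith))
    (fun t _ r hr => by rw [dT_comp_snd hζd, abs_zero]; positivity)
    (fun t _ r hr => by
      rw [dR_comp_snd hζd, deriv_primitive hφ.continuous]
      exact (hB r).trans (by linarith))
  have hn : ∀ x : Space, ζ ‖x‖ = ∫ s, (Set.Iio ‖x‖).indicator φ s := fun x =>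
    primitive_eq_integral_indicator h0 (norm_nonneg x)
  have e1 : ∀ t, ∫ s, φ s * tailIntegral volume norm (fun x => α t x + β t x) s
      = ∫ x, ζ ‖x‖ * (α t x + β t x) := fun t => by
    rw [integral_mul_tailIntegral measurable_norm (h.density_energy.integrable t) hφi]
    simp only [hn]
  have hbulk := h.integrable_bulk ht
  have e2 : ∫ s, φ s * tailIntegral (slab t₁ t₂) (fun z => ‖z.2‖) (fun z => N z.1 z.2 / ‖z.2‖) s
      = ∫ z, ζ ‖z.2‖ * (N z.1 z.2 / ‖z.2‖) ∂slab t₁ t₂ := by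
    rw [integral_mul_tailIntegral measurable_snd.norm hbulk hφi]
    simp only [hn]
  have e3 : ∫ s in Set.Ioi 0, φ s * flux α β t₁ t₂ s
      = ∫ z, φ ‖z.2‖ * (α z.1 z.2 - β z.1 z.2) ∂slab t₁ t₂ :=
    (integral_radial_slab (h.integrable_flux t₁ t₂) hφ.continuous.measurable hB).symm
  have i1 : Integrable (fun z : ℝ × Space => φ ‖z.2‖ * (α z.1 z.2 - β z.1 z.2)) (slab t₁ t₂) :=
    (h.integrable_flux t₁ t₂).bdd_mul (c := B)
      (hφ.continuous.comp continuous_snd.norm).aestronglyMeasurable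
      (Eventually.of_forall fun z => hB _)
  have i2 : Integrable (fun z : ℝ × Space => ζ ‖z.2‖ * (N z.1 z.2 / ‖z.2‖)) (slab t₁ t₂) :=
    hbulk.bdd_mul (c := I) (hζs.continuous.comp continuous_snd.norm).aestronglyMeasurable
      (Eventually.of_forall fun z => abs_primitive_le_integral hφi _)
  have i3 : Integrable (fun z : ℝ × Space => -(φ ‖z.2‖ * (α z.1 z.2 - β z.1 z.2)
      + ζ ‖z.2‖ * (N z.1 z.2 / ‖z.2‖))) (slab t₁ t₂) := (i1.add i2).neg
  have e4 : ∫ t in t₁..t₂, ∫ x, balanceIntegrand α β N (fun q => ζ q.2) t x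
      = -((∫ z, φ ‖z.2‖ * (α z.1 z.2 - β z.1 z.2) ∂slab t₁ t₂)
        + ∫ z, ζ ‖z.2‖ * (N z.1 z.2 / ‖z.2‖) ∂slab t₁ t₂) := by
    rw [← integral_add i1 i2, ← integral_neg, integral_slab ht i3]
    refine intervalIntegral.integral_congr fun t _ => integral_congr_ae
      (Eventually.of_forall fun x => ?_)
    have hdR : dR (fun q => ζ q.2) (t, ‖x‖) = φ ‖x‖ :=
      (dR_comp_snd hζd _).trans (deriv_primitive hφ.continuous _)
    simp only [balanceIntegrand, dT_comp_snd hζd, hdR]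
    ring
  rw [e1, e1, e2, e3]
  rw [e4] at hb
  linarith

/-- The flux through small cylinders tends to the decrease of the total loss. -/
lemma tendsto_flux (h : IsInwardFlow α β N) {t₁ t₂ : ℝ} (ht : t₁ ≤ t₂) :
    Tendsto (flux α β t₁ t₂) (𝓝[>] 0 ⊓ ae volume)
      (𝓝 (totalLoss α β N t₁ - totalLoss α β N t₂)) := by
  have hbulk := h.integrable_bulk ht
  set T₁ := tailIntegral volume norm fun x => α t₁ x + β t₁ x with hT₁
  set T₂ := tailIntegral volume norm fun x => α t₂ x + β t₂ x with hT₂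
  set T₃ := tailIntegral (slab t₁ t₂) (fun z => ‖z.2‖) fun z => N z.1 z.2 / ‖z.2‖ with hT₃
  have l1 : LocallyIntegrable T₁ :=
    locallyIntegrable_tailIntegral measurable_norm (h.density_energy.integrable t₁)
  have l2 : LocallyIntegrable T₂ :=
    locallyIntegrable_tailIntegral measurable_norm (h.density_energy.integrable t₂)
  have l3 : LocallyIntegrable T₃ := locallyIntegrable_tailIntegral measurable_snd.norm hbulk
  have hfl : IntegrableOn (flux α β t₁ t₂) (Set.Ioi 0) :=
    integrable_radialMeasure (integrable_cylinderIntegral (h.integrable_flux t₁ t₂))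
  -- The flux and the combination of tails agree against every test function on (0,∞), hence for
  -- almost every radius. This is the origin of the null set of excluded radii.
  have hae : ∀ᵐ s, s ∈ Set.Ioi (0 : ℝ) → flux α β t₁ t₂ s - (T₁ s - T₂ s - T₃ s) = 0 := by
    refine isOpen_Ioi.ae_eq_zero_of_integral_contDiff_smul_eq_zero
      (f := fun s => flux α β t₁ t₂ s - (T₁ s - T₂ s - T₃ s))
      (hfl.locallyIntegrableOn.sub (((l1.sub l2).sub l3).locallyIntegrableOn _)) ?_
    intro φ hφ hc hs
    have h0 : ∀ s, s ≤ 0 → φ s = 0 := fun s hs0 =>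
      image_eq_zero_of_notMem_tsupport fun hm => not_lt.2 hs0 (hs hm)
    have hφi : Integrable φ := hφ.continuous.integrable_of_hasCompactSupport hc
    obtain ⟨B, hB⟩ := hc.exists_bound_of_continuous hφ.continuous
    have j1 := integrable_mul_tailIntegral measurable_norm (h.density_energy.integrable t₁) hφi
    have j2 := integrable_mul_tailIntegral measurable_norm (h.density_energy.integrable t₂) hφi
    have j3 := integrable_mul_tailIntegral measurable_snd.norm hbulk hφi
    have j0 : Integrable fun s => φ s * (Set.Ioi 0).indicator (flux α β t₁ t₂) s :=
      ((integrable_indicator_iff measurableSet_Ioi).2 hfl).bdd_mul (c := B)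
        hφ.continuous.aestronglyMeasurable (Eventually.of_forall hB)
    have e0 : ∫ s, φ s * (Set.Ioi 0).indicator (flux α β t₁ t₂) s
        = ∫ s in Set.Ioi 0, φ s * flux α β t₁ t₂ s := by
      rw [← integral_indicator measurableSet_Ioi]
      refine integral_congr_ae (Eventually.of_forall fun s => ?_)
      by_cases hs' : s ∈ Set.Ioi (0 : ℝ) <;> simp [Set.indicator, hs']
    have key := h.integral_mul_flux ht hφ hc h0
    have j12 : Integrable fun s => φ s * T₁ s - φ s * T₂ s := j1.sub j2
    have j123 : Integrable fun s => φ s * T₁ s - φ s * T₂ s - φ s * T₃ s := j12.sub j3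
    rw [← e0, ← integral_sub j1 j2, ← integral_sub j12 j3, ← sub_eq_zero,
      ← integral_sub j0 j123] at key
    refine Eq.trans (integral_congr_ae (Eventually.of_forall fun s => ?_)) key
    simp only [smul_eq_mul]
    by_cases hs' : s ∈ Set.Ioi (0 : ℝ)
    · rw [Set.indicator_of_mem hs']
      simp only [hT₁, hT₂, hT₃]
      ring
    · rw [h0 s (not_lt.1 hs')]; simp
  have hx : ∀ᵐ x : Space, 0 < ‖x‖ := by simp [ae_iff]
  have hz : ∀ᵐ z ∂slab t₁ t₂, 0 < ‖z.2‖ :=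
    Measure.quasiMeasurePreserving_snd.ae hx
  -- Tails are defined for every s and converge to the full integrals as s → 0, because {x = 0} is
  -- null and the loss density is integrable on the slab.
  have lim : Tendsto (fun s => T₁ s - T₂ s - T₃ s) (𝓝[>] 0)
      (𝓝 (totalLoss α β N t₁ - totalLoss α β N t₂)) := by
    rw [h.totalLoss_sub, ← integral_slab ht hbulk]
    exact ((tendsto_tailIntegral measurable_norm hx (h.density_energy.integrable t₁)).sub
      (tendsto_tailIntegral measurable_norm hx (h.density_energy.integrable t₂))).sub
      (tendsto_tailIntegral measurable_snd.norm hz hbulk)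
  refine (lim.mono_left inf_le_left).congr' ?_
  filter_upwards [mem_inf_of_left self_mem_nhdsWithin, mem_inf_of_right hae] with s hs h1
  linarith [h1 hs]

/-- The total loss as an increasing function, normalised as in the energy flux formula. -/
noncomputable def lossFunction (h : IsInwardFlow α β N) : StieltjesFunction ℝ where
  toFun t := -(totalLoss α β N t) / Real.pi
  mono' _ _ hst := div_le_div_of_nonneg_right (neg_le_neg (h.antitone_totalLoss hst))
    Real.pi_pos.le
  right_continuous' _ := (h.continuous_totalLoss.neg.div_const _).continuousWithinAt

lemma continuous_lossFunction (h : IsInwardFlow α β N) : Continuous h.lossFunction :=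
  h.continuous_totalLoss.neg.div_const _

lemma lossFunction_measure_Icc (h : IsInwardFlow α β N) (t₁ t₂ : ℝ) :
    h.lossFunction.measure (Set.Icc t₁ t₂)
      = ENNReal.ofReal ((totalLoss α β N t₁ - totalLoss α β N t₂) / Real.pi) := by
  rw [StieltjesFunction.measure_Icc,
    h.continuous_lossFunction.continuousAt.continuousWithinAt.leftLim_eq]
  congr 1
  simp only [lossFunction]
  ring

lemma lossFunction_measure_singleton (h : IsInwardFlow α β N) (t : ℝ) :
    h.lossFunction.measure {t} = 0 := by
  rw [← Set.Icc_self, lossFunction_measure_Icc, sub_self, zero_div, ENNReal.ofReal_zero]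

lemma isFiniteMeasure_lossFunction (h : IsInwardFlow α β N) :
    IsFiniteMeasure h.lossFunction.measure := by
  obtain ⟨M, hM⟩ := h.exists_totalLoss_le
  refine ⟨lt_of_le_of_lt (b := ENNReal.ofReal (M / Real.pi)) ?_ ENNReal.ofReal_lt_top⟩
  have hU : (Set.univ : Set ℝ) = ⋃ n : ℕ, Set.Icc (-(n : ℝ)) n := by
    refine (Set.eq_univ_of_forall fun t => ?_).symm
    obtain ⟨n, hn⟩ := exists_nat_ge |t|
    exact Set.mem_iUnion.2 ⟨n, abs_le.1 hn⟩
  have hmono : Monotone fun n : ℕ => Set.Icc (-(n : ℝ)) n := fun m n hmn =>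
    Set.Icc_subset_Icc (neg_le_neg (Nat.cast_le.2 hmn)) (Nat.cast_le.2 hmn)
  rw [hU, hmono.measure_iUnion]
  refine iSup_le fun n => ?_
  rw [lossFunction_measure_Icc]
  refine ENNReal.ofReal_le_ofReal (div_le_div_of_nonneg_right ?_ Real.pi_pos.le)
  linarith [hM (-(n : ℝ)), h.totalLoss_nonneg n]

end IsInwardFlow

end DefocusingWave

/-! ### Finite-energy solutions as inward flows -/

namespace DefocusingWave

/-- The part `|𝐋₊u|² / 4` of the density of the inward energy. -/
noncomputable def radialPart (u v : ℝ → Space → ℝ) (g : ℝ → Space → Space) (t : ℝ) (x : Space) : ℝ :=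
  1 / 4 * |Lplus (u t) (v t) (g t) x| ^ 2

/-- The part `|∇̸u|² / 4 + |u|^{p+1} / (2(p+1))` of the density of the inward energy. -/
noncomputable def angularPart (p : ℝ) (u : ℝ → Space → ℝ) (g : ℝ → Space → Space) (t : ℝ)
    (x : Space) : ℝ :=
  1 / 4 * ‖angularGrad (g t) x‖ ^ 2 + 1 / (2 * (p + 1)) * |u t x| ^ (p + 1)

/-- The density of the loss of inward energy, without the factor `1 / |x|`. -/
noncomputable def lossPart (p : ℝ) (u : ℝ → Space → ℝ) (g : ℝ → Space → Space) (t : ℝ)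
    (x : Space) : ℝ :=
  1 / 2 * ‖angularGrad (g t) x‖ ^ 2 + (p - 1) / (2 * (p + 1)) * |u t x| ^ (p + 1)

lemma eLpNorm_two_eq_ofReal_sqrt {G : Type*} [NormedAddCommGroup G] {f : Space → G}
    (hf : MemLp f 2 volume) : eLpNorm f 2 volume = ENNReal.ofReal (√(∫ x, ‖f x‖ ^ 2)) := by
  rw [hf.eLpNorm_eq_integral_rpow_norm (by simp) (by simp)]
  simp [Real.sqrt_eq_rpow]

lemma integral_sq_le_of_eLpNorm_le {G G' : Type*} [NormedAddCommGroup G] [NormedAddCommGroup G']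
    {f : Space → G} {k : Space → G'} (hf : MemLp f 2 volume) (hk : MemLp k 2 volume)
    (h : eLpNorm f 2 volume ≤ 2 * eLpNorm k 2 volume) :
    ∫ x, ‖f x‖ ^ 2 ≤ 4 * ∫ x, ‖k x‖ ^ 2 := by
  have h2 : ∀ a : ℝ, 2 * ENNReal.ofReal a = ENNReal.ofReal (2 * a) := fun a => by
    rw [ENNReal.ofReal_mul zero_le_two, ENNReal.ofReal_ofNat]
  rw [eLpNorm_two_eq_ofReal_sqrt hf, eLpNorm_two_eq_ofReal_sqrt hk, h2,
    ENNReal.ofReal_le_ofReal_iff (by positivity)] at h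
  have h3 := Real.sq_sqrt (integral_nonneg (μ := volume) fun x => sq_nonneg ‖f x‖)
  have h4 := Real.sq_sqrt (integral_nonneg (μ := volume) fun x => sq_nonneg ‖k x‖)
  have h5 := Real.sqrt_nonneg (∫ x, ‖f x‖ ^ 2)
  nlinarith

namespace IsFiniteEnergySolution

variable {p : ℝ} {u v : ℝ → Space → ℝ} {g : ℝ → Space → Space}

lemma norm_angularGrad_le (k : Space → Space) (x : Space) : ‖angularGrad k x‖ ≤ 2 * ‖k x‖ := by
  have h1 := norm_radialDir_le x
  have h2 : ‖inner ℝ (k x) (radialDir x)‖ ≤ ‖k x‖ := by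
    refine (norm_inner_le_norm _ _).trans (mul_le_of_le_one_right (norm_nonneg _) h1)
  refine (norm_sub_le _ _).trans ?_
  rw [norm_smul]
  nlinarith [norm_nonneg (radialDir x), norm_nonneg (k x),
    mul_le_mul h2 h1 (norm_nonneg _) (norm_nonneg _)]

lemma curve_radial (h : IsFiniteEnergySolution p u v g) :
    IsL2Curve fun t x => (inner ℝ (g t x) (radialDir x) : ℝ) := by
  have key : ∀ y x : Space, ‖(inner ℝ y (radialDir x) : ℝ)‖ ≤ 1 * ‖y‖ := fun y x => by
    rw [one_mul]
    exact (norm_inner_le_norm _ _).trans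
      (mul_le_of_le_one_right (norm_nonneg _) (norm_radialDir_le x))
  refine h.curve_g.of_bound (C := 1)
    (fun t => (h.curve_g.memLp t).1.inner (𝕜 := ℝ) measurable_radialDir.aestronglyMeasurable)
    (fun t x => key _ _) fun t s x => ?_
  rw [← inner_sub_left]
  exact key _ _

lemma curve_Lplus (h : IsFiniteEnergySolution p u v g) :
    IsL2Curve fun t => Lplus (u t) (v t) (g t) :=
  (h.curve_radial.add h.curve_hardy).add h.curve_v

lemma curve_angularGrad (h : IsFiniteEnergySolution p u v g) :
    IsL2Curve fun t => angularGrad (g t) := by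
  refine h.curve_g.of_bound (C := 2) (fun t => ?_) (fun t x => norm_angularGrad_le _ _)
    fun t s x => ?_
  · exact (h.curve_g.memLp t).1.sub (((h.curve_g.memLp t).1.inner (𝕜 := ℝ)
      measurable_radialDir.aestronglyMeasurable).smul measurable_radialDir.aestronglyMeasurable)
  · have : angularGrad (g t) x - angularGrad (g s) x = angularGrad (fun x => g t x - g s x) x := by
      simp only [angularGrad, inner_sub_left, sub_smul]
      abel
    rw [this]
    exact norm_angularGrad_le _ _

lemma density_radialPart (h : IsFiniteEnergySolution p u v g) :
    IsContDensity (radialPart u v g) := by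
  have hm : AEStronglyMeasurable fun z : ℝ × Space => Lplus (u z.1) (v z.1) (g z.1) z.2 := by
    simp only [Lplus_eq_lplusJet]
    exact aestronglyMeasurable_lplusJet h.aestronglyMeasurable_jet
  exact (h.curve_Lplus.isContDensity hm).const_mul (by norm_num)

lemma density_angularGrad (h : IsFiniteEnergySolution p u v g) :
    IsContDensity fun t x => ‖angularGrad (g t) x‖ ^ 2 := by
  have hm : AEStronglyMeasurable fun z : ℝ × Space => angularGrad (g z.1) z.2 := by
    simp only [angularGrad_eq_angularJet u v]
    exact aestronglyMeasurable_angularJet h.aestronglyMeasurable_jet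
  exact h.curve_angularGrad.isContDensity hm

lemma density_angularPart (h : IsFiniteEnergySolution p u v g) (hp : 3 ≤ p) (hp' : p < 5) :
    IsContDensity (angularPart p u g) :=
  (h.density_angularGrad.const_mul (by norm_num)).add ((h.density_potential hp hp').const_mul
    (one_div_nonneg.2 (by linarith)))

lemma density_lossPart (h : IsFiniteEnergySolution p u v g) (hp : 3 ≤ p) (hp' : p < 5) :
    IsContDensity (lossPart p u g) :=
  (h.density_angularGrad.const_mul (by norm_num)).add ((h.density_potential hp hp').const_mul
    (div_nonneg (by linarith) (by linarith)))

lemma inwardDensity_eq (p : ℝ) (u v : ℝ → Space → ℝ) (g : ℝ → Space → Space) (t : ℝ) (x : Space) :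
    inwardDensity p (u t) (v t) (g t) x = radialPart u v g t x + angularPart p u g t x := by
  unfold inwardDensity radialPart angularPart
  ring

lemma fluxDensity_eq (p : ℝ) (u v : ℝ → Space → ℝ) (g : ℝ → Space → Space) (t : ℝ) (x : Space) :
    fluxDensity p (u t) (v t) (g t) x = radialPart u v g t x - angularPart p u g t x := by
  unfold fluxDensity radialPart angularPart
  ring

/-- A crude bound: the square of the three terms of L₊u costs a factor 3. The u/|x| part is later
controlled by Hardy, which makes the inward energy bounded in time. -/
lemma inwardDensity_le (hp : 3 ≤ p) (t : ℝ) (x : Space) :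
    radialPart u v g t x + angularPart p u g t x
      ≤ 4 * energyDensity p u v g t x + 3 / 4 * ‖u t x / ‖x‖‖ ^ 2 := by
  have hA := norm_angularGrad_le (g t) x
  have hi : (inner ℝ (g t x) (radialDir x) : ℝ) ^ 2 ≤ ‖g t x‖ ^ 2 := by
    refine sq_le_sq' ?_ ?_
    all_goals
      have h1 := (abs_real_inner_le_norm (g t x) (radialDir x)).trans
        (mul_le_of_le_one_right (norm_nonneg _) (norm_radialDir_le x))
      linarith [(abs_le.1 h1).1, (abs_le.1 h1).2]
  have hP : 0 ≤ |u t x| ^ (p + 1) := Real.rpow_nonneg (abs_nonneg _) _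
  have hc : 1 / (2 * (p + 1)) * |u t x| ^ (p + 1) ≤ 4 * (1 / (p + 1) * |u t x| ^ (p + 1)) := by
    have : 1 / (2 * (p + 1)) = 1 / 2 * (1 / (p + 1)) := by field_simp
    rw [this]
    have : 0 ≤ 1 / (p + 1) * |u t x| ^ (p + 1) :=
      mul_nonneg (one_div_nonneg.2 (by linarith)) hP
    linarith
  simp only [radialPart, angularPart, energyDensity, Lplus, sq_abs, Real.norm_eq_abs]
  nlinarith [sq_nonneg ((inner ℝ (g t x) (radialDir x) : ℝ) - u t x / ‖x‖), norm_nonneg (angularGrad (g t) x),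
    sq_nonneg ((inner ℝ (g t x) (radialDir x) : ℝ) - v t x), sq_nonneg (u t x / ‖x‖ - v t x),
    sq_nonneg (v t x), norm_nonneg (g t x)]

/-- The inward energy of a solution satisfies the balance law. -/
lemma isInwardFlow (h : IsFiniteEnergySolution p u v g) (hp : 3 ≤ p) (hp' : p < 5) :
    IsInwardFlow (radialPart u v g) (angularPart p u g) (lossPart p u g) where
  density_α := h.density_radialPart
  density_β := h.density_angularPart hp hp'
  density_N := h.density_lossPart hp hp'
  -- For the potential terms this reads 2 ≤ p - 1, the use of p ≥ 3; the angular terms are equal.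
  le_N t x := by
    have hP : 0 ≤ |u t x| ^ (p + 1) := Real.rpow_nonneg (abs_nonneg _) _
    have hc : 2 * (1 / (2 * (p + 1))) ≤ (p - 1) / (2 * (p + 1)) := by
      rw [mul_one_div]
      exact div_le_div_of_nonneg_right (by linarith) (by linarith)
    simp only [angularPart, lossPart]
    nlinarith [mul_le_mul_of_nonneg_right hc hP]
  -- For the potential terms this reads p - 1 ≤ 4, the use of p ≤ 5.
  N_le t x := by
    have hP : 0 ≤ |u t x| ^ (p + 1) := Real.rpow_nonneg (abs_nonneg _) _
    have hc : (p - 1) / (2 * (p + 1)) ≤ 4 * (1 / (2 * (p + 1))) := by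
      rw [mul_one_div]
      exact div_le_div_of_nonneg_right (by linarith) (by linarith)
    simp only [angularPart, lossPart]
    nlinarith [mul_le_mul_of_nonneg_right hc hP, sq_nonneg ‖angularGrad (g t) x‖]
  bounded := by
    -- 10 = 4 + ¾·4·2: the factor 4 of the energy density, then ¾ times the Hardy constant 4 times 2
    -- from ‖g‖² ≤ 2e.
    refine ⟨10 * ∫ x, energyDensity p u v g 0 x, fun t => ?_⟩
    obtain ⟨hi, he⟩ := h.energy_conservation hp hp' t
    have hh := (h.curve_hardy.memLp t).integrable_norm_pow two_ne_zero
    have h1 := integral_mono ((h.density_radialPart.integrable t).add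
      ((h.density_angularPart hp hp').integrable t)) ((hi.const_mul 4).add (hh.const_mul (3 / 4)))
      fun x => inwardDensity_le hp t x
    have h2 := integral_sq_le_of_eLpNorm_le (h.curve_hardy.memLp t) (h.curve_g.memLp t)
      (hardy_inequality (h.memEnergySpace t).memLp_six (h.memEnergySpace t).memLp_grad
        (h.memEnergySpace t).isWeakGradient)
    have h3 : ∫ x, ‖g t x‖ ^ 2 ≤ ∫ x, 2 * energyDensity p u v g t x := by
      refine integral_mono (h.density_g.integrable t) (hi.const_mul 2) fun x => ?_
      have hP : 0 ≤ 1 / (p + 1) * |u t x| ^ (p + 1) :=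
        mul_nonneg (one_div_nonneg.2 (by linarith)) (Real.rpow_nonneg (abs_nonneg _) _)
      simp only [energyDensity]
      nlinarith [sq_nonneg ‖v t x‖]
    have h4 : ∫ x, (4 * energyDensity p u v g t x + 3 / 4 * ‖u t x / ‖x‖‖ ^ 2)
        = 4 * (∫ x, energyDensity p u v g t x) + 3 / 4 * ∫ x, ‖u t x / ‖x‖‖ ^ 2 := by
      rw [integral_add (hi.const_mul 4) (hh.const_mul (3 / 4)), integral_const_mul,
        integral_const_mul]
    rw [integral_const_mul] at h3
    rw [← he]
    refine (h1.trans_eq h4).trans ?_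
    linarith
  balance X hX := by
    have := (h.isWeakWave hp hp').inward_balance (by linarith) hX
    simp only [inwardDensity_eq, fluxDensity_eq] at this
    exact this

lemma cylinderFlux_eq (p : ℝ) (u v : ℝ → Space → ℝ) (g : ℝ → Space → Space) (t₁ t₂ r : ℝ) :
    cylinderFlux p u v g t₁ t₂ r
      = IsInwardFlow.flux (radialPart u v g) (angularPart p u g) t₁ t₂ r := by
  unfold cylinderFlux IsInwardFlow.flux cylinderIntegral
  simp only [integral_mul_const, ← fluxDensity_eq]
  rw [integral_Icc_eq_integral_Ioo]
  rfl

/-- A conull set of radii meets every interval (0, b); limits along this filter are therefore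
unique, on which uniqueness of the flux measure rests. -/
instance neBot_radii : (𝓝[>] (0 : ℝ) ⊓ ae volume).NeBot := by
  refine inf_neBot_iff.2 fun {s} hs {s'} hs' => ?_
  obtain ⟨b, hb, hsub⟩ := mem_nhdsGT_iff_exists_Ioo_subset.1 hs
  by_contra hne
  have h1 : Set.Ioo 0 b ⊆ s'ᶜ := fun r hr hr' => hne ⟨r, hsub hr, hr'⟩
  have h2 : volume (Set.Ioo 0 b) = 0 := measure_mono_null h1 hs'
  rw [Real.volume_Ioo, ENNReal.ofReal_eq_zero] at h2
  have : (0 : ℝ) < b := hb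
  linarith

lemma isFluxMeasure (h : IsFiniteEnergySolution p u v g) (hp : 3 ≤ p) (hp' : p < 5) :
    IsFluxMeasure p u v g (h.isInwardFlow hp hp').lossFunction.measure where
  isFiniteMeasure := (h.isInwardFlow hp hp').isFiniteMeasure_lossFunction
  noAtoms := (h.isInwardFlow hp hp').lossFunction_measure_singleton
  tendsto_flux t₁ t₂ ht := by
    have hF := h.isInwardFlow hp hp'
    rw [hF.lossFunction_measure_Icc, ENNReal.toReal_ofReal
      (div_nonneg (sub_nonneg.2 (hF.antitone_totalLoss ht.le)) Real.pi_pos.le),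
      mul_div_cancel₀ _ Real.pi_pos.ne']
    simp only [funext fun r => cylinderFlux_eq p u v g t₁ t₂ r]
    exact hF.tendsto_flux ht.le

/-- The limits fix the measure of closed intervals. Absence of atoms transfers this to half-open
intervals, which determine a finite measure. -/
lemma _root_.DefocusingWave.IsFluxMeasure.eq {μ ν : Measure ℝ} (hμ : IsFluxMeasure p u v g μ)
    (hν : IsFluxMeasure p u v g ν) : μ = ν := by
  have := hμ.isFiniteMeasure
  have := hν.isFiniteMeasure
  refine Measure.ext_of_Ioc μ ν fun a b hab => ?_
  have h0 := tendsto_nhds_unique (hμ.tendsto_flux a b hab) (hν.tendsto_flux a b hab)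
  have h1 : μ (Set.Icc a b) = ν (Set.Icc a b) :=
    (ENNReal.toReal_eq_toReal_iff' (measure_ne_top _ _) (measure_ne_top _ _)).1
      (mul_left_cancel₀ Real.pi_pos.ne' h0)
  have key : ∀ {ξ : Measure ℝ}, IsFluxMeasure p u v g ξ → ξ (Set.Icc a b) = ξ (Set.Ioc a b) :=
    fun {ξ} hξ => by
      have : NullSingletonClass ξ := ⟨hξ.noAtoms⟩
      exact measure_congr Ioc_ae_eq_Icc.symm
  rw [← key hμ, ← key hν, h1]

end IsFiniteEnergySolution

end DefocusingWave

/-! ### The weighted energy inequality -/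

namespace DefocusingWave

/-- Bounded smooth weights which grow at most like `s ^ κ`. -/
structure IsWeight (κ : ℝ) (φ : ℝ → ℝ) : Prop where
  contDiff : ContDiff ℝ ∞ φ
  nonneg : ∀ s, 0 ≤ φ s
  bounded : ∃ B, ∀ s, |φ s| ≤ B ∧ |deriv φ s| ≤ B
  deriv_nonneg : ∀ s, 0 ≤ s → 0 ≤ deriv φ s
  mul_deriv_le : ∀ s, 0 ≤ s → s * deriv φ s ≤ κ * φ s

/-- Insert φ(t) = φ(0) + ∫₀^t φ' and apply Fubini. Used for the loss density with Lebesgue measure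
and for the flux measure, it replaces a Stieltjes integration by parts. -/
lemma integral_mul_eq_layers {φ : ℝ → ℝ} (hφ : ContDiff ℝ ∞ φ) {B : ℝ} (hB : ∀ s, |φ s| ≤ B)
    {ν : Measure ℝ} [SFinite ν] {ρ : ℝ → ℝ} {T : ℝ} (hT : 0 ≤ T) (hρ : IntegrableOn ρ (Set.Icc 0 T) ν) :
    ∫ t in Set.Icc 0 T, φ t * ρ t ∂ν = φ 0 * (∫ t in Set.Icc 0 T, ρ t ∂ν)
      + ∫ s in (0 : ℝ)..T, deriv φ s * ∫ t in Set.Ioc s T, ρ t ∂ν := by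
  have hdc : Continuous (deriv φ) := hφ.continuous_deriv (by simp)
  have hψ : Integrable ((Set.Ioc 0 T).indicator (deriv φ)) :=
    (integrable_indicator_iff measurableSet_Ioc).2 hdc.integrableOn_Ioc
  have key := integral_mul_tailIntegral (m := ν.restrict (Set.Icc 0 T)) measurable_id hρ hψ
  have e1 : ∫ s, (Set.Ioc 0 T).indicator (deriv φ) s
        * tailIntegral (ν.restrict (Set.Icc 0 T)) id ρ s
      = ∫ s in (0 : ℝ)..T, deriv φ s * ∫ t in Set.Ioc s T, ρ t ∂ν := by
    rw [intervalIntegral.integral_of_le hT, ← integral_indicator measurableSet_Ioc]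
    refine integral_congr_ae (Eventually.of_forall fun s => ?_)
    by_cases hs : s ∈ Set.Ioc 0 T
    · simp only [Set.indicator_of_mem hs]
      have hset : {y | s < id y} ∩ Set.Icc 0 T = Set.Ioc s T := by
        ext y
        exact ⟨fun hy => ⟨hy.1, hy.2.2⟩, fun hy => ⟨hy.1, hs.1.le.trans hy.1.le, hy.2⟩⟩
      rw [tailIntegral, integral_indicator (measurableSet_lt measurable_const measurable_id),
        Measure.restrict_restrict (measurableSet_lt measurable_const measurable_id), hset]
    · simp only [Set.indicator_of_notMem hs, zero_mul]
  have e2 : ∫ y in Set.Icc 0 T, (∫ s, (Set.Iio (id y)).indicator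
        ((Set.Ioc 0 T).indicator (deriv φ)) s) * ρ y ∂ν
      = ∫ y in Set.Icc 0 T, (φ y * ρ y - φ 0 * ρ y) ∂ν := by
    refine setIntegral_congr_fun measurableSet_Icc fun y hy => ?_
    have h1 : ∫ s, (Set.Iio (id y)).indicator ((Set.Ioc 0 T).indicator (deriv φ)) s
        = φ y - φ 0 := by
      rw [Set.indicator_indicator, integral_indicator (measurableSet_Iio.inter measurableSet_Ioc),
        ← intervalIntegral.integral_deriv_eq_sub
          (fun s _ => (hφ.differentiable (by simp)) s) (hdc.intervalIntegrable _ _),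
        intervalIntegral.integral_of_le hy.1, integral_Ioc_eq_integral_Ioo]
      congr 2
      ext s
      exact ⟨fun hs => ⟨hs.2.1, hs.1⟩, fun hs => ⟨hs.2, hs.1, hs.2.le.trans hy.2⟩⟩
    simp only [h1]
    ring
  have i1 : IntegrableOn (fun t => φ t * ρ t) (Set.Icc 0 T) ν :=
    hρ.bdd_mul (c := B) hφ.continuous.aestronglyMeasurable (Eventually.of_forall hB)
  rw [e1, e2, integral_sub i1 (hρ.const_mul _), integral_const_mul] at key
  linarith

namespace IsWeight

variable {κ : ℝ} {φ : ℝ → ℝ}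

lemma hasFDerivAt_increment (h : IsWeight κ φ) (q : ℝ × ℝ) :
    dT (fun q : ℝ × ℝ => φ (q.1 + q.2) - φ q.1) q = deriv φ (q.1 + q.2) - deriv φ q.1 ∧
      dR (fun q : ℝ × ℝ => φ (q.1 + q.2) - φ q.1) q = deriv φ (q.1 + q.2) := by
  have hd : Differentiable ℝ φ := h.contDiff.differentiable (by simp)
  have h1 := (hd (q.1 + q.2)).hasDerivAt.comp_hasFDerivAt q
    ((hasFDerivAt_fst (𝕜 := ℝ) (E := ℝ) (F := ℝ) (p := q)).add hasFDerivAt_snd)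
  have h2 := (hd q.1).hasDerivAt.comp_hasFDerivAt q
    (hasFDerivAt_fst (𝕜 := ℝ) (E := ℝ) (F := ℝ) (p := q))
  have h3 := (h1.sub h2).fderiv
  constructor
  · refine (congrArg (fun T : ℝ × ℝ →L[ℝ] ℝ => T (1, 0)) h3).trans ?_
    simp
  · refine (congrArg (fun T : ℝ × ℝ →L[ℝ] ℝ => T (0, 1)) h3).trans ?_
    simp

lemma abs_increment_le (h : IsWeight κ φ) {B : ℝ} (hB : ∀ s, |φ s| ≤ B ∧ |deriv φ s| ≤ B)
    (t : ℝ) {r : ℝ} (hr : 0 ≤ r) : |φ (t + r) - φ t| ≤ B * r := by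
  have := convex_univ.norm_image_sub_le_of_norm_deriv_le (f := φ) (C := B) (x := t) (y := t + r)
    (fun s _ => (h.contDiff.differentiable (by simp)) s) (fun s _ => (hB s).2) trivial trivial
  rwa [add_sub_cancel_left, Real.norm_of_nonneg hr] at this

end IsWeight

namespace IsInwardFlow

variable {α β N : ℝ → Space → ℝ} {κ : ℝ} {φ : ℝ → ℝ}

/-- For X = φ(t+r) - φ(t) one has X_t - X_r = -φ'(t) and X_t + X_r = 2φ'(t+r) - φ'(t). Only
2φ'(t+r)β has the wrong sign, and 2β ≤ N with rφ'(t+r) ≤ κφ(t+r) absorbs it into the loss, leaving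
the factor 1 - κ. -/
lemma balanceIntegrand_increment_le (h : IsInwardFlow α β N) (hφ : IsWeight κ φ) {t : ℝ}
    (ht : 0 ≤ t) {x : Space} (hx : 0 < ‖x‖) :
    balanceIntegrand α β N (fun q : ℝ × ℝ => φ (q.1 + q.2) - φ q.1) t x
      ≤ -(deriv φ t * (α t x + β t x)) - (1 - κ) * (φ (t + ‖x‖) * (N t x / ‖x‖))
        + φ t * (N t x / ‖x‖) := by
  obtain ⟨eT, eR⟩ := hφ.hasFDerivAt_increment (t, ‖x‖)
  rw [balanceIntegrand, eT, eR]
  simp only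
  have hs : 0 ≤ t + ‖x‖ := by linarith
  have hN := h.density_N.nonneg t x
  -- Here ‖x‖ ≤ t + ‖x‖ and φ' ≥ 0; this is where t ≥ 0 matters.
  have h1 : deriv φ (t + ‖x‖) * ‖x‖ ≤ κ * φ (t + ‖x‖) := by
    refine le_trans ?_ (hφ.mul_deriv_le _ hs)
    rw [mul_comm]
    exact mul_le_mul_of_nonneg_right (by linarith) (hφ.deriv_nonneg _ hs)
  have h2 : deriv φ (t + ‖x‖) * (2 * β t x) ≤ κ * φ (t + ‖x‖) * (N t x / ‖x‖) := by
    calc deriv φ (t + ‖x‖) * (2 * β t x) ≤ deriv φ (t + ‖x‖) * N t x :=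
          mul_le_mul_of_nonneg_left (h.le_N t x) (hφ.deriv_nonneg _ hs)
      _ = deriv φ (t + ‖x‖) * ‖x‖ * (N t x / ‖x‖) := by field_simp
      _ ≤ _ := mul_le_mul_of_nonneg_right h1 (h.bulk_nonneg t x)
  have h3 : (φ (t + ‖x‖) - φ t) / ‖x‖ * N t x
      = φ (t + ‖x‖) * (N t x / ‖x‖) - φ t * (N t x / ‖x‖) := by ring
  linarith

/-- The weighted energy inequality. -/
lemma weighted_inequality (h : IsInwardFlow α β N) (hφ : IsWeight κ φ) {T : ℝ} (hT : 0 ≤ T) :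
    (∫ x, φ (T + ‖x‖) * (α T x + β T x))
      + (1 - κ) * (∫ z, φ (z.1 + ‖z.2‖) * (N z.1 z.2 / ‖z.2‖) ∂slab 0 T)
      + Real.pi * (∫ t in Set.Icc 0 T, φ t ∂h.lossFunction.measure)
      ≤ ∫ x, φ ‖x‖ * (α 0 x + β 0 x) := by
  obtain ⟨B, hB⟩ := hφ.bounded
  have hB0 : 0 ≤ B := (abs_nonneg _).trans (hB 0).1
  have hc : Continuous φ := hφ.contDiff.continuous
  have hdc : Continuous (deriv φ) := hφ.contDiff.continuous_deriv (by simp)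
  -- The weight φ(t+r) does not vanish on the axis. Subtracting φ(t) makes the balance law
  -- applicable, and the terms in φ(t) recombine below into the flux π∫φ dμ.
  set X : ℝ × ℝ → ℝ := fun q => φ (q.1 + q.2) - φ q.1 with hX
  have hXs : ContDiff ℝ ∞ X :=
    (hφ.contDiff.comp (contDiff_fst.add contDiff_snd)).sub (hφ.contDiff.comp contDiff_fst)
  have b0 : ∀ t r, |X (t, r)| ≤ 2 * B := fun t r => by
    refine (abs_sub _ _).trans ?_
    linarith [(hB (t + r)).1, (hB t).1]
  have b1 : ∀ t r, 0 ≤ r → |X (t, r)| ≤ 2 * B * r := fun t r hr =>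
    (hφ.abs_increment_le hB t hr).trans (by nlinarith)
  have b2 : ∀ q, |dT X q| ≤ 2 * B := fun q => by
    rw [(hφ.hasFDerivAt_increment q).1]
    refine (abs_sub _ _).trans ?_
    linarith [(hB (q.1 + q.2)).2, (hB q.1).2]
  have b3 : ∀ q, |dR X q| ≤ 2 * B := fun q => by
    rw [(hφ.hasFDerivAt_increment q).2]
    linarith [(hB (q.1 + q.2)).2]
  obtain ⟨hi, hb⟩ := h.integral_balance hXs hT (C := 2 * B) (fun t _ r _ => b0 t r)
    (fun t _ r hr => b1 t r hr) (fun t _ r _ => b2 _) fun t _ r _ => b3 _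
  have hbi : ∀ t, Integrable (balanceIntegrand α β N X t) := fun t =>
    ((h.density_energy.integrable t).const_mul (6 * (2 * B))).mono'
      (h.aestronglyMeasurable_balanceIntegrand hXs t)
      (Eventually.of_forall fun x => h.abs_balanceIntegrand_le (b2 _) (b3 _)
        (b1 _ _ (norm_nonneg _)))
  have hbulk := h.integrable_bulk hT
  have j1 : Integrable (fun z : ℝ × Space => deriv φ z.1 * (α z.1 z.2 + β z.1 z.2)) (slab 0 T) :=
    h.density_energy.integrable_slab 0 T (w := fun z => deriv φ z.1)
      (hdc.comp continuous_fst).aestronglyMeasurable fun z => (hB _).2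
  have j2 : Integrable (fun z : ℝ × Space => φ (z.1 + ‖z.2‖) * (N z.1 z.2 / ‖z.2‖)) (slab 0 T) :=
    hbulk.bdd_mul (c := B)
      (hc.comp (continuous_fst.add continuous_snd.norm)).aestronglyMeasurable
      (Eventually.of_forall fun z => (hB _).1)
  have j3 : Integrable (fun z : ℝ × Space => φ z.1 * (N z.1 z.2 / ‖z.2‖)) (slab 0 T) :=
    hbulk.bdd_mul (c := B) (hc.comp continuous_fst).aestronglyMeasurable
      (Eventually.of_forall fun z => (hB _).1)
  have j1n : Integrable (fun z : ℝ × Space => -(deriv φ z.1 * (α z.1 z.2 + β z.1 z.2)))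
      (slab 0 T) := j1.neg
  have j12 : Integrable (fun z : ℝ × Space => -(deriv φ z.1 * (α z.1 z.2 + β z.1 z.2))
      - (1 - κ) * (φ (z.1 + ‖z.2‖) * (N z.1 z.2 / ‖z.2‖))) (slab 0 T) :=
    j1.neg.sub (j2.const_mul (1 - κ))
  have j : Integrable (fun z : ℝ × Space => -(deriv φ z.1 * (α z.1 z.2 + β z.1 z.2))
      - (1 - κ) * (φ (z.1 + ‖z.2‖) * (N z.1 z.2 / ‖z.2‖)) + φ z.1 * (N z.1 z.2 / ‖z.2‖)) (slab 0 T) :=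
    j12.add j3
  have hx : ∀ᵐ x : Space, 0 < ‖x‖ := by simp [ae_iff]
  have hmono : ∫ t in (0 : ℝ)..T, ∫ x, balanceIntegrand α β N X t x
      ≤ ∫ z, (-(deriv φ z.1 * (α z.1 z.2 + β z.1 z.2))
      - (1 - κ) * (φ (z.1 + ‖z.2‖) * (N z.1 z.2 / ‖z.2‖)) + φ z.1 * (N z.1 z.2 / ‖z.2‖)) ∂slab 0 T := by
    rw [integral_slab hT j]
    refine intervalIntegral.integral_mono_ae_restrict hT hi ?_ ?_
    · rw [intervalIntegrable_iff_integrableOn_Icc_of_le hT]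
      exact j.integral_prod_left
    · filter_upwards [j.prod_right_ae, ae_restrict_mem measurableSet_Icc] with t ht ht0
      refine integral_mono_ae (hbi t) ht ?_
      filter_upwards [hx] with x hx0
      exact h.balanceIntegrand_increment_le hφ ht0.1 hx0
  have s1 : ∫ z, deriv φ z.1 * (α z.1 z.2 + β z.1 z.2) ∂slab 0 T
      = ∫ t in (0 : ℝ)..T, deriv φ t * mass (fun t x => α t x + β t x) t := by
    rw [integral_slab hT j1]
    simp only [integral_const_mul, mass]
  have s3 : ∫ z, φ z.1 * (N z.1 z.2 / ‖z.2‖) ∂slab 0 T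
      = ∫ t in Set.Icc 0 T, φ t * ∫ x, N t x / ‖x‖ := by
    rw [integral_slab hT j3, intervalIntegral.integral_of_le hT, ← integral_Icc_eq_integral_Ioc]
    simp only [integral_const_mul]
  rw [integral_add j12 j3, integral_sub j1n (j2.const_mul (1 - κ)), integral_const_mul,
    integral_neg] at hmono
  have hm : IntegrableOn (fun t => ∫ x, N t x / ‖x‖) (Set.Icc 0 T) := by
    rw [← intervalIntegrable_iff_integrableOn_Icc_of_le hT]
    exact h.intervalIntegrable_bulk 0 T
  -- Both integrals against φ(t) are written as integrals of φ'(s) against the quantity lost during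
  -- (s, T]: L1 for the bulk loss, L2 for the flux into the axis.
  have L1 := integral_mul_eq_layers hφ.contDiff (fun s => (hB s).1) hT hm
  have hfin := h.isFiniteMeasure_lossFunction
  have L2 := integral_mul_eq_layers hφ.contDiff (fun s => (hB s).1) hT
    (ν := h.lossFunction.measure) (ρ := fun _ => 1) (integrableOn_const (measure_ne_top _ _))
  have hGr : ∀ s, s ≤ T → ∫ t in Set.Ioc s T, (1 : ℝ) ∂h.lossFunction.measure
      = (totalLoss α β N s - totalLoss α β N T) / Real.pi := fun s hs => by
    rw [setIntegral_const, smul_eq_mul, mul_one, measureReal_def, StieltjesFunction.measure_Ioc,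
      ENNReal.toReal_ofReal (sub_nonneg.2 (h.lossFunction.mono hs))]
    simp only [lossFunction]
    ring
  have hG0 : ∫ t in Set.Icc 0 T, (1 : ℝ) ∂h.lossFunction.measure
      = (totalLoss α β N 0 - totalLoss α β N T) / Real.pi := by
    rw [setIntegral_const, smul_eq_mul, mul_one, measureReal_def, h.lossFunction_measure_Icc,
      ENNReal.toReal_ofReal (div_nonneg (sub_nonneg.2 (h.antitone_totalLoss hT)) Real.pi_pos.le)]
  have c1 : ∫ s in (0 : ℝ)..T, deriv φ s * ∫ t in Set.Ioc s T, (1 : ℝ) ∂h.lossFunction.measure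
      = ∫ s in (0 : ℝ)..T, deriv φ s * ((totalLoss α β N s - totalLoss α β N T) / Real.pi) := by
    refine intervalIntegral.integral_congr fun s hs => ?_
    rw [Set.uIcc_of_le hT] at hs
    simp only [hGr s hs.2]
  have c2 : ∫ s in (0 : ℝ)..T, deriv φ s * ∫ t in Set.Ioc s T, ∫ x, N t x / ‖x‖
      = ∫ s in (0 : ℝ)..T, deriv φ s * (mass (fun t x => α t x + β t x) s
        - mass (fun t x => α t x + β t x) T - (totalLoss α β N s - totalLoss α β N T)) := by
    refine intervalIntegral.integral_congr fun s hs => ?_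
    rw [Set.uIcc_of_le hT] at hs
    rw [h.totalLoss_sub, intervalIntegral.integral_of_le hs.2]
    ring
  have c3 : ∫ t in Set.Icc 0 T, ∫ x, N t x / ‖x‖ = mass (fun t x => α t x + β t x) 0
        - mass (fun t x => α t x + β t x) T - (totalLoss α β N 0 - totalLoss α β N T) := by
    rw [h.totalLoss_sub, intervalIntegral.integral_of_le hT, integral_Icc_eq_integral_Ioc]
    ring
  have hEc := h.continuous_mass
  have hGc := h.continuous_totalLoss
  -- In each layer the flux and the bulk loss add up to E₋(s) - E₋(T), so the total loss cancels and
  -- only the energy remains.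
  have c4 : Real.pi * (∫ s in (0 : ℝ)..T, deriv φ s
        * ((totalLoss α β N s - totalLoss α β N T) / Real.pi))
      + (∫ s in (0 : ℝ)..T, deriv φ s * (mass (fun t x => α t x + β t x) s
        - mass (fun t x => α t x + β t x) T - (totalLoss α β N s - totalLoss α β N T)))
      = (∫ t in (0 : ℝ)..T, deriv φ t * mass (fun t x => α t x + β t x) t)
        - mass (fun t x => α t x + β t x) T * (φ T - φ 0) := by
    rw [← intervalIntegral.integral_deriv_eq_sub
          (fun s _ => (hφ.contDiff.differentiable (by simp)) s) (hdc.intervalIntegrable _ _),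
      ← intervalIntegral.integral_const_mul, ← intervalIntegral.integral_const_mul,
      ← intervalIntegral.integral_add (Continuous.intervalIntegrable (by fun_prop) _ _)
        (Continuous.intervalIntegrable (by fun_prop) _ _),
      ← intervalIntegral.integral_sub (Continuous.intervalIntegrable (by fun_prop) _ _)
        (Continuous.intervalIntegrable (by fun_prop) _ _)]
    refine intervalIntegral.integral_congr fun s _ => ?_
    have := Real.pi_pos.ne'
    field_simp
    ring
  rw [c1, hG0] at L2
  rw [c2, c3] at L1
  have d : ∀ t, ∫ x, X (t, ‖x‖) * (α t x + β t x) = (∫ x, φ (t + ‖x‖) * (α t x + β t x))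
      - φ t * mass (fun t x => α t x + β t x) t := fun t => by
    have k1 : Integrable fun x => φ (t + ‖x‖) * (α t x + β t x) :=
      h.density_energy.integrable_mul
        (hc.comp (continuous_const.add continuous_norm)).aestronglyMeasurable (fun x => (hB _).1) t
    rw [mass, ← integral_const_mul, ← integral_sub k1 ((h.density_energy.integrable t).const_mul _)]
    refine integral_congr_ae (Eventually.of_forall fun x => ?_)
    simp only [hX]
    ring
  rw [d, d] at hb
  simp only [mul_one] at L2
  simp only [zero_add] at hb
  have hpi : Real.pi * (φ 0 * ((totalLoss α β N 0 - totalLoss α β N T) / Real.pi))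
      = φ 0 * (totalLoss α β N 0 - totalLoss α β N T) := by
    have := Real.pi_pos.ne'
    field_simp
  rw [L2, mul_add, hpi]
  rw [s1, s3, L1] at hmono
  linarith

end IsInwardFlow

end DefocusingWave

/-! ### Power weights and removal of the regularisation -/

namespace DefocusingWave

/-- A bounded regularisation of `s ^ κ`. -/
noncomputable def powWeight (κ ε s : ℝ) : ℝ :=
  ((ε + s ^ 2) / (1 + ε * (ε + s ^ 2))) ^ (κ / 2)

section PowWeight

variable {κ ε : ℝ}

lemma powWeight_base_pos (hε : 0 < ε) (s : ℝ) : 0 < (ε + s ^ 2) / (1 + ε * (ε + s ^ 2)) := by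
  positivity

lemma hasDerivAt_powWeight (hε : 0 < ε) (s : ℝ) : HasDerivAt (powWeight κ ε)
    (κ * powWeight κ ε s * (s / ((ε + s ^ 2) * (1 + ε * (ε + s ^ 2))))) s := by
  have h1 : HasDerivAt (fun s : ℝ => ε + s ^ 2) (2 * s) s := by
    simpa using (hasDerivAt_pow 2 s).const_add ε
  have hy : 0 < ε + s ^ 2 := by positivity
  have hz : 0 < 1 + ε * (ε + s ^ 2) := by positivity
  have h2 := (h1.div ((h1.const_mul ε).const_add 1) hz.ne').rpow_const (p := κ / 2)
    (Or.inl (powWeight_base_pos hε s).ne')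
  refine h2.congr_deriv ?_
  simp only [Pi.div_apply]
  rw [Real.rpow_sub_one (powWeight_base_pos hε s).ne', powWeight]
  field_simp
  ring

/-- The logarithmic derivative gives sφ'(s) = κφ(s)·s²/((ε+s²)(1+ε(ε+s²))), and the last fraction is
at most 1. The quotient in the base is bounded by 1/ε, which bounds φ and φ'. -/
lemma isWeight_powWeight (hκ : 0 ≤ κ) (hκ1 : κ ≤ 1) (hε : 0 < ε) (hε1 : ε ≤ 1) :
    IsWeight κ (powWeight κ ε) := by
  have h0 : ∀ s, 0 ≤ powWeight κ ε s := fun s => Real.rpow_nonneg (powWeight_base_pos hε s).le _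
  have hd : ∀ s, deriv (powWeight κ ε) s
      = κ * powWeight κ ε s * (s / ((ε + s ^ 2) * (1 + ε * (ε + s ^ 2)))) := fun s =>
    (hasDerivAt_powWeight hε s).deriv
  have hB : ∀ s, powWeight κ ε s ≤ ε⁻¹ ^ (κ / 2) := fun s => by
    refine Real.rpow_le_rpow (powWeight_base_pos hε s).le ?_ (by positivity)
    rw [div_le_iff₀ (by positivity)]
    have : ε⁻¹ * (1 + ε * (ε + s ^ 2)) = ε⁻¹ + (ε + s ^ 2) := by field_simp
    rw [this]
    have := inv_pos.2 hε
    linarith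
  have hP : 0 ≤ ε⁻¹ ^ (κ / 2) := by positivity
  refine ⟨?_, h0, ⟨ε⁻¹ ^ (κ / 2) * (1 + ε⁻¹), fun s => ⟨?_, ?_⟩⟩, fun s hs => ?_, fun s hs => ?_⟩
  · have h1 : ContDiff ℝ ∞ fun s : ℝ => ε + s ^ 2 := contDiff_const.add (contDiff_id.pow 2)
    exact (h1.div (contDiff_const.add (contDiff_const.mul h1)) fun s => by positivity).rpow_const_of_ne
      fun s => (powWeight_base_pos hε s).ne'
  · rw [abs_of_nonneg (h0 s)]
    have := inv_pos.2 hε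
    nlinarith [hB s]
  · rw [hd, abs_mul, abs_mul, abs_of_nonneg hκ, abs_of_nonneg (h0 s)]
    have h1 : |s / ((ε + s ^ 2) * (1 + ε * (ε + s ^ 2)))| ≤ ε⁻¹ := by
      have hy : 0 < ε + s ^ 2 := by positivity
      rw [abs_div, abs_of_nonneg (a := (ε + s ^ 2) * _) (by positivity), div_le_iff₀ (by positivity),
        inv_mul_eq_div, le_div_iff₀ hε]
      have h3 : |s| * ε ≤ ε + s ^ 2 := by
        have h2 : |s| ≤ 1 + s ^ 2 := by
          nlinarith [sq_abs s, sq_nonneg (|s| - 1), abs_nonneg s]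
        nlinarith [sq_nonneg s]
      have : 0 ≤ ε * (ε + s ^ 2) := by positivity
      nlinarith
    have hi := inv_pos.2 hε
    calc κ * powWeight κ ε s * |s / ((ε + s ^ 2) * (1 + ε * (ε + s ^ 2)))|
        ≤ 1 * ε⁻¹ ^ (κ / 2) * ε⁻¹ := by
          refine mul_le_mul (mul_le_mul hκ1 (hB s) (h0 s) zero_le_one) h1 (abs_nonneg _) ?_
          positivity
      _ ≤ _ := by nlinarith
  · rw [hd]
    have := h0 s
    positivity
  · rw [hd]
    have h1 : s * (s / ((ε + s ^ 2) * (1 + ε * (ε + s ^ 2)))) ≤ 1 := by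
      rw [mul_div_assoc']
      refine div_le_one_of_le₀ ?_ (by positivity)
      have : 0 ≤ (ε + s ^ 2) * (ε * (ε + s ^ 2)) := by positivity
      nlinarith
    have h2 := mul_le_mul_of_nonneg_left h1 (mul_nonneg hκ (h0 s))
    linarith

/-- Subadditivity of y ↦ y^{κ/2}. The regularised weight does not vanish at 0, and the price ε^{κ/2}
times the initial inward energy disappears in the limit. -/
lemma powWeight_le (hκ : 0 ≤ κ) (hκ1 : κ ≤ 1) (hε : 0 < ε) {r : ℝ} (hr : 0 ≤ r) :
    powWeight κ ε r ≤ ε ^ (κ / 2) + r ^ κ := by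
  have h1 : powWeight κ ε r ≤ (ε + r ^ 2) ^ (κ / 2) := by
    refine Real.rpow_le_rpow (powWeight_base_pos hε r).le ?_ (by positivity)
    refine div_le_self (by positivity) ?_
    have : 0 ≤ ε * (ε + r ^ 2) := by positivity
    linarith
  have h2 := Real.rpow_add_le_add_rpow hε.le (sq_nonneg r) (by positivity : 0 ≤ κ / 2)
    (by linarith)
  have h3 : (r ^ 2) ^ (κ / 2) = r ^ κ := by
    rw [← Real.rpow_natCast, ← Real.rpow_mul hr]
    congr 1
    push_cast
    ring
  linarith

lemma tendsto_powWeight (hκ : 0 < κ) {s : ℝ} (hs : 0 ≤ s) :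
    Tendsto (fun n : ℕ => powWeight κ (1 / ((n : ℝ) + 1)) s) atTop (𝓝 (s ^ κ)) := by
  have h0 := tendsto_one_div_add_atTop_nhds_zero_nat (𝕜 := ℝ)
  have h1 := h0.add_const (s ^ 2)
  have h2 := (h1.div ((h0.mul h1).const_add 1) (by simp)).rpow_const (p := κ / 2)
    (Or.inr (by positivity))
  have h3 : ((0 + s ^ 2) / (1 + 0 * (0 + s ^ 2))) ^ (κ / 2) = s ^ κ := by
    rw [zero_add, zero_mul, add_zero, div_one, ← Real.rpow_natCast, ← Real.rpow_mul hs]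
    congr 1
    push_cast
    ring
  rw [h3] at h2
  exact h2

end PowWeight

namespace IsInwardFlow

variable {α β N : ℝ → Space → ℝ} {κ : ℝ}

/-- The weighted inward energy at time `0`. -/
noncomputable def initialWeight (α β : ℝ → Space → ℝ) (κ : ℝ) : ℝ≥0∞ :=
  ∫⁻ x, ENNReal.ofReal (‖x‖ ^ κ * (α 0 x + β 0 x))

/-- The right-hand side of the regularised weighted inequality. -/
noncomputable def regularisedWeight (α β : ℝ → Space → ℝ) (κ : ℝ) (n : ℕ) : ℝ≥0∞ :=
  ENNReal.ofReal ((1 / ((n : ℝ) + 1)) ^ (κ / 2) * mass (fun t x => α t x + β t x) 0)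
    + initialWeight α β κ

lemma tendsto_regularisedWeight (α β : ℝ → Space → ℝ) (hκ : 0 < κ) :
    Tendsto (regularisedWeight α β κ) atTop (𝓝 (initialWeight α β κ)) := by
  have h1 := (tendsto_one_div_add_atTop_nhds_zero_nat (𝕜 := ℝ)).rpow_const (p := κ / 2)
    (Or.inr (by positivity))
  rw [Real.zero_rpow (by positivity)] at h1
  have h2 := h1.mul_const (mass (fun t x => α t x + β t x) 0)
  rw [zero_mul] at h2
  have h3 := (ENNReal.tendsto_ofReal h2).add_const (initialWeight α β κ)
  rwa [ENNReal.ofReal_zero, zero_add] at h3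

lemma ofReal_integral_powWeight_le (h : IsInwardFlow α β N) (hκ : 0 ≤ κ) (hκ1 : κ ≤ 1) (n : ℕ) :
    ENNReal.ofReal (∫ x, powWeight κ (1 / ((n : ℝ) + 1)) ‖x‖ * (α 0 x + β 0 x))
      ≤ regularisedWeight α β κ n := by
  set ε : ℝ := 1 / ((n : ℝ) + 1) with hεd
  have hε : 0 < ε := by positivity
  have hε1 : ε ≤ 1 := by
    rw [hεd, div_le_one (by positivity)]; linarith [Nat.cast_nonneg (α := ℝ) n]
  have hw := isWeight_powWeight hκ hκ1 hε hε1
  obtain ⟨B, hB⟩ := hw.bounded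
  have he := h.density_energy.nonneg 0
  have hi := h.density_energy.integrable 0
  have hφi : Integrable fun x => powWeight κ ε ‖x‖ * (α 0 x + β 0 x) :=
    h.density_energy.integrable_mul
      (hw.contDiff.continuous.comp continuous_norm).aestronglyMeasurable (fun x => (hB _).1) 0
  rw [ofReal_integral_eq_lintegral_ofReal hφi
    (Eventually.of_forall fun x => mul_nonneg (hw.nonneg _) (he x))]
  have hε0 : 0 ≤ ε ^ (κ / 2) := by positivity
  calc ∫⁻ x, ENNReal.ofReal (powWeight κ ε ‖x‖ * (α 0 x + β 0 x))
      ≤ ∫⁻ x, (ENNReal.ofReal (ε ^ (κ / 2) * (α 0 x + β 0 x))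
        + ENNReal.ofReal (‖x‖ ^ κ * (α 0 x + β 0 x))) := by
        refine lintegral_mono fun x => ?_
        rw [← ENNReal.ofReal_add (mul_nonneg hε0 (he x)) (mul_nonneg (by positivity) (he x)),
          ← add_mul]
        exact ENNReal.ofReal_le_ofReal (mul_le_mul_of_nonneg_right
          (powWeight_le hκ hκ1 hε (norm_nonneg x)) (he x))
    _ = regularisedWeight α β κ n := by
        rw [lintegral_add_left' (hi.const_mul _).1.aemeasurable.ennreal_ofReal,
          ← ofReal_integral_eq_lintegral_ofReal (hi.const_mul _)
            (Eventually.of_forall fun x => mul_nonneg hε0 (he x)), integral_const_mul]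
        rfl

/-- The three terms of the weighted inequality, for the regularised weights. -/
lemma regularised_bounds (h : IsInwardFlow α β N) (hκ : 0 ≤ κ) (hκ1 : κ ≤ 1) (n : ℕ) {T : ℝ}
    (hT : 0 ≤ T) :
    ∫⁻ x, ENNReal.ofReal (powWeight κ (1 / ((n : ℝ) + 1)) (T + ‖x‖) * (α T x + β T x))
        ≤ regularisedWeight α β κ n ∧
    ENNReal.ofReal (1 - κ) * ∫⁻ z, ENNReal.ofReal
        (powWeight κ (1 / ((n : ℝ) + 1)) (z.1 + ‖z.2‖) * (N z.1 z.2 / ‖z.2‖)) ∂slab 0 T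
        ≤ regularisedWeight α β κ n ∧
    ENNReal.ofReal Real.pi * ∫⁻ t in Set.Icc 0 T,
        ENNReal.ofReal (powWeight κ (1 / ((n : ℝ) + 1)) t) ∂h.lossFunction.measure
        ≤ regularisedWeight α β κ n := by
  have hRHS := h.ofReal_integral_powWeight_le hκ hκ1 n
  set ε : ℝ := 1 / ((n : ℝ) + 1) with hεd
  have hε : 0 < ε := by positivity
  have hε1 : ε ≤ 1 := by
    rw [hεd, div_le_one (by positivity)]; linarith [Nat.cast_nonneg (α := ℝ) n]
  have hw := isWeight_powWeight hκ hκ1 hε hε1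
  obtain ⟨B, hB⟩ := hw.bounded
  have hc : Continuous (powWeight κ ε) := hw.contDiff.continuous
  have hfin := h.isFiniteMeasure_lossFunction
  have i1 : Integrable fun x => powWeight κ ε (T + ‖x‖) * (α T x + β T x) :=
    h.density_energy.integrable_mul
      (hc.comp (continuous_const.add continuous_norm)).aestronglyMeasurable (fun x => (hB _).1) T
  have i2 : Integrable (fun z : ℝ × Space => powWeight κ ε (z.1 + ‖z.2‖) * (N z.1 z.2 / ‖z.2‖))
      (slab 0 T) := (h.integrable_bulk hT).bdd_mul (c := B)
      (hc.comp (continuous_fst.add continuous_snd.norm)).aestronglyMeasurable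
      (Eventually.of_forall fun z => (hB _).1)
  have i3 : IntegrableOn (powWeight κ ε) (Set.Icc 0 T) h.lossFunction.measure :=
    hc.integrableOn_Icc
  have n1 : ∀ x, 0 ≤ powWeight κ ε (T + ‖x‖) * (α T x + β T x) := fun x =>
    mul_nonneg (hw.nonneg _) (h.density_energy.nonneg T x)
  have n2 : ∀ z : ℝ × Space, 0 ≤ powWeight κ ε (z.1 + ‖z.2‖) * (N z.1 z.2 / ‖z.2‖) := fun z =>
    mul_nonneg (hw.nonneg _) (h.bulk_nonneg _ _)
  have I1 : 0 ≤ ∫ x, powWeight κ ε (T + ‖x‖) * (α T x + β T x) := integral_nonneg n1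
  have I2 := mul_nonneg (sub_nonneg.2 hκ1) (show 0 ≤ ∫ z, powWeight κ ε (z.1 + ‖z.2‖)
    * (N z.1 z.2 / ‖z.2‖) ∂slab 0 T from integral_nonneg n2)
  have I3 := mul_nonneg Real.pi_pos.le (setIntegral_nonneg (μ := h.lossFunction.measure)
    (measurableSet_Icc (a := 0) (b := T)) fun t _ => hw.nonneg t)
  have key := h.weighted_inequality hw hT
  refine ⟨?_, ?_, ?_⟩
  · rw [← ofReal_integral_eq_lintegral_ofReal i1 (Eventually.of_forall n1)]
    exact (ENNReal.ofReal_le_ofReal (by linarith)).trans hRHS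
  · rw [← ofReal_integral_eq_lintegral_ofReal i2 (Eventually.of_forall n2),
      ← ENNReal.ofReal_mul (sub_nonneg.2 hκ1)]
    exact (ENNReal.ofReal_le_ofReal (by linarith)).trans hRHS
  · rw [← ofReal_integral_eq_lintegral_ofReal i3 (Eventually.of_forall fun t => hw.nonneg t),
      ← ENNReal.ofReal_mul Real.pi_pos.le]
    exact (ENNReal.ofReal_le_ofReal (by linarith)).trans hRHS

/-- Fatou's lemma, in the form used to remove the regularisation and let T → ∞ together. -/
lemma lintegral_le_of_tendsto {Y : Type*} [MeasurableSpace Y] {m : Measure Y} {f : Y → ℝ≥0∞}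
    {F : ℕ → Y → ℝ≥0∞} (hF : ∀ n, AEMeasurable (F n) m)
    (hlim : ∀ᵐ y ∂m, Tendsto (fun n => F n y) atTop (𝓝 (f y))) {c : ℝ≥0∞} (hc : c ≠ ⊤)
    {b : ℕ → ℝ≥0∞} {b' : ℝ≥0∞} (hb : Tendsto b atTop (𝓝 b')) (hle : ∀ n, c * ∫⁻ y, F n y ∂m ≤ b n) :
    c * ∫⁻ y, f y ∂m ≤ b' := by
  have h1 : ∫⁻ y, f y ∂m = ∫⁻ y, liminf (fun n => F n y) atTop ∂m :=
    lintegral_congr_ae (hlim.mono fun y hy => hy.liminf_eq.symm)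
  have h2 : c * ∫⁻ y, f y ∂m = ∫⁻ y, liminf (fun n => c * F n y) atTop ∂m := by
    rw [← lintegral_const_mul' _ _ hc]
    exact lintegral_congr_ae (hlim.mono fun y hy =>
      (ENNReal.Tendsto.const_mul hy (Or.inr hc)).liminf_eq.symm)
  rw [h2, ← hb.liminf_eq]
  refine (lintegral_liminf_le' fun n => (hF n).const_mul c).trans
    (liminf_le_liminf (Eventually.of_forall fun n => ?_))
  exact (lintegral_const_mul' _ _ hc).trans_le (hle n)

lemma continuous_powWeight (hκ : 0 ≤ κ) (hκ1 : κ ≤ 1) (n : ℕ) :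
    Continuous (powWeight κ (1 / ((n : ℝ) + 1))) := by
  refine (isWeight_powWeight hκ hκ1 (by positivity) ?_).contDiff.continuous
  rw [div_le_one (by positivity)]; linarith [Nat.cast_nonneg (α := ℝ) n]

lemma lintegral_energy_le (h : IsInwardFlow α β N) (hκ : 0 < κ) (hκ1 : κ ≤ 1) {T : ℝ}
    (hT : 0 ≤ T) :
    ∫⁻ x, ENNReal.ofReal ((T + ‖x‖) ^ κ * (α T x + β T x)) ≤ initialWeight α β κ := by
  have key := lintegral_le_of_tendsto (m := (volume : Measure Space)) (c := 1)
    (f := fun x => ENNReal.ofReal ((T + ‖x‖) ^ κ * (α T x + β T x)))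
    (F := fun n x => ENNReal.ofReal
      (powWeight κ (1 / ((n : ℝ) + 1)) (T + ‖x‖) * (α T x + β T x)))
    (fun n => (((continuous_powWeight hκ.le hκ1 n).comp
      (continuous_const.add continuous_norm)).aestronglyMeasurable.mul
        (h.density_energy.integrable T).1).aemeasurable.ennreal_ofReal)
    (Eventually.of_forall fun x => ENNReal.tendsto_ofReal
      ((tendsto_powWeight hκ (add_nonneg hT (norm_nonneg x))).mul_const _)) ENNReal.one_ne_top
    (tendsto_regularisedWeight α β hκ) fun n => by
      rw [one_mul]; exact (h.regularised_bounds hκ.le hκ1 n hT).1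
  rwa [one_mul] at key

lemma lintegral_lossFunction_le (h : IsInwardFlow α β N) (hκ : 0 < κ) (hκ1 : κ ≤ 1) :
    ENNReal.ofReal Real.pi * ∫⁻ t in Set.Ici 0, ENNReal.ofReal (t ^ κ) ∂h.lossFunction.measure
      ≤ initialWeight α β κ := by
  -- A single index n governs both the regularisation ε = 1/(n+1) and the time horizon T = n; every
  -- fixed t ≥ 0 is eventually inside [0, n].
  refine lintegral_le_of_tendsto
    (F := fun n t => (Set.Icc (0 : ℝ) n).indicator
      (fun t => ENNReal.ofReal (powWeight κ (1 / ((n : ℝ) + 1)) t)) t)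
    (fun n => ((continuous_powWeight hκ.le hκ1 n).measurable.ennreal_ofReal.indicator
      measurableSet_Icc).aemeasurable) ?_ ENNReal.ofReal_ne_top
    (tendsto_regularisedWeight α β hκ) fun n => ?_
  · filter_upwards [ae_restrict_mem measurableSet_Ici] with t ht
    refine (ENNReal.tendsto_ofReal (tendsto_powWeight hκ ht)).congr' ?_
    obtain ⟨m, hm⟩ := exists_nat_ge t
    filter_upwards [eventually_ge_atTop m] with n hn
    have hmem : t ∈ Set.Icc (0 : ℝ) n := ⟨ht, hm.trans (Nat.cast_le.2 hn)⟩
    rw [Set.indicator_of_mem hmem]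
  · rw [lintegral_indicator measurableSet_Icc, Measure.restrict_restrict measurableSet_Icc,
      Set.inter_eq_left.2 fun t ht => ht.1]
    exact (h.regularised_bounds hκ.le hκ1 n (Nat.cast_nonneg n)).2.2

lemma lintegral_loss_le (h : IsInwardFlow α β N) (hκ : 0 < κ) (hκ1 : κ ≤ 1) :
    ENNReal.ofReal (1 - κ) * ∫⁻ t in Set.Ioi (0 : ℝ), ∫⁻ x,
      ENNReal.ofReal ((t + ‖x‖) ^ κ * (N t x / ‖x‖)) ≤ initialWeight α β κ := by
  have hm : ∀ S : Set ℝ, AEStronglyMeasurable (fun z : ℝ × Space => N z.1 z.2 / ‖z.2‖)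
      ((volume.restrict S).prod volume) := fun S =>
    h.aestronglyMeasurable_bulk.mono_ac (Measure.AbsolutelyContinuous.prod
      Measure.restrict_le_self.absolutelyContinuous Measure.AbsolutelyContinuous.rfl)
  have hp : Continuous fun z : ℝ × Space => (z.1 + ‖z.2‖) ^ κ :=
    (continuous_fst.add continuous_snd.norm).rpow_const fun _ => Or.inr hκ.le
  have e := lintegral_prod (μ := volume.restrict (Set.Ioi (0 : ℝ))) (ν := (volume : Measure Space))
    (fun z : ℝ × Space => ENNReal.ofReal ((z.1 + ‖z.2‖) ^ κ * (N z.1 z.2 / ‖z.2‖)))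
    (hp.aestronglyMeasurable.mul (hm _)).aemeasurable.ennreal_ofReal
  rw [← e]
  have hS : ∀ n : ℕ, MeasurableSet (Set.Icc (0 : ℝ) n ×ˢ (Set.univ : Set Space)) := fun n =>
    measurableSet_Icc.prod MeasurableSet.univ
  refine lintegral_le_of_tendsto
    (F := fun n z => (Set.Icc (0 : ℝ) n ×ˢ Set.univ).indicator (fun z : ℝ × Space =>
      ENNReal.ofReal (powWeight κ (1 / ((n : ℝ) + 1)) (z.1 + ‖z.2‖) * (N z.1 z.2 / ‖z.2‖))) z)
    (fun n => AEMeasurable.indicator (((continuous_powWeight hκ.le hκ1 n).comp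
      (continuous_fst.add continuous_snd.norm)).aestronglyMeasurable.mul
        (hm _)).aemeasurable.ennreal_ofReal (hS n)) ?_ ENNReal.ofReal_ne_top
    (tendsto_regularisedWeight α β hκ) fun n => ?_
  · have h0 : ∀ᵐ z ∂(volume.restrict (Set.Ioi (0 : ℝ))).prod (volume : Measure Space), 0 < z.1 :=
      Measure.quasiMeasurePreserving_fst.ae (ae_restrict_mem measurableSet_Ioi)
    filter_upwards [h0] with z hz
    refine (ENNReal.tendsto_ofReal ((tendsto_powWeight hκ
      (add_nonneg hz.le (norm_nonneg z.2))).mul_const _)).congr' ?_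
    obtain ⟨m, hm⟩ := exists_nat_ge z.1
    filter_upwards [eventually_ge_atTop m] with n hn
    have hmem : z ∈ Set.Icc (0 : ℝ) n ×ˢ (Set.univ : Set Space) :=
      ⟨⟨hz.le, hm.trans (Nat.cast_le.2 hn)⟩, trivial⟩
    rw [Set.indicator_of_mem hmem]
  · rw [lintegral_indicator (hS n)]
    have hres : ((volume.restrict (Set.Ioi (0 : ℝ))).prod (volume : Measure Space)).restrict
        (Set.Icc (0 : ℝ) n ×ˢ Set.univ) = slab 0 n := by
      rw [← Measure.prod_restrict, Measure.restrict_univ, slab,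
        Measure.restrict_congr_set Ioi_ae_eq_Ici, Measure.restrict_restrict measurableSet_Icc,
        Set.inter_eq_left.2 fun t ht => ht.1]
    rw [hres]
    exact (h.regularised_bounds hκ.le hκ1 n (Nat.cast_nonneg n)).2.1

end IsInwardFlow

end DefocusingWave

/-! ### The three estimates -/

namespace DefocusingWave

lemma le_toNNReal_inv_mul {c : ℝ} (hc : 0 < c) {I K : ℝ≥0∞} (h : ENNReal.ofReal c * I ≤ K) :
    I ≤ (Real.toNNReal c⁻¹ : ℝ≥0) * K := by
  have h1 : ENNReal.ofReal c⁻¹ * ENNReal.ofReal c = 1 := by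
    rw [← ENNReal.ofReal_mul (inv_nonneg.2 hc.le), inv_mul_cancel₀ hc.ne', ENNReal.ofReal_one]
  calc I = ENNReal.ofReal c⁻¹ * (ENNReal.ofReal c * I) := by rw [← mul_assoc, h1, one_mul]
    _ ≤ _ := mul_le_mul_right h _

namespace IsFiniteEnergySolution

variable {p κ : ℝ} {u v : ℝ → Space → ℝ} {g : ℝ → Space → Space}

lemma initialWeight_eq (p κ : ℝ) (u v : ℝ → Space → ℝ) (g : ℝ → Space → Space) :
    IsInwardFlow.initialWeight (radialPart u v g) (angularPart p u g) κ
      = weightedInwardEnergy p κ (u 0) (v 0) (g 0) := by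
  unfold IsInwardFlow.initialWeight weightedInwardEnergy
  simp only [inwardDensity_eq]

lemma existsUnique_isFluxMeasure (h : IsFiniteEnergySolution p u v g) (hp : 3 ≤ p) (hp' : p < 5) :
    ∃! μ : Measure ℝ, IsFluxMeasure p u v g μ :=
  ⟨_, h.isFluxMeasure hp hp', fun _ hμ => hμ.eq (h.isFluxMeasure hp hp')⟩

lemma lintegral_fluxMeasure_le (h : IsFiniteEnergySolution p u v g) (hp : 3 ≤ p) (hp' : p < 5)
    (hκ : 0 < κ) (hκ1 : κ ≤ 1) {μ : Measure ℝ} (hμ : IsFluxMeasure p u v g μ) :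
    ∫⁻ t in Set.Ici 0, ENNReal.ofReal (t ^ κ) ∂μ
      ≤ (Real.toNNReal Real.pi⁻¹ : ℝ≥0) * weightedInwardEnergy p κ (u 0) (v 0) (g 0) := by
  rw [hμ.eq (h.isFluxMeasure hp hp'), ← initialWeight_eq]
  exact le_toNNReal_inv_mul Real.pi_pos ((h.isInwardFlow hp hp').lintegral_lossFunction_le hκ hκ1)

/-- The potential coefficient satisfies (p-1)/(2(p+1)) ≥ 1/4 exactly when p ≥ 3; for the angular
part there is room to spare. -/
lemma le_lossPart (hp : 3 ≤ p) (t : ℝ) (x : Space) :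
    |u t x| ^ (p + 1) + ‖angularGrad (g t) x‖ ^ 2 ≤ 4 * lossPart p u g t x := by
  have hP : 0 ≤ |u t x| ^ (p + 1) := Real.rpow_nonneg (abs_nonneg _) _
  have hc : 1 / 4 ≤ (p - 1) / (2 * (p + 1)) := by
    rw [div_le_div_iff₀ (by norm_num) (by linarith)]
    linarith
  have h1 := mul_le_mul_of_nonneg_right hc hP
  unfold lossPart
  linarith [sq_nonneg ‖angularGrad (g t) x‖]

lemma lintegral_morawetz_le (h : IsFiniteEnergySolution p u v g) (hp : 3 ≤ p) (hp' : p < 5)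
    (hκ : 0 < κ) (hκ1 : κ < 1) :
    ∫⁻ t in Set.Ioi (0 : ℝ), ∫⁻ x : Space, ENNReal.ofReal ((‖x‖ + t) ^ κ *
        (|u t x| ^ (p + 1) + ‖angularGrad (g t) x‖ ^ 2) / ‖x‖)
      ≤ (4 * Real.toNNReal (1 - κ)⁻¹ : ℝ≥0) * weightedInwardEnergy p κ (u 0) (v 0) (g 0) := by
  have key := le_toNNReal_inv_mul (sub_pos.2 hκ1)
    ((h.isInwardFlow hp hp').lintegral_loss_le hκ hκ1.le)
  rw [initialWeight_eq] at key
  rw [ENNReal.coe_mul, mul_assoc]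
  refine le_trans ?_ (mul_le_mul_right key _)
  rw [← lintegral_const_mul' _ _ ENNReal.coe_ne_top]
  refine setLIntegral_mono' measurableSet_Ioi fun t ht => ?_
  rw [← lintegral_const_mul' _ _ ENNReal.coe_ne_top]
  refine lintegral_mono fun x => ?_
  have h4 : ((4 : ℝ≥0) : ℝ≥0∞) = ENNReal.ofReal 4 := by simp
  rw [h4, ← ENNReal.ofReal_mul (by norm_num)]
  refine ENNReal.ofReal_le_ofReal ?_
  have hw : 0 ≤ (‖x‖ + t) ^ κ / ‖x‖ :=
    div_nonneg (Real.rpow_nonneg (add_nonneg (norm_nonneg x) (le_of_lt ht)) _) (norm_nonneg x)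
  calc (‖x‖ + t) ^ κ * (|u t x| ^ (p + 1) + ‖angularGrad (g t) x‖ ^ 2) / ‖x‖
      = (‖x‖ + t) ^ κ / ‖x‖ * (|u t x| ^ (p + 1) + ‖angularGrad (g t) x‖ ^ 2) := by ring
    _ ≤ (‖x‖ + t) ^ κ / ‖x‖ * (4 * lossPart p u g t x) :=
        mul_le_mul_of_nonneg_left (le_lossPart hp t x) hw
    _ = 4 * ((t + ‖x‖) ^ κ * (lossPart p u g t x / ‖x‖)) := by rw [add_comm t]; ring

/-- At time t the weight (t+|x|)^κ is at least t^κ everywhere, so the weighted bound yields the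
decay with constant 1. -/
lemma inwardEnergy_le (h : IsFiniteEnergySolution p u v g) (hp : 3 ≤ p) (hp' : p < 5)
    (hκ : 0 < κ) (hκ1 : κ ≤ 1) {t : ℝ} (ht : 0 < t) :
    inwardEnergy p (u t) (v t) (g t)
      ≤ weightedInwardEnergy p κ (u 0) (v 0) (g 0) * ENNReal.ofReal (t ^ (-κ)) := by
  have hF := h.isInwardFlow hp hp'
  have htκ := Real.rpow_pos_of_pos ht (-κ)
  have key := hF.lintegral_energy_le hκ hκ1 ht.le
  rw [initialWeight_eq] at key
  refine le_trans ?_ (mul_le_mul_left key _)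
  rw [← lintegral_mul_const' _ _ ENNReal.ofReal_ne_top]
  refine lintegral_mono fun x => ?_
  have he := hF.density_energy.nonneg t x
  rw [inwardDensity_eq, ← ENNReal.ofReal_mul (mul_nonneg (by positivity) he)]
  refine ENNReal.ofReal_le_ofReal ?_
  have h1 : t ^ κ ≤ (t + ‖x‖) ^ κ :=
    Real.rpow_le_rpow ht.le (by linarith [norm_nonneg x]) hκ.le
  have h2 : t ^ κ * t ^ (-κ) = 1 := by rw [← Real.rpow_add ht, add_neg_cancel, Real.rpow_zero]
  calc radialPart u v g t x + angularPart p u g t x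
      = t ^ κ * t ^ (-κ) * (radialPart u v g t x + angularPart p u g t x) := by rw [h2, one_mul]
    _ ≤ (t + ‖x‖) ^ κ * t ^ (-κ) * (radialPart u v g t x + angularPart p u g t x) :=
        mul_le_mul_of_nonneg_right (mul_le_mul_of_nonneg_right h1 htκ.le) he
    _ = _ := by ring

end IsFiniteEnergySolution

end DefocusingWave

theorem mainTheorem8 (p : ℝ) (hp : 3 ≤ p) (hp' : p < 5) :
    ∃ C₁ : ℝ≥0, ∀ κ : ℝ, 0 < κ → κ < 1 → ∃ C₂ C₃ : ℝ≥0,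
      ∀ (u v : ℝ → DefocusingWave.Space → ℝ)
        (g : ℝ → DefocusingWave.Space → DefocusingWave.Space),
        DefocusingWave.IsFiniteEnergySolution p u v g →
        DefocusingWave.weightedInwardEnergy p κ (u 0) (v 0) (g 0) < ⊤ →
        (∃! μ : Measure ℝ, DefocusingWave.IsFluxMeasure p u v g μ) ∧
        (∀ μ : Measure ℝ, DefocusingWave.IsFluxMeasure p u v g μ →
          ∫⁻ t in Set.Ici 0, ENNReal.ofReal (t ^ κ) ∂μ
            ≤ C₁ * DefocusingWave.weightedInwardEnergy p κ (u 0) (v 0) (g 0)) ∧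
        (∫⁻ t in Set.Ioi (0 : ℝ), ∫⁻ x : DefocusingWave.Space,
            ENNReal.ofReal ((‖x‖ + t) ^ κ *
              (|u t x| ^ (p + 1) + ‖DefocusingWave.angularGrad (g t) x‖ ^ 2) / ‖x‖)
            ≤ C₂ * DefocusingWave.weightedInwardEnergy p κ (u 0) (v 0) (g 0)) ∧
        (∀ t : ℝ, 0 < t →
          DefocusingWave.inwardEnergy p (u t) (v t) (g t)
            ≤ C₃ * DefocusingWave.weightedInwardEnergy p κ (u 0) (v 0) (g 0)
                * ENNReal.ofReal (t ^ (-κ))) := by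
  -- 1/π comes from the normalisation of μ, 1/(1-κ) from absorbing the β term, and 4 from comparing
  -- the integrand with the loss density.
  refine ⟨Real.toNNReal Real.pi⁻¹, fun κ hκ hκ1 => ⟨4 * Real.toNNReal (1 - κ)⁻¹, 1,
    fun u v g h _ => ⟨h.existsUnique_isFluxMeasure hp hp', fun μ hμ => ?_, ?_, fun t ht => ?_⟩⟩⟩
  · exact h.lintegral_fluxMeasure_le hp hp' hκ hκ1.le hμ
  · exact h.lintegral_morawetz_le hp hp' hκ hκ1
  · rw [ENNReal.coe_one, one_mul]
    exact h.inwardEnergy_le hp hp' hκ hκ1.le ht
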